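/- Let $Y$ be a smooth algebraic curve over $\mathbb C$ with canonical bundle $\Omega$ and tangent bundle $\Theta$, and let $\mathfrak g\neq 0$ be a finite-dimensional semisimple Lie algebra over $\mathbb C$ with a Cartan subalgebra $\mathfrak h$ and a Borel subalgebra $\mathfrak b\supset\mathfrak h$. Let $\Gamma$ be the set of simple roots, $\mathfrak g=\bigoplus_k\mathfrak g_k$ the grading by height of roots ($\mathfrak g_0=\mathfrak h$, $\mathfrak g_{\pm1}=\bigoplus_{\alpha\in\Gamma}\mathfrak g^{\pm\alpha}$), $\mathfrak g^k=\bigoplus_{r\ge k}\mathfrak g_r$, $G_{\rm ad}$ the group of inner automorphisms of $\mathfrak g$ and $B_{\rm ad}\subset G_{\rm ad}$ its Borel subgroup corresponding to $\mathfrak b$. A $\mathfrak g$-oper on $Y$ is a $B_{\rm ad}$-bundle $\mathcal F$ on $Y$ with a connection $\nabla$ on the induced $G_{\rm ad}$-bundle such that, in every local trivialization of $\mathcal F$, $\nabla=d+A$ with $A$ a $\mathfrak g^{-1}$-valued $1$-form whose $\mathfrak g^{-\alpha}$-component has no zeros for each $\alpha\in\Gamma$. Let $\mathrm{Op}_{\mathfrak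 g}(Y)$ be the set of isomorphism classes of $\mathfrak g$-opers on $Y$. For $\mathfrak g=sl(2)$ we use the diagonal Cartan subalgebra and the upper triangular Borel subalgebra, and denote by $B_0\subset PGL(2)$ the upper triangular subgroup. If $(\mathcal F_0,\nabla_0)$ is an $sl(2)$-oper, then $\nabla_0$ defines an isomorphism $\Theta\cong sl(2)^{-1}_{\mathcal F_0}/sl(2)^0_{\mathcal F_0}$, hence by the form $\mathrm{Tr}(XY)$ an isomorphism $sl(2)^1_{\mathcal F_0}\cong\Omega$. The group $H^0(Y,\Omega^{\otimes2})$ acts on $\mathrm{Op}_{sl(2)}(Y)$ by $L=(\mathcal F_0,\nabla_0)\mapsto L+\omega=(\mathcal F_0,\nabla_0-\omega)$, where $\omega$ is viewed as a section of $sl(2)^1_{\mathcal F_0}\otimes\Omega$. Fix an $sl(2)$-triple $\{h,x,y\}\subset\mathfrak g$ with $h=2\sum_{\alpha\in\Gamma}\check\omega_\alpha\in\mathfrak h$ (twice the sum of the fundamental coweights), $x=\sum_{\alpha\in\Gamma}x_\alpha$, $y=\sum_{\alpha\in\Gamma}y_\alpha$, $0\ne x_\alpha\in\mathfrak g^\alpha$,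 $0\neq y_\alpha\in\mathfrak g^{-\alpha}$. Put $V=\mathrm{Ker}\,\mathrm{ad}\,x$, $V_k=V\cap\mathfrak g_k$ and $$V^{\mathfrak g}(Y)=\bigoplus_k V_{k-1}\otimes H^0(Y,\Omega^{\otimes k}).$$ Let $\underline{\mathrm{Op}}_{\mathfrak g}(Y)$ be the quotient of $\mathrm{Op}_{sl(2)}(Y)\times V^{\mathfrak g}(Y)$ by the equivalence relation generated by $(L+\omega,\eta)\sim(L,\eta-\omega\cdot x)$, $\omega\in H^0(Y,\Omega^{\otimes2})$, $\omega\cdot x\in V_1\otimes H^0(Y,\Omega^{\otimes 2})$. To an $sl(2)$-oper $L=(\mathcal F_0,\nabla_0)$ and $\eta\in V^{\mathfrak g}(Y)$ one associates the $\mathfrak g$-oper $(\mathcal F,\nabla+\eta)$, where $(\mathcal F,\nabla)$ is induced from $(\mathcal F_0,\nabla_0)$ by the homomorphism $\rho:PGL(2)\to G_{\rm ad}$ corresponding to the triple, and $\eta$ is viewed as a section of $V_{\mathcal F_0}\otimes\Omega\subset\mathfrak b_{\mathcal F}\otimes\Omega$ by means of the isomorphism $V_{\mathcal F_0}=\bigoplus_k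 V_k\otimes\Omega^{\otimes k}$ that comes from $sl(2)^1_{\mathcal F_0}\cong\Omega$ (the group $B_0$ acts on $V_k$ by the $k$-th power of its character on $sl(2)^1$). Then $(L,\eta)\mapsto(\mathcal F,\nabla+\eta)$ induces a well-defined map $\underline{\mathrm{Op}}_{\mathfrak g}(Y)\to\mathrm{Op}_{\mathfrak g}(Y)$, and this map is a bijection. -/

import Mathlib

open CategoryTheory AlgebraicGeometry Opposite TopologicalSpace TensorProduct

noncomputable section

namespace Opers

/-! ### Lie-theoretic data

Throughout, `H` is a Cartan subalgebra `𝔥` of `𝔤` and `α : ι → Dual ℂ H` is the family of simple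
roots. Fixing a Borel subalgebra containing `𝔥` is the same as fixing the simple roots. -/

section Lie

variable {𝔤 : Type} [LieRing 𝔤] [LieAlgebra ℂ 𝔤] (H : LieSubalgebra ℂ 𝔤)

/-- `𝔤^β = {z | [a, z] = β(a) z for all a ∈ 𝔥}`. -/
def rootSub (β : Module.Dual ℂ H) : Submodule ℂ 𝔤 where
  carrier := {z | ∀ a : H, ⁅(a : 𝔤), z⁆ = β a • z}
  zero_mem' := by simp
  add_mem' := by
    intro z w hz hw a
    rw [lie_add, hz a, hw a, smul_add]
  smul_mem' := by
    intro c z hz a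
    rw [lie_smul, hz a, smul_comm]

variable {ι : Type} [Fintype ι] (α : ι → Module.Dual ℂ H)

/-- The component `𝔤_k` of the grading by height: the sum of the `𝔤^β` over all integral
combinations `β = ∑ nᵢ αᵢ` of simple roots with `∑ nᵢ = k`. -/
def gr (k : ℤ) : Submodule ℂ 𝔤 :=
  ⨆ (n : ι → ℤ) (_ : ∑ i, n i = k), rootSub H (∑ i, n i • α i)

/-- The filtration `𝔤^k = ⨁_{r ≥ k} 𝔤_r`; in particular `𝔟 = 𝔤^0` is the Borel subalgebra and
`𝔤^1 = [𝔟, 𝔟]`. -/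
def filt (k : ℤ) : Submodule ℂ 𝔤 :=
  ⨆ (r : ℤ) (_ : k ≤ r), gr H α r

/-- The complex points of the Borel subgroup `B_ad = H_ad · exp (ad 𝔤^1)` of the group of inner
automorphisms of `𝔤`. The torus `H_ad` consists of the automorphisms of `𝔤` that fix `𝔥`
pointwise; `exp (ad n)` is the finite exponential series of the nilpotent operator `ad n`. -/
def borelGroup : Subgroup (Module.End ℂ 𝔤)ˣ :=
  Subgroup.closure
    ({u | ∃ e : 𝔤 ≃ₗ⁅ℂ⁆ 𝔤, (∀ a ∈ H, e a = a) ∧ ∀ z, (u : Module.End ℂ 𝔤) z = e z} ∪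
     {u | ∃ n ∈ filt H α 1, ∃ N : ℕ, LieAlgebra.ad ℂ 𝔤 n ^ N = 0 ∧
        (u : Module.End ℂ 𝔤) =
          ∑ i ∈ Finset.range N, (i.factorial : ℂ)⁻¹ • LieAlgebra.ad ℂ 𝔤 n ^ i})

/-- An `sl(2)`-triple `{h, x, y}` in `𝔤` with `h = 2 ∑ ω̌ᵢ ∈ 𝔥`, `x = ∑ xᵢ`, `y = ∑ yᵢ`,
`0 ≠ xᵢ ∈ 𝔤^{αᵢ}`, `0 ≠ yᵢ ∈ 𝔤^{-αᵢ}`; thus `x` is a principal nilpotent element of `𝔟`. The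
fundamental coweights `ω̌ᵢ` are the basis of `𝔥` dual to the simple roots, so that
`h = 2 ∑ ω̌ᵢ` means that `αᵢ(h) = 2` for all `i`. -/
structure PrincipalTriple where
  h : 𝔤
  x : 𝔤
  y : 𝔤
  isSl2Triple : IsSl2Triple h x y
  h_mem : h ∈ H
  root_h : ∀ i, α i ⟨h, h_mem⟩ = 2
  exists_x : ∃ e : ι → 𝔤, (∀ i, e i ∈ rootSub H (α i) ∧ e i ≠ 0) ∧ x = ∑ i, e i
  exists_y : ∃ f : ι → 𝔤, (∀ i, f i ∈ rootSub H (-α i) ∧ f i ≠ 0) ∧ y = ∑ i, f i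

variable {H α}

/-- `V_k`, where `V = Ker ad x`. -/
def PrincipalTriple.V (T : PrincipalTriple H α) (k : ℤ) : Submodule ℂ 𝔤 :=
  LinearMap.ker (LieAlgebra.ad ℂ 𝔤 T.x) ⊓ gr H α k

lemma PrincipalTriple.x_mem_V (T : PrincipalTriple H α) : T.x ∈ T.V 1 := by
  classical
  refine Submodule.mem_inf.2 ⟨by simp, ?_⟩
  obtain ⟨e, he, hx⟩ := T.exists_x
  rw [hx]
  refine Submodule.sum_mem _ fun i _ => ?_
  refine Submodule.mem_iSup_of_mem (Pi.single i 1) (Submodule.mem_iSup_of_mem (by simp) ?_)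
  have : (∑ j, (Pi.single i (1 : ℤ) : ι → ℤ) j • α j) = α i := by
    simp [Pi.single_apply, ite_smul]
  rw [this]
  exact (he i).1

end Lie

/-! ### The Lie algebra `sl(2)` with its upper triangular Borel subalgebra -/

/-- `sl(2)`. -/
abbrev sl2 : Type := LieAlgebra.SpecialLinear.sl (Fin 2) ℂ

/-- The diagonal Cartan subalgebra of `sl(2)`. -/
def sl2Cartan : LieSubalgebra ℂ sl2 where
  carrier := {A | A.1 0 1 = 0 ∧ A.1 1 0 = 0}
  zero_mem' := by simp
  add_mem' := by
    rintro A B ⟨h1, h2⟩ ⟨h3, h4⟩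
    simp [h1, h2, h3, h4]
  smul_mem' := by
    rintro c A ⟨h1, h2⟩
    simp [h1, h2]
  lie_mem' := by
    rintro A B ⟨h1, h2⟩ ⟨h3, h4⟩
    simp [Ring.lie_def, Matrix.mul_apply, h1, h2, h3, h4]

/-- The positive root `diag(a, d) ↦ a - d` of `sl(2)`. -/
def sl2Root : Unit → Module.Dual ℂ sl2Cartan := fun _ =>
  { toFun := fun A => A.1.1 0 0 - A.1.1 1 1
    map_add' := by intro A B; simp; ring
    map_smul' := by intro c A; simp; ring }

/-- The standard `sl(2)`-triple of `sl(2)`. -/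
def sl2Triple : PrincipalTriple sl2Cartan sl2Root where
  h := ⟨!![1, 0; 0, -1], by
    simp [LieAlgebra.SpecialLinear.sl, Matrix.trace_fin_two]⟩
  x := ⟨!![0, 1; 0, 0], by
    simp [LieAlgebra.SpecialLinear.sl, Matrix.trace_fin_two]⟩
  y := ⟨!![0, 0; 1, 0], by
    simp [LieAlgebra.SpecialLinear.sl, Matrix.trace_fin_two]⟩
  isSl2Triple :=
    { h_ne_zero := by
        intro h
        have := congrFun (congrFun (congrArg Subtype.val h) 0) 0
        simp at this
      lie_e_f := by
        apply Subtype.ext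
        ext i j
        fin_cases i <;> fin_cases j <;>
          simp [Ring.lie_def]
      lie_h_e_nsmul := by
        apply Subtype.ext
        ext i j
        fin_cases i <;> fin_cases j <;>
          simp [Ring.lie_def] <;> norm_num
      lie_h_f_nsmul := by
        apply Subtype.ext
        ext i j
        fin_cases i <;> fin_cases j <;>
          simp [Ring.lie_def] <;> norm_num }
  h_mem := by simp [sl2Cartan]
  root_h := by intro i; simp [sl2Root]; norm_num
  exists_x := by
    refine ⟨fun _ => ⟨!![0, 1; 0, 0], by
      simp [LieAlgebra.SpecialLinear.sl, Matrix.trace_fin_two]⟩, fun i => ⟨?_, ?_⟩, by simp⟩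
    · rintro ⟨a, h1, h2⟩
      apply Subtype.ext
      ext i j
      fin_cases i <;> fin_cases j <;>
        simp_all [Ring.lie_def, sl2Root, Matrix.mul_apply, Matrix.vecMul, dotProduct]
    · intro h
      have := congrFun (congrFun (congrArg Subtype.val h) 0) 1
      simp at this
  exists_y := by
    refine ⟨fun _ => ⟨!![0, 0; 1, 0], by
      simp [LieAlgebra.SpecialLinear.sl, Matrix.trace_fin_two]⟩, fun i => ⟨?_, ?_⟩, by simp⟩
    · rintro ⟨a, h1, h2⟩
      apply Subtype.ext
      ext i j
      fin_cases i <;> fin_cases j <;>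
        simp_all [Ring.lie_def, sl2Root, Matrix.mul_apply, Matrix.vecMul, dotProduct]
    · intro h
      have := congrFun (congrFun (congrArg Subtype.val h) 1) 0
      simp at this

/-- The homomorphism `sl(2) → 𝔤` defined by an `sl(2)`-triple `{h, x, y}` of `𝔤`. -/
def PrincipalTriple.hom {𝔤 : Type} [LieRing 𝔤] [LieAlgebra ℂ 𝔤] {H : LieSubalgebra ℂ 𝔤}
    {ι : Type} [Fintype ι] {α : ι → Module.Dual ℂ H} (T : PrincipalTriple H α) :
    sl2 →ₗ[ℂ] 𝔤 where
  toFun A := A.1 0 0 • T.h + A.1 0 1 • T.x + A.1 1 0 • T.y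
  map_add' := by intro A B; simp [add_smul]; abel
  map_smul' := by intro c A; simp [mul_smul]

/-! ### `B_ad`-valued functions and `𝔤`-valued forms over a `ℂ`-algebra -/

section Algebra

variable {R S : Type} [CommRing R] [Algebra ℂ R] [CommRing S] [Algebra ℂ S]
variable (𝔤 : Type) [LieRing 𝔤] [LieAlgebra ℂ 𝔤]

/-- Base change `End_R (R ⊗ 𝔤) → End_S (S ⊗ 𝔤)` along `φ : R → S`. -/
def endMapFun (φ : R →ₐ[ℂ] S) (b : Module.End R (R ⊗[ℂ] 𝔤)) : Module.End S (S ⊗[ℂ] 𝔤) :=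
  LinearMap.liftBaseChange S
    (φ.toLinearMap.rTensor 𝔤 ∘ₗ b.restrictScalars ℂ ∘ₗ TensorProduct.mk ℂ R 𝔤 1)

lemma rTensor_smul (φ : R →ₐ[ℂ] S) (r : R) (t : R ⊗[ℂ] 𝔤) :
    φ.toLinearMap.rTensor 𝔤 (r • t) = φ r • φ.toLinearMap.rTensor 𝔤 t := by
  induction t with
  | zero => simp
  | add a b ha hb => simp only [smul_add, map_add, ha, hb]
  | tmul a z => simp [TensorProduct.smul_tmul']

lemma endMapFun_rTensor (φ : R →ₐ[ℂ] S) (b : Module.End R (R ⊗[ℂ] 𝔤)) (t : R ⊗[ℂ] 𝔤) :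
    endMapFun 𝔤 φ b (φ.toLinearMap.rTensor 𝔤 t) = φ.toLinearMap.rTensor 𝔤 (b t) := by
  induction t with
  | zero => simp
  | add a b ha hb => simp only [map_add, ha, hb]
  | tmul a z =>
    have : (a ⊗ₜ[ℂ] z : R ⊗[ℂ] 𝔤) = a • ((1 : R) ⊗ₜ[ℂ] z) := by
      simp [TensorProduct.smul_tmul']
    rw [this, LinearMap.map_smul b, rTensor_smul, rTensor_smul, LinearMap.map_smul]
    simp [endMapFun]

/-- Base change as a homomorphism of monoids. -/
def endMap (φ : R →ₐ[ℂ] S) : Module.End R (R ⊗[ℂ] 𝔤) →* Module.End S (S ⊗[ℂ] 𝔤) where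
  toFun := endMapFun 𝔤 φ
  map_one' := by
    ext z
    simp [endMapFun]
  map_mul' := by
    intro b c
    ext z
    have h := endMapFun_rTensor 𝔤 φ b (c (1 ⊗ₜ[ℂ] z))
    have h' := endMapFun_rTensor 𝔤 φ c (1 ⊗ₜ[ℂ] z)
    have h'' := endMapFun_rTensor 𝔤 φ (b * c) (1 ⊗ₜ[ℂ] z)
    simp at h h' h'' ⊢
    rw [h'', h', h]

/-- The value at a complex point `p : R → ℂ` of an `R`-linear endomorphism of `R ⊗ 𝔤`. -/
def endEval (p : R →ₐ[ℂ] ℂ) : Module.End R (R ⊗[ℂ] 𝔤) →* Module.End ℂ 𝔤 :=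
  ((TensorProduct.lid ℂ 𝔤).conjRingEquiv : _ →* _).comp (endMap 𝔤 p)

lemma endEval_endMap (φ : R →ₐ[ℂ] S) (p : S →ₐ[ℂ] ℂ) (b : Module.End R (R ⊗[ℂ] 𝔤)) :
    endEval 𝔤 p (endMap 𝔤 φ b) = endEval 𝔤 (p.comp φ) b := by
  ext z
  simp [endEval, endMap, endMapFun]
  rw [← LinearMap.comp_apply, ← LinearMap.rTensor_comp]


variable {𝔤}
variable (H : LieSubalgebra ℂ 𝔤) {ι : Type} [Fintype ι] (α : ι → Module.Dual ℂ H)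

variable (R) in
/-- The group `B_ad(R)` of `B_ad`-valued regular functions, for a reduced `ℂ`-algebra `R` of
functions: the invertible `R`-linear operators on `R ⊗ 𝔤` all of whose values lie in `B_ad`. -/
def borelPts : Subgroup (Module.End R (R ⊗[ℂ] 𝔤))ˣ :=
  ⨅ p : R →ₐ[ℂ] ℂ, (borelGroup H α).comap (Units.map (endEval 𝔤 p))

/-- Functoriality of `B_ad(R)`. -/
def borelMap (φ : R →ₐ[ℂ] S) : borelPts R H α →* borelPts S H α :=
  ((Units.map (endMap 𝔤 φ)).comp (borelPts R H α).subtype).codRestrict (borelPts S H α) (by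
    rintro ⟨b, hb⟩
    simp only [borelPts, Subgroup.mem_iInf, Subgroup.mem_comap] at hb ⊢
    intro p
    have := hb (p.comp φ)
    convert this using 1
    ext1
    exact endEval_endMap 𝔤 φ p b)

variable (R) in
/-- Kähler differentials `Ω_{R/ℂ}`. -/
abbrev Om : Type := KaehlerDifferential ℂ R

/-- The map `Ω_{R/ℂ} → Ω_{S/ℂ}` induced by `φ : R → S`. -/
def omMap (φ : R →ₐ[ℂ] S) : Om R →ₗ[ℂ] Om S :=
  letI := φ.toRingHom.toAlgebra
  haveI : IsScalarTower ℂ R S := IsScalarTower.of_algebraMap_eq fun c => (φ.commutes c).symm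
  (KaehlerDifferential.map ℂ ℂ R S).restrictScalars ℂ

/-- The map `Ω_{R/ℂ}^{⊗ k} → Ω_{S/ℂ}^{⊗ k}` induced by `φ : R → S`. -/
def omPowMap (φ : R →ₐ[ℂ] S) (k : ℕ) : (⨂[R]^k (Om R)) →ₗ[ℂ] (⨂[S]^k (Om S)) :=
  letI := φ.toRingHom.toAlgebra
  haveI : IsScalarTower ℂ R S := IsScalarTower.of_algebraMap_eq fun c => (φ.commutes c).symm
  (PiTensorProduct.lift
    (((PiTensorProduct.tprod S).restrictScalars R).compLinearMap
      fun _ : Fin k => KaehlerDifferential.map ℂ ℂ R S)).restrictScalars ℂ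

/-- `ω ↦ ω ⊗ a^{⊗ j}`, as a map `Ω → Ω^{⊗ (j+1)}`. -/
def mulPow (a : Om R) (j : ℕ) : Om R →ₗ[ℂ] (⨂[R]^(j + 1) (Om R)) :=
  ((PiTensorProduct.tprod R).toLinearMap (fun _ : Fin (j + 1) => a) 0).restrictScalars ℂ

/-- The operator `d + ad A : R ⊗ 𝔤 → Ω ⊗ 𝔤` for `A ∈ Ω ⊗ 𝔤`, i.e.
`f ⊗ z ↦ df ⊗ z + f [A, z]`. -/
def connOp (A : Om R ⊗[ℂ] 𝔤) : R ⊗[ℂ] 𝔤 →ₗ[ℂ] Om R ⊗[ℂ] 𝔤 :=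
  (KaehlerDifferential.D ℂ R).toLinearMap.rTensor 𝔤 +
    TensorProduct.lift (LinearMap.mk₂ ℂ
      (fun (f : R) (z : 𝔤) => f • (-LieAlgebra.ad ℂ 𝔤 z).lTensor (Om R) A)
      (by intros; rw [add_smul])
      (by intros; rw [smul_assoc])
      (by intros; simp [LinearMap.lTensor_add, LinearMap.lTensor_neg, add_comm])
      (by
        intro c f z
        rw [map_smul, ← smul_neg, LinearMap.lTensor_smul, LinearMap.smul_apply, smul_comm]))

/-- The action of `b ∈ End_R (R ⊗ 𝔤)` on `Ω ⊗ 𝔤 = Ω ⊗_R (R ⊗ 𝔤)`. -/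
def formAct (b : Module.End R (R ⊗[ℂ] 𝔤)) : Om R ⊗[ℂ] 𝔤 →ₗ[ℂ] Om R ⊗[ℂ] 𝔤 :=
  TensorProduct.lift (LinearMap.mk₂ ℂ
    (fun (ω : Om R) (z : 𝔤) =>
      ((LinearMap.toSpanSingleton R (Om R) ω).restrictScalars ℂ).rTensor 𝔤 (b (1 ⊗ₜ[ℂ] z)))
    (by
      intro ω ω' z
      rw [← LinearMap.add_apply, ← LinearMap.rTensor_add]
      congr 2
      ext r
      simp)
    (by
      intro c ω z
      rw [← LinearMap.smul_apply, ← LinearMap.rTensor_smul]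
      congr 2
      ext r
      exact smul_comm r c ω)
    (by intros; simp [TensorProduct.tmul_add])
    (by intro c ω z; rw [TensorProduct.tmul_smul, LinearMap.map_smul_of_tower, map_smul]))

variable (R) in
/-- The subspace `Ω ⊗ W ⊆ Ω ⊗ 𝔤` of forms with values in a subspace `W ⊆ 𝔤`. -/
def formsIn (W : Submodule ℂ 𝔤) : Submodule ℂ (Om R ⊗[ℂ] 𝔤) :=
  LinearMap.range (W.subtype.lTensor (Om R))

/-- The oper condition on a connection form: `A` takes values in `𝔤^{-1}`, and for each simple
root `αᵢ` its component in `Ω ⊗ 𝔤^{-αᵢ}` (here `𝔤^{-αᵢ}` is a line) has no zeros, i.e. is a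
generator of the rank one module `Ω` times a generator of `𝔤^{-αᵢ}`. -/
def IsOperForm (A : Om R ⊗[ℂ] 𝔤) : Prop :=
  ∃ (a : ι → Om R) (e : ι → 𝔤),
    (∀ i, Function.Bijective (fun f : R => f • a i)) ∧
    (∀ i, e i ∈ rootSub H (-α i) ∧ e i ≠ 0) ∧
    A - ∑ i, a i ⊗ₜ[ℂ] e i ∈ formsIn R (filt H α 0)

end Algebra

/-! ### Regular functions and differentials on a curve over `ℂ` -/

section Curve

variable {Y : Scheme.{0}} (π : Y ⟶ Spec (.of ℂ))

/-- The `ℂ`-algebra `𝒪_Y(U)`. -/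
def Reg (_π : Y ⟶ Spec (.of ℂ)) (U : Y.Opens) : Type := Γ(Y, U)

instance (U : Y.Opens) : CommRing (Reg π U) := inferInstanceAs (CommRing Γ(Y, U))

instance (U : Y.Opens) : Algebra ℂ (Reg π U) :=
  ((Scheme.ΓSpecIso (.of ℂ)).inv ≫ π.appLE ⊤ U le_top).hom.toAlgebra

/-- Restriction of functions. -/
def res {U V : Y.Opens} (i : V ≤ U) : Reg π U →ₐ[ℂ] Reg π V where
  toRingHom := (Y.presheaf.map (homOfLE i).op).hom
  commutes' := by
    intro c
    have h := Scheme.Hom.appLE_map π (U := ⊤) (V := U) (V' := V) le_top (homOfLE i).op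
    exact congrArg (fun k => k.hom ((Scheme.ΓSpecIso (.of ℂ)).inv.hom c)) h

/-- `H⁰(Y, Ω^{⊗ k})`: compatible families of sections of the sheaf `Ω^{⊗ k}` over the affine
opens, on which these sections are the `k`-th tensor power of the Kähler differentials. -/
def H0 (k : ℕ) : Submodule ℂ (∀ U : Y.affineOpens, ⨂[Reg π U]^k (Om (Reg π U))) where
  carrier := {ω | ∀ (U V : Y.affineOpens) (i : V.1 ≤ U.1), omPowMap (res π i) k (ω U) = ω V}
  zero_mem' := by intro U V i; simp
  add_mem' := by intro a b ha hb U V i; simp [ha U V i, hb U V i]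
  smul_mem' := by intro c a ha U V i; simp [ha U V i]

/-- The value of a global section of `Ω^{⊗ k}` on an affine open. -/
def H0.restr (k : ℕ) (U : Y.affineOpens) : H0 π k →ₗ[ℂ] ⨂[Reg π U]^k (Om (Reg π U)) :=
  LinearMap.proj U ∘ₗ (H0 π k).subtype

/-! ### Opers -/

variable {𝔤 : Type} [LieRing 𝔤] [LieAlgebra ℂ 𝔤] (H : LieSubalgebra ℂ 𝔤)
variable {ι : Type} [Fintype ι] (α : ι → Module.Dual ℂ H)

/-- A `B_ad`-bundle on `Y`: a sheaf of sets (the sheaf of sections) that is a right torsor under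
the sheaf of groups `U ↦ B_ad(𝒪(U))`. -/
structure BorelBundle where
  sheaf : TopCat.Sheaf Type Y.toTopCat
  act : ∀ U : Y.Opens, sheaf.presheaf.obj (op U) → borelPts (Reg π U) H α →
    sheaf.presheaf.obj (op U)
  act_one : ∀ U s, act U s 1 = s
  act_mul : ∀ U s b c, act U s (b * c) = act U (act U s b) c
  map_act : ∀ (U V : Y.Opens) (i : V ≤ U) s b,
    sheaf.presheaf.map (homOfLE i).op (act U s b) =
      act V (sheaf.presheaf.map (homOfLE i).op s) (borelMap H α (res π i) b)
  simply_transitive : ∀ U s t, ∃! b, act U s b = t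
  locally_nonempty : ∀ p : Y, ∃ U : Y.Opens, p ∈ U ∧ Nonempty (sheaf.presheaf.obj (op U))

/-- A `𝔤`-oper on `Y`: a `B_ad`-bundle with a connection on the induced `G_ad`-bundle satisfying
the oper condition. The connection is given by its connection forms `form U s ∈ Ω(U) ⊗ 𝔤` with
respect to the local sections `s` of the `B_ad`-bundle over affine opens, subject to the gauge law
`d + form (s b) = b⁻¹ ∘ (d + form s) ∘ b`. -/
structure Oper extends BorelBundle π H α where
  form : ∀ U : Y.affineOpens, sheaf.presheaf.obj (op U.1) → Om (Reg π U) ⊗[ℂ] 𝔤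
  form_map : ∀ (U V : Y.affineOpens) (i : V.1 ≤ U.1) s,
    form V (sheaf.presheaf.map (homOfLE i).op s) = (omMap (res π i)).rTensor 𝔤 (form U s)
  form_act : ∀ (U : Y.affineOpens) s (b : borelPts (Reg π U) H α),
    formAct (b.1 : Module.End (Reg π U) (Reg π U ⊗[ℂ] 𝔤)) ∘ₗ connOp (form U (act U s b)) =
      connOp (form U s) ∘ₗ
        (b.1 : Module.End (Reg π U) (Reg π U ⊗[ℂ] 𝔤)).restrictScalars ℂ
  isOperForm : ∀ (U : Y.affineOpens) s, IsOperForm H α (form U s)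

variable {π H α}

/-- Two opers are isomorphic if there is an isomorphism of `B_ad`-bundles respecting the
connections. -/
def Oper.IsIso (P Q : Oper π H α) : Prop :=
  ∃ φ : P.sheaf.presheaf ≅ Q.sheaf.presheaf,
    (∀ (U : Y.Opens) s b, φ.hom.app (op U) (P.act U s b) = Q.act U (φ.hom.app (op U) s) b) ∧
    ∀ (U : Y.affineOpens) s, Q.form U (φ.hom.app (op U.1) s) = P.form U s

lemma Oper.IsIso.refl (P : Oper π H α) : P.IsIso P :=
  ⟨Iso.refl _, fun _ _ _ => rfl, fun _ _ => rfl⟩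

lemma Oper.IsIso.symm {P Q : Oper π H α} (h : P.IsIso Q) : Q.IsIso P := by
  obtain ⟨φ, h1, h2⟩ := h
  have hl : ∀ (U : Y.Opens) s, φ.inv.app (op U) (φ.hom.app (op U) s) = s := fun U s => by simp
  have hr : ∀ (U : Y.Opens) s, φ.hom.app (op U) (φ.inv.app (op U) s) = s := fun U s => by simp
  refine ⟨φ.symm, fun U s b => ?_, fun U s => ?_⟩
  · change φ.inv.app (op U) _ = P.act U (φ.inv.app (op U) s) b
    rw [← hl U (P.act U (φ.inv.app (op U) s) b), h1, hr]
  · change P.form U (φ.inv.app (op U.1) s) = _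
    rw [← h2, hr]

lemma Oper.IsIso.trans {P Q K : Oper π H α} (h : P.IsIso Q) (h' : Q.IsIso K) : P.IsIso K := by
  obtain ⟨φ, h1, h2⟩ := h
  obtain ⟨ψ, h3, h4⟩ := h'
  refine ⟨φ ≪≫ ψ, fun U s b => ?_, fun U s => ?_⟩
  · change ψ.hom.app (op U) (φ.hom.app (op U) _) =
      K.act U (ψ.hom.app (op U) (φ.hom.app (op U) s)) b
    rw [h1, h3]
  · change K.form U (ψ.hom.app (op U.1) (φ.hom.app (op U.1) s)) = _
    rw [h4, h2]

instance Oper.setoid : Setoid (Oper π H α) where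
  r := Oper.IsIso
  iseqv := ⟨Oper.IsIso.refl, Oper.IsIso.symm, Oper.IsIso.trans⟩

variable (π H α) in
/-- `Op_𝔤(Y)`: the set of isomorphism classes of `𝔤`-opers on `Y`. -/
def Op : Type 1 := Quotient (Oper.setoid (π := π) (H := H) (α := α))

variable (π) in
/-- An `sl(2)`-oper. -/
abbrev Sl2Oper : Type 1 := Oper π sl2Cartan sl2Root

variable (π) in
/-- `V^𝔤(Y) = ⨁_k V_{k-1} ⊗ H⁰(Y, Ω^{⊗ k})`, indexed by `j = k - 1 ≥ 0`
(recall that `V_j = 0` for `j ≤ 0`). -/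
abbrev VY (T : PrincipalTriple H α) : Type :=
  DirectSum ℕ fun j => T.V j ⊗[ℂ] H0 π (j + 1)

/-- `ω ↦ ω · 𝒳`, the element of `V_1 ⊗ H⁰(Y, Ω^{⊗ 2}) ⊆ V^𝔤(Y)` with `𝒳 = x ∈ V_1`. -/
def mulX (T : PrincipalTriple H α) (ω : H0 π 2) : VY π T :=
  DirectSum.lof ℂ ℕ (fun j => T.V j ⊗[ℂ] H0 π (j + 1)) 1
    ((⟨T.x, T.x_mem_V⟩ : T.V ((1 : ℕ) : ℤ)) ⊗ₜ[ℂ] ω)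

/-- The sum map `⨁_j V_j ⊗ Ω → Ω ⊗ 𝔤`. -/
def sumForm (R : Type) [CommRing R] [Algebra ℂ R] (T : PrincipalTriple H α) :
    (DirectSum ℕ fun j => T.V j ⊗[ℂ] Om R) →ₗ[ℂ] Om R ⊗[ℂ] 𝔤 :=
  DirectSum.toModule ℂ ℕ _ fun j =>
    (TensorProduct.comm ℂ 𝔤 (Om R)).toLinearMap ∘ₗ (T.V j).subtype.rTensor (Om R)

/-- Let `(ℱ₀, ∇₀)` be the `sl(2)`-oper `L` and `η ∈ V^𝔤(Y)`. `IsInduced T L η P` says that `P` is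
the `𝔤`-oper `(ℱ, ∇ + η)`, where `ℱ` is the `B_ad`-bundle induced from `ℱ₀` by the homomorphism
`ρ` of Borel groups defined by the triple `T`, and `∇` is the connection induced by `∇₀`.

* The induced bundle is characterized by a `ρ`-equivariant map of torsors `φ : ℱ₀ → ℱ`. The
  element `ρ(b₀) ∈ B_ad` is the only one whose action on `𝔤` is intertwined with that of `b₀` on
  `sl(2)` by `T.hom : sl(2) → 𝔤`, as the centralizer of the triple in `B_ad` is trivial.
* Let `s` be a section of `ℱ₀` and `a` the coefficient of `y` in its connection form. Then `a` is
  the generator of `Ω` that trivializes `Ω` as the line bundle induced by `ℱ₀` and the character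
  `χ`, so that in the trivialization `s` the section `v ⊗ (ω ⊗ a^{⊗ j})` of `V_j ⊗ Ω^{⊗ (j+1)}`
  is the `V_j`-valued form `v ⊗ ω`. The form `θ` is `η` in this trivialization. -/
def IsInduced (T : PrincipalTriple H α) (L : Sl2Oper π) (η : VY π T) (P : Oper π H α) : Prop :=
  ∃ φ : L.sheaf.presheaf ⟶ P.sheaf.presheaf,
    (∀ (U : Y.Opens) s (b₀ : borelPts (Reg π U) sl2Cartan sl2Root)
      (b : borelPts (Reg π U) H α),
      (∀ z, (b.1 : Module.End (Reg π U) (Reg π U ⊗[ℂ] 𝔤)) (T.hom.lTensor (Reg π U) z) =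
        T.hom.lTensor (Reg π U)
          ((b₀.1 : Module.End (Reg π U) (Reg π U ⊗[ℂ] sl2)) z)) →
      φ.app (op U) (L.act U s b₀) = P.act U (φ.app (op U) s) b) ∧
    ∀ (U : Y.affineOpens) s, ∃ (a : Om (Reg π U))
      (θ : DirectSum ℕ fun j => T.V j ⊗[ℂ] Om (Reg π U)),
      L.form U s - a ⊗ₜ[ℂ] sl2Triple.y ∈ formsIn (Reg π U) (filt sl2Cartan sl2Root 0) ∧
      P.form U (φ.app (op U.1) s) =
        T.hom.lTensor (Om (Reg π U)) (L.form U s) + sumForm (Reg π U) T θ ∧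
      ∀ j, (mulPow a j).lTensor (T.V j) (θ j) = (H0.restr π (j + 1) U).lTensor (T.V j) (η j)

/-- `IsShift L ω L'` says that `L' = L + ω` for the action of `ω ∈ H⁰(Y, Ω^{⊗ 2})` on
`sl(2)`-opers `L = (ℱ₀, ∇₀)`: this action replaces `∇₀` by `∇₀ - ω`, where `ω` is viewed as a
section of `𝔤^1_{ℱ₀} ⊗ Ω` by means of the isomorphism `𝔤^1_{ℱ₀} = Ω` given by `∇₀` and the
pairing `Tr(XY)`. -/
def IsShift (L : Sl2Oper π) (ω : H0 π 2) (L' : Sl2Oper π) : Prop :=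
  IsInduced sl2Triple L (-mulX sl2Triple ω) L'

variable (π) in
/-- The relation `(L + ω, η) ∼ (L, η - ω · 𝒳)` on `Op_{sl(2)}(Y) × V^𝔤(Y)`. -/
def shiftRel (T : PrincipalTriple H α) (p q : Op π sl2Cartan sl2Root × VY π T) : Prop :=
  ∃ (L L' : Sl2Oper π) (ω : H0 π 2) (η : VY π T), IsShift L ω L' ∧
    p = (Quotient.mk _ L', η) ∧ q = (Quotient.mk _ L, η - mulX T ω)

variable (π) in
/-- The affine space over `V^𝔤(Y)` induced by `Op_{sl(2)}(Y)`: the quotient of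
`Op_{sl(2)}(Y) × V^𝔤(Y)` by the equivalence relation generated by `shiftRel`. -/
def UnderlineOp (T : PrincipalTriple H α) : Type 1 := Quot (shiftRel π T)

/-- The class of `(L, η)`. -/
def UnderlineOp.mk (T : PrincipalTriple H α) (L : Sl2Oper π) (η : VY π T) : UnderlineOp π T :=
  Quot.mk _ (Quotient.mk _ L, η)

end Curve

end Opers

end

/-! Over an affine open with a generator `a` of `Ω`, a connection form is `a X` for a `𝔤`-valued
function `X`. It is an oper form when `X` lives in degrees at least `-1` and its coefficients at the
negative simple root vectors are invertible. The torus scales these coefficients to `1`, so that `X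
∈ y + 𝔟`. By `sl(2)`-theory `𝔟 = [y, 𝔤^1] ⊕ V`; conjugating by exponentials of elements of degree 1,
2, ... therefore removes everything outside `V` and leaves a normal form `y + v` with `v ∈ V`
(`PrincipalGrading.exists_gauge`). The gauge transformation to normal form is unique
(`PrincipalGrading.Gauge.eq_refl`). Hence opers have no automorphisms
(`OperData.eq_refl_of_formGauge`), a section of the bundle is determined by its connection form
(`Oper.form_inj`), and bundles can be built and compared through their connection forms alone
(`OperAtlas.toOper`, `Oper.exists_morphism`).

Replacing `a` by `u a` changes the normal form by an explicit element of the torus times `exp (r ad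
x)`, that is, by the image of an upper triangular element of `PGL(2)`
(`PrincipalGrading.upTri_gauge`). Under this change the degree `k` part of `v` behaves like the
coefficient of a section of `Ω^{⊗ (k+1)}`, apart from an additional Schwarzian-type term along `x`
that is the same for every `𝔤` (`OperData.pr_chg`). For surjectivity, choose a linear functional
that is `1` at `x` and lives in degree `1`: the `x`-coefficients of the normal forms are those of an
`sl(2)`-oper, and the remaining part of `v` is a global element of `V^𝔤(Y)` (`exists_isInduced_eq`).
For injectivity, the pair `(L, η)` has normal form `y + q x + η`, where `y + q x` is the normal form
of `L`; two pairs with the same image can only differ by moving a multiple of `x` from one summand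
to the other, which is the defining relation (`exists_isShift`). The same computation shows that the
map is well defined (`IsShift.isIso`).

Two inputs connect this with the definitions. The Borel group, given by generators, consists of the
automorphisms that preserve the filtration and are trivial on `F 0 / F 1`
(`OperData.mem_borelGroup_iff`); since functions on a smooth scheme are separated by complex points,
the same description holds for functions with values in it (`OperData.mem_borelPts_iff`). Local data
glue because `Ω` is finite projective on affine opens and restriction maps are étale
(`exists_dualBasis`). -/

noncomputable section

namespace Opers

/-! ### Integral gradings of Lie algebras and the tori they define. -/

/-- A bounded `ℤ`-grading of a Lie algebra, given by its projections. -/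
structure IntGrading (R E : Type) [CommRing R] [LieRing E] [LieAlgebra R E] where
  pr : ℤ → E →ₗ[R] E
  bound : ℕ
  pr_pr : ∀ i j z, pr i (pr j z) = if i = j then pr j z else 0
  pr_eq_zero : ∀ (k : ℤ) (z : E), ((bound : ℤ) < k ∨ k < -(bound : ℤ)) → pr k z = 0
  sum_pr : ∀ z, ∑ k ∈ Finset.Icc (-(bound : ℤ)) (bound : ℤ), pr k z = z
  pr_lie : ∀ k i z w, pr k ⁅pr i z, w⁆ = ⁅pr i z, pr (k - i) w⁆

/-- A `ℤ`-grading of a Lie algebra `E` by the eigenvalues of `ad h / 2`, where `h` belongs to an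
`sl(2)`-triple `{h, x, y}`, together with an operator `sig` of degree `1` which is left inverse to
`ad y` in positive degrees, right inverse to it in negative degrees, and whose kernel in
non-negative degrees is killed by `ad x`. -/
structure PrincipalGrading (R E : Type) [CommRing R] [LieRing E] [LieAlgebra R E] extends
    IntGrading R E where
  h : E
  x : E
  y : E
  pr_h : pr 0 h = h
  pr_x : pr 1 x = x
  pr_y : pr (-1) y = y
  lie_h : ∀ k z, ⁅h, pr k z⁆ = ((2 * k : ℤ) : R) • pr k z
  lie_x_y : ⁅x, y⁆ = h
  sig : E →ₗ[R] E
  pr_sig : ∀ k z, pr (k + 1) (sig z) = sig (pr k z)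
  sig_lie : ∀ k z, 1 ≤ k → sig ⁅y, pr k z⁆ = pr k z
  lie_sig : ∀ k z, k ≤ -1 → ⁅y, sig (pr k z)⁆ = pr k z
  lie_x_lie_y_sig : ∀ k z, 0 ≤ k → ⁅x, ⁅y, sig (pr k z)⁆⁆ = ⁅x, pr k z⁆
  sig_x : sig x = 0
  faithful : ∀ z : E, (∀ w : E, ⁅z, w⁆ = 0) → z = 0

namespace IntGrading

variable {R E : Type} [CommRing R] [LieRing E] [LieAlgebra R E] (G : IntGrading R E)

/-- The linear map that multiplies the elements of degree `k` by `u ^ k`. -/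
def torusMap (u : Rˣ) : E →ₗ[R] E :=
  ∑ j ∈ Finset.Icc (-(G.bound : ℤ)) (G.bound : ℤ), ((u ^ j : Rˣ) : R) • G.pr j

lemma torusMap_pr (u : Rˣ) (k : ℤ) (z : E) :
    G.torusMap u (G.pr k z) = ((u ^ k : Rˣ) : R) • G.pr k z := by
  rw [torusMap, LinearMap.sum_apply]
  by_cases hk : (-(G.bound : ℤ)) ≤ k ∧ k ≤ G.bound
  · rw [Finset.sum_eq_single k]
    · simp [G.pr_pr]
    · intro j _ hj
      simp [G.pr_pr, hj]
    · intro h; simp at h; omega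
  · rw [G.pr_eq_zero k z (by omega)]; simp

lemma torusMap_torusMap {u v : Rˣ} (huv : v * u = 1) (z : E) :
    G.torusMap u (G.torusMap v z) = z := by
  conv_rhs => rw [← G.sum_pr z]
  conv_lhs => rw [torusMap.eq_def G v]
  rw [LinearMap.sum_apply, map_sum]
  refine Finset.sum_congr rfl fun j _ => ?_
  rw [LinearMap.smul_apply, map_smul, torusMap_pr, smul_smul, ← Units.val_mul, ← mul_zpow,
    huv, one_zpow, Units.val_one, one_smul]

lemma torusMap_lie (u : Rˣ) (z w : E) :
    G.torusMap u ⁅z, w⁆ = ⁅G.torusMap u z, G.torusMap u w⁆ := by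
  have h1 : ∀ i j, G.torusMap u ⁅G.pr i z, G.pr j w⁆ =
      ((u ^ (i + j) : Rˣ) : R) • ⁅G.pr i z, G.pr j w⁆ := by
    intro i j
    have : ⁅G.pr i z, G.pr j w⁆ = G.pr (i + j) ⁅G.pr i z, w⁆ := by
      rw [G.pr_lie, add_sub_cancel_left]
    rw [this, torusMap_pr]
  conv_lhs => rw [← G.sum_pr z, ← G.sum_pr w]
  conv_rhs => rw [← G.sum_pr z, ← G.sum_pr w]
  rw [sum_lie_sum, map_sum, map_sum, map_sum, sum_lie_sum]
  refine Finset.sum_congr rfl fun i _ => ?_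
  rw [map_sum]
  refine Finset.sum_congr rfl fun j _ => ?_
  rw [h1, torusMap_pr, torusMap_pr, smul_lie, lie_smul, smul_smul, zpow_add, Units.val_mul]

/-- The automorphism of a graded Lie algebra that multiplies the elements of degree `k` by
`u ^ k`. -/
def torus (u : Rˣ) : E ≃ₗ⁅R⁆ E :=
  { toLinearMap := G.torusMap u
    map_lie' := fun {z w} => G.torusMap_lie u z w
    invFun := fun z => G.torusMap u⁻¹ z
    left_inv := fun z => G.torusMap_torusMap (mul_inv_cancel u) z
    right_inv := fun z => G.torusMap_torusMap (inv_mul_cancel u) z }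

lemma torus_pr (u : Rˣ) (k : ℤ) (z : E) :
    G.torus u (G.pr k z) = ((u ^ k : Rˣ) : R) • G.pr k z :=
  G.torusMap_pr u k z

lemma torus_symm_pr (u : Rˣ) (k : ℤ) (z : E) :
    (G.torus u).symm (G.pr k z) = ((u ^ (-k) : Rˣ) : R) • G.pr k z := by
  rw [zpow_neg, ← inv_zpow]
  exact G.torusMap_pr u⁻¹ k z

lemma torus_apply (u : Rˣ) (z : E) :
    G.torus u z = ∑ j ∈ Finset.Icc (-(G.bound : ℤ)) (G.bound : ℤ), ((u ^ j : Rˣ) : R) • G.pr j z := by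
  change G.torusMap u z = _
  simp [torusMap]

end IntGrading

/-! ### The filtration of a principal grading, its automorphisms and normal forms of connections. -/

namespace PrincipalGrading

variable {R E : Type} [CommRing R] [LieRing E] [LieAlgebra R E] (G : PrincipalGrading R E)

/-- The filtration by degree. -/
def F (k : ℤ) : Submodule R E := ⨅ j : {j : ℤ // j < k}, LinearMap.ker (G.pr j)

/-- The elements of non-negative degree that are killed by `sig`. -/
def V : Submodule R E := G.F 0 ⊓ LinearMap.ker G.sig

variable {G}

lemma mem_F {k : ℤ} {z : E} : z ∈ G.F k ↔ ∀ j < k, G.pr j z = 0 := by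
  simp [F, Submodule.mem_iInf]

lemma mem_V {z : E} : z ∈ G.V ↔ z ∈ G.F 0 ∧ G.sig z = 0 := by
  simp [V]

lemma F_mono {i j : ℤ} (h : i ≤ j) {z : E} (hz : z ∈ G.F j) : z ∈ G.F i :=
  mem_F.2 fun k hk => mem_F.1 hz k (hk.trans_le h)

lemma pr_self (k : ℤ) (z : E) : G.pr k (G.pr k z) = G.pr k z := by simp [G.pr_pr]

lemma pr_mem_F {k j : ℤ} (h : k ≤ j) (z : E) : G.pr j z ∈ G.F k :=
  mem_F.2 fun i hi => by rw [G.pr_pr, if_neg (by omega)]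

lemma mem_F_succ {k : ℤ} {z : E} (hz : z ∈ G.F k) (h : G.pr k z = 0) : z ∈ G.F (k + 1) :=
  mem_F.2 fun j hj => by
    rcases (Int.lt_add_one_iff.1 hj).lt_or_eq with h' | h'
    · exact mem_F.1 hz j h'
    · rw [h', h]

lemma sub_pr_mem {k : ℤ} {z : E} (hz : z ∈ G.F k) : z - G.pr k z ∈ G.F (k + 1) :=
  mem_F_succ (sub_mem hz (pr_mem_F le_rfl z)) (by simp [pr_self])

lemma eq_zero_of_mem_F {k : ℤ} (hk : (G.bound : ℤ) < k) {z : E} (hz : z ∈ G.F k) : z = 0 := by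
  rw [← G.sum_pr z]
  exact Finset.sum_eq_zero fun j hj => mem_F.1 hz j (by simp at hj; omega)

lemma mem_F_of_le {k : ℤ} (hk : k ≤ -(G.bound : ℤ)) (z : E) : z ∈ G.F k :=
  mem_F.2 fun j hj => G.pr_eq_zero j z (Or.inr (by omega))

lemma ext_pr {z w : E} (h : ∀ k, G.pr k z = G.pr k w) : z = w := by
  rw [← G.sum_pr z, ← G.sum_pr w]
  exact Finset.sum_congr rfl fun k _ => h k

/-- An element is the finite sum of its homogeneous components, and in `F k` those of degree below
`k` vanish. Additive statements about `F k` thus reduce to homogeneous elements. -/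
lemma F_induction {k : ℤ} {p : E → Prop} (h0 : p 0) (hadd : ∀ z w, p z → p w → p (z + w))
    (hpr : ∀ j, k ≤ j → ∀ z, p (G.pr j z)) {z : E} (hz : z ∈ G.F k) : p z := by
  classical
  rw [← G.sum_pr z]
  refine Finset.sum_induction _ p hadd h0 fun j _ => ?_
  rcases lt_or_ge j k with h | h
  · rw [mem_F.1 hz j h]; exact h0
  · exact hpr j h z

lemma pr_lie_sum (k : ℤ) (z w : E) :
    G.pr k ⁅z, w⁆ = ∑ i ∈ Finset.Icc (-(G.bound : ℤ)) G.bound, ⁅G.pr i z, G.pr (k - i) w⁆ := by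
  conv_lhs => rw [← G.sum_pr z]
  rw [sum_lie, map_sum]
  exact Finset.sum_congr rfl fun i _ => G.pr_lie k i z w

lemma lie_mem_F {i j : ℤ} {z w : E} (hz : z ∈ G.F i) (hw : w ∈ G.F j) : ⁅z, w⁆ ∈ G.F (i + j) :=
  mem_F.2 fun k hk => by
    rw [pr_lie_sum]
    refine Finset.sum_eq_zero fun l _ => ?_
    rcases lt_or_ge l i with h | h
    · rw [mem_F.1 hz l h, zero_lie]
    · rw [mem_F.1 hw (k - l) (by omega), lie_zero]

lemma lie_mem_F' {i j k : ℤ} (h : k ≤ i + j) {z w : E} (hz : z ∈ G.F i) (hw : w ∈ G.F j) :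
    ⁅z, w⁆ ∈ G.F k :=
  F_mono h (lie_mem_F hz hw)

/-- The leading term of a bracket is the bracket of the leading terms, since `z - pr i z` lies one
step deeper and contributes nothing in degree `i + j`. -/
lemma pr_lie_of_mem {i j : ℤ} {z w : E} (hz : z ∈ G.F i) (hw : w ∈ G.F j) :
    G.pr (i + j) ⁅z, w⁆ = ⁅G.pr i z, G.pr j w⁆ := by
  have h1 := lie_mem_F (sub_pr_mem hz) hw
  have h2 := mem_F.1 h1 (i + j) (by omega)
  rw [sub_lie, map_sub, sub_eq_zero, G.pr_lie] at h2
  rw [h2, add_sub_cancel_left]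

lemma h_mem : G.h ∈ G.F 0 := by rw [← G.pr_h]; exact pr_mem_F le_rfl _

lemma y_mem : G.y ∈ G.F (-1) := by rw [← G.pr_y]; exact pr_mem_F le_rfl _

lemma pr_lie_y (k : ℤ) (w : E) : G.pr k ⁅G.y, w⁆ = ⁅G.y, G.pr (k + 1) w⁆ := by
  have := G.pr_lie k (-1) G.y w
  rw [G.pr_y] at this
  rw [this]; congr 2

lemma pr_lie_h (k : ℤ) (w : E) : G.pr k ⁅G.h, w⁆ = ((2 * k : ℤ) : R) • G.pr k w := by
  have := G.pr_lie k 0 G.h w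
  rw [G.pr_h, sub_zero, G.lie_h] at this
  exact this

lemma sig_mem {k : ℤ} {z : E} (hz : z ∈ G.F k) : G.sig z ∈ G.F (k + 1) :=
  mem_F.2 fun j hj => by
    have := G.pr_sig (j - 1) z
    rw [sub_add_cancel] at this
    rw [this, mem_F.1 hz _ (by omega), map_zero]

lemma sig_lie_of_mem {w : E} (hw : w ∈ G.F 1) : G.sig ⁅G.y, w⁆ = w :=
  F_induction (p := fun w => G.sig ⁅G.y, w⁆ = w) (by simp)
    (fun z w hz hw => by rw [lie_add, map_add, hz, hw]) (fun j hj z => G.sig_lie j z hj) hw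

lemma lie_y_sig_of_neg {k : ℤ} (hk : k ≤ -1) (z : E) : ⁅G.y, G.pr (k + 1) (G.sig z)⁆ = G.pr k z := by
  rw [G.pr_sig, G.lie_sig k z hk]

lemma pr_mem_V {z : E} (hz : z ∈ G.V) (k : ℤ) : G.pr k z ∈ G.V := by
  rw [mem_V] at hz ⊢
  refine ⟨mem_F.2 fun j hj => ?_, ?_⟩
  · rw [G.pr_pr]; split_ifs with h
    · rw [← h]; exact mem_F.1 hz.1 j hj
    · rfl
  · rw [← G.pr_sig, hz.2, map_zero]

/-- Transversality of `V` and `[y, F 1]`: `sig` recovers `w` from `[y, w]` and kills `V`. -/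
lemma eq_zero_of_lie_y_mem_V {w : E} (hw : w ∈ G.F 1) (h : ⁅G.y, w⁆ ∈ G.V) : w = 0 := by
  rw [← sig_lie_of_mem hw, (mem_V.1 h).2]

lemma int_smul_eq_zero [Algebra ℂ R] {k : ℤ} (hk : k ≠ 0) {z : E} (h : (k : R) • z = 0) :
    z = 0 := by
  have : IsUnit (k : R) := by
    have : IsUnit (k : ℂ) := by simpa using hk
    simpa using this.map (algebraMap ℂ R)
  exact this.smul_eq_zero.1 h

/-- For `j < m` the degree `j` component of `Z` maps degree `k - j` to degree `k`, where the
hypothesis leaves no room for it. So this component commutes with everything and vanishes by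
`faithful`. -/
lemma mem_F_of_forall_lie {m : ℤ} {Z : E} (h : ∀ k, ∀ z ∈ G.F k, ⁅Z, z⁆ ∈ G.F (k + m)) :
    Z ∈ G.F m :=
  mem_F.2 fun j hj => G.faithful _ fun w => by
    refine ext_pr (G := G) fun k => ?_
    rw [G.pr_lie, map_zero]
    have h1 := mem_F.1 (h (k - j) (G.pr (k - j) w) (pr_mem_F le_rfl _)) k (by omega)
    rw [pr_lie_sum] at h1
    by_cases hb : (-(G.bound : ℤ)) ≤ j ∧ j ≤ G.bound
    · rw [Finset.sum_eq_single j] at h1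
      · rwa [pr_self] at h1
      · intro i _ hi
        rw [G.pr_pr, if_neg (by omega), lie_zero]
      · intro h; simp at h; omega
    · rw [G.pr_eq_zero j Z (by omega), zero_lie]

/-! ### Automorphisms -/

variable (G) in
/-- Automorphisms of `E` preserving the filtration and trivial on `F 0 / F 1`. -/
structure IsUpper (b : E ≃ₗ⁅R⁆ E) : Prop where
  mem : ∀ k, ∀ z ∈ G.F k, b z ∈ G.F k
  sub_mem : ∀ z ∈ G.F 0, b z - z ∈ G.F 1

variable (G) in
/-- The elements of the Borel subgroup. -/
structure IsBorel (b : E ≃ₗ⁅R⁆ E) : Prop where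
  upper : G.IsUpper b
  symm_upper : G.IsUpper b.symm

lemma IsUpper.refl : G.IsUpper LieEquiv.refl := ⟨fun _ _ hz => hz, fun z _ => by simp⟩

lemma IsUpper.trans {b c : E ≃ₗ⁅R⁆ E} (hb : G.IsUpper b) (hc : G.IsUpper c) :
    G.IsUpper (b.trans c) where
  mem k z hz := hc.mem k _ (hb.mem k z hz)
  sub_mem z hz := by
    have := add_mem (hc.sub_mem _ (hb.mem 0 z hz)) (hb.sub_mem z hz)
    simpa using this

lemma IsBorel.refl : G.IsBorel LieEquiv.refl := ⟨IsUpper.refl, IsUpper.refl⟩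

lemma IsBorel.symm {b : E ≃ₗ⁅R⁆ E} (hb : G.IsBorel b) : G.IsBorel b.symm :=
  ⟨hb.symm_upper, hb.upper⟩

lemma IsBorel.trans {b c : E ≃ₗ⁅R⁆ E} (hb : G.IsBorel b) (hc : G.IsBorel c) :
    G.IsBorel (b.trans c) :=
  ⟨hb.upper.trans hc.upper, hc.symm_upper.trans hb.symm_upper⟩

/-- An automorphism congruent to the identity up to degree `m ≥ 1` belongs to the Borel
subgroup. -/
lemma IsBorel.of_sub_mem {m : ℤ} (hm : 1 ≤ m) {b : E ≃ₗ⁅R⁆ E}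
    (h : ∀ k, ∀ z ∈ G.F k, b z - z ∈ G.F (k + m))
    (h' : ∀ k, ∀ z ∈ G.F k, b.symm z - z ∈ G.F (k + m)) : G.IsBorel b :=
  ⟨⟨fun k z hz => by simpa using add_mem (F_mono (by omega) (h k z hz)) hz,
    fun z hz => F_mono (by omega) (h 0 z hz)⟩,
   ⟨fun k z hz => by simpa using add_mem (F_mono (by omega) (h' k z hz)) hz,
    fun z hz => F_mono (by omega) (h' 0 z hz)⟩⟩

/-! ### Exponentials -/

lemma ad_pow_mem {m k : ℤ} {n z : E} (hn : n ∈ G.F m) (hz : z ∈ G.F k) (i : ℕ) :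
    (LieAlgebra.ad R E n ^ i) z ∈ G.F (k + i * m) := by
  induction i with
  | zero => simpa using hz
  | succ i ih =>
    rw [pow_succ', Module.End.mul_apply, LieAlgebra.ad_apply]
    refine lie_mem_F' (le_of_eq ?_) hn ih
    push_cast; ring

lemma exists_ad_pow_eq_zero {n : E} (hn : n ∈ G.F 1) : ∃ N : ℕ, LieAlgebra.ad R E n ^ N = 0 := by
  -- Degrees range over `[-bound, bound]` and `ad n` raises them by at least one.
  refine ⟨2 * G.bound + 1, LinearMap.ext fun z => ?_⟩
  refine eq_zero_of_mem_F (G := G) ?_ (ad_pow_mem hn (mem_F_of_le le_rfl z) _)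
  push_cast; omega

/-- The partial sums of the exponential series of `ad n`. -/
def expSum [Algebra ℂ R] (n : E) (N : ℕ) : E →ₗ[R] E :=
  ∑ i ∈ Finset.range N, algebraMap ℂ R (i.factorial : ℂ)⁻¹ • LieAlgebra.ad R E n ^ i

end PrincipalGrading

/-- This is `LieDerivation.exp`, which works with rational coefficients. The rational structures on
`R` and `E` are induced from the complex one, so that the factorials of both exponential series
agree. -/
lemma exists_lieEquiv_expSum {R E : Type} [CommRing R] [LieRing E] [LieAlgebra R E] [Algebra ℂ R]
    (n : E) (N : ℕ) (hN : LieAlgebra.ad R E n ^ N = 0) :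
    ∃ b : E ≃ₗ⁅R⁆ E, (∀ z, b z = PrincipalGrading.expSum (R := R) n N z) ∧
      ∀ z, b.symm z = PrincipalGrading.expSum (R := R) (-n) N z := by
  let _ : Algebra ℚ R := ((algebraMap ℂ R).comp (algebraMap ℚ ℂ)).toAlgebra
  let _ : Module ℚ E := Module.compHom E (algebraMap ℚ R)
  have : IsScalarTower ℚ R E := ⟨fun q r z => by
    rw [Algebra.smul_def, mul_smul]; rfl⟩
  let _ : LieAlgebra ℚ E := { lie_smul := fun q z w => by
                               change ⁅z, algebraMap ℚ R q • w⁆ = algebraMap ℚ R q • ⁅z, w⁆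
                               rw [lie_smul] }
  have hq : ∀ (q : ℚ) (f : E →ₗ[R] E), q • f = algebraMap ℂ R (q : ℂ) • f := by
    intro q f
    ext z
    change q • f z = _
    rw [← algebraMap_smul R q (f z)]; rfl
  have had : (LieDerivation.ad R E n).toLinearMap = LieAlgebra.ad R E n := by
    ext z; simp
  have hD : IsNilpotent (LieDerivation.ad R E n).toLinearMap := ⟨N, by rw [had, hN]⟩
  refine ⟨LieDerivation.exp (LieDerivation.ad R E n) hD, fun z => ?_, fun z => ?_⟩
  · have : LieDerivation.exp (LieDerivation.ad R E n) hD z =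
      IsNilpotent.exp (LieDerivation.ad R E n).toLinearMap z := LieDerivation.exp_map_apply _ hD z
    rw [this, had, IsNilpotent.exp_eq_sum (k := N) hN, PrincipalGrading.expSum]
    congr 1
    refine Finset.sum_congr rfl fun i _ => ?_
    rw [hq]; push_cast; rfl
  -- The inverse of the exponential is by construction the exponential of the opposite derivation.
  · change IsNilpotent.exp (-(LieDerivation.ad R E n).toLinearMap) z = _
    have e : -(LieDerivation.ad R E n).toLinearMap = LieAlgebra.ad R E (-n) := by
      rw [map_neg, had]
    have hN' : LieAlgebra.ad R E (-n) ^ N = 0 := by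
      rw [map_neg, neg_pow, hN, mul_zero]
    rw [e, IsNilpotent.exp_eq_sum (k := N) hN', PrincipalGrading.expSum]
    congr 1
    refine Finset.sum_congr rfl fun i _ => ?_
    rw [hq]; push_cast; rfl

namespace PrincipalGrading

variable {R E : Type} [CommRing R] [LieRing E] [LieAlgebra R E] {G : PrincipalGrading R E}

lemma expSum_add_two [Algebra ℂ R] (n : E) (N : ℕ) (z : E) :
    expSum (R := R) n (N + 2) z = z + ⁅n, z⁆ + ∑ i ∈ Finset.range N,
      algebraMap ℂ R ((i + 2).factorial : ℂ)⁻¹ • (LieAlgebra.ad R E n ^ (i + 2)) z := by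
  rw [expSum, Finset.sum_range_succ', Finset.sum_range_succ']
  simp [LinearMap.sum_apply]
  abel

/-- All terms of the series after the linear one contain `ad n` at least twice, and each factor
raises the degree by `m`. -/
lemma expSum_sub_mem [Algebra ℂ R] {m k : ℤ} (hm : 1 ≤ m) {n z : E} (hn : n ∈ G.F m)
    (hz : z ∈ G.F k) (N : ℕ) :
    expSum (R := R) n (N + 2) z - z - ⁅n, z⁆ ∈ G.F (k + 2 * m) := by
  rw [expSum_add_two]
  have : ∀ a b c : E, a + b + c - a - b = c := fun a b c => by abel
  rw [this]
  refine Submodule.sum_mem _ fun i _ => Submodule.smul_mem _ _ ?_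
  refine F_mono ?_ (ad_pow_mem hn hz (i + 2))
  push_cast
  nlinarith [Int.natCast_nonneg i]

variable (G) in
/-- The exponential of `ad n` for `n` of positive degree. -/
lemma exists_exp [Algebra ℂ R] {m : ℤ} (hm : 1 ≤ m) {n : E} (hn : n ∈ G.F m) :
    ∃ (b : E ≃ₗ⁅R⁆ E) (N : ℕ), LieAlgebra.ad R E n ^ N = 0 ∧ G.IsBorel b ∧
      (∀ z, b z = expSum (R := R) n N z) ∧ (∀ z, b.symm z = expSum (R := R) (-n) N z) ∧
      (∀ k, ∀ z ∈ G.F k, b z - z ∈ G.F (k + m)) ∧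
      (∀ k, ∀ z ∈ G.F k, b z - z - ⁅n, z⁆ ∈ G.F (k + 2 * m)) ∧
      (∀ k, ∀ z ∈ G.F k, b.symm z - z + ⁅n, z⁆ ∈ G.F (k + 2 * m)) := by
  obtain ⟨N, hN⟩ := exists_ad_pow_eq_zero (F_mono hm hn)
  -- The exponent is raised by two so that the constant and linear terms can always be split off.
  have hN2 : LieAlgebra.ad R E n ^ (N + 2) = 0 := by rw [pow_add, hN, zero_mul]
  obtain ⟨b, hb, hb'⟩ := exists_lieEquiv_expSum n (N + 2) hN2
  have h2 : ∀ k, ∀ z ∈ G.F k, b z - z - ⁅n, z⁆ ∈ G.F (k + 2 * m) := fun k z hz => by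
    rw [hb]; exact expSum_sub_mem hm hn hz N
  have h3 : ∀ k, ∀ z ∈ G.F k, b.symm z - z + ⁅n, z⁆ ∈ G.F (k + 2 * m) := fun k z hz => by
    rw [hb']
    have := expSum_sub_mem hm (neg_mem hn) hz N
    rwa [neg_lie, sub_neg_eq_add] at this
  have h1 : ∀ k, ∀ z ∈ G.F k, b z - z ∈ G.F (k + m) := fun k z hz => by
    have := add_mem (F_mono (by omega) (h2 k z hz)) (lie_mem_F' (k := k + m) (by omega) hn hz)
    simpa using this
  have h4 : ∀ k, ∀ z ∈ G.F k, b.symm z - z ∈ G.F (k + m) := fun k z hz => by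
    have := sub_mem (F_mono (by omega) (h3 k z hz)) (lie_mem_F' (k := k + m) (by omega) hn hz)
    simpa using this
  exact ⟨b, N + 2, hN2, IsBorel.of_sub_mem hm h1 h4, hb, hb', h1, h2, h3⟩

/-! ### Gauge transformations -/

variable (G) in
/-- A derivation of `E` of degree zero over a derivation `d` of the ground ring, compatible with
automorphisms up to inner derivations. -/
structure IsDer [Algebra ℂ R] (d : Derivation ℂ R R) (δ : E →+ E) : Prop where
  smul : ∀ (r : R) z, δ (r • z) = d r • z + r • δ z
  map_h : δ G.h = 0
  map_x : δ G.x = 0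
  lie : ∀ z w, δ ⁅z, w⁆ = ⁅δ z, w⁆ + ⁅z, δ w⁆
  pr : ∀ k z, δ (G.pr k z) = G.pr k (δ z)
  exists_conn : ∀ b : E ≃ₗ⁅R⁆ E, ∃ Z : E, ∀ t : E, δ (b t) = b (δ t) + b ⁅Z, t⁆

/-- `b` transforms the connection `δ + ad X` into `δ + ad X'`. -/
def Gauge (δ : E →+ E) (b : E ≃ₗ⁅R⁆ E) (X X' : E) : Prop :=
  ∀ t, b (δ t + ⁅X', t⁆) = δ (b t) + ⁅X, b t⁆

variable {δ : E →+ E}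

lemma Gauge.refl (X : E) : Gauge δ (LieEquiv.refl : E ≃ₗ⁅R⁆ E) X X := fun t => by simp

lemma Gauge.trans {b c : E ≃ₗ⁅R⁆ E} {X X' X'' : E} (h : Gauge δ b X X') (h' : Gauge δ c X' X'') :
    Gauge δ (c.trans b) X X'' := fun t => by
  simp only [LieEquiv.trans_apply]
  rw [h' t, h (c t)]

/-- With `b⁻¹ δ b = δ + ad Z`, the gauge law compares inner derivations. As the adjoint action is
faithful, it becomes an equation between elements of `E`. -/
lemma gauge_iff {b : E ≃ₗ⁅R⁆ E} {Z : E} (hZ : ∀ t, δ (b t) = b (δ t) + b ⁅Z, t⁆)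
    (G : PrincipalGrading R E) {X X' : E} : Gauge δ b X X' ↔ b X' = X + b Z := by
  constructor
  · intro h
    rw [← sub_eq_zero]
    refine G.faithful _ fun w => ?_
    obtain ⟨t, rfl⟩ : ∃ t, b t = w := ⟨b.symm w, b.apply_symm_apply w⟩
    have := h t
    rw [hZ, map_add, LieEquiv.map_lie, LieEquiv.map_lie] at this
    rw [sub_lie, add_lie, sub_eq_zero]
    have h2 := add_left_cancel (this.trans (add_assoc _ _ _))
    rw [h2, add_comm]
  · intro h t
    rw [hZ, map_add, LieEquiv.map_lie, LieEquiv.map_lie, h, add_lie]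
    abel

/-- `b [Z, z] = δ (b z - z) - (b (δ z) - δ z)` and `δ` preserves degrees, so `ad Z` raises the
filtration by as much as `b - 1` does; then `mem_F_of_forall_lie` applies. -/
lemma conn_mem [Algebra ℂ R] {d : Derivation ℂ R R} (hδ : G.IsDer d δ) {b : E ≃ₗ⁅R⁆ E} (hb : G.IsBorel b) {Z : E}
    (hZ : ∀ t, δ (b t) = b (δ t) + b ⁅Z, t⁆) {m : ℤ}
    (h : ∀ k, ∀ z ∈ G.F k, b z - z ∈ G.F (k + m)) : Z ∈ G.F m := by
  have hδF : ∀ k, ∀ z ∈ G.F k, δ z ∈ G.F k := fun k z hz => mem_F.2 fun j hj => by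
    rw [← hδ.pr, mem_F.1 hz j hj, map_zero]
  refine mem_F_of_forall_lie fun k z hz => ?_
  have h1 : b ⁅Z, z⁆ = δ (b z - z) - (b (δ z) - δ z) := by
    rw [map_sub, hZ]; abel
  have h2 : b ⁅Z, z⁆ ∈ G.F (k + m) := by
    rw [h1]
    exact sub_mem (hδF _ _ (h k z hz)) (h k _ (hδF k z hz))
  simpa using hb.symm_upper.mem _ _ h2

lemma forall_sub_mem_of_pr {b : E ≃ₗ⁅R⁆ E} {m : ℤ}
    (h : ∀ k z, b (G.pr k z) - G.pr k z ∈ G.F (k + m)) (k : ℤ) (z : E) (hz : z ∈ G.F k) :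
    b z - z ∈ G.F (k + m) :=
  F_induction (p := fun z => b z - z ∈ G.F (k + m)) (by simp)
    (fun z w hz hw => by
      have := add_mem hz hw
      rw [map_add]
      convert this using 1; abel)
    (fun j hj z => F_mono (by omega) (h j z)) hz

/-- By definition `b` is trivial on `F 0 / F 1`. Bracketing with `y`, which `b` fixes modulo `F 0`,
spreads this to the other graded pieces: upwards because `ad y` is injective in positive degrees,
downwards because it maps onto the negative ones. -/
lemma sub_mem_one {b : E ≃ₗ⁅R⁆ E} (hb : G.IsBorel b) (hy : b G.y - G.y ∈ G.F 0) (k : ℤ) (z : E)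
    (hz : z ∈ G.F k) : b z - z ∈ G.F (k + 1) := by
  refine forall_sub_mem_of_pr (fun k z => ?_) k z hz
  clear hz
  have hpos : ∀ (j : ℕ) (z : E), b (G.pr j z) - G.pr j z ∈ G.F (j + 1) := by
    intro j
    induction j with
    | zero =>
      intro z
      exact F_mono (by simp) (hb.upper.sub_mem _ (pr_mem_F (by simp) z))
    | succ j ih =>
      intro z
      set u := G.pr ((j + 1 : ℕ) : ℤ) z with hu
      have hu1 : u ∈ G.F (j + 1) := pr_mem_F (by push_cast; omega) z
      have hw : b u - u ∈ G.F (j + 1) := sub_mem (hb.upper.mem _ _ hu1) hu1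
      have hyu : ⁅G.y, u⁆ = G.pr j ⁅G.y, z⁆ := by
        rw [pr_lie_y, hu]; norm_cast
      have h1 : ⁅G.y, b u - u⁆ ∈ G.F (j + 1) := by
        have e : ⁅G.y, b u - u⁆ = (b ⁅G.y, u⁆ - ⁅G.y, u⁆) - ⁅b G.y - G.y, b u⁆ := by
          rw [LieEquiv.map_lie, lie_sub, sub_lie]; abel
        rw [e]
        refine sub_mem ?_ (lie_mem_F' (by omega) hy (hb.upper.mem _ _ hu1))
        rw [hyu]; exact ih _
      have h2 := mem_F.1 h1 j (by omega)
      rw [pr_lie_y] at h2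
      have h3 := G.sig_lie (j + 1) (b u - u) (by omega)
      rw [h2, map_zero] at h3
      push_cast
      exact mem_F_succ hw h3.symm
  have hneg : ∀ (j : ℕ) (z : E), b (G.pr (-j) z) - G.pr (-j) z ∈ G.F (-j + 1) := by
    intro j
    induction j with
    | zero => intro z; simpa using hpos 0 z
    | succ j ih =>
      intro z
      have h0 := lie_y_sig_of_neg (G := G) (k := -((j + 1 : ℕ) : ℤ)) (by push_cast; omega) z
      have h0' : -((j + 1 : ℕ) : ℤ) + 1 = -(j : ℤ) := by push_cast; ring
      rw [h0'] at h0 ⊢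
      rw [← h0]
      set u := G.pr (-(j : ℤ)) (G.sig z)
      have hu : u ∈ G.F (-(j : ℤ)) := pr_mem_F le_rfl _
      have e : b ⁅G.y, u⁆ - ⁅G.y, u⁆ = ⁅b G.y - G.y, b u⁆ + ⁅G.y, b u - u⁆ := by
        rw [LieEquiv.map_lie, lie_sub, sub_lie]; abel
      rw [e]
      exact add_mem (lie_mem_F' (by omega) hy (hb.upper.mem _ _ hu))
        (lie_mem_F' (by omega) y_mem (ih _))
  rcases le_total 0 k with h | h
  · obtain ⟨j, rfl⟩ := Int.eq_ofNat_of_zero_le h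
    exact hpos j z
  · obtain ⟨j, hj⟩ := Int.eq_ofNat_of_zero_le (neg_nonneg.2 h)
    obtain rfl : k = -(j : ℤ) := by omega
    exact hneg j z

/-- Gauge transformations between connections in normal form are trivial. -/
theorem Gauge.eq_refl [Algebra ℂ R] {d : Derivation ℂ R R} (hδ : G.IsDer d δ) {b : E ≃ₗ⁅R⁆ E} (hb : G.IsBorel b) {X X' : E}
    (h : Gauge δ b X X') (hX : X - G.y ∈ G.V) (hX' : X' - G.y ∈ G.V) : b = LieEquiv.refl := by
  obtain ⟨Z, hZ⟩ := hδ.exists_conn b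
  rw [gauge_iff hZ G] at h
  have hv := (mem_V.1 hX).1
  have hv' := (mem_V.1 hX').1
  have hby : b G.y - G.y = (X - G.y) - b (X' - G.y) + b Z := by
    rw [map_sub, h]; abel
  have hZ0 : Z ∈ G.F 0 := conn_mem hδ hb hZ fun k z hz => by
    rw [add_zero]; exact sub_mem (hb.upper.mem _ _ hz) hz
  have hy0 : b G.y - G.y ∈ G.F 0 := by
    rw [hby]
    exact add_mem (sub_mem hv (hb.upper.mem _ _ hv')) (hb.upper.mem _ _ hZ0)
  -- Induction on the depth to which `b` agrees with the identity. At depth `l` the leading term of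
  -- `b - 1` is a multiple of `ad` of the degree `l` component of `c = b h - h`, so it is enough to
  -- kill that component. Its bracket with `y` is a multiple of the leading term of `b y - y`, which
  -- the gauge law places in `V`.
  have key : ∀ m : ℕ, ∀ k, ∀ z ∈ G.F k, b z - z ∈ G.F (k + (m + 1 : ℕ)) := by
    intro m
    induction m with
    | zero => intro k z hz; simpa using sub_mem_one hb hy0 k z hz
    | succ m ih =>
      set l : ℤ := ((m + 1 : ℕ) : ℤ) with hl
      have hlpos : 1 ≤ l := by rw [hl]; push_cast; omega
      have hc : b G.h - G.h ∈ G.F l := by simpa using ih 0 _ h_mem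
      set c := b G.h - G.h with hcdef
      -- Apply `b` to `[h, u] = 2 k u` and take the component of degree `k + l`: the weights of `ad
      -- h` in degrees `k + l` and `k` differ by `2 l`, and `[c, s]` starts only in degree `k + 2
      -- l`.
      have hlead : ∀ k z, ((2 * l : ℤ) : R) • G.pr (k + l) (b (G.pr k z) - G.pr k z) =
          - ⁅G.pr l c, G.pr k z⁆ := by
        intro k z
        have hu : G.pr k z ∈ G.F k := pr_mem_F le_rfl z
        set u := G.pr k z with hudef
        have hs := ih k u hu
        set s := b u - u with hsdef
        have e1 : ⁅G.h, s⁆ + ⁅c, u⁆ + ⁅c, s⁆ = ((2 * k : ℤ) : R) • s := by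
          have : ⁅b G.h, b u⁆ = ((2 * k : ℤ) : R) • b u := by
            rw [← LieEquiv.map_lie, hudef, G.lie_h, map_smul]
          have e2 : b G.h = G.h + c := by rw [hcdef]; abel
          have e3 : b u = u + s := by rw [hsdef]; abel
          have e4 : ⁅G.h, u⁆ = ((2 * k : ℤ) : R) • u := by rw [hudef, G.lie_h]
          rw [e2, e3, add_lie, lie_add, lie_add, e4, smul_add] at this
          have h5 := add_left_cancel ((add_assoc _ _ _).symm.trans (this.trans rfl))
          rw [← h5]; abel
        have e2 := congrArg (G.pr (k + l)) e1
        rw [map_add, map_add, pr_lie_h, map_smul] at e2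
        have e3 : G.pr (k + l) ⁅c, u⁆ = ⁅G.pr l c, u⁆ := by
          rw [add_comm, pr_lie_of_mem hc hu, hudef, pr_self]
        have e4 : G.pr (k + l) ⁅c, s⁆ = 0 := mem_F.1 (lie_mem_F hc hs) _ (by omega)
        rw [e3, e4, add_zero] at e2
        rw [eq_neg_iff_add_eq_zero]
        have : ((2 * l : ℤ) : R) = ((2 * (k + l) : ℤ) : R) - ((2 * k : ℤ) : R) := by
          push_cast; ring
        rw [this, sub_smul, sub_add_eq_add_sub, e2, sub_self]
      -- This is `hlead` for `y`. Modulo `F l`, the element `b y - y` is the difference of the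
      -- `V`-parts of the two normal forms.
      have hV : ⁅G.y, G.pr l c⁆ ∈ G.V := by
        have h1 := hlead (-1) G.y
        rw [G.pr_y, lie_skew] at h1
        rw [← h1]
        refine Submodule.smul_mem _ _ ?_
        have h2 : b G.y - G.y = (X - G.y) - (X' - G.y) + (b Z - (b (X' - G.y) - (X' - G.y))) := by
          rw [hby]; abel
        have hZl : Z ∈ G.F l := conn_mem hδ hb hZ ih
        have h3 : b Z - (b (X' - G.y) - (X' - G.y)) ∈ G.F l :=
          sub_mem (hb.upper.mem _ _ hZl) (by simpa using ih 0 _ hv')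
        rw [h2, map_add, mem_F.1 h3 (-1 + l) (by omega), add_zero]
        exact pr_mem_V (sub_mem hX hX') _
      have hc0 : G.pr l c = 0 := eq_zero_of_lie_y_mem_V (pr_mem_F hlpos _) hV
      refine forall_sub_mem_of_pr fun k z => ?_
      have h1 := hlead k z
      rw [hc0, zero_lie, neg_zero] at h1
      have h2 := int_smul_eq_zero (by omega) h1
      have := mem_F_succ (ih k _ (pr_mem_F le_rfl z)) h2
      refine F_mono ?_ this
      rw [hl]; push_cast; omega
  ext z
  -- Every element lies in `F (-bound)`; a gain of `2 * bound + 1` leads beyond the top degree.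
  have := key (2 * G.bound) (-G.bound) z (mem_F_of_le le_rfl z)
  have h0 := eq_zero_of_mem_F (by push_cast; omega) this
  simpa [sub_eq_zero] using h0

/-- Every connection of the form `δ + ad (y + F 0)` can be brought to normal form. -/
theorem exists_gauge [Algebra ℂ R] {d : Derivation ℂ R R} (hδ : G.IsDer d δ) {X : E} (hX : X - G.y ∈ G.F 0) :
    ∃ b X', G.IsBorel b ∧ Gauge δ b X X' ∧ X' - G.y ∈ G.V := by
  -- Normalization degree by degree. Conjugating by `exp (ad n)` with `n` of degree `m + 1` leaves
  -- the degrees below `m` alone and adds `[y, n]` to the degree `m` part `W_m`. For `n = -sig W_m`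
  -- one gets `sig (W_m + [y, n]) = sig W_m + n = 0`. The derivative term `Z` only affects degrees
  -- above `m`.
  have key : ∀ m : ℕ, ∃ b X', G.IsBorel b ∧ Gauge δ b X X' ∧ X' - G.y ∈ G.F 0 ∧
      ∀ k < (m : ℤ), G.sig (G.pr k (X' - G.y)) = 0 := by
    intro m
    induction m with
    | zero =>
      exact ⟨LieEquiv.refl, X, IsBorel.refl, Gauge.refl X, hX, fun k hk => by
        rw [mem_F.1 hX k (by simpa using hk), map_zero]⟩
    | succ m ih =>
      obtain ⟨b, X', hb, hg, h0, hk⟩ := ih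
      set W := X' - G.y with hW
      have hn : -G.sig (G.pr m W) ∈ G.F (m + 1) :=
        neg_mem (sig_mem (pr_mem_F le_rfl _))
      set n := -G.sig (G.pr m W) with hndef
      obtain ⟨e, N, -, he, -, -, h1, -, h3⟩ := G.exists_exp (by omega) hn
      obtain ⟨Z, hZ⟩ := hδ.exists_conn e
      have hZm : Z ∈ G.F (m + 1) := conn_mem hδ he hZ h1
      have hge : Gauge δ e X' (e.symm X' + Z) := (gauge_iff hZ G).2 (by simp)
      have hX'1 : X' ∈ G.F (-1) := by
        have : X' = W + G.y := by rw [hW]; abel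
        rw [this]
        exact add_mem (F_mono (by omega) h0) y_mem
      have hdiff : e.symm X' + Z - G.y - (W + ⁅G.y, n⁆) ∈ G.F (m + 1) := by
        have e1 : e.symm X' + Z - G.y - (W + ⁅G.y, n⁆) =
            (e.symm X' - X' + ⁅n, X'⁆) - ⁅n, W⁆ + Z := by
          have : X' = W + G.y := by rw [hW]; abel
          have h5 : ⁅n, X'⁆ = ⁅n, W⁆ - ⁅G.y, n⁆ := by
            rw [this, lie_add, ← lie_skew n G.y, sub_eq_add_neg]
          rw [h5, hW]; abel
        rw [e1]
        exact add_mem (sub_mem (F_mono (by omega) (h3 _ _ hX'1)) (lie_mem_F' (by omega) hn h0)) hZm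
      refine ⟨e.trans b, e.symm X' + Z, he.trans hb, hg.trans hge, ?_, ?_⟩
      · have := add_mem (F_mono (by omega) hdiff) (add_mem h0 (lie_mem_F' (k := 0) (by omega) y_mem hn))
        simpa using this
      · intro k hkm
        have e2 := mem_F.1 hdiff k (by push_cast at hkm; omega)
        rw [map_sub, sub_eq_zero] at e2
        rw [e2, map_add, pr_lie_y]
        rcases (Int.lt_add_one_iff.1 (by push_cast at hkm; exact hkm)).lt_or_eq with h | h
        · rw [mem_F.1 hn _ (by omega), lie_zero, add_zero, hk k h]
        · subst h
          have hpn : G.pr (m + 1) n = n := by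
            rw [hndef, map_neg, G.pr_sig, pr_self]
          rw [hpn, map_add, sig_lie_of_mem (F_mono (by omega) hn), hndef, add_neg_cancel]
  obtain ⟨b, X', hb, hg, h0, hk⟩ := key (G.bound + 1)
  refine ⟨b, X', hb, hg, mem_V.2 ⟨h0, ext_pr (G := G) fun k => ?_⟩⟩
  have h1 := G.pr_sig (k - 1) (X' - G.y)
  rw [sub_add_cancel] at h1
  rw [map_zero, h1]
  rcases lt_or_ge (k - 1) ((G.bound + 1 : ℕ) : ℤ) with h | h
  · exact hk _ h
  · rw [G.pr_eq_zero _ _ (Or.inl (by push_cast at h; omega)), map_zero]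

end PrincipalGrading

/-! ### Explicit upper triangular gauge transformations and their effect on normal forms. -/

lemma derivation_units_zpow {R : Type} [CommRing R] [Algebra ℂ R] (d : Derivation ℂ R R) (u : Rˣ)
    (k : ℤ) : d ((u ^ k : Rˣ) : R) = k * (u ^ k : Rˣ) * ((u⁻¹ : Rˣ) : R) * d u := by
  have hinc : ∀ k : ℤ, ((u ^ (k + 1) : Rˣ) : R) = (u ^ k : Rˣ) * u := fun k => by
    rw [zpow_add_one, Units.val_mul]
  have hu : ((u⁻¹ : Rˣ) : R) * u = 1 := Units.inv_mul u
  induction k using Int.induction_on with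
  | zero => simp
  | succ k ih =>
    rw [hinc, Derivation.leibniz, ih, smul_eq_mul, smul_eq_mul]
    push_cast
    linear_combination (-((u ^ (k : ℤ) : Rˣ) : R) * d u) * hu
  | pred k ih =>
    have h1 := hinc (-k - 1)
    rw [sub_add_cancel] at h1
    rw [h1, Derivation.leibniz, smul_eq_mul, smul_eq_mul] at ih
    push_cast at ih ⊢
    linear_combination ((u⁻¹ : Rˣ) : R) * ih +
      (-(d ((u ^ (-(k : ℤ) - 1) : Rˣ) : R)) +
        -(k : R) * ((u ^ (-(k : ℤ) - 1) : Rˣ) : R) * (u⁻¹ : Rˣ) * d u) * hu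

lemma expSum_eq_of_le {R E : Type} [CommRing R] [LieRing E] [LieAlgebra R E] [Algebra ℂ R]
    {n : E} {N M : ℕ} (hN : LieAlgebra.ad R E n ^ N = 0) (h : N ≤ M) :
    PrincipalGrading.expSum (R := R) n M = PrincipalGrading.expSum (R := R) n N := by
  rw [PrincipalGrading.expSum, PrincipalGrading.expSum]
  symm
  refine Finset.sum_subset (by simpa using h) fun i _ hi => ?_
  rw [pow_eq_zero_of_le (by simpa using hi) hN, smul_zero]

lemma expSum_of_lie_lie_lie_eq_zero {R E : Type} [CommRing R] [LieRing E] [LieAlgebra R E]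
    [Algebra ℂ R] {n z : E} {N : ℕ} (hN : LieAlgebra.ad R E n ^ N = 0) (h : ⁅n, ⁅n, ⁅n, z⁆⁆⁆ = 0) :
    PrincipalGrading.expSum (R := R) n N z =
      z + ⁅n, z⁆ + algebraMap ℂ R 2⁻¹ • ⁅n, ⁅n, z⁆⁆ := by
  rw [← expSum_eq_of_le hN (show N ≤ N + 1 + 2 by omega), PrincipalGrading.expSum_add_two,
    Finset.sum_range_succ', Finset.sum_eq_zero]
  · simp [pow_two]
  · intro i _
    have : (LieAlgebra.ad R E n ^ (i + 1 + 2)) z = 0 := by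
      rw [show i + 1 + 2 = i + 3 by ring, pow_add, Module.End.mul_apply]
      have : (LieAlgebra.ad R E n ^ 3) z = 0 := by
        simpa [pow_succ, Module.End.mul_apply] using h
      rw [this, map_zero]
    rw [this, smul_zero]

namespace PrincipalGrading

variable {R E : Type} [CommRing R] [LieRing E] [LieAlgebra R E] {G : PrincipalGrading R E}

lemma pr_torus (D : IntGrading R E) (u : Rˣ) (k : ℤ) (z : E) :
    D.pr k (D.torus u z) = ((u ^ k : Rˣ) : R) • D.pr k z := by
  rw [D.torus_apply, map_sum]
  by_cases hk : (-(D.bound : ℤ)) ≤ k ∧ k ≤ D.bound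
  · rw [Finset.sum_eq_single k]
    · simp [D.pr_pr]
    · intro j _ hj
      simp [D.pr_pr, hj.symm]
    · intro h; simp at h; omega
  · rw [D.pr_eq_zero k z (by omega), smul_zero]
    exact Finset.sum_eq_zero fun j hj => by
      simp at hj
      rw [map_smul, D.pr_pr, if_neg (by omega), smul_zero]

lemma torus_isUpper (u : Rˣ) : G.IsUpper (G.torus u) where
  mem k z hz := mem_F.2 fun j hj => by
    rw [pr_torus, mem_F.1 hz j hj, smul_zero]
  sub_mem z hz := mem_F.2 fun j hj => by
    rw [map_sub, pr_torus]
    rcases (Int.lt_add_one_iff.1 (by simpa using hj) : j ≤ 0).lt_or_eq with h | h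
    · rw [mem_F.1 hz j h, smul_zero, sub_zero]
    · rw [h]; simp

lemma torus_isBorel (u : Rˣ) : G.IsBorel (G.torus u) :=
  ⟨torus_isUpper u, torus_isUpper u⁻¹⟩

lemma x_mem : G.x ∈ G.F 1 := by rw [← G.pr_x]; exact pr_mem_F le_rfl _

lemma x_mem_V : G.x ∈ G.V := mem_V.2 ⟨F_mono (by omega) x_mem, G.sig_x⟩

/-- `V` is defined through `sig`; the property `lie_x_lie_y_sig` gives back the inclusion of `V` in
the kernel of `ad x`. -/
lemma lie_x_of_mem_V {v : E} (hv : v ∈ G.V) : ⁅G.x, v⁆ = 0 := by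
  obtain ⟨h0, h1⟩ := mem_V.1 hv
  have : ⁅G.x, ⁅G.y, G.sig v⁆⁆ = ⁅G.x, v⁆ :=
    F_induction (p := fun v => ⁅G.x, ⁅G.y, G.sig v⁆⁆ = ⁅G.x, v⁆) (by simp)
      (fun z w hz hw => by simp only [map_add, lie_add, hz, hw])
      (fun j hj z => G.lie_x_lie_y_sig j z hj) h0
  rw [← this, h1, lie_zero, lie_zero]

lemma lie_x_h : ⁅G.x, G.h⁆ = -(2 : R) • G.x := by
  have := G.lie_h 1 G.x
  rw [G.pr_x] at this
  rw [← lie_skew, this, neg_smul]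
  norm_num

variable [Algebra ℂ R]

variable (G) in
/-- The automorphism `exp (r ad x)` followed by `torus u`. -/
def upTri (u : Rˣ) (r : R) : E ≃ₗ⁅R⁆ E :=
  (Classical.choose (G.exists_exp le_rfl ((G.F 1).smul_mem r x_mem))).trans (G.torus u)

lemma exists_upTri (u : Rˣ) (r : R) : ∃ (e : E ≃ₗ⁅R⁆ E) (N : ℕ), G.upTri u r = e.trans (G.torus u) ∧
    LieAlgebra.ad R E (r • G.x) ^ N = 0 ∧ G.IsBorel e ∧
      (∀ z, e z = expSum (R := R) (r • G.x) N z) ∧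
      (∀ z, e.symm z = expSum (R := R) (-(r • G.x)) N z) ∧
      (∀ k, ∀ z ∈ G.F k, e z - z ∈ G.F (k + 1)) := by
  obtain ⟨N, h1, h2, h3, h4, h5, -⟩ :=
    Classical.choose_spec (G.exists_exp le_rfl ((G.F 1).smul_mem r x_mem))
  exact ⟨_, N, rfl, h1, h2, h3, h4, h5⟩

lemma upTri_isBorel (u : Rˣ) (r : R) : G.IsBorel (G.upTri u r) := by
  obtain ⟨e, N, he, -, hb, -⟩ := exists_upTri (G := G) u r
  rw [he]
  exact hb.trans (torus_isBorel u)

/-- The automorphisms `upTri u r` are compatible with graded homomorphisms. -/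
lemma map_upTri {E₀ : Type} [LieRing E₀] [LieAlgebra R E₀] {G₀ : PrincipalGrading R E₀}
    (φ : E₀ →ₗ[R] E) (hl : ∀ z w, φ ⁅z, w⁆ = ⁅φ z, φ w⁆) (hpr : ∀ k z, φ (G₀.pr k z) = G.pr k (φ z))
    (hx : φ G₀.x = G.x) (u : Rˣ) (r : R) (z : E₀) : φ (G₀.upTri u r z) = G.upTri u r (φ z) := by
  obtain ⟨e₀, N₀, he₀, hN₀, -, h₀, -⟩ := exists_upTri (G := G₀) u r
  obtain ⟨e, N, he, hN, -, h, -⟩ := exists_upTri (G := G) u r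
  rw [he₀, he, LieEquiv.trans_apply, LieEquiv.trans_apply, h₀, h,
    ← expSum_eq_of_le hN₀ (le_max_left N₀ N), ← expSum_eq_of_le hN (le_max_right N₀ N)]
  have hexp : ∀ M w, φ (expSum (R := R) (r • G₀.x) M w) = expSum (R := R) (r • G.x) M (φ w) := by
    intro M w
    simp only [expSum, LinearMap.sum_apply, LinearMap.smul_apply, map_sum, map_smul φ]
    refine Finset.sum_congr rfl fun i hi => congrArg _ ?_
    clear hi
    induction i with
    | zero => simp
    | succ i ih =>
      rw [pow_succ', Module.End.mul_apply, LieAlgebra.ad_apply, hl, ih, map_smul, hx, pow_succ',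
        Module.End.mul_apply, LieAlgebra.ad_apply]
  rw [← hexp]
  refine ext_pr (G := G) fun k => ?_
  rw [← hpr, pr_torus, pr_torus, map_smul, hpr]

lemma torus_symm_eq (u : Rˣ) {k : ℤ} {z : E} (hz : G.pr k z = z) :
    (G.torus u).symm z = ((u ^ (-k) : Rˣ) : R) • z := by
  have := G.torus_symm_pr u k z
  rwa [hz] at this

lemma two_inv_mul (a : R) : algebraMap ℂ R 2⁻¹ * (2 * a) = a := by
  rw [← mul_assoc, ← map_ofNat (algebraMap ℂ R) 2, ← map_mul]
  norm_num

/-- On `y` the series of `exp (-r ad x)` stops after the quadratic term, because `(ad x)^3 y = 0`.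
-/
lemma upTri_symm_y (u : Rˣ) (r : R) : (G.upTri u r).symm G.y =
    (u : R) • (G.y - r • G.h - (r * r) • G.x) := by
  obtain ⟨e, N, he, hN, -, -, h, -⟩ := exists_upTri (G := G) u r
  have hN' : LieAlgebra.ad R E (-(r • G.x)) ^ N = 0 := by rw [map_neg, neg_pow, hN, mul_zero]
  rw [he]
  change e.symm ((G.torus u).symm G.y) = _
  rw [torus_symm_eq u G.pr_y, map_smul, h, neg_neg, zpow_one]
  congr 1
  have h1 : ⁅-(r • G.x), G.y⁆ = -(r • G.h) := by rw [neg_lie, smul_lie, G.lie_x_y]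
  have h2 : ⁅-(r • G.x), -(r • G.h)⁆ = -((2 * (r * r)) • G.x) := by
    rw [neg_lie, lie_neg, neg_neg, smul_lie, lie_smul, lie_x_h, smul_smul, smul_smul, ← neg_smul]
    congr 1; ring
  rw [expSum_of_lie_lie_lie_eq_zero hN', h1, h2, smul_neg, smul_smul, two_inv_mul, sub_eq_add_neg,
    sub_eq_add_neg]
  rw [h1, h2, neg_lie, lie_neg, neg_neg, smul_lie, lie_smul, lie_self, smul_zero, smul_zero]

lemma upTri_symm_h (u : Rˣ) (r : R) : (G.upTri u r).symm G.h = G.h + (2 * r) • G.x := by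
  obtain ⟨e, N, he, hN, -, -, h, -⟩ := exists_upTri (G := G) u r
  have hN' : LieAlgebra.ad R E (-(r • G.x)) ^ N = 0 := by rw [map_neg, neg_pow, hN, mul_zero]
  rw [he]
  change e.symm ((G.torus u).symm G.h) = _
  have h1 : ⁅-(r • G.x), G.h⁆ = (2 * r) • G.x := by
    rw [neg_lie, smul_lie, lie_x_h, smul_smul, ← neg_smul]; congr 1; ring
  have h2 : ⁅-(r • G.x), (2 * r) • G.x⁆ = 0 := by
    rw [neg_lie, smul_lie, lie_smul, lie_self, smul_zero, smul_zero, neg_zero]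
  rw [torus_symm_eq u G.pr_h, neg_zero, zpow_zero, Units.val_one, one_smul, h,
    expSum_of_lie_lie_lie_eq_zero hN', h1, h2, smul_zero, add_zero]
  rw [h1, h2, lie_zero]

/-- `exp (r ad x)` acts trivially on `V`, which commutes with `x`. Only the torus is felt, and it
acts in degree `k` by the `k`-th power of the character. -/
lemma pr_upTri_symm_of_mem_V (u : Rˣ) (r : R) {v : E} (hv : v ∈ G.V) (k : ℤ) :
    G.pr k ((G.upTri u r).symm v) = ((u ^ (-k) : Rˣ) : R) • G.pr k v := by
  obtain ⟨e, N, he, hN, -, -, h, -⟩ := exists_upTri (G := G) u r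
  have hN' : LieAlgebra.ad R E (-(r • G.x)) ^ N = 0 := by rw [map_neg, neg_pow, hN, mul_zero]
  rw [he]
  change G.pr k (e.symm ((G.torus u).symm v)) = _
  have ht : (G.torus u).symm v ∈ G.V := by
    rw [← G.sum_pr v, map_sum]
    refine Submodule.sum_mem _ fun j _ => ?_
    rw [G.torus_symm_pr]
    exact Submodule.smul_mem _ _ (pr_mem_V hv j)
  have h1 : ⁅-(r • G.x), (G.torus u).symm v⁆ = 0 := by
    rw [neg_lie, smul_lie, lie_x_of_mem_V ht, smul_zero, neg_zero]
  rw [h, expSum_of_lie_lie_lie_eq_zero hN' (by rw [h1, lie_zero, lie_zero]), h1, lie_zero,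
    smul_zero, add_zero, add_zero]
  have := pr_torus G.toIntGrading u⁻¹ k v
  rw [inv_zpow, ← zpow_neg] at this
  exact this

lemma upTri_symm_mem_V (u : Rˣ) (r : R) {v : E} (hv : v ∈ G.V) : (G.upTri u r).symm v ∈ G.V := by
  rw [← G.sum_pr ((G.upTri u r).symm v)]
  refine Submodule.sum_mem _ fun j _ => ?_
  rw [pr_upTri_symm_of_mem_V u r hv]
  exact Submodule.smul_mem _ _ (pr_mem_V hv j)

variable {d : Derivation ℂ R R} {δ : E →+ E}

/-- The connection `b⁻¹ d b` for `b = upTri u r`. -/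
lemma upTri_conn (hδ : G.IsDer d δ) (u : Rˣ) (r : R) {c : R} (hc : 2 * c = (u⁻¹ : Rˣ) * d u)
    (t : E) : δ (G.upTri u r t) = G.upTri u r (δ t) +
      G.upTri u r ⁅c • G.h + (2 * r * c + d r) • G.x, t⁆ := by
  -- The logarithmic derivative of `u ^ k` is `k` times that of `u`, which is how `ad (c h)` acts in
  -- degree `k` when `2 c = du / u`.
  have htor : ∀ t, δ (G.torus u t) = G.torus u (δ t) + G.torus u ⁅c • G.h, t⁆ := by
    intro t
    rw [← G.sum_pr t]
    simp only [map_sum, lie_sum]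
    rw [← Finset.sum_add_distrib]
    refine Finset.sum_congr rfl fun k _ => ?_
    rw [G.torus_pr, hδ.smul, hδ.pr, G.torus_pr, smul_lie, G.lie_h, smul_smul, map_smul, G.torus_pr,
      derivation_units_zpow, smul_smul, add_comm]
    congr 2
    push_cast
    linear_combination -(k : R) * ((u ^ k : Rˣ) : R) * hc
  obtain ⟨e, N, he, hN, hb, h, h', h1⟩ := exists_upTri (G := G) u r
  have hN' : LieAlgebra.ad R E (-(r • G.x)) ^ N = 0 := by rw [map_neg, neg_pow, hN, mul_zero]
  obtain ⟨Z, hZ⟩ := hδ.exists_conn e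
  have hZ1 : Z ∈ G.F 1 := conn_mem hδ hb hZ h1
  have hn : ⁅r • G.x, G.h⁆ = (-(2 * r)) • G.x := by
    rw [smul_lie, lie_x_h, smul_smul]; congr 1; ring
  have hnx : ∀ s : R, ⁅r • G.x, s • G.x⁆ = 0 := fun s => by
    rw [smul_lie, lie_smul, lie_self, smul_zero, smul_zero]
  have heh : e G.h = G.h + (-(2 * r)) • G.x := by
    rw [h, expSum_of_lie_lie_lie_eq_zero hN (by rw [hn, hnx, lie_zero]), hn, hnx, smul_zero,
      add_zero]
  have hex : ∀ s : R, e (s • G.x) = s • G.x := fun s => by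
    rw [h, expSum_of_lie_lie_lie_eq_zero hN (by rw [hnx, lie_zero, lie_zero]), hnx, lie_zero,
      smul_zero, add_zero, add_zero]
  -- Differentiating `e h = h - 2 r x` gives `[Z, h] = -2 (d r) x`. Since `Z` has positive degree,
  -- where `ad h` is injective, this determines `Z`.
  have hZx : Z = d r • G.x := by
    have h2 := hZ G.h
    have hd2 : d (-(2 * r)) = -(2 * d r) := by
      rw [map_neg, Derivation.leibniz]
      have : d (2 : R) = 0 := by
        have := d.map_natCast 2
        simpa using this
      rw [this]; simp
    rw [heh, map_add, hδ.map_h, hδ.smul, hδ.map_x, smul_zero, add_zero, zero_add, map_zero,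
      zero_add, hd2, ← hex] at h2
    have h3 : (-(2 * d r)) • G.x = ⁅Z, G.h⁆ := by
      have := congrArg e.symm h2
      simpa using this
    refine ext_pr (G := G) fun k => ?_
    have h4 : ⁅G.h, Z⁆ = (2 * d r) • G.x := by
      rw [← lie_skew, ← h3, neg_smul, neg_neg]
    have h5 := congrArg (G.pr k) h4
    rw [pr_lie_h, map_smul] at h5
    rw [map_smul]
    by_cases hk : k = 1
    · subst hk
      have h6 : ((2 : ℤ) : R) • (G.pr 1 Z - d r • G.pr 1 G.x) = 0 := by
        rw [smul_sub, sub_eq_zero, smul_smul]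
        simpa using h5
      exact sub_eq_zero.1 (int_smul_eq_zero (by norm_num) h6)
    · have : G.pr k G.x = 0 := by rw [← G.pr_x, G.pr_pr, if_neg hk]
      rw [this, smul_zero] at h5 ⊢
      rcases lt_or_ge k 1 with h7 | h7
      · exact mem_F.1 hZ1 k h7
      · exact int_smul_eq_zero (by omega) h5
  rw [he]
  simp only [LieEquiv.trans_apply]
  rw [htor, hZ, map_add, add_assoc, ← map_add (G.torus u) (e _), hZx]
  congr 2
  -- Pulling the torus contribution `c h` back through `e` produces the mixed term `2 r c x`.
  have h8 : e (c • G.h + (2 * r * c) • G.x) = c • G.h := by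
    rw [map_add, hex, map_smul, heh, smul_add, smul_smul, add_assoc, ← add_smul]
    rw [show c * -(2 * r) + 2 * r * c = 0 by ring, zero_smul, add_zero]
  have h9 : ⁅c • G.h, e t⁆ = e ⁅c • G.h + (2 * r * c) • G.x, t⁆ := by
    rw [LieEquiv.map_lie, h8]
  rw [h9, ← map_add, ← add_lie, add_smul]
  congr 2; abel

/-- The change of the normal form under the change of the generator of the module of
differentials by `u`. -/
lemma upTri_gauge (hδ : G.IsDer d δ) (u : Rˣ) {c : R} (hc : 2 * c = (u⁻¹ : Rˣ) * d u) {v : E} :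
    Gauge δ (G.upTri u (c * (u⁻¹ : Rˣ))) (G.y + v)
      ((u : R) • G.y + (G.upTri u (c * (u⁻¹ : Rˣ))).symm v +
        (c * c * (u⁻¹ : Rˣ) + d (c * (u⁻¹ : Rˣ))) • G.x) := by
  -- The choice `r = c / u` eliminates `h`: its coefficient is `-u r` from `b⁻¹ y` plus `c` from the
  -- connection term. The two contributions along `x` combine to the stated coefficient.
  rw [gauge_iff (upTri_conn hδ u _ hc) G]
  rw [← LieEquiv.symm_apply_apply (G.upTri u (c * (u⁻¹ : Rˣ))) (c • G.h + _)]
  set b := G.upTri u (c * (u⁻¹ : Rˣ)) with hb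
  have hu : (u : R) * (u⁻¹ : Rˣ) = 1 := Units.mul_inv u
  have : ∀ z w, b.symm z = b.symm w → z = w := fun z w h => by
    simpa using congrArg b h
  apply this
  rw [map_add b.symm, LieEquiv.symm_apply_apply, LieEquiv.symm_apply_apply, map_add b.symm,
    hb, upTri_symm_y, ← hb, LieEquiv.symm_apply_apply]
  have e1 : (u : R) • (G.y - (c * ((u⁻¹ : Rˣ) : R)) • G.h -
      (c * ((u⁻¹ : Rˣ) : R) * (c * ((u⁻¹ : Rˣ) : R))) • G.x) =
      (u : R) • G.y - c • G.h - (c * c * ((u⁻¹ : Rˣ) : R)) • G.x := by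
    rw [smul_sub, smul_sub, smul_smul, smul_smul]
    have e3 : (u : R) * (c * ((u⁻¹ : Rˣ) : R)) = c := by linear_combination c * hu
    have e4 : (u : R) * (c * ((u⁻¹ : Rˣ) : R) * (c * ((u⁻¹ : Rˣ) : R))) =
        c * c * ((u⁻¹ : Rˣ) : R) := by linear_combination c * c * ((u⁻¹ : Rˣ) : R) * hu
    rw [e3, e4]
  rw [e1]
  have e2 : (2 * (c * ((u⁻¹ : Rˣ) : R)) * c + d (c * ((u⁻¹ : Rˣ) : R))) • G.x =
      (c * c * ((u⁻¹ : Rˣ) : R)) • G.x +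
      (c * c * ((u⁻¹ : Rˣ) : R) + d (c * ((u⁻¹ : Rˣ) : R))) • G.x := by
    rw [← add_smul]; congr 1; ring
  rw [e2]; abel

end PrincipalGrading

/-! ### Contractions of tensors, extension of scalars and inner derivations. -/

section Contract

variable {W M N : Type} [AddCommGroup W] [Module ℂ W] [AddCommGroup M] [Module ℂ M]
  [AddCommGroup N] [Module ℂ N]

/-- Contraction with a linear functional. -/
def contract (M : Type) [AddCommGroup M] [Module ℂ M] (ξ : Module.Dual ℂ W) : W ⊗[ℂ] M →ₗ[ℂ] M :=
  (TensorProduct.lid ℂ M).toLinearMap ∘ₗ ξ.rTensor M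

@[simp] lemma contract_tmul (ξ : Module.Dual ℂ W) (w : W) (m : M) :
    contract M ξ (w ⊗ₜ m) = ξ w • m := by simp [contract]

lemma contract_lTensor (ξ : Module.Dual ℂ W) (f : M →ₗ[ℂ] N) (t : W ⊗[ℂ] M) :
    contract N ξ (f.lTensor W t) = f (contract M ξ t) := by
  induction t with
  | zero => simp
  | add a b ha hb => simp only [map_add, ha, hb]
  | tmul a z => simp

/-- Over a field, the coordinate functionals of a basis of `W` already detect the tensor. -/
lemma eq_zero_of_contract {t : W ⊗[ℂ] M} (h : ∀ ξ : Module.Dual ℂ W, contract M ξ t = 0) :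
    t = 0 := by
  classical
  have B := Module.Basis.ofVectorSpace ℂ W
  apply (TensorProduct.equivFinsuppOfBasisLeft (N := M) B).injective
  ext i
  have h1 := h (B.coord i)
  rw [map_zero, Finsupp.zero_apply, ← h1]
  clear h1 h
  induction t with
  | zero => simp
  | add a b ha hb => simp only [map_add, Finsupp.add_apply, ha, hb]
  | tmul a z => simp

end Contract

section Algebra

variable {R : Type} [CommRing R] [Algebra ℂ R] {𝔤 : Type} [LieRing 𝔤] [LieAlgebra ℂ 𝔤]

lemma contract_lie (ξ : Module.Dual ℂ R) (X : R ⊗[ℂ] 𝔤) (z : 𝔤) :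
    contract 𝔤 ξ ⁅X, (1 : R) ⊗ₜ[ℂ] z⁆ = ⁅contract 𝔤 ξ X, z⁆ := by
  induction X with
  | zero => simp
  | add a b ha hb => simp only [map_add, add_lie, ha, hb]
  | tmul a w => simp [LieAlgebra.ExtendScalars.bracket_tmul]

variable (𝔤) in
/-- Every derivation of `𝔤` is inner. -/
def DerivationsInner : Prop :=
  ∀ D : 𝔤 →ₗ[ℂ] 𝔤, (∀ z w, D ⁅z, w⁆ = ⁅D z, w⁆ + ⁅z, D w⁆) → ∃ x : 𝔤, ∀ z : 𝔤, D z = ⁅x, z⁆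

/-- Derivations `𝔤 → R ⊗ 𝔤` are inner if those of `𝔤` are. -/
lemma exists_eq_lie_of_derivation [FiniteDimensional ℂ 𝔤] (hin : DerivationsInner 𝔤)
    (hf : ∀ z : 𝔤, (∀ w : 𝔤, ⁅z, w⁆ = 0) → z = 0) (D : 𝔤 →ₗ[ℂ] R ⊗[ℂ] 𝔤)
    (hD : ∀ z w, D ⁅z, w⁆ = ⁅D z, (1 : R) ⊗ₜ[ℂ] w⁆ + ⁅(1 : R) ⊗ₜ[ℂ] z, D w⁆) :
    ∃ X : R ⊗[ℂ] 𝔤, ∀ z, D z = ⁅X, (1 : R) ⊗ₜ[ℂ] z⁆ := by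
  have hinj : LinearMap.ker (LieAlgebra.ad ℂ 𝔤 : 𝔤 →ₗ[ℂ] Module.End ℂ 𝔤) = ⊥ := by
    rw [LinearMap.ker_eq_bot']
    intro z hz
    exact hf z fun w => by
      have := LinearMap.congr_fun hz w
      simpa using this
  -- A linear left inverse `κ` of `ad` depends on an endomorphism only through its finitely many
  -- values on a basis. It therefore makes sense with coefficients in `R`, and its value at `D` is
  -- the candidate; contracting with functionals on `R` reduces the verification to derivations of
  -- `𝔤`.
  obtain ⟨κ, hκ⟩ := LinearMap.exists_leftInverse_of_injective _ hinj
  let B := Module.finBasis ℂ 𝔤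
  have hsum : ∀ e : 𝔤 →ₗ[ℂ] 𝔤, κ e = ∑ i, κ ((B.coord i).smulRight (e (B i))) := by
    intro e
    rw [← map_sum]
    congr 1
    refine B.ext fun j => ?_
    simp [Finsupp.single_apply]
  let κi : ∀ i : Fin (Module.finrank ℂ 𝔤), 𝔤 →ₗ[ℂ] 𝔤 := fun i =>
    κ ∘ₗ LinearMap.smulRightₗ (B.coord i)
  refine ⟨∑ i, (κi i).lTensor R (D (B i)), fun z => ?_⟩
  rw [← sub_eq_zero]
  refine eq_zero_of_contract fun ξ => ?_
  obtain ⟨w, hw⟩ := hin (contract 𝔤 ξ ∘ₗ D) fun a b => by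
    simp only [LinearMap.comp_apply, hD, map_add, contract_lie]
    congr 1
    rw [← lie_skew, map_neg, contract_lie, lie_skew]
  have hw' : κ (contract 𝔤 ξ ∘ₗ D) = w := by
    have h1 : contract 𝔤 ξ ∘ₗ D = LieAlgebra.ad ℂ 𝔤 w := LinearMap.ext fun z => by simp [hw]
    rw [h1]
    exact LinearMap.congr_fun hκ w
  rw [map_sub, contract_lie, map_sum, sub_eq_zero]
  have h2 : ∑ i, contract 𝔤 ξ ((κi i).lTensor R (D (B i))) = w := by
    rw [← hw', hsum]
    refine Finset.sum_congr rfl fun i _ => ?_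
    rw [contract_lTensor]
    rfl
  rw [h2]
  exact hw z

lemma baseChange_comp_apply {M N P : Type} [AddCommGroup M] [Module ℂ M] [AddCommGroup N]
    [Module ℂ N] [AddCommGroup P] [Module ℂ P] (f : M →ₗ[ℂ] N) (g : N →ₗ[ℂ] P) (t : R ⊗[ℂ] M) :
    g.baseChange R (f.baseChange R t) = (g ∘ₗ f).baseChange R t := by
  rw [LinearMap.baseChange_comp]; rfl

lemma lie_one_tmul_eq_baseChange (z : 𝔤) (t : R ⊗[ℂ] 𝔤) :
    ⁅(1 : R) ⊗ₜ[ℂ] z, t⁆ = (LieAlgebra.ad ℂ 𝔤 z).baseChange R t := by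
  induction t with
  | zero => simp
  | add a b ha hb => simp only [map_add, lie_add, ha, hb]
  | tmul a w => simp [LieAlgebra.ExtendScalars.bracket_tmul]

variable (R) in
/-- Extension of scalars of a graded Lie algebra. -/
def IntGrading.baseChange (G : IntGrading ℂ 𝔤) : IntGrading R (R ⊗[ℂ] 𝔤) where
  pr k := (G.pr k).baseChange R
  bound := G.bound
  pr_pr i j z := by
    rw [baseChange_comp_apply]
    split_ifs with h
    · congr 2; ext w; simp [G.pr_pr, h]
    · have : G.pr i ∘ₗ G.pr j = 0 := by ext w; simp [G.pr_pr, h]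
      rw [this]; simp
  pr_eq_zero k z hk := by
    have : G.pr k = 0 := by ext w; simp [G.pr_eq_zero k w hk]
    rw [this]; simp
  sum_pr z := by
    induction z with
    | zero => simp
    | add a b ha hb =>
      simp only [map_add, Finset.sum_add_distrib]
      rw [ha, hb]
    | tmul a w =>
      simp only [LinearMap.baseChange_tmul]
      rw [← TensorProduct.tmul_sum, G.sum_pr]
  pr_lie k i z w := by
    induction z with
    | zero => simp
    | add a b ha hb => simp only [map_add, add_lie, ha, hb]
    | tmul a z =>
      induction w with
      | zero => simp
      | add c d hc hd => simp only [map_add, lie_add, hc, hd]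
      | tmul b w => simp [LieAlgebra.ExtendScalars.bracket_tmul, G.pr_lie]

variable (R) in
/-- Extension of scalars of a principal grading. -/
def PrincipalGrading.baseChange (G : PrincipalGrading ℂ 𝔤) : PrincipalGrading R (R ⊗[ℂ] 𝔤) where
  toIntGrading := G.toIntGrading.baseChange R
  h := 1 ⊗ₜ G.h
  x := 1 ⊗ₜ G.x
  y := 1 ⊗ₜ G.y
  pr_h := by simp [IntGrading.baseChange, G.pr_h]
  pr_x := by simp [IntGrading.baseChange, G.pr_x]
  pr_y := by simp [IntGrading.baseChange, G.pr_y]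
  lie_h k z := by
    change ⁅_, (G.pr k).baseChange R z⁆ = _ • (G.pr k).baseChange R z
    rw [lie_one_tmul_eq_baseChange, baseChange_comp_apply]
    have : LieAlgebra.ad ℂ 𝔤 G.h ∘ₗ G.pr k = ((2 * k : ℤ) : ℂ) • G.pr k := by
      ext w; simp only [LinearMap.comp_apply, LieAlgebra.ad_apply, G.lie_h]; rfl
    rw [this, LinearMap.baseChange_smul, LinearMap.smul_apply, ← algebraMap_smul R, map_intCast]
  lie_x_y := by simp [LieAlgebra.ExtendScalars.bracket_tmul, G.lie_x_y]
  sig := G.sig.baseChange R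
  pr_sig k z := by
    change (G.pr (k + 1)).baseChange R _ = G.sig.baseChange R ((G.pr k).baseChange R z)
    rw [baseChange_comp_apply, baseChange_comp_apply]
    congr 2; ext w; simp [G.pr_sig]
  sig_lie k z hk := by
    change G.sig.baseChange R ⁅_, (G.pr k).baseChange R z⁆ = (G.pr k).baseChange R z
    rw [lie_one_tmul_eq_baseChange, baseChange_comp_apply, baseChange_comp_apply]
    congr 2; ext w; simp [G.sig_lie k w hk]
  lie_sig k z hk := by
    change ⁅_, G.sig.baseChange R ((G.pr k).baseChange R z)⁆ = (G.pr k).baseChange R z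
    rw [lie_one_tmul_eq_baseChange, baseChange_comp_apply, baseChange_comp_apply]
    congr 2; ext w; simp [G.lie_sig k w hk]
  lie_x_lie_y_sig k z hk := by
    change ⁅_, ⁅_, G.sig.baseChange R ((G.pr k).baseChange R z)⁆⁆ = ⁅_, (G.pr k).baseChange R z⁆
    rw [lie_one_tmul_eq_baseChange, lie_one_tmul_eq_baseChange, lie_one_tmul_eq_baseChange,
      baseChange_comp_apply, baseChange_comp_apply, baseChange_comp_apply, baseChange_comp_apply]
    congr 2; ext w; simp [G.lie_x_lie_y_sig k w hk]
  sig_x := by simp [G.sig_x]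
  faithful z hz := eq_zero_of_contract fun ξ => G.faithful _ fun w => by
    rw [← contract_lie, hz, map_zero]

/-- The derivation `d ⊗ 1` of `R ⊗ 𝔤`. -/
def derTensor (𝔤 : Type) [LieRing 𝔤] [LieAlgebra ℂ 𝔤] (d : Derivation ℂ R R) :
    R ⊗[ℂ] 𝔤 →+ R ⊗[ℂ] 𝔤 :=
  ((d : R →ₗ[ℂ] R).rTensor 𝔤).toAddMonoidHom

@[simp] lemma derTensor_tmul (d : Derivation ℂ R R) (r : R) (z : 𝔤) :
    derTensor 𝔤 d (r ⊗ₜ z) = d r ⊗ₜ z := rfl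

lemma derTensor_smul (d : Derivation ℂ R R) (r : R) (t : R ⊗[ℂ] 𝔤) :
    derTensor 𝔤 d (r • t) = d r • t + r • derTensor 𝔤 d t := by
  induction t with
  | zero => simp
  | add a b ha hb =>
    simp only [smul_add, map_add, ha, hb]; abel
  | tmul a w =>
    simp only [TensorProduct.smul_tmul', derTensor_tmul, smul_eq_mul, Derivation.leibniz,
      TensorProduct.add_tmul]
    rw [add_comm, mul_comm a]

lemma derTensor_lie (d : Derivation ℂ R R) (s t : R ⊗[ℂ] 𝔤) :
    derTensor 𝔤 d ⁅s, t⁆ = ⁅derTensor 𝔤 d s, t⁆ + ⁅s, derTensor 𝔤 d t⁆ := by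
  induction s with
  | zero => simp
  | add a b ha hb => simp only [map_add, add_lie, ha, hb]; abel
  | tmul a z =>
    induction t with
    | zero => simp
    | add a b ha hb => simp only [map_add, lie_add, ha, hb]; abel
    | tmul b w =>
      simp only [LieAlgebra.ExtendScalars.bracket_tmul, derTensor_tmul, Derivation.leibniz,
        TensorProduct.add_tmul, smul_eq_mul]
      rw [add_comm, mul_comm b]

/-- The essential field is `exists_conn`: for an automorphism `b`, the map `b⁻¹ δ b` restricted to
constant vectors is a derivation `𝔤 → R ⊗ 𝔤`, hence inner. Linearity over `R` extends the formula to
all vectors. -/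
lemma derTensor_isDer [FiniteDimensional ℂ 𝔤] (hin : DerivationsInner 𝔤)
    (G : PrincipalGrading ℂ 𝔤) (d : Derivation ℂ R R) :
    (G.baseChange R).IsDer d (derTensor 𝔤 d) where
  smul := derTensor_smul d
  map_h := by simp [PrincipalGrading.baseChange]
  map_x := by simp [PrincipalGrading.baseChange]
  lie := derTensor_lie d
  pr k z := by
    change derTensor 𝔤 d ((G.pr k).baseChange R z) = (G.pr k).baseChange R _
    induction z with
    | zero => simp
    | add a b ha hb => simp only [map_add, ha, hb]
    | tmul a w => simp
  exists_conn b := by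
    let D : 𝔤 →ₗ[ℂ] R ⊗[ℂ] 𝔤 :=
      { toFun := fun z => b.symm (derTensor 𝔤 d (b (1 ⊗ₜ z)))
        map_add' := by intro z w; simp [TensorProduct.tmul_add]
        map_smul' := by
          intro c z
          have h1 : ∀ t : R ⊗[ℂ] 𝔤, c • t = algebraMap ℂ R c • t := fun t =>
            (algebraMap_smul R c t).symm
          simp only [TensorProduct.tmul_smul, h1, map_smul b, map_smul b.symm, derTensor_smul,
            Derivation.map_algebraMap, zero_smul, zero_add, RingHom.id_apply] }
    obtain ⟨Z, hZ⟩ := exists_eq_lie_of_derivation hin G.faithful D fun z w => by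
      change b.symm (derTensor 𝔤 d (b (1 ⊗ₜ ⁅z, w⁆))) =
        ⁅b.symm (derTensor 𝔤 d (b (1 ⊗ₜ z))), _⁆ + ⁅_, b.symm (derTensor 𝔤 d (b (1 ⊗ₜ w)))⁆
      have h1 : (1 : R) ⊗ₜ[ℂ] ⁅z, w⁆ = ⁅(1 : R) ⊗ₜ[ℂ] z, (1 : R) ⊗ₜ[ℂ] w⁆ := by
        simp [LieAlgebra.ExtendScalars.bracket_tmul]
      rw [h1, LieEquiv.map_lie, derTensor_lie, map_add, LieEquiv.map_lie, LieEquiv.map_lie,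
        LieEquiv.symm_apply_apply, LieEquiv.symm_apply_apply]
    refine ⟨Z, fun t => ?_⟩
    induction t with
    | zero => simp
    | add s t hs ht => simp only [map_add, lie_add, hs, ht]; abel
    | tmul r z =>
      have h1 : r ⊗ₜ[ℂ] z = r • ((1 : R) ⊗ₜ[ℂ] z) := by simp [TensorProduct.smul_tmul']
      have h2 : d r ⊗ₜ[ℂ] z = d r • ((1 : R) ⊗ₜ[ℂ] z) := by simp [TensorProduct.smul_tmul']
      have h3 : derTensor 𝔤 d (b (1 ⊗ₜ z)) = b ⁅Z, (1 : R) ⊗ₜ[ℂ] z⁆ := by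
        rw [← hZ]
        exact (b.apply_symm_apply _).symm
      rw [derTensor_tmul, h2, h1, map_smul, derTensor_smul, h3, lie_smul, map_smul, map_smul]

end Algebra

/-! ### Principal gradings from `sl(2)`-triples. -/

section Lie

variable {𝔤 : Type} [LieRing 𝔤] [LieAlgebra ℂ 𝔤]

/-- The grading of a Lie algebra defined by a semisimple element with integral eigenvalues. -/
lemma exists_intGrading [FiniteDimensional ℂ 𝔤] (a : 𝔤)
    (h : ⨆ k : ℤ, Module.End.eigenspace (LieAlgebra.ad ℂ 𝔤 a) (k : ℂ) = ⊤) :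
    ∃ D : IntGrading ℂ 𝔤, (∀ k z, ⁅a, D.pr k z⁆ = (k : ℂ) • D.pr k z) ∧
      ∀ (k : ℤ) z, ⁅a, z⁆ = (k : ℂ) • z → D.pr k z = z := by
  classical
  let S : ℤ → Submodule ℂ 𝔤 := fun k => Module.End.eigenspace (LieAlgebra.ad ℂ 𝔤 a) (k : ℂ)
  have hS : ∀ {k z}, z ∈ S k ↔ ⁅a, z⁆ = (k : ℂ) • z := fun {k z} => by
    rw [Module.End.mem_eigenspace_iff, LieAlgebra.ad_apply]
  have hind : iSupIndep S :=
    (Module.End.eigenspaces_iSupIndep (LieAlgebra.ad ℂ 𝔤 a)).comp Int.cast_injective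
  have hint : DirectSum.IsInternal S :=
    DirectSum.isInternal_submodule_of_iSupIndep_of_iSup_eq_top hind h
  let dec : DirectSum.Decomposition S := hint.chooseDecomposition
  let pr : ℤ → 𝔤 →ₗ[ℂ] 𝔤 := fun k =>
    (S k).subtype ∘ₗ DirectSum.component ℂ ℤ (fun k => S k) k ∘ₗ
      (DirectSum.decomposeLinearEquiv S).toLinearMap
  have hpr : ∀ k z, pr k z = (DirectSum.decompose S z k : 𝔤) := fun k z => rfl
  have hmem : ∀ k z, pr k z ∈ S k := fun k z => (DirectSum.decompose S z k).2
  have hsame : ∀ k z, z ∈ S k → pr k z = z := fun k z hz => by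
    rw [hpr, DirectSum.decompose_of_mem_same S hz]
  have hne : ∀ i j z, z ∈ S j → i ≠ j → pr i z = 0 := fun i j z hz hij => by
    rw [hpr, DirectSum.decompose_of_mem_ne S hz hij.symm]
  have hfin : {k | S k ≠ ⊥}.Finite := WellFoundedGT.finite_ne_bot_of_iSupIndep hind
  obtain ⟨N, hN⟩ : ∃ N : ℕ, ∀ k, S k ≠ ⊥ → (-(N : ℤ)) ≤ k ∧ k ≤ N := by
    refine ⟨hfin.toFinset.sup Int.natAbs, fun k hk => ?_⟩
    have := Finset.le_sup (f := Int.natAbs) (hfin.mem_toFinset.2 hk)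
    omega
  have hzero : ∀ (k : ℤ) (z : 𝔤), ((N : ℤ) < k ∨ k < -(N : ℤ)) → pr k z = 0 := by
    intro k z hk
    by_contra h0
    have := hN k fun hb => h0 (by
      have := hmem k z
      rwa [hb, Submodule.mem_bot] at this)
    omega
  have hsum : ∀ z, ∑ k ∈ Finset.Icc (-(N : ℤ)) (N : ℤ), pr k z = z := by
    intro z
    conv_rhs => rw [← DirectSum.sum_support_decompose S z]
    symm
    refine Finset.sum_subset (fun k hk => ?_) fun k _ hk => ?_
    · by_contra hk'
      simp only [Finset.mem_Icc] at hk'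
      have h1 := hzero k z (by omega)
      rw [DFinsupp.mem_support_iff] at hk
      exact hk (Subtype.ext h1)
    · rw [DFinsupp.notMem_support_iff] at hk
      change (DirectSum.decompose S z k : 𝔤) = 0
      rw [hk]; rfl
  have hlie : ∀ i j z w, z ∈ S i → w ∈ S j → ⁅z, w⁆ ∈ S (i + j) := by
    intro i j z w hz hw
    rw [hS] at hz hw ⊢
    rw [leibniz_lie, hz, hw, smul_lie, lie_smul, ← add_smul]
    push_cast; rfl
  refine ⟨⟨pr, N, fun i j z => ?_, hzero, hsum, fun k i z w => ?_⟩, fun k z => hS.1 (hmem k z),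
    fun k z hz => hsame k z (hS.2 hz)⟩
  · split_ifs with hij
    · rw [hij, hsame _ _ (hmem j z)]
    · exact hne _ _ _ (hmem j z) hij
  · conv_lhs => rw [← hsum w]
    rw [lie_sum, map_sum]
    by_cases hk : (-(N : ℤ)) ≤ k - i ∧ k - i ≤ N
    · rw [Finset.sum_eq_single (k - i)]
      · refine hsame _ _ ?_
        have := hlie i (k - i) _ _ (hmem i z) (hmem (k - i) w)
        rwa [add_sub_cancel] at this
      · intro j _ hj
        exact hne _ _ _ (hlie i j _ _ (hmem i z) (hmem j w)) (by omega)
      · intro hk'; simp at hk'; omega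
    · rw [hzero (k - i) w (by omega), lie_zero]
      refine Finset.sum_eq_zero fun j hj => ?_
      simp only [Finset.mem_Icc] at hj
      exact hne _ _ _ (hlie i j _ _ (hmem i z) (hmem j w)) (by omega)

lemma IntGrading.eq_of_eigen (D : IntGrading ℂ 𝔤) {k j : ℤ} {z : 𝔤} (hz : D.pr j z = z)
    (hk : k ≠ j) : D.pr k z = 0 := by
  rw [← hz, D.pr_pr, if_neg hk]

lemma exists_linear_lift {M : Type} [AddCommGroup M] [Module ℂ M] (f g : M →ₗ[ℂ] M)
    (S S' : Submodule ℂ M) (h : ∀ z ∈ S, ∃ u ∈ S', f u = g z) :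
    ∃ σ : M →ₗ[ℂ] M, ∀ z ∈ S, σ z ∈ S' ∧ f (σ z) = g z := by
  let B := Module.Basis.ofVectorSpace ℂ S
  choose u hu hfu using fun i => h (B i) (B i).2
  obtain ⟨σ, hσ⟩ := LinearMap.exists_extend (B.constr ℂ u)
  have hσ' : ∀ z : S, σ z = B.constr ℂ u z := fun z => LinearMap.congr_fun hσ z
  refine ⟨σ, fun z hz => ⟨?_, ?_⟩⟩
  · have : LinearMap.range (B.constr ℂ u) ≤ S' := by
      rw [Module.Basis.constr_range, Submodule.span_le]
      rintro _ ⟨i, rfl⟩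
      exact hu i
    have h1 := hσ' ⟨z, hz⟩
    change σ z = _ at h1
    rw [h1]
    exact this ⟨_, rfl⟩
  · have : f ∘ₗ B.constr ℂ u = g ∘ₗ S.subtype := by
      refine B.ext fun i => ?_
      simp [hfu]
    have h1 := hσ' ⟨z, hz⟩
    change σ z = _ at h1
    rw [h1]
    exact LinearMap.congr_fun this ⟨z, hz⟩

section Sl2

variable {M : Type} [AddCommGroup M] [Module ℂ M] {X Y : M →ₗ[ℂ] M} {S : ℤ → Submodule ℂ M}

/-- Descending induction from the top degree. If `X Y z = -c z`, then `Y X z = -(c + 2 k) z`, so `X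
z` satisfies the hypothesis in degree `k + 1` and vanishes; as `c + 2 k ≠ 0`, so does `z`. The case
`c = 0` is injectivity of `X Y` in positive degrees, and the general `c` keeps the induction going.
-/
lemma eq_zero_of_sl2 {N : ℕ} (hX : ∀ k, ∀ z ∈ S k, X z ∈ S (k + 1))
    (hc : ∀ k, ∀ z ∈ S k, X (Y z) = Y (X z) + ((2 * k : ℤ) : ℂ) • z)
    (hN : ∀ k : ℤ, N < k → ∀ z ∈ S k, z = 0) {k : ℤ} (hk : 1 ≤ k) {z : M} (hz : z ∈ S k) (c : ℕ)
    (h : X (Y z) = -(c : ℂ) • z) : z = 0 := by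
  obtain ⟨m, hm⟩ : ∃ m : ℕ, (N : ℤ) < k + m := ⟨N, by omega⟩
  induction m generalizing k z c with
  | zero => exact hN k (by simpa using hm) z hz
  | succ m ih =>
    obtain ⟨k, rfl⟩ := Int.eq_ofNat_of_zero_le (show 0 ≤ k by omega)
    have h1 : Y (X z) = -((c + 2 * k : ℕ) : ℂ) • z := by
      rw [eq_sub_of_add_eq (hc _ z hz).symm, h, ← sub_smul]
      push_cast; congr 1; ring
    have h2 : X z = 0 := by
      refine ih (k := k + 1) (by omega) (hX _ z hz) (c + 2 * k) ?_ (by push_cast at hm ⊢; omega)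
      rw [h1, map_smul]
    rw [h2, map_zero] at h1
    have h3 : (c + 2 * k : ℕ) ≠ 0 := by omega
    have h4 : -((c + 2 * k : ℕ) : ℂ) ≠ 0 := neg_ne_zero.2 (by exact_mod_cast h3)
    exact (smul_eq_zero.1 h1.symm).resolve_left h4

/-- `X Y` is injective on the finite-dimensional space `S k`, hence bijective. -/
lemma exists_of_sl2 [FiniteDimensional ℂ M] {N : ℕ} (hX : ∀ k, ∀ z ∈ S k, X z ∈ S (k + 1))
    (hY : ∀ k, ∀ z ∈ S k, Y z ∈ S (k - 1))
    (hc : ∀ k, ∀ z ∈ S k, X (Y z) = Y (X z) + ((2 * k : ℤ) : ℂ) • z)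
    (hN : ∀ k : ℤ, N < k → ∀ z ∈ S k, z = 0) {k : ℤ} (hk : 1 ≤ k) {z : M} (hz : z ∈ S k) :
    ∃ u ∈ S k, X (Y u) = z := by
  have hmaps : ∀ u ∈ S k, (X ∘ₗ Y) u ∈ S k := fun u hu => by
    simpa using hX _ _ (hY k u hu)
  have hinj : Function.Injective ((X ∘ₗ Y).restrict hmaps) := by
    rw [injective_iff_map_eq_zero]
    rintro ⟨u, hu⟩ h0
    have h1 : X (Y u) = 0 := congrArg Subtype.val h0
    exact Subtype.ext (eq_zero_of_sl2 hX hc hN hk hu 0 (by simpa using h1))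
  obtain ⟨u, hu⟩ := (LinearMap.injective_iff_surjective.1 hinj) ⟨z, hz⟩
  exact ⟨u, u.2, congrArg Subtype.val hu⟩

end Sl2

/-- The principal grading defined by an `sl(2)`-triple with even integral eigenvalues. -/
lemma exists_principalGrading [FiniteDimensional ℂ 𝔤] {h x y : 𝔤} (t : IsSl2Triple h x y)
    (hint : ⨆ k : ℤ, Module.End.eigenspace (LieAlgebra.ad ℂ 𝔤 ((2 : ℂ)⁻¹ • h)) (k : ℂ) = ⊤)
    (hf : ∀ z : 𝔤, (∀ w : 𝔤, ⁅z, w⁆ = 0) → z = 0) :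
    ∃ G : PrincipalGrading ℂ 𝔤, G.h = h ∧ G.x = x ∧ G.y = y ∧
      (∀ k z, ⁅h, z⁆ = ((2 * k : ℤ) : ℂ) • z → G.pr k z = z) ∧
      ∀ k z, 0 ≤ k → G.pr k z = z → ⁅x, z⁆ = 0 → G.sig z = 0 := by
  obtain ⟨D, hD1, hD2⟩ := exists_intGrading _ hint
  have hD1' : ∀ k z, ⁅h, D.pr k z⁆ = ((2 * k : ℤ) : ℂ) • D.pr k z := fun k z => by
    have h1 := congrArg ((2 : ℂ) • ·) (hD1 k z)
    simp only [smul_lie, smul_smul] at h1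
    rw [mul_inv_cancel₀ two_ne_zero, one_smul] at h1
    rw [h1]; push_cast; rfl
  have hD2' : ∀ k z, ⁅h, z⁆ = ((2 * k : ℤ) : ℂ) • z → D.pr k z = z := fun k z hz => by
    refine hD2 k z ?_
    rw [smul_lie, hz, smul_smul]
    push_cast
    rw [← mul_assoc, inv_mul_cancel₀ two_ne_zero, one_mul]
  have hhx : ⁅h, x⁆ = (2 : ℂ) • x := t.lie_h_e_smul ℂ
  have hhy : ⁅h, y⁆ = -((2 : ℂ) • y) := t.lie_lie_smul_f ℂ
  have hprh : D.pr 0 h = h := hD2' 0 h (by simp)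
  have hprx : D.pr 1 x = x := hD2' 1 x (by rw [hhx]; norm_num)
  have hpry : D.pr (-1) y = y := hD2' (-1) y (by rw [hhy, ← neg_smul]; norm_num)
  let S : ℤ → Submodule ℂ 𝔤 := fun k => LinearMap.range (D.pr k)
  have hS : ∀ {k z}, z ∈ S k ↔ D.pr k z = z := fun {k z} =>
    ⟨by rintro ⟨w, rfl⟩; rw [D.pr_pr, if_pos rfl], fun hz => ⟨z, hz⟩⟩
  have hSlie : ∀ i k z w, z ∈ S i → w ∈ S k → ⁅z, w⁆ ∈ S (i + k) := by
    intro i k z w hz hw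
    rw [hS] at hz hw ⊢
    have := D.pr_lie (i + k) i z w
    rwa [hz, add_sub_cancel_left, hw] at this
  let X : 𝔤 →ₗ[ℂ] 𝔤 := LieAlgebra.ad ℂ 𝔤 x
  let Y : 𝔤 →ₗ[ℂ] 𝔤 := LieAlgebra.ad ℂ 𝔤 y
  have hX : ∀ k, ∀ z ∈ S k, X z ∈ S (k + 1) := fun k z hz => by
    rw [add_comm]; exact hSlie 1 k x z (hS.2 hprx) hz
  have hY : ∀ k, ∀ z ∈ S k, Y z ∈ S (k - 1) := fun k z hz => by
    rw [sub_eq_add_neg, add_comm]; exact hSlie (-1) k y z (hS.2 hpry) hz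
  have hc : ∀ k, ∀ z ∈ S k, X (Y z) = Y (X z) + ((2 * k : ℤ) : ℂ) • z := fun k z hz => by
    change ⁅x, ⁅y, z⁆⁆ = ⁅y, ⁅x, z⁆⁆ + _
    rw [leibniz_lie, t.lie_e_f, add_comm]
    congr 1
    rw [← hS.1 hz, hD1']
  have hN : ∀ k : ℤ, (D.bound : ℤ) < k → ∀ z ∈ S k, z = 0 := fun k hk z hz => by
    rw [← hS.1 hz, D.pr_eq_zero k z (Or.inl hk)]
  -- Exchanging `x` and `y` and reversing the degrees preserves the relations, so the results for
  -- positive degrees also serve the negative ones.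
  have hX' : ∀ k, ∀ z ∈ S (-k), Y z ∈ S (-(k + 1)) := fun k z hz => by
    have := hY _ z hz
    rwa [show -k - 1 = -(k + 1) by ring] at this
  have hY' : ∀ k, ∀ z ∈ S (-k), X z ∈ S (-(k - 1)) := fun k z hz => by
    have := hX _ z hz
    rwa [show -k + 1 = -(k - 1) by ring] at this
  have hc' : ∀ k, ∀ z ∈ S (-k), Y (X z) = X (Y z) + ((2 * k : ℤ) : ℂ) • z := fun k z hz => by
    rw [hc _ z hz, add_assoc, ← add_smul]
    push_cast
    rw [show (2 * -(k : ℂ) + 2 * k) = 0 by ring, zero_smul, add_zero]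
  have hN' : ∀ k : ℤ, (D.bound : ℤ) < k → ∀ z ∈ S (-k), z = 0 := fun k hk z hz => by
    rw [← hS.1 hz, D.pr_eq_zero (-k) z (Or.inr (by omega))]
  have hinj : ∀ k : ℤ, 1 ≤ k → ∀ z ∈ S k, X (Y z) = 0 → z = 0 := fun k hk z hz h0 =>
    eq_zero_of_sl2 hX hc hN hk hz 0 (by simpa using h0)
  -- In degrees `k ≥ 0` one solves `X Y σ = X`, so that `z - Y (σ z)` is the part of `z` killed by
  -- `X`. In negative degrees `Y` itself is onto, because `Y X` is.
  have hlift : ∀ k : ℤ, ∃ σ : 𝔤 →ₗ[ℂ] 𝔤, (∀ z ∈ S k, σ z ∈ S (k + 1)) ∧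
      (0 ≤ k → ∀ z ∈ S k, X (Y (σ z)) = X z) ∧ (k ≤ -1 → ∀ z ∈ S k, Y (σ z) = z) := by
    intro k
    rcases le_or_gt 0 k with hk | hk
    · obtain ⟨σ, hσ⟩ := exists_linear_lift (X ∘ₗ Y) X (S k) (S (k + 1)) fun z hz =>
        exists_of_sl2 hX hY hc hN (by omega) (hX k z hz)
      exact ⟨σ, fun z hz => (hσ z hz).1, fun _ z hz => (hσ z hz).2, fun h => by omega⟩
    · obtain ⟨σ, hσ⟩ := exists_linear_lift Y LinearMap.id (S k) (S (k + 1)) fun z hz => by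
        obtain ⟨u, hu, hu'⟩ := exists_of_sl2 (S := fun k => S (-k)) hX' hY' hc' hN' (k := -k)
          (by omega) (z := z) (by simpa using hz)
        refine ⟨X u, hX k u (by simpa using hu), hu'⟩
      exact ⟨σ, fun z hz => (hσ z hz).1, fun h => by omega, fun _ z hz => (hσ z hz).2⟩
  choose σ hσ1 hσ2 hσ3 using hlift
  let sig : 𝔤 →ₗ[ℂ] 𝔤 := ∑ k ∈ Finset.Icc (-(D.bound : ℤ)) (D.bound : ℤ), σ k ∘ₗ D.pr k
  have hsig : ∀ k z, sig (D.pr k z) = σ k (D.pr k z) := by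
    intro k z
    simp only [sig, LinearMap.sum_apply, LinearMap.comp_apply]
    by_cases hk : (-(D.bound : ℤ)) ≤ k ∧ k ≤ D.bound
    · rw [Finset.sum_eq_single k]
      · simp [D.pr_pr]
      · intro j _ hj
        simp [D.pr_pr, hj]
      · intro h; simp at h; omega
    · rw [D.pr_eq_zero k z (by omega)]; simp
  have hsigS : ∀ k z, D.pr k z = z → sig z = σ k z := fun k z hz => by
    rw [← hz, hsig]
  have hmem : ∀ k z, D.pr k z ∈ S k := fun k z => ⟨z, rfl⟩
  have hdeg : ∀ k j z, D.pr j (sig (D.pr k z)) = if j = k + 1 then sig (D.pr k z) else 0 := by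
    intro k j z
    rw [hsig, ← hS.1 (hσ1 k _ (hmem k z)), D.pr_pr]
  have hinj2 : ∀ k z, 0 ≤ k → D.pr k z = z → ⁅x, z⁆ = 0 → sig z = 0 := by
    intro k z hk hz h0
    have hz' : z ∈ S k := hS.2 hz
    rw [hsigS k z hz]
    refine hinj (k + 1) (by omega) _ (hσ1 k z hz') ?_
    rw [hσ2 k hk z hz']
    exact h0
  refine ⟨{ toIntGrading := D, h := h, x := x, y := y, pr_h := hprh, pr_x := hprx, pr_y := hpry,
            lie_h := hD1', lie_x_y := t.lie_e_f, sig := sig, pr_sig := ?_, sig_lie := ?_,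
            lie_sig := ?_, lie_x_lie_y_sig := ?_, sig_x := ?_, faithful := hf },
          rfl, rfl, rfl, hD2', hinj2⟩
  · intro k z
    conv_lhs => rw [← D.sum_pr z]
    rw [map_sum, map_sum]
    by_cases hk : (-(D.bound : ℤ)) ≤ k ∧ k ≤ D.bound
    · rw [Finset.sum_eq_single k]
      · rw [hdeg, if_pos rfl]
      · intro j _ hj
        rw [hdeg, if_neg (by omega)]
      · intro h; simp at h; omega
    · rw [D.pr_eq_zero k z (by omega), map_zero]
      refine Finset.sum_eq_zero fun j hj => ?_
      simp only [Finset.mem_Icc] at hj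
      rw [hdeg, if_neg (by omega)]
  · intro k z hk
    have h1 := hY k _ (hmem k z)
    have h2 : sig (Y (D.pr k z)) = σ (k - 1) (Y (D.pr k z)) := hsigS _ _ (hS.1 h1)
    have h3 := hσ1 (k - 1) _ h1
    have h4 := hσ2 (k - 1) (by omega) _ h1
    rw [sub_add_cancel] at h3
    change sig (Y (D.pr k z)) = _
    rw [h2, ← sub_eq_zero]
    -- Both elements have the same image under `X Y`, which is injective in positive degrees.
    refine hinj k hk _ (sub_mem h3 (hmem k z)) ?_
    rw [map_sub, map_sub, h4, sub_self]
  · intro k z hk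
    rw [hsig]
    exact hσ3 k hk _ (hmem k z)
  · intro k z hk
    rw [hsig]
    exact hσ2 k hk _ (hmem k z)
  · exact hinj2 1 x (by norm_num) hprx (lie_self x)

end Lie

/-! ### Simple roots and the data attached to a principal triple. -/

section Lie

variable {𝔤 : Type} [LieRing 𝔤] [LieAlgebra ℂ 𝔤] {H : LieSubalgebra ℂ 𝔤}
  {ι : Type} [Fintype ι] {α : ι → Module.Dual ℂ H}

/-- The properties of the simple roots of a semisimple Lie algebra on which the classification of
opers relies. -/
structure IsSimpleRoots (H : LieSubalgebra ℂ 𝔤) (α : ι → Module.Dual ℂ H) : Prop where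
  iSup_rootSub : ⨆ n : ι → ℤ, rootSub H (∑ i, n i • α i) = ⊤
  exists_coweight : ∀ i, ∃ w : H, α i w = 1 ∧ ∀ j, j ≠ i → α j w = 0
  lie_H : ∀ a ∈ H, ∀ b ∈ H, ⁅a, b⁆ = 0
  gr_zero : ∀ z ∈ gr H α 0, z ∈ H
  gr_neg_one : gr H α (-1) ≤ ⨆ i, rootSub H (-α i)
  rootSub_neg : ∀ i, ∀ z ∈ rootSub H (-α i), z ≠ 0 → ∀ w ∈ rootSub H (-α i), ∃ c : ℂ, w = c • z
  faithful : ∀ z : 𝔤, (∀ w : 𝔤, ⁅z, w⁆ = 0) → z = 0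
  inner : DerivationsInner 𝔤

/-- The principal grading of `𝔤` and the gradings by the coefficients of the simple roots. -/
structure OperData (T : PrincipalTriple H α) where
  G : PrincipalGrading ℂ 𝔤
  h_eq : G.h = T.h
  x_eq : G.x = T.x
  y_eq : G.y = T.y
  inner : DerivationsInner 𝔤
  mem_filt : ∀ k z, z ∈ filt H α k ↔ z ∈ G.F k
  mem_V : ∀ (j : ℕ) z, z ∈ T.V j ↔ G.pr j z = z ∧ z ∈ G.V
  mem_H : ∀ z, z ∈ H ↔ G.pr 0 z = z
  f : ι → 𝔤
  f_ne_zero : ∀ i, f i ≠ 0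
  f_mem : ∀ i, f i ∈ rootSub H (-α i)
  sum_f : G.y = ∑ i, f i
  rootSub_neg : ∀ i, ∀ z ∈ rootSub H (-α i), z ≠ 0 → ∃ c : ℂ, c ≠ 0 ∧ z = c • f i
  ψ : ι → Module.Dual ℂ 𝔤
  ψ_f_self : ∀ i, ψ i (f i) = 1
  ψ_f_ne : ∀ i j, i ≠ j → ψ i (f j) = 0
  ψ_pr : ∀ i k z, k ≠ -1 → ψ i (G.pr k z) = 0
  pr_neg_one : ∀ z, G.pr (-1) z = ∑ i, ψ i z • f i
  w : ι → 𝔤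
  pr_w : ∀ i, G.pr 0 (w i) = w i
  lie_w_self : ∀ i, ⁅w i, f i⁆ = -f i
  lie_w_ne : ∀ i j, i ≠ j → ⁅w i, f j⁆ = 0
  cow : ι → IntGrading ℂ 𝔤
  cow_f_self : ∀ i, (cow i).pr (-1) (f i) = f i
  cow_f_ne : ∀ i j, i ≠ j → (cow i).pr 0 (f j) = f j
  cow_H : ∀ i, ∀ a ∈ H, (cow i).pr 0 a = a
  pr_cow : ∀ i k j z, G.pr j ((cow i).pr k z) = (cow i).pr k (G.pr j z)

lemma rootSub_le_gr (n : ι → ℤ) : rootSub H (∑ i, n i • α i) ≤ gr H α (∑ i, n i) :=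
  le_iSup₂_of_le n rfl le_rfl

lemma lie_coe_of_mem_rootSub {β : Module.Dual ℂ H} {z : 𝔤} (hz : z ∈ rootSub H β) (a : H) :
    ⁅(a : 𝔤), z⁆ = β a • z := hz a

/-- An operator commuting with `ad a` preserves its eigenspaces, which are the graded pieces. -/
lemma IntGrading.pr_comm (D : IntGrading ℂ 𝔤) {a : 𝔤}
    (h1 : ∀ k z, ⁅a, D.pr k z⁆ = (k : ℂ) • D.pr k z)
    (h2 : ∀ (k : ℤ) z, ⁅a, z⁆ = (k : ℂ) • z → D.pr k z = z) (A : 𝔤 →ₗ[ℂ] 𝔤)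
    (hA : ∀ z, A ⁅a, z⁆ = ⁅a, A z⁆) (k : ℤ) (z : 𝔤) : D.pr k (A z) = A (D.pr k z) := by
  have h3 : ∀ j, D.pr j (A (D.pr j z)) = A (D.pr j z) := fun j => by
    refine h2 j _ ?_
    rw [← hA, h1, map_smul]
  conv_lhs => rw [← D.sum_pr z]
  rw [map_sum, map_sum]
  by_cases hk : (-(D.bound : ℤ)) ≤ k ∧ k ≤ D.bound
  · rw [Finset.sum_eq_single k]
    · exact h3 k
    · intro j _ hj
      rw [← h3 j, D.pr_pr, if_neg hj.symm]
    · intro h; simp at h; omega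
  · rw [D.pr_eq_zero k z (by omega), map_zero]
    refine Finset.sum_eq_zero fun j hj => ?_
    simp only [Finset.mem_Icc] at hj
    rw [← h3 j, D.pr_pr, if_neg (by omega)]

/-- Since `αᵢ(h) = 2`, the eigenvalue of `ad (h / 2)` on a root space is the height, so the grading
by height is the principal grading of the triple. The fundamental coweights give the finer gradings
by single coefficients, which separate the `fᵢ`. -/
theorem IsSimpleRoots.exists_operData [FiniteDimensional ℂ 𝔤] (hα : IsSimpleRoots H α)
    (T : PrincipalTriple H α) : Nonempty (OperData T) := by
  classical
  have hroot : ∀ (w : H) (m : ι → ℤ), (∀ i, α i w = m i) → ∀ n : ι → ℤ,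
      (∑ i, n i • α i) w = ((∑ i, n i * m i : ℤ) : ℂ) := by
    intro w m hm n
    simp [LinearMap.sum_apply, hm]
  have htop : ∀ (w : H) (m : ι → ℤ), (∀ i, α i w = m i) →
      ⨆ k : ℤ, Module.End.eigenspace (LieAlgebra.ad ℂ 𝔤 (w : 𝔤)) (k : ℂ) = ⊤ := by
    intro w m hm
    rw [eq_top_iff, ← hα.iSup_rootSub]
    refine iSup_le fun n => le_iSup_of_le (∑ i, n i * m i) fun z hz => ?_
    rw [Module.End.mem_eigenspace_iff, LieAlgebra.ad_apply, hz w, hroot w m hm]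
  have hh2 : ∀ i, α i ((2 : ℂ)⁻¹ • (⟨T.h, T.h_mem⟩ : H)) = ((1 : ℤ) : ℂ) := fun i => by
    rw [map_smul, T.root_h]; simp
  have htop2 := htop ((2 : ℂ)⁻¹ • ⟨T.h, T.h_mem⟩) (fun _ : ι => (1 : ℤ)) hh2
  have hcoe : (((2 : ℂ)⁻¹ • (⟨T.h, T.h_mem⟩ : H) : H) : 𝔤) = (2 : ℂ)⁻¹ • T.h := rfl
  rw [hcoe] at htop2
  obtain ⟨G, hGh, hGx, hGy, hG1, hG2⟩ := exists_principalGrading T.isSl2Triple htop2 hα.faithful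
  have hgr1 : ∀ k, ∀ z ∈ gr H α k, G.pr k z = z := by
    intro k z hz
    have : gr H α k ≤ LinearMap.ker (G.pr k - LinearMap.id) := by
      refine iSup₂_le fun n hn z hz => ?_
      rw [LinearMap.mem_ker, LinearMap.sub_apply, LinearMap.id_apply, sub_eq_zero]
      refine hG1 k z ?_
      rw [lie_coe_of_mem_rootSub hz ⟨T.h, T.h_mem⟩, hroot _ (fun _ => 2) (fun i => by
        rw [T.root_h]; norm_num)]
      rw [← hn, Finset.mul_sum]
      simp [mul_comm]
    have h1 := this hz
    rwa [LinearMap.mem_ker, LinearMap.sub_apply, LinearMap.id_apply, sub_eq_zero] at h1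
  have hgr2 : ∀ k z, G.pr k z ∈ gr H α k := by
    intro k z
    have : (⊤ : Submodule ℂ 𝔤) ≤ (gr H α k).comap (G.pr k) := by
      rw [← hα.iSup_rootSub]
      refine iSup_le fun n z hz => ?_
      rw [Submodule.mem_comap]
      have h1 := rootSub_le_gr n hz
      have h2 := hgr1 _ z h1
      by_cases hk : ∑ i, n i = k
      · subst hk; rwa [h2]
      · rw [G.toIntGrading.eq_of_eigen h2 (Ne.symm hk)]
        exact zero_mem _
    exact this (Submodule.mem_top (x := z))
  have hgr : ∀ k z, z ∈ gr H α k ↔ G.pr k z = z := fun k z =>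
    ⟨hgr1 k z, fun h => h ▸ hgr2 k z⟩
  have hfilt : ∀ k z, z ∈ filt H α k ↔ z ∈ G.F k := by
    intro k z
    constructor
    · intro hz
      have : filt H α k ≤ G.F k := by
        refine iSup₂_le fun r hr z hz => ?_
        rw [← hgr1 r z hz]
        exact PrincipalGrading.pr_mem_F hr z
      exact this hz
    · intro hz
      refine PrincipalGrading.F_induction (p := fun z => z ∈ filt H α k) (zero_mem _)
        (fun _ _ => add_mem) (fun j hj z => ?_) hz
      exact (le_iSup₂_of_le (f := fun r (_ : k ≤ r) => gr H α r) j hj le_rfl) (hgr2 j z)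
  have hH : ∀ z, z ∈ H ↔ G.pr 0 z = z := by
    intro z
    rw [← hgr]
    refine ⟨fun hz => ?_, hα.gr_zero z⟩
    have h0 : z ∈ rootSub H (∑ i, (0 : ι → ℤ) i • α i) := by
      intro a
      simp [hα.lie_H a a.2 z hz]
    simpa using rootSub_le_gr _ h0
  obtain ⟨f, hf, hyf⟩ := T.exists_y
  choose w hw1 hw2 using hα.exists_coweight
  have hwm : ∀ i j, α j (w i) = ((Pi.single i 1 : ι → ℤ) j : ℂ) := by
    intro i j
    by_cases hij : j = i
    · subst hij; simp [hw1]
    · simp [hw2 i j hij, Pi.single_eq_of_ne hij]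
  choose D hD1 hD2 using fun i => exists_intGrading (w i : 𝔤) (htop (w i) (Pi.single i 1) (hwm i))
  have hDf1 : ∀ i, (D i).pr (-1) (f i) = f i := fun i => by
    refine hD2 i _ _ ?_
    rw [lie_coe_of_mem_rootSub (hf i).1, LinearMap.neg_apply, hw1]; simp
  have hDf2 : ∀ i j, i ≠ j → (D i).pr 0 (f j) = f j := fun i j hij => by
    refine hD2 i _ _ ?_
    rw [lie_coe_of_mem_rootSub (hf j).1, LinearMap.neg_apply, hw2 i j hij.symm]; simp
  have hli : LinearIndependent ℂ f := by
    rw [Fintype.linearIndependent_iff]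
    intro c hc i
    have h1 := congrArg ((D i).pr (-1)) hc
    rw [map_sum, map_zero, Finset.sum_eq_single i] at h1
    · rw [map_smul, hDf1] at h1
      exact (smul_eq_zero.1 h1).resolve_right (hf i).2
    · intro j _ hj
      rw [map_smul, ← hDf2 i j hj.symm, (D i).pr_pr]
      simp
    · simp
  have hspan : ∀ z, G.pr (-1) z ∈ Submodule.span ℂ (Set.range f) := by
    intro z
    refine (hα.gr_neg_one.trans (iSup_le fun i u hu => ?_)) (hgr2 (-1) z)
    obtain ⟨c, rfl⟩ := hα.rootSub_neg i (f i) (hf i).1 (hf i).2 u hu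
    exact Submodule.smul_mem _ _ (Submodule.subset_span ⟨i, rfl⟩)
  choose ψ hψ using fun i => LinearMap.exists_extend
    ((Module.Basis.span hli).coord i)
  have hfs : ∀ j, f j ∈ Submodule.span ℂ (Set.range f) := fun j => Submodule.subset_span ⟨j, rfl⟩
  have hψf : ∀ i j, ψ i (f j) = if j = i then 1 else 0 := by
    intro i j
    have h1 := LinearMap.congr_fun (hψ i) ⟨f j, hfs j⟩
    have h2 : (⟨f j, hfs j⟩ : Submodule.span ℂ (Set.range f)) = Module.Basis.span hli j :=
      (Module.Basis.span_apply hli j).symm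
    change ψ i (f j) = _ at h1
    rw [h1, h2]
    simp [Finsupp.single_apply]
  have hfdeg : ∀ i, G.pr (-1) (f i) = f i := fun i => by
    refine hgr1 _ _ ?_
    have h0 : f i ∈ rootSub H (∑ j, (-Pi.single i 1 : ι → ℤ) j • α j) := by
      have : ∑ j, (-Pi.single i 1 : ι → ℤ) j • α j = -α i := by
        simp [Pi.single_apply, ite_smul]
      rw [this]; exact (hf i).1
    have := rootSub_le_gr _ h0
    simpa using this
  -- The functionals `ψ i` were extended arbitrarily from the span of the `fᵢ`; composing with the
  -- projection to degree `-1` makes them vanish in all other degrees.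
  refine ⟨⟨G, hGh, hGx, hGy, hα.inner, hfilt, ?_, hH, f, fun i => (hf i).2, fun i => (hf i).1,
    by rw [hGy, hyf], ?_, fun i => ψ i ∘ₗ G.pr (-1), ?_, ?_, ?_, ?_,
    fun i => w i, fun i => (hH _).1 (w i).2, ?_, ?_, D, hDf1, hDf2, ?_, ?_⟩⟩
  · intro j z
    rw [PrincipalTriple.V, Submodule.mem_inf, hgr, LinearMap.mem_ker, LieAlgebra.ad_apply, ← hGx,
      and_comm]
    refine and_congr_right fun hz => ⟨fun h => PrincipalGrading.mem_V.2 ⟨?_, ?_⟩,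
      PrincipalGrading.lie_x_of_mem_V⟩
    · rw [← hz]; exact PrincipalGrading.pr_mem_F (by positivity) z
    · exact hG2 j z (by positivity) hz (by rwa [hGx] at h)
  · intro i z hz hz0
    obtain ⟨c, rfl⟩ := hα.rootSub_neg i (f i) (hf i).1 (hf i).2 z hz
    exact ⟨c, fun h => hz0 (by rw [h, zero_smul]), rfl⟩
  · intro i; simp [hfdeg, hψf]
  · intro i j hij; simp [hfdeg, hψf, hij.symm]
  · intro i k z hk; simp [G.pr_pr, hk.symm]
  · intro z
    have h1 : ∀ u ∈ Submodule.span ℂ (Set.range f), u = ∑ i, ψ i u • f i := by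
      intro u hu
      induction hu using Submodule.span_induction with
      | mem u hu => obtain ⟨j, rfl⟩ := hu; simp [hψf]
      | zero => simp
      | add u v _ _ hu hv =>
        simp only [map_add, add_smul, Finset.sum_add_distrib]
        rw [← hu, ← hv]
      | smul c u _ hu =>
        simp only [map_smul, smul_assoc]
        rw [← Finset.smul_sum, ← hu]
    exact h1 _ (hspan z)
  · intro i
    rw [lie_coe_of_mem_rootSub (hf i).1, LinearMap.neg_apply, hw1, neg_one_smul]
  · intro i j hij
    rw [lie_coe_of_mem_rootSub (hf j).1, LinearMap.neg_apply, hw2 i j hij.symm, neg_zero, zero_smul]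
  · intro i a ha
    refine hD2 i 0 a ?_
    rw [hα.lie_H _ (w i).2 a ha]; simp
  · intro i k j z
    have hc : ∀ u, ⁅T.h, (D i).pr k u⁆ = (D i).pr k ⁅T.h, u⁆ := fun u =>
      ((D i).pr_comm (hD1 i) (hD2 i) (LieAlgebra.ad ℂ 𝔤 T.h) (fun z => by
        simp only [LieAlgebra.ad_apply]
        rw [leibniz_lie, hα.lie_H _ T.h_mem _ (w i).2, zero_lie, zero_add]) k u).symm
    have h3 : ∀ l, G.pr l ((D i).pr k (G.pr l z)) = (D i).pr k (G.pr l z) := fun l => by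
      refine hG1 l _ ?_
      rw [hc, ← hGh, G.lie_h, map_smul]
    conv_lhs => rw [← G.sum_pr z]
    rw [map_sum, map_sum]
    by_cases hj : (-(G.bound : ℤ)) ≤ j ∧ j ≤ G.bound
    · rw [Finset.sum_eq_single j]
      · exact h3 j
      · intro l _ hl
        rw [← h3 l, G.pr_pr, if_neg hl.symm]
      · intro h; simp at h; omega
    · rw [G.pr_eq_zero j z (by omega), map_zero]
      refine Finset.sum_eq_zero fun l hl => ?_
      simp only [Finset.mem_Icc] at hl
      rw [← h3 l, G.pr_pr, if_neg (by omega)]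

end Lie

/-! ### The simple roots of a semisimple Lie algebra. -/

section Semisimple

open LieAlgebra LieAlgebra.IsKilling LieModule

variable {𝔤 : Type} [LieRing 𝔤] [LieAlgebra ℂ 𝔤] [FiniteDimensional ℂ 𝔤]
  [LieAlgebra.IsSemisimple ℂ 𝔤] (H : LieSubalgebra ℂ 𝔤) [H.IsCartanSubalgebra]

/-- A Cartan subalgebra of a semisimple algebra acts diagonalizably, so generalized weight vectors
are eigenvectors. -/
lemma mem_rootSub_iff (β : Module.Dual ℂ H) (z : 𝔤) : z ∈ rootSub H β ↔ z ∈ rootSpace H β := by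
  constructor
  · intro hz
    refine weightSpace_le_genWeightSpace 𝔤 (β : H → ℂ) ((mem_weightSpace _ _).2 fun a => ?_)
    exact hz a
  · intro hz a
    exact lie_eq_smul_of_mem_rootSpace hz a

lemma rootSub_zero_le {z : 𝔤} (hz : z ∈ rootSub H 0) : z ∈ H := by
  rw [mem_rootSub_iff] at hz
  have h := rootSpace_zero_eq ℂ 𝔤 H
  have h2 : z ∈ rootSpace H (0 : H → ℂ) := hz
  rw [h] at h2
  exact h2

lemma exists_root_of_rootSub {β : Module.Dual ℂ H} (hβ : β ≠ 0) {z : 𝔤} (hz : z ∈ rootSub H β)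
    (hz0 : z ≠ 0) : ∃ i, (rootSystem H).root i = β := by
  rw [mem_rootSub_iff] at hz
  have hne : rootSpace H β ≠ ⊥ := fun h => hz0 (by rw [h] at hz; simpa using hz)
  let w : Weight ℂ H 𝔤 := ⟨β, hne⟩
  have hw : w.IsNonZero := fun h => hβ (by
    ext a
    exact congrFun h a)
  refine ⟨⟨w, by simpa using hw⟩, ?_⟩
  rw [rootSystem_root_apply]
  rfl

theorem isSimpleRoots_base (Γ : (rootSystem H).Base) :
    IsSimpleRoots H (fun i : Γ.support => (rootSystem H).root i) := by
  classical
  have hcow : ∀ i : Γ.support, ∃ w : H, (rootSystem H).root i w = 1 ∧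
      ∀ j : Γ.support, j ≠ i → (rootSystem H).root j w = 0 := by
    intro i
    refine ⟨(Module.evalEquiv ℂ H).symm (Γ.toWeightBasis.coord i), ?_, fun j hj => ?_⟩
    · rw [Module.apply_evalEquiv_symm_apply, ← Γ.toWeightBasis_apply, Module.Basis.coord_apply,
        Module.Basis.repr_self, Finsupp.single_eq_same]
    · rw [Module.apply_evalEquiv_symm_apply, ← Γ.toWeightBasis_apply, Module.Basis.coord_apply,
        Module.Basis.repr_self, Finsupp.single_eq_of_ne hj.symm]
  have hsum : ∀ f : H.root → ℤ, ∑ j ∈ Γ.support, f j • (rootSystem H).root j =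
      ∑ j : Γ.support, f j • (rootSystem H).root j := fun f =>
    (Finset.sum_coe_sort Γ.support fun j => f j • (rootSystem H).root j).symm
  have hext : ∀ n : Γ.support → ℤ, ∃ f : H.root → ℤ, ∀ j : Γ.support, f j = n j := fun n =>
    ⟨fun j => if h : j ∈ Γ.support then n ⟨j, h⟩ else 0, fun j => by simp⟩
  have hheight : ∀ (i : H.root) (n : Γ.support → ℤ),
      (rootSystem H).root i = ∑ j, n j • (rootSystem H).root j → Γ.height i = ∑ j, n j := by
    intro i n hn
    obtain ⟨f, hf⟩ := hext n
    rw [RootPairing.Base.height_eq_sum (f := f), ← Finset.sum_coe_sort]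
    · exact Finset.sum_congr rfl fun j _ => hf j
    · rw [hsum, hn]
      exact Finset.sum_congr rfl fun j _ => by rw [hf]
  refine ⟨?_, hcow, ?_, ?_, ?_, ?_, ?_, ?_⟩
  · rw [eq_top_iff]
    have h := iSup_genWeightSpace_eq_top ℂ H 𝔤
    have h' : (⊤ : Submodule ℂ 𝔤) = ⨆ χ : H → ℂ, (genWeightSpace 𝔤 χ).toSubmodule := by
      rw [← LieSubmodule.iSup_toSubmodule, h]; rfl
    rw [h']
    refine iSup_le fun χ z hz => ?_
    by_cases hz0 : z = 0
    · rw [hz0]; exact zero_mem _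
    have hne : rootSpace H χ ≠ ⊥ := fun h => hz0 (by
      have hz' : z ∈ rootSpace H χ := hz
      rw [h] at hz'; simpa using hz')
    let w : Weight ℂ H 𝔤 := ⟨χ, hne⟩
    have hzw : z ∈ rootSub H (w.toLinear ℂ H 𝔤) := by
      rw [mem_rootSub_iff]; exact hz
    by_cases hw : w.toLinear ℂ H 𝔤 = 0
    · refine Submodule.mem_iSup_of_mem 0 ?_
      simpa [hw] using hzw
    · obtain ⟨i, hi⟩ := exists_root_of_rootSub H hw hzw hz0
      obtain ⟨f, -, -, hf⟩ := Γ.exists_root_eq_sum_int i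
      refine Submodule.mem_iSup_of_mem (fun j => f j) ?_
      rw [hsum] at hf
      rw [← hf, hi]
      exact hzw
  · intro a ha b hb
    have := trivial_lie_zero H H ⟨a, ha⟩ ⟨b, hb⟩
    exact congrArg Subtype.val this
  · intro z hz
    have : gr H (fun i : Γ.support => (rootSystem H).root i) 0 ≤ H.toSubmodule := by
      refine iSup₂_le fun n hn z hz => ?_
      by_cases hz0 : z = 0
      · rw [hz0]; exact zero_mem _
      by_cases hβ : ∑ i, n i • (rootSystem H).root i = 0
      · rw [hβ] at hz
        exact rootSub_zero_le H hz
      · obtain ⟨i, hi⟩ := exists_root_of_rootSub H hβ hz hz0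
        exact absurd ((hheight i n hi).trans hn) (Γ.height_ne_zero i)
    exact this hz
  · refine iSup₂_le fun n hn z hz => ?_
    by_cases hz0 : z = 0
    · rw [hz0]; exact zero_mem _
    by_cases hβ : ∑ i, n i • (rootSystem H).root i = 0
    · exfalso
      have : ∀ i, n i = 0 := by
        intro i
        obtain ⟨w, hw1, hw2⟩ := hcow i
        have h1 := LinearMap.congr_fun hβ w
        rw [LinearMap.sum_apply, Finset.sum_eq_single i] at h1
        · rw [LinearMap.smul_apply, hw1] at h1
          simpa using h1
        · intro j _ hj
          rw [LinearMap.smul_apply, hw2 j hj, smul_zero]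
        · simp
      simp [this] at hn
    -- A root of height `-1` is the negative of a simple root: its integral coefficients have one
    -- sign and add up to `-1`, so exactly one of them is `-1` and the others vanish.
    · obtain ⟨i, hi⟩ := exists_root_of_rootSub H hβ hz hz0
      obtain ⟨f, hf0, hf1, hf⟩ := Γ.exists_root_eq_sum_int i
      rw [hsum] at hf
      have h1 : ∑ j : Γ.support, f j = -1 := by
        rw [← hheight i (fun j => f j) hf, hheight i n hi, hn]
      have h2 : ∀ j, f j ≤ 0 := by
        rcases hf1 with h | h
        · have : 0 ≤ ∑ j : Γ.support, f j := Finset.sum_nonneg fun j _ => h.le j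
          omega
        · exact fun j => h.le j
      have h3 : ∃ j : Γ.support, f j ≠ 0 := by
        by_contra! h
        simp [h] at h1
      obtain ⟨j, hj⟩ := h3
      have h4 : ∀ k : Γ.support, k ≠ j → f k = 0 := by
        intro k hk
        have h5 : ∑ l : Γ.support, f l ≤ ∑ l ∈ ({j, k} : Finset Γ.support), f l := by
          rw [← Finset.sum_compl_add_sum ({j, k} : Finset Γ.support)]
          have : ∑ l ∈ ({j, k} : Finset Γ.support)ᶜ, f l ≤ 0 := Finset.sum_nonpos fun l _ => h2 l
          omega
        rw [Finset.sum_pair hk.symm] at h5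
        have := h2 j; have := h2 k
        omega
      have h5 : f j = -1 := by
        rw [Finset.sum_eq_single j (fun k _ hk => h4 k hk) (by simp)] at h1
        exact h1
      refine Submodule.mem_iSup_of_mem j ?_
      have h6 : -(rootSystem H).root j = ∑ i, n i • (rootSystem H).root i := by
        rw [← hi, hf, Finset.sum_eq_single j (fun k _ hk => by rw [h4 k hk, zero_smul]) (by simp),
          h5, neg_one_smul]
      rw [h6]; exact hz
  · intro i z hz hz0 w hw
    have hne : -(rootSystem H).root i ≠ 0 := neg_ne_zero.2 ((rootSystem H).ne_zero i)
    obtain ⟨k, hk⟩ := exists_root_of_rootSub H hne hz hz0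
    rw [← hk, mem_rootSub_iff] at hz hw
    rw [rootSystem_root_apply] at hz hw
    have h1 := finrank_rootSpace_eq_one k.1 (Finset.mem_filter.1 k.2).2
    obtain ⟨c, hc⟩ := (finrank_eq_one_iff_of_nonzero' (⟨z, hz⟩ : rootSpace H k.1)
      (fun h => hz0 (congrArg Subtype.val h))).1 h1 ⟨w, hw⟩
    exact ⟨c, (congrArg Subtype.val hc).symm⟩
  · intro z hz
    have : z ∈ LieAlgebra.center ℂ 𝔤 := by
      rw [LieModule.mem_maxTrivSubmodule]
      intro w
      rw [← lie_skew, hz, neg_zero]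
    rwa [LieAlgebra.center_eq_bot, LieSubmodule.mem_bot] at this
  · intro D hD
    let D' : LieDerivation ℂ 𝔤 𝔤 := ⟨D, fun a b => by rw [hD, ← lie_skew b (D a)]; abel⟩
    obtain ⟨a, ha⟩ := LieDerivation.IsKilling.exists_eq_ad D'
    exact ⟨a, fun z => by
      have := congrArg (fun E : LieDerivation ℂ 𝔤 𝔤 => E z) ha
      simpa [D'] using this.symm⟩

end Semisimple

/-! ### The algebra `sl(2)` in matrix coordinates. -/

section Sl2

lemma sl2_trace (A : sl2) : A.1 0 0 + A.1 1 1 = 0 := by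
  have h := A.2
  simpa [LieAlgebra.SpecialLinear.sl, Matrix.trace_fin_two] using h

lemma sl2_eq (A : sl2) :
    A = A.1 0 0 • sl2Triple.h + A.1 0 1 • sl2Triple.x + A.1 1 0 • sl2Triple.y := by
  have h := sl2_trace A
  apply Subtype.ext
  ext i j
  fin_cases i <;> fin_cases j <;> simp [sl2Triple]
  linear_combination h

lemma sl2_lie_h (A : sl2) :
    ⁅sl2Triple.h, A⁆ = (2 * A.1 0 1) • sl2Triple.x + (-2 * A.1 1 0) • sl2Triple.y := by
  apply Subtype.ext
  ext i j
  fin_cases i <;> fin_cases j <;>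
    simp [sl2Triple, Ring.lie_def, Matrix.mul_apply, Matrix.vecMul, dotProduct] <;> ring

lemma sl2_cartan {a : sl2} (ha : a ∈ sl2Cartan) : a = a.1 0 0 • sl2Triple.h := by
  conv_lhs => rw [sl2_eq a]
  rw [ha.1, ha.2, zero_smul, zero_smul, add_zero, add_zero]

/-- The Cartan subalgebra is spanned by `h`, so the eigenvalue condition need only be tested on `h`.
-/
lemma sl2_mem_rootSub (n : ℤ) (z : sl2) :
    z ∈ rootSub sl2Cartan (n • sl2Root ()) ↔
      (n : ℂ) * z.1 0 0 = 0 ∧ ((n : ℂ) - 1) * z.1 0 1 = 0 ∧ ((n : ℂ) + 1) * z.1 1 0 = 0 := by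
  have key : ⁅sl2Triple.h, z⁆ = (2 * n : ℂ) • z ↔
      (n : ℂ) * z.1 0 0 = 0 ∧ ((n : ℂ) - 1) * z.1 0 1 = 0 ∧ ((n : ℂ) + 1) * z.1 1 0 = 0 := by
    rw [sl2_lie_h]
    constructor
    · intro h
      have h0 := congrFun (congrFun (congrArg Subtype.val h) 0) 0
      have h1 := congrFun (congrFun (congrArg Subtype.val h) 0) 1
      have h2 := congrFun (congrFun (congrArg Subtype.val h) 1) 0
      simp [sl2Triple] at h0 h1 h2
      refine ⟨by simpa using h0, ?_, ?_⟩
      · rcases h1 with h1 | h1 <;> simp [h1]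
      · linear_combination (-1 / 2 : ℂ) * h2
    · rintro ⟨h0, h1, h2⟩
      conv_rhs => rw [sl2_eq z]
      rw [smul_add, smul_add, smul_smul, smul_smul, smul_smul,
        show (2 * n : ℂ) * z.1 0 0 = 0 by linear_combination 2 * h0,
        show (2 * n : ℂ) * z.1 0 1 = 2 * z.1 0 1 by linear_combination 2 * h1,
        show (2 * n : ℂ) * z.1 1 0 = -2 * z.1 1 0 by linear_combination 2 * h2, zero_smul, zero_add]
  rw [← key]
  constructor
  · intro h
    have := h ⟨sl2Triple.h, sl2Triple.h_mem⟩
    rw [LinearMap.smul_apply, sl2Triple.root_h] at this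
    rw [this]
    congr 1
    simp [mul_comm]
  · intro h a
    have ha := sl2_cartan a.2
    have ha' : a = a.1.1 0 0 • (⟨sl2Triple.h, sl2Triple.h_mem⟩ : sl2Cartan) := Subtype.ext ha
    rw [LinearMap.smul_apply]
    conv_lhs => rw [ha, smul_lie, h]
    conv_rhs => rw [ha', map_smul, sl2Triple.root_h]
    rw [smul_smul]
    congr 1
    simp
    ring

/-- The Cartan subalgebra and the root of `sl(2)` are concrete and do not come from a chosen base of
a root system, so the axioms are verified directly on coefficients. -/
theorem isSimpleRoots_sl2 : IsSimpleRoots sl2Cartan sl2Root := by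
  have hs : ∀ n : Unit → ℤ, ∑ i, n i • sl2Root i = n () • sl2Root () := fun n => by simp
  refine ⟨?_, ?_, ?_, ?_, ?_, ?_, ?_, ?_⟩
  · rw [eq_top_iff]
    intro z _
    rw [sl2_eq z]
    refine add_mem (add_mem ?_ ?_) ?_ <;> refine Submodule.smul_mem _ _ ?_
    · refine Submodule.mem_iSup_of_mem (fun _ => 0) ?_
      rw [hs, sl2_mem_rootSub]
      simp [sl2Triple]
    · refine Submodule.mem_iSup_of_mem (fun _ => 1) ?_
      rw [hs, sl2_mem_rootSub]
      simp [sl2Triple]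
    · refine Submodule.mem_iSup_of_mem (fun _ => -1) ?_
      rw [hs, sl2_mem_rootSub]
      simp [sl2Triple]
  · rintro ⟨⟩
    refine ⟨(2 : ℂ)⁻¹ • ⟨sl2Triple.h, sl2Triple.h_mem⟩, ?_, fun j hj => absurd rfl hj⟩
    rw [map_smul, sl2Triple.root_h]
    simp
  · intro a ha b hb
    rw [sl2_cartan ha, sl2_cartan hb, smul_lie, lie_smul, lie_self, smul_zero, smul_zero]
  · intro z hz
    have : gr sl2Cartan sl2Root 0 ≤ sl2Cartan.toSubmodule := by
      refine iSup₂_le fun n hn z hz => ?_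
      rw [hs, sl2_mem_rootSub] at hz
      have hn0 : n () = 0 := by simpa using hn
      rw [hn0] at hz
      have h2 : z.1 0 1 = 0 ∧ z.1 1 0 = 0 := by simpa using hz.2
      exact h2
    exact this hz
  · refine iSup₂_le fun n hn z hz => Submodule.mem_iSup_of_mem () ?_
    have hn0 : n () = -1 := by simpa using hn
    rw [hs, hn0] at hz
    simpa using hz
  · rintro ⟨⟩ z hz hz0 w hw
    have e : -sl2Root () = (-1 : ℤ) • sl2Root () := by simp
    rw [e, sl2_mem_rootSub] at hz hw
    norm_num at hz hw
    have h1 := sl2_eq z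
    have h2 := sl2_eq w
    rw [hz.1, hz.2, zero_smul, zero_smul, zero_add, zero_add] at h1
    rw [hw.1, hw.2, zero_smul, zero_smul, zero_add, zero_add] at h2
    have h3 : z.1 1 0 ≠ 0 := fun h => hz0 (by rw [h1, h, zero_smul])
    refine ⟨w.1 1 0 / z.1 1 0, ?_⟩
    generalize z.1 1 0 = c at h1 h3
    rw [h1, smul_smul, div_mul_cancel₀ _ h3]
    exact h2
  · intro z hz
    have h1 := hz sl2Triple.h
    have h2 := hz sl2Triple.x
    rw [← lie_skew, neg_eq_zero, sl2_lie_h] at h1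
    have a1 := congrFun (congrFun (congrArg Subtype.val h1) 0) 1
    have a2 := congrFun (congrFun (congrArg Subtype.val h1) 1) 0
    simp [sl2Triple] at a1 a2
    have a0 := congrFun (congrFun (congrArg Subtype.val h2) 0) 1
    have ht := sl2_trace z
    simp [sl2Triple, Ring.lie_def, Matrix.mul_apply, Matrix.vecMul, dotProduct] at a0
    have a3 : z.1 0 0 = 0 := by linear_combination (1 / 2 : ℂ) * a0 + (1 / 2 : ℂ) * ht
    rw [sl2_eq z, a1, a2, a3]
    simp
  · intro D hD
    have hhx : ⁅sl2Triple.h, sl2Triple.x⁆ = (2 : ℂ) • sl2Triple.x := by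
      rw [sl2_lie_h]; simp [sl2Triple]
    have hhy : ⁅sl2Triple.h, sl2Triple.y⁆ = (-2 : ℂ) • sl2Triple.y := by
      rw [sl2_lie_h]; simp [sl2Triple]
    have hxy : ⁅sl2Triple.x, sl2Triple.y⁆ = sl2Triple.h := sl2Triple.isSl2Triple.lie_e_f
    have hxh : ⁅sl2Triple.x, sl2Triple.h⁆ = (-2 : ℂ) • sl2Triple.x := by
      rw [← lie_skew, hhx, neg_smul]
    have hyh : ⁅sl2Triple.y, sl2Triple.h⁆ = (2 : ℂ) • sl2Triple.y := by
      rw [← lie_skew, hhy, neg_smul, neg_neg]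
    have hyx : ⁅sl2Triple.y, sl2Triple.x⁆ = -sl2Triple.h := by rw [← lie_skew, hxy]
    have e1 := hD sl2Triple.h sl2Triple.x
    have e2 := hD sl2Triple.h sl2Triple.y
    have e3 := hD sl2Triple.x sl2Triple.y
    rw [hhx, map_smul] at e1
    rw [hhy, map_smul] at e2
    rw [hxy] at e3
    have dh := sl2_eq (D sl2Triple.h)
    have dx := sl2_eq (D sl2Triple.x)
    have dy := sl2_eq (D sl2Triple.y)
    generalize (D sl2Triple.h).1 0 0 = h0 at dh
    generalize (D sl2Triple.h).1 0 1 = h1 at dh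
    generalize (D sl2Triple.h).1 1 0 = h2 at dh
    generalize (D sl2Triple.x).1 0 0 = x0 at dx
    generalize (D sl2Triple.x).1 0 1 = x1 at dx
    generalize (D sl2Triple.x).1 1 0 = x2 at dx
    generalize (D sl2Triple.y).1 0 0 = y0 at dy
    generalize (D sl2Triple.y).1 0 1 = y1 at dy
    generalize (D sl2Triple.y).1 1 0 = y2 at dy
    have ec : ∀ a b c a' b' c' : ℂ,
        a • sl2Triple.h + b • sl2Triple.x + c • sl2Triple.y =
        a' • sl2Triple.h + b' • sl2Triple.x + c' • sl2Triple.y → a = a' ∧ b = b' ∧ c = c' := by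
      intro a b c a' b' c' h
      have h0 := congrFun (congrFun (congrArg Subtype.val h) 0) 0
      have h1 := congrFun (congrFun (congrArg Subtype.val h) 0) 1
      have h2 := congrFun (congrFun (congrArg Subtype.val h) 1) 0
      simp [sl2Triple] at h0 h1 h2
      exact ⟨h0, h1, h2⟩
    rw [dh, dx] at e1
    rw [dh, dy] at e2
    rw [dh, dx, dy] at e3
    simp only [lie_add, add_lie, lie_smul, smul_lie, lie_self, hhx, hhy, hxy, hxh, hyh, hyx] at e1 e2 e3
    have e1' := ec (2 * x0) (2 * x1) (2 * x2) (-h2) (2 * h0 + 2 * x1) (-2 * x2) (by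
      convert e1 using 1 <;> module)
    have e2' := ec (-2 * y0) (-2 * y1) (-2 * y2) h1 (2 * y1) (-2 * h0 - 2 * y2) (by
      convert e2 using 1 <;> module)
    have e3' := ec h0 h1 h2 (x1 + y2) (-2 * y0) (-2 * x0) (by
      convert e3 using 1 <;> module)
    have x20 : x2 = 0 := by linear_combination (1 / 4 : ℂ) * e1'.2.2
    have y10 : y1 = 0 := by linear_combination (-1 / 4 : ℂ) * e2'.2.1
    have h00 : h0 = 0 := by linear_combination (-1 / 2 : ℂ) * e1'.2.1
    have y2e : y2 = -x1 := by linear_combination h00 - e3'.1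
    -- For `w = a h + b x + c y` one has `[w, x] = 2 a x - c h` and `[w, y] = -2 a y + b h`;
    -- comparison with `D x` and `D y` gives `a`, `b` and `c`.
    refine ⟨(x1 / 2) • sl2Triple.h + y0 • sl2Triple.x - x0 • sl2Triple.y, fun z => ?_⟩
    rw [sl2_eq z]
    simp only [map_add, map_smul, lie_add, lie_smul]
    congr 1
    · congr 1
      · congr 1
        rw [dh, sub_lie, add_lie, smul_lie, smul_lie, smul_lie, lie_self, hxh, hyh, h00, e3'.2.1,
          e3'.2.2]
        module
      · congr 1
        rw [dx, sub_lie, add_lie, smul_lie, smul_lie, smul_lie, lie_self, hhx, hyx, x20]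
        module
    · congr 1
      rw [dy, sub_lie, add_lie, smul_lie, smul_lie, smul_lie, lie_self, hhy, hxy, y10, y2e]
      module

end Sl2

/-! ### The Borel group as a group of filtered automorphisms. -/

section LieUnit

variable {R E : Type} [CommRing R] [LieRing E] [LieAlgebra R E]

/-- A Lie algebra automorphism as an invertible linear operator. -/
def lieUnit (b : E ≃ₗ⁅R⁆ E) : (Module.End R E)ˣ where
  val := b
  inv := b.symm
  val_inv := by ext z; simp
  inv_val := by ext z; simp

@[simp] lemma lieUnit_apply (b : E ≃ₗ⁅R⁆ E) (z : E) : (lieUnit b : Module.End R E) z = b z := rfl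

lemma lieUnit_refl : lieUnit (LieEquiv.refl : E ≃ₗ⁅R⁆ E) = 1 := rfl

lemma lieUnit_trans (b c : E ≃ₗ⁅R⁆ E) : lieUnit (c.trans b) = lieUnit b * lieUnit c := rfl

lemma lieUnit_symm (b : E ≃ₗ⁅R⁆ E) : lieUnit b.symm = (lieUnit b)⁻¹ := rfl

/-- An invertible linear operator that respects brackets, as a Lie algebra automorphism. -/
def lieEquivOfUnit (u : (Module.End R E)ˣ) (hu : ∀ s t, u.1 ⁅s, t⁆ = ⁅u.1 s, u.1 t⁆) : E ≃ₗ⁅R⁆ E :=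
  { toLinearMap := u.1
    map_lie' := fun {s t} => hu s t
    invFun := u.2
    left_inv := fun z => LinearMap.congr_fun u.4 z
    right_inv := fun z => LinearMap.congr_fun u.3 z }

lemma lieUnit_lieEquivOfUnit (u : (Module.End R E)ˣ) (hu : ∀ s t, u.1 ⁅s, t⁆ = ⁅u.1 s, u.1 t⁆) :
    lieUnit (lieEquivOfUnit u hu) = u := Units.ext rfl

lemma lieEquivOfUnit_apply (u : (Module.End R E)ˣ) (hu : ∀ s t, u.1 ⁅s, t⁆ = ⁅u.1 s, u.1 t⁆) (z : E) :
    lieEquivOfUnit u hu z = u.1 z := rfl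

lemma lieEquivOfUnit_symm_apply (u : (Module.End R E)ˣ) (hu : ∀ s t, u.1 ⁅s, t⁆ = ⁅u.1 s, u.1 t⁆)
    (z : E) : (lieEquivOfUnit u hu).symm z = u⁻¹.1 z := rfl

lemma PrincipalGrading.pr_map_of_map_h [Algebra ℂ R] (G : PrincipalGrading R E) {b : E ≃ₗ⁅R⁆ E}
    (hb : b G.h = G.h) (k : ℤ) (z : E) : b (G.pr k z) = G.pr k (b z) := by
  have h1 : ∀ j : ℤ, ⁅G.h, b (G.pr j z)⁆ = ((2 * j : ℤ) : R) • b (G.pr j z) := fun j => by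
    conv_lhs => rw [← hb, ← LieEquiv.map_lie, G.lie_h]
    exact map_smul b.toLinearEquiv _ _
  have h2 : ∀ i j : ℤ, i ≠ j → G.pr i (b (G.pr j z)) = 0 := by
    intro i j hij
    have h3 := congrArg (G.pr i) (h1 j)
    rw [PrincipalGrading.pr_lie_h, map_smul, ← sub_eq_zero, ← sub_smul, ← Int.cast_sub] at h3
    exact PrincipalGrading.int_smul_eq_zero (R := R) (by omega) h3
  refine PrincipalGrading.ext_pr (G := G) fun i => ?_
  rw [G.pr_pr]
  split_ifs with h
  · subst h
    conv_rhs => rw [← G.sum_pr z, map_sum, map_sum]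
    by_cases hi : (-(G.bound : ℤ)) ≤ i ∧ i ≤ G.bound
    · rw [Finset.sum_eq_single i]
      · exact fun j _ hj => h2 i j hj.symm
      · intro h; simp at h; omega
    · rw [G.pr_eq_zero i z (by omega), map_zero, map_zero]
      refine (Finset.sum_eq_zero fun j hj => h2 i j ?_).symm
      rintro rfl
      simp at hj; omega
  · exact h2 i k h

end LieUnit

section Complex

variable {𝔤 : Type} [LieRing 𝔤] [LieAlgebra ℂ 𝔤] {H : LieSubalgebra ℂ 𝔤}
  {ι : Type} [Fintype ι] {α : ι → Module.Dual ℂ H} {T : PrincipalTriple H α}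

/-- Fixing `𝔥` pointwise, the automorphism fixes `h` and so preserves degrees; degree zero is `𝔥`
itself. -/
lemma OperData.isBorel_of_fix (D : OperData T) {e : 𝔤 ≃ₗ⁅ℂ⁆ 𝔤} (he : ∀ a ∈ H, e a = a) :
    D.G.IsBorel e := by
  have key : ∀ e : 𝔤 ≃ₗ⁅ℂ⁆ 𝔤, (∀ a ∈ H, e a = a) → D.G.IsUpper e := by
    intro e he
    have hh : e D.G.h = D.G.h := he _ ((D.mem_H _).2 D.G.pr_h)
    have hp := D.G.pr_map_of_map_h hh
    refine ⟨fun k z hz => PrincipalGrading.mem_F.2 fun j hj => ?_, fun z hz => ?_⟩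
    · rw [← hp, PrincipalGrading.mem_F.1 hz j hj, map_zero]
    · refine PrincipalGrading.mem_F.2 fun j hj => ?_
      rw [map_sub, ← hp]
      rcases (Int.lt_add_one_iff.1 (show j < 0 + 1 by simpa using hj)).lt_or_eq with h | h
      · rw [PrincipalGrading.mem_F.1 hz j h, map_zero, sub_zero]
      · rw [h, he _ ((D.mem_H _).2 (PrincipalGrading.pr_self 0 z)), sub_self]
  refine ⟨key e he, key e.symm fun a ha => ?_⟩
  conv_lhs => rw [← he a ha, LieEquiv.symm_apply_apply]

lemma expSum_complex (n : 𝔤) (N : ℕ) : PrincipalGrading.expSum (R := ℂ) n N =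
    ∑ i ∈ Finset.range N, (i.factorial : ℂ)⁻¹ • LieAlgebra.ad ℂ 𝔤 n ^ i := rfl

/-- Replaces generators by an intrinsic condition. A filtered automorphism `b` trivial on `F 0 / F
1` is composed with exponentials that push `b h - h` ever deeper, until `h` is fixed. Then degrees
are preserved, and triviality on `F 0 / F 1` says that `𝔥` is fixed pointwise: what remains is in
the torus. -/
theorem OperData.mem_borelGroup_iff (D : OperData T) (u : (Module.End ℂ 𝔤)ˣ) :
    u ∈ borelGroup H α ↔ ∃ b, D.G.IsBorel b ∧ lieUnit b = u := by
  constructor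
  · intro hu
    induction hu using Subgroup.closure_induction with
    | mem u hu =>
      rcases hu with ⟨e, he, hue⟩ | ⟨n, hn, N, hN, hun⟩
      · exact ⟨e, D.isBorel_of_fix he, Units.ext (LinearMap.ext fun z => (hue z).symm)⟩
      · rw [D.mem_filt] at hn
        obtain ⟨b, M, hM, hb, hb1, -⟩ := D.G.exists_exp le_rfl hn
        refine ⟨b, hb, Units.ext (LinearMap.ext fun z => ?_)⟩
        rw [lieUnit_apply, hb1, hun, ← expSum_complex]
        rcases le_total N M with h | h
        · rw [expSum_eq_of_le hN h]
        · rw [expSum_eq_of_le hM h]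
    | one => exact ⟨LieEquiv.refl, PrincipalGrading.IsBorel.refl, rfl⟩
    | mul u v _ _ hu hv =>
      obtain ⟨b, hb, rfl⟩ := hu
      obtain ⟨c, hc, rfl⟩ := hv
      exact ⟨c.trans b, hc.trans hb, rfl⟩
    | inv u _ hu =>
      obtain ⟨b, hb, rfl⟩ := hu
      exact ⟨b.symm, hb.symm, rfl⟩
  · rintro ⟨b, hb, rfl⟩
    have key : ∀ m : ℕ, ∃ c, lieUnit c ∈ borelGroup H α ∧ D.G.IsBorel c ∧
        c (b D.G.h) - D.G.h ∈ D.G.F (m + 1) := by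
      intro m
      induction m with
      | zero =>
        exact ⟨LieEquiv.refl, by rw [lieUnit_refl]; exact one_mem _, PrincipalGrading.IsBorel.refl,
          by simpa using hb.upper.sub_mem _ PrincipalGrading.h_mem⟩
      | succ m ih =>
        obtain ⟨c, hc1, hc2, hc3⟩ := ih
        set z := c (b D.G.h) with hz
        -- `[n, h] = -2 (m + 1) n` then cancels the component of degree `m + 1` exactly.
        let n := ((2 * (m + 1) : ℂ))⁻¹ • D.G.pr (m + 1) z
        have hn : n ∈ D.G.F (m + 1) :=
          Submodule.smul_mem _ _ (PrincipalGrading.pr_mem_F le_rfl _)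
        obtain ⟨e, N, hN, he, he1, -, -, he2, -⟩ :=
          D.G.exists_exp (by omega) hn
        refine ⟨c.trans e, ?_, hc2.trans he, ?_⟩
        · rw [lieUnit_trans]
          refine mul_mem (Subgroup.subset_closure (Or.inr ⟨n, ?_, N, hN, ?_⟩)) hc1
          · rw [D.mem_filt]; exact PrincipalGrading.F_mono (by omega) hn
          · exact LinearMap.ext he1
        · rw [LieEquiv.trans_apply, ← hz]
          have hz0 : z ∈ D.G.F 0 := by
            have := add_mem (PrincipalGrading.F_mono (i := 0) (by omega) hc3)
              (PrincipalGrading.h_mem (G := D.G))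
            simpa using this
          have h1 : e z - z - ⁅n, z⁆ ∈ D.G.F (m + 1 + 1) :=
            PrincipalGrading.F_mono (by omega) (he2 0 z hz0)
          have h2 : ⁅n, z - D.G.h⁆ ∈ D.G.F (m + 1 + 1) :=
            PrincipalGrading.lie_mem_F' (by omega) hn hc3
          have h3 : z - D.G.h - D.G.pr (m + 1) (z - D.G.h) ∈ D.G.F (m + 1 + 1) :=
            PrincipalGrading.sub_pr_mem hc3
          have h4 : D.G.pr (m + 1) (z - D.G.h) = D.G.pr (m + 1) z := by
            have : D.G.pr (m + 1) D.G.h = 0 := by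
              rw [← D.G.pr_h, D.G.pr_pr, if_neg (by omega)]
            rw [map_sub, this, sub_zero]
          have h5 : ⁅n, D.G.h⁆ = - D.G.pr (m + 1) z := by
            rw [← lie_skew]
            simp only [n]
            rw [lie_smul, D.G.lie_h, smul_smul]
            congr 1
            have : (m + 1 : ℂ) ≠ 0 := by exact_mod_cast Nat.succ_ne_zero m
            rw [show ((2 * (m + 1) : ℂ))⁻¹ * ((2 * ((m : ℤ) + 1) : ℤ) : ℂ) = 1 by
              push_cast; field_simp, one_smul]
          have h6 := add_mem (add_mem h1 h2) h3
          rw [lie_sub, h5, h4] at h6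
          push_cast
          convert h6 using 1
          abel
    obtain ⟨c, hc1, hc2, hc3⟩ := key D.G.bound
    have hfix : ∀ a ∈ H, (b.trans c) a = a := by
      have hh : (b.trans c) D.G.h = D.G.h :=
        sub_eq_zero.1 (PrincipalGrading.eq_zero_of_mem_F (by omega) hc3)
      intro a ha
      rw [D.mem_H] at ha
      have h1 : D.G.pr 0 ((b.trans c) a) = (b.trans c) a := by
        rw [← D.G.pr_map_of_map_h hh, ha]
      have h2 := (hb.trans hc2).upper.sub_mem a (by
        rw [← ha]; exact PrincipalGrading.pr_mem_F le_rfl _)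
      have h3 := PrincipalGrading.mem_F.1 h2 0 (by norm_num)
      rw [map_sub, h1, ha, sub_eq_zero] at h3
      exact h3
    have h1 : lieUnit (b.trans c) ∈ borelGroup H α :=
      Subgroup.subset_closure (Or.inl ⟨b.trans c, hfix, fun z => rfl⟩)
    rw [lieUnit_trans] at h1
    exact (Subgroup.mul_mem_cancel_left _ hc1).1 h1

end Complex

/-! ### Functions with values in the Borel group, tested at complex points. -/

section Points

variable {R S : Type} [CommRing R] [Algebra ℂ R] [CommRing S] [Algebra ℂ S]
variable {𝔤 : Type} [LieRing 𝔤] [LieAlgebra ℂ 𝔤] {H : LieSubalgebra ℂ 𝔤}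
  {ι : Type} [Fintype ι] {α : ι → Module.Dual ℂ H} {T : PrincipalTriple H α}

variable (R) in
/-- The elements of `R` are determined by their values at complex points. -/
def SeparatedByPoints : Prop := ∀ r : R, (∀ p : R →ₐ[ℂ] ℂ, p r = 0) → r = 0

lemma rTensor_lie (φ : R →ₐ[ℂ] S) (s t : R ⊗[ℂ] 𝔤) :
    φ.toLinearMap.rTensor 𝔤 ⁅s, t⁆ =
      ⁅φ.toLinearMap.rTensor 𝔤 s, φ.toLinearMap.rTensor 𝔤 t⁆ := by
  induction s with
  | zero => simp
  | add a b ha hb => simp only [map_add, add_lie, ha, hb]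
  | tmul a z =>
    induction t with
    | zero => simp
    | add a b ha hb => simp only [map_add, lie_add, ha, hb]
    | tmul c w => simp [LieAlgebra.ExtendScalars.bracket_tmul]

lemma rTensor_baseChange {V W : Type} [AddCommGroup V] [Module ℂ V] [AddCommGroup W] [Module ℂ W]
    (φ : R →ₐ[ℂ] S) (f : V →ₗ[ℂ] W) (t : R ⊗[ℂ] V) :
    φ.toLinearMap.rTensor W (f.baseChange R t) = f.baseChange S (φ.toLinearMap.rTensor V t) := by
  induction t with
  | zero => simp
  | add a b ha hb => simp only [map_add, ha, hb]
  | tmul a z => simp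

/-- The value of a `𝔤`-valued function at a complex point. -/
def evalVec (p : R →ₐ[ℂ] ℂ) : R ⊗[ℂ] 𝔤 →ₗ[ℂ] 𝔤 :=
  (TensorProduct.lid ℂ 𝔤).toLinearMap ∘ₗ p.toLinearMap.rTensor 𝔤

@[simp] lemma evalVec_tmul (p : R →ₐ[ℂ] ℂ) (r : R) (z : 𝔤) : evalVec p (r ⊗ₜ z) = p r • z := by
  simp [evalVec]

lemma evalVec_lie (p : R →ₐ[ℂ] ℂ) (s t : R ⊗[ℂ] 𝔤) :
    evalVec p ⁅s, t⁆ = ⁅evalVec p s, evalVec p t⁆ := by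
  induction s with
  | zero => simp
  | add a b ha hb => simp only [map_add, add_lie, ha, hb]
  | tmul a z =>
    induction t with
    | zero => simp
    | add a b ha hb => simp only [map_add, lie_add, ha, hb]
    | tmul c w => simp [LieAlgebra.ExtendScalars.bracket_tmul, smul_smul, mul_comm]

lemma evalVec_baseChange (p : R →ₐ[ℂ] ℂ) (f : 𝔤 →ₗ[ℂ] 𝔤) (t : R ⊗[ℂ] 𝔤) :
    evalVec p (f.baseChange R t) = f (evalVec p t) := by
  induction t with
  | zero => simp
  | add a b ha hb => simp only [map_add, ha, hb]
  | tmul a z => simp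

lemma endEval_evalVec (p : R →ₐ[ℂ] ℂ) (u : Module.End R (R ⊗[ℂ] 𝔤)) (t : R ⊗[ℂ] 𝔤) :
    endEval 𝔤 p u (evalVec p t) = evalVec p (u t) := by
  have h := endMapFun_rTensor 𝔤 p u t
  simp only [evalVec, LinearMap.comp_apply, LinearEquiv.coe_coe]
  rw [← h]
  simp [endEval, endMap, LinearEquiv.conjRingEquiv]

lemma evalVec_surjective (p : R →ₐ[ℂ] ℂ) (z : 𝔤) : ∃ t : R ⊗[ℂ] 𝔤, evalVec p t = z :=
  ⟨1 ⊗ₜ z, by simp⟩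

lemma SeparatedByPoints.ext (hR : SeparatedByPoints R) {s t : R ⊗[ℂ] 𝔤}
    (h : ∀ p : R →ₐ[ℂ] ℂ, evalVec p s = evalVec p t) : s = t := by
  rw [← sub_eq_zero]
  have h' : ∀ p : R →ₐ[ℂ] ℂ, evalVec p (s - t) = 0 := fun p => by rw [map_sub, h, sub_self]
  generalize s - t = t at h'
  apply (TensorProduct.comm ℂ R 𝔤).injective
  rw [map_zero]
  refine eq_zero_of_contract fun ξ => hR _ fun p => ?_
  have : ∀ t : R ⊗[ℂ] 𝔤, p (contract R ξ (TensorProduct.comm ℂ R 𝔤 t)) = ξ (evalVec p t) := by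
    intro t
    induction t with
    | zero => simp
    | add a b ha hb => simp only [map_add, ha, hb]
    | tmul a z => simp [mul_comm]
  rw [this, h', map_zero]

lemma SeparatedByPoints.mem_F_iff (hR : SeparatedByPoints R) (G : PrincipalGrading ℂ 𝔤) {k : ℤ}
    {t : R ⊗[ℂ] 𝔤} : t ∈ (G.baseChange R).F k ↔ ∀ p : R →ₐ[ℂ] ℂ, evalVec p t ∈ G.F k := by
  constructor
  · intro ht p
    refine PrincipalGrading.mem_F.2 fun j hj => ?_
    rw [← evalVec_baseChange]
    have := PrincipalGrading.mem_F.1 ht j hj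
    exact (congrArg (evalVec p) this).trans (map_zero _)
  · intro ht
    refine PrincipalGrading.mem_F.2 fun j hj => hR.ext fun p => ?_
    rw [map_zero]
    exact (evalVec_baseChange p _ t).trans (PrincipalGrading.mem_F.1 (ht p) j hj)

/-- Compatibility with brackets, with the filtration and with `F 0 / F 1` are all vanishing
conditions on `𝔤`-valued functions, so they can be tested at points. Conversely, the values of `b`
inherit them because every vector of `F k` lifts to a constant function in the filtration over `R`.
-/
theorem OperData.mem_borelPts_iff (D : OperData T) (hR : SeparatedByPoints R)
    (u : (Module.End R (R ⊗[ℂ] 𝔤))ˣ) :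
    u ∈ borelPts R H α ↔ ∃ b, (D.G.baseChange R).IsBorel b ∧ lieUnit b = u := by
  simp only [borelPts, Subgroup.mem_iInf, Subgroup.mem_comap, D.mem_borelGroup_iff]
  constructor
  · intro h
    have hev : ∀ p : R →ₐ[ℂ] ℂ, ∃ b, D.G.IsBorel b ∧ (∀ t, evalVec p (u.1 t) = b (evalVec p t)) ∧
        ∀ t, evalVec p (u⁻¹.1 t) = b.symm (evalVec p t) := by
      intro p
      obtain ⟨b, hb, hbu⟩ := h p
      refine ⟨b, hb, fun t => ?_, fun t => ?_⟩
      · rw [← endEval_evalVec, ← lieUnit_apply, hbu]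
        rfl
      · rw [← endEval_evalVec, ← lieUnit_apply, lieUnit_symm, hbu]
        rfl
    have hl : ∀ s t, u.1 ⁅s, t⁆ = ⁅u.1 s, u.1 t⁆ := fun s t => hR.ext fun p => by
      obtain ⟨b, -, hb, -⟩ := hev p
      rw [hb, evalVec_lie, evalVec_lie, LieEquiv.map_lie, hb, hb]
    refine ⟨lieEquivOfUnit u hl, ⟨⟨fun k z hz => ?_, fun z hz => ?_⟩, ⟨fun k z hz => ?_, fun z hz => ?_⟩⟩,
      lieUnit_lieEquivOfUnit u hl⟩ <;> rw [hR.mem_F_iff] at hz ⊢ <;> intro p <;>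
      obtain ⟨b, hb, hb1, hb2⟩ := hev p
    · rw [lieEquivOfUnit_apply, hb1]; exact hb.upper.mem k _ (hz p)
    · rw [lieEquivOfUnit_apply, map_sub, hb1]; exact hb.upper.sub_mem _ (hz p)
    · rw [lieEquivOfUnit_symm_apply, hb2]; exact hb.symm_upper.mem k _ (hz p)
    · rw [lieEquivOfUnit_symm_apply, map_sub, hb2]; exact hb.symm_upper.sub_mem _ (hz p)
  · rintro ⟨b, hb, rfl⟩ p
    set v := Units.map (endEval 𝔤 p) (lieUnit b) with hv
    have h1 : ∀ t, v.1 (evalVec p t) = evalVec p (b t) := fun t => endEval_evalVec p _ t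
    have h2 : ∀ t, v⁻¹.1 (evalVec p t) = evalVec p (b.symm t) := fun t => endEval_evalVec p _ t
    have hl : ∀ s t, v.1 ⁅s, t⁆ = ⁅v.1 s, v.1 t⁆ := by
      intro s t
      obtain ⟨s, rfl⟩ := evalVec_surjective p s
      obtain ⟨t, rfl⟩ := evalVec_surjective p t
      rw [← evalVec_lie, h1, h1, h1, LieEquiv.map_lie, evalVec_lie]
    have hlift : ∀ k, ∀ z ∈ D.G.F k, ∃ t ∈ (D.G.baseChange R).F k, evalVec p t = z := by
      intro k z hz
      refine ⟨1 ⊗ₜ z, PrincipalGrading.mem_F.2 fun j hj => ?_, by simp⟩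
      have := PrincipalGrading.mem_F.1 hz j hj
      simp [PrincipalGrading.baseChange, IntGrading.baseChange, this]
    refine ⟨lieEquivOfUnit v hl, ⟨⟨fun k z hz => ?_, fun z hz => ?_⟩, ⟨fun k z hz => ?_, fun z hz => ?_⟩⟩,
      lieUnit_lieEquivOfUnit v hl⟩ <;> obtain ⟨t, ht, rfl⟩ := hlift _ z hz
    · rw [lieEquivOfUnit_apply, h1]; exact (hR.mem_F_iff D.G).1 (hb.upper.mem k t ht) p
    · rw [lieEquivOfUnit_apply, h1, ← map_sub]
      exact (hR.mem_F_iff D.G).1 (hb.upper.sub_mem t ht) p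
    · rw [lieEquivOfUnit_symm_apply, h2]; exact (hR.mem_F_iff D.G).1 (hb.symm_upper.mem k t ht) p
    · rw [lieEquivOfUnit_symm_apply, h2, ← map_sub]
      exact (hR.mem_F_iff D.G).1 (hb.symm_upper.sub_mem t ht) p

end Points

/-! ### Connection forms, gauge transformations and generators of the module of differentials. -/

section Forms

variable {R S : Type} [CommRing R] [Algebra ℂ R] [CommRing S] [Algebra ℂ S]
variable {𝔤 : Type} [LieRing 𝔤] [LieAlgebra ℂ 𝔤]

/-- `a` is a generator of the rank one module of differentials. -/
def IsGen (a : Om R) : Prop := Function.Bijective (fun f : R => f • a)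

/-- Multiplication of `𝔤`-valued functions by a differential. -/
def mulForm (a : Om R) : R ⊗[ℂ] 𝔤 →ₗ[ℂ] Om R ⊗[ℂ] 𝔤 :=
  ((LinearMap.toSpanSingleton R (Om R) a).restrictScalars ℂ).rTensor 𝔤

@[simp] lemma mulForm_tmul (a : Om R) (r : R) (z : 𝔤) : mulForm a (r ⊗ₜ[ℂ] z) = (r • a) ⊗ₜ z := by
  simp [mulForm]

lemma mulForm_smul (a : Om R) (r : R) (t : R ⊗[ℂ] 𝔤) : mulForm a (r • t) = r • mulForm a t := by
  induction t with
  | zero => simp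
  | add s t hs ht => simp only [smul_add, map_add, hs, ht]
  | tmul f z => simp [TensorProduct.smul_tmul', mul_smul]

lemma smul_mulForm (a : Om R) (r : R) (t : R ⊗[ℂ] 𝔤) : mulForm (r • a) t = mulForm a (r • t) := by
  induction t with
  | zero => simp
  | add s t hs ht => simp only [smul_add, map_add, hs, ht]
  | tmul f z => simp [TensorProduct.smul_tmul', mul_smul, smul_comm f r a]

lemma mulForm_baseChange {V W : Type} [LieRing V] [LieAlgebra ℂ V] [LieRing W] [LieAlgebra ℂ W]
    (a : Om R) (f : V →ₗ[ℂ] W) (t : R ⊗[ℂ] V) :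
    mulForm a (f.baseChange R t) = f.lTensor (Om R) (mulForm a t) := by
  induction t with
  | zero => simp
  | add s t hs ht => simp only [map_add, hs, ht]
  | tmul f z => simp

lemma IsGen.mulForm_bijective {a : Om R} (ha : IsGen a) :
    Function.Bijective (mulForm a : R ⊗[ℂ] 𝔤 → Om R ⊗[ℂ] 𝔤) := by
  let e : R ≃ₗ[ℂ] Om R :=
    LinearEquiv.ofBijective ((LinearMap.toSpanSingleton R (Om R) a).restrictScalars ℂ) ha
  exact (TensorProduct.congr e (LinearEquiv.refl ℂ 𝔤)).bijective

/-- The derivation `∂` with `df = ∂f • a`. -/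
def IsGen.der {a : Om R} (ha : IsGen a) : Derivation ℂ R R :=
  (LinearEquiv.ofBijective (LinearMap.toSpanSingleton R (Om R) a) ha).symm.toLinearMap.compDer
    (KaehlerDifferential.D ℂ R)

lemma IsGen.der_smul {a : Om R} (ha : IsGen a) (f : R) :
    ha.der f • a = KaehlerDifferential.D ℂ R f :=
  (LinearEquiv.ofBijective (LinearMap.toSpanSingleton R (Om R) a) ha).apply_symm_apply _

lemma IsGen.exists_unit {a a' : Om R} (ha : IsGen a) (ha' : IsGen a') : ∃ u : Rˣ, a' = (u : R) • a := by
  obtain ⟨f, hf⟩ := ha.2 a'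
  obtain ⟨g, hg⟩ := ha'.2 a
  simp only at hf hg
  have h1 : f * g = 1 := ha'.1 (by simp only; rw [mul_smul, hg, hf, one_smul])
  exact ⟨⟨f, g, h1, by rw [mul_comm, h1]⟩, hf.symm⟩

lemma IsGen.smul_unit {a : Om R} (ha : IsGen a) (u : Rˣ) : IsGen ((u : R) • a) := by
  have : (fun f : R => f • (u : R) • a) = (fun f : R => f • a) ∘ (Units.mulRight u) := by
    ext f; simp [mul_smul]
  rw [IsGen, this]
  exact ha.comp (Units.mulRight u).bijective

lemma IsGen.isUnit {a : Om R} (ha : IsGen a) {f : R} (hf : IsGen (f • a)) : IsUnit f := by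
  obtain ⟨u, hu⟩ := ha.exists_unit hf
  exact ⟨u, (ha.1 hu).symm⟩

lemma formAct_tmul (b : Module.End R (R ⊗[ℂ] 𝔤)) (ω : Om R) (z : 𝔤) :
    formAct b (ω ⊗ₜ z) = mulForm ω (b (1 ⊗ₜ z)) := rfl

lemma formAct_mulForm (b : Module.End R (R ⊗[ℂ] 𝔤)) (a : Om R) (t : R ⊗[ℂ] 𝔤) :
    formAct b (mulForm a t) = mulForm a (b t) := by
  induction t with
  | zero => simp
  | add s t hs ht => simp only [map_add, hs, ht]
  | tmul f z =>
    rw [mulForm_tmul, formAct_tmul, smul_mulForm, ← map_smul, TensorProduct.smul_tmul', smul_eq_mul,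
      mul_one]

lemma formAct_smul (b : Module.End R (R ⊗[ℂ] 𝔤)) (r : R) (A : Om R ⊗[ℂ] 𝔤) :
    formAct b (r • A) = r • formAct b A := by
  induction A with
  | zero => simp
  | add s t hs ht => simp only [smul_add, map_add, hs, ht]
  | tmul ω z => rw [TensorProduct.smul_tmul', formAct_tmul, formAct_tmul, smul_mulForm, mulForm_smul]

lemma connOp_tmul (A : Om R ⊗[ℂ] 𝔤) (f : R) (z : 𝔤) :
    connOp A (f ⊗ₜ z) = KaehlerDifferential.D ℂ R f ⊗ₜ z +
      f • (-LieAlgebra.ad ℂ 𝔤 z).lTensor (Om R) A := by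
  simp [connOp]

lemma connOp_smul (A : Om R ⊗[ℂ] 𝔤) (r : R) (t : R ⊗[ℂ] 𝔤) :
    connOp A (r • t) = mulForm (KaehlerDifferential.D ℂ R r) t + r • connOp A t := by
  induction t with
  | zero => simp
  | add s t hs ht => simp only [smul_add, map_add, hs, ht]; abel
  | tmul f z =>
    rw [TensorProduct.smul_tmul', connOp_tmul, connOp_tmul, mulForm_tmul, smul_eq_mul,
      Derivation.leibniz, TensorProduct.add_tmul, smul_add, mul_smul, TensorProduct.smul_tmul']
    abel

/-- The connection with form `A'` is obtained from that with form `A` by the gauge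
transformation `b`. -/
def FormGauge (b : Module.End R (R ⊗[ℂ] 𝔤)) (A A' : Om R ⊗[ℂ] 𝔤) : Prop :=
  formAct b ∘ₗ connOp A' = connOp A ∘ₗ b.restrictScalars ℂ

/-- Both sides of the gauge law obey the same Leibniz rule, so equality on constant vectors
suffices. -/
lemma formGauge_iff (b : Module.End R (R ⊗[ℂ] 𝔤)) (A A' : Om R ⊗[ℂ] 𝔤) :
    FormGauge b A A' ↔ ∀ z : 𝔤, formAct b (connOp A' (1 ⊗ₜ z)) = connOp A (b (1 ⊗ₜ z)) := by
  constructor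
  · intro h z
    exact LinearMap.congr_fun h (1 ⊗ₜ z)
  · intro h
    refine TensorProduct.ext' fun f z => ?_
    have e : (f ⊗ₜ[ℂ] z : R ⊗[ℂ] 𝔤) = f • (1 ⊗ₜ[ℂ] z) := by simp [TensorProduct.smul_tmul']
    rw [LinearMap.comp_apply, LinearMap.comp_apply, LinearMap.restrictScalars_apply, e, map_smul b,
      connOp_smul, connOp_smul, map_add, formAct_mulForm, formAct_smul, h]

/-- Dividing by the generator `a` turns the connection `d + ad (a X)` into the operator `δ + ad X`
on `R ⊗ 𝔤`, where `δ` differentiates along the vector field dual to `a`. This is the passage from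
forms to the algebraic results on `Gauge`. -/
lemma connOp_mulForm {a : Om R} (ha : IsGen a) (X t : R ⊗[ℂ] 𝔤) :
    connOp (mulForm a X) t = mulForm a (derTensor 𝔤 ha.der t + ⁅X, t⁆) := by
  induction t with
  | zero => simp
  | add s t hs ht => rw [map_add, hs, ht, ← map_add]; congr 1; simp only [map_add, lie_add]; abel
  | tmul f z =>
    rw [connOp_tmul, map_add, derTensor_tmul, mulForm_tmul, ha.der_smul]
    congr 1
    induction X with
    | zero => simp
    | add s t hs ht => simp only [map_add, smul_add, add_lie, hs, ht]
    | tmul g w =>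
      rw [LieAlgebra.ExtendScalars.bracket_tmul, mulForm_tmul, mulForm_tmul, LinearMap.lTensor_tmul,
        TensorProduct.smul_tmul', smul_smul, mul_comm f g]
      simp

lemma formGauge_mulForm_iff {a : Om R} (ha : IsGen a) (b : (R ⊗[ℂ] 𝔤) ≃ₗ⁅R⁆ (R ⊗[ℂ] 𝔤))
    (X X' : R ⊗[ℂ] 𝔤) : FormGauge (lieUnit b).1 (mulForm a X) (mulForm a X') ↔
      PrincipalGrading.Gauge (derTensor 𝔤 ha.der) b X X' := by
  constructor
  · intro h t
    have h1 := LinearMap.congr_fun h t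
    simp only [LinearMap.comp_apply, LinearMap.restrictScalars_apply] at h1
    rw [connOp_mulForm ha, connOp_mulForm ha, formAct_mulForm] at h1
    exact ha.mulForm_bijective.1 h1
  · intro h
    refine LinearMap.ext fun t => ?_
    simp only [LinearMap.comp_apply, LinearMap.restrictScalars_apply]
    rw [connOp_mulForm ha, connOp_mulForm ha, formAct_mulForm]
    exact congrArg _ (h t)

lemma omMap_smul (φ : R →ₐ[ℂ] S) (r : R) (ω : Om R) : omMap φ (r • ω) = φ r • omMap φ ω := by
  letI := φ.toRingHom.toAlgebra
  haveI : IsScalarTower ℂ R S := IsScalarTower.of_algebraMap_eq fun c => (φ.commutes c).symm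
  have h := (KaehlerDifferential.map ℂ ℂ R S).map_smul r ω
  exact h.trans (algebra_compatible_smul S r _)

lemma omMap_D (φ : R →ₐ[ℂ] S) (r : R) :
    omMap φ (KaehlerDifferential.D ℂ R r) = KaehlerDifferential.D ℂ S (φ r) := by
  letI := φ.toRingHom.toAlgebra
  haveI : IsScalarTower ℂ R S := IsScalarTower.of_algebraMap_eq fun c => (φ.commutes c).symm
  exact KaehlerDifferential.map_D ℂ ℂ R S r

lemma rTensor_omMap_mulForm (φ : R →ₐ[ℂ] S) (a : Om R) (t : R ⊗[ℂ] 𝔤) :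
    (omMap φ).rTensor 𝔤 (mulForm a t) = mulForm (omMap φ a) (φ.toLinearMap.rTensor 𝔤 t) := by
  induction t with
  | zero => simp
  | add s t hs ht => simp only [map_add, hs, ht]
  | tmul f z => simp [omMap_smul]

lemma rTensor_omMap_smul (φ : R →ₐ[ℂ] S) (r : R) (A : Om R ⊗[ℂ] 𝔤) :
    (omMap φ).rTensor 𝔤 (r • A) = φ r • (omMap φ).rTensor 𝔤 A := by
  induction A with
  | zero => simp
  | add s t hs ht => simp only [smul_add, map_add, hs, ht]
  | tmul f z => simp [TensorProduct.smul_tmul', omMap_smul]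

lemma rTensor_omMap_lTensor {V W : Type} [AddCommGroup V] [Module ℂ V] [AddCommGroup W] [Module ℂ W]
    (φ : R →ₐ[ℂ] S) (f : V →ₗ[ℂ] W) (A : Om R ⊗[ℂ] V) :
    (omMap φ).rTensor W (f.lTensor (Om R) A) = f.lTensor (Om S) ((omMap φ).rTensor V A) := by
  induction A with
  | zero => simp
  | add s t hs ht => simp only [map_add, hs, ht]
  | tmul f z => simp

lemma rTensor_omMap_connOp (φ : R →ₐ[ℂ] S) (A : Om R ⊗[ℂ] 𝔤) (t : R ⊗[ℂ] 𝔤) :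
    (omMap φ).rTensor 𝔤 (connOp A t) =
      connOp ((omMap φ).rTensor 𝔤 A) (φ.toLinearMap.rTensor 𝔤 t) := by
  induction t with
  | zero => simp
  | add s t hs ht => simp only [map_add, hs, ht]
  | tmul f z =>
    rw [connOp_tmul, LinearMap.rTensor_tmul, connOp_tmul, map_add, rTensor_omMap_smul,
      rTensor_omMap_lTensor, LinearMap.rTensor_tmul, omMap_D]
    rfl

lemma rTensor_omMap_formAct (φ : R →ₐ[ℂ] S) (b : Module.End R (R ⊗[ℂ] 𝔤)) (A : Om R ⊗[ℂ] 𝔤) :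
    (omMap φ).rTensor 𝔤 (formAct b A) = formAct (endMap 𝔤 φ b) ((omMap φ).rTensor 𝔤 A) := by
  induction A with
  | zero => simp
  | add s t hs ht => simp only [map_add, hs, ht]
  | tmul ω z =>
    rw [formAct_tmul, rTensor_omMap_mulForm, LinearMap.rTensor_tmul, formAct_tmul]
    congr 1
    have := endMapFun_rTensor 𝔤 φ b (1 ⊗ₜ z)
    rw [LinearMap.rTensor_tmul, AlgHom.toLinearMap_apply, map_one] at this
    exact this.symm

lemma FormGauge.map (φ : R →ₐ[ℂ] S) {b : Module.End R (R ⊗[ℂ] 𝔤)} {A A' : Om R ⊗[ℂ] 𝔤}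
    (h : FormGauge b A A') :
    FormGauge (endMap 𝔤 φ b) ((omMap φ).rTensor 𝔤 A) ((omMap φ).rTensor 𝔤 A') := by
  rw [formGauge_iff] at h ⊢
  intro z
  have h1 := congrArg ((omMap φ).rTensor 𝔤) (h z)
  rw [rTensor_omMap_formAct, rTensor_omMap_connOp, rTensor_omMap_connOp] at h1
  have := endMapFun_rTensor 𝔤 φ b (1 ⊗ₜ z)
  rw [← this, LinearMap.rTensor_tmul, AlgHom.toLinearMap_apply, map_one] at h1
  exact h1

lemma FormGauge.refl (A : Om R ⊗[ℂ] 𝔤) : FormGauge 1 A A := by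
  rw [formGauge_iff]
  intro z
  have : ∀ A : Om R ⊗[ℂ] 𝔤, formAct (1 : Module.End R (R ⊗[ℂ] 𝔤)) A = A := by
    intro A
    induction A with
    | zero => simp
    | add s t hs ht => simp only [map_add, hs, ht]
    | tmul ω z => simp [formAct_tmul]
  rw [this]; rfl

lemma formAct_mul (b c : Module.End R (R ⊗[ℂ] 𝔤)) (A : Om R ⊗[ℂ] 𝔤) :
    formAct (b * c) A = formAct b (formAct c A) := by
  induction A with
  | zero => simp
  | add s t hs ht => simp only [map_add, hs, ht]
  | tmul ω z => rw [formAct_tmul, formAct_tmul, formAct_mulForm]; rfl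

lemma FormGauge.mul {b c : Module.End R (R ⊗[ℂ] 𝔤)} {A A' A'' : Om R ⊗[ℂ] 𝔤}
    (h : FormGauge b A A') (h' : FormGauge c A' A'') : FormGauge (b * c) A A'' := by
  refine LinearMap.ext fun t => ?_
  have h1 := LinearMap.congr_fun h' t
  have h2 := LinearMap.congr_fun h (c t)
  simp only [LinearMap.comp_apply, LinearMap.restrictScalars_apply] at h1 h2 ⊢
  rw [formAct_mul, h1, h2]; rfl

lemma FormGauge.inv {b : (Module.End R (R ⊗[ℂ] 𝔤))ˣ} {A A' : Om R ⊗[ℂ] 𝔤}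
    (h : FormGauge b.1 A A') : FormGauge b⁻¹.1 A' A := by
  refine LinearMap.ext fun t => ?_
  have h2 := LinearMap.congr_fun h (b⁻¹.1 t)
  simp only [LinearMap.comp_apply, LinearMap.restrictScalars_apply] at h2 ⊢
  have e : ∀ t, b.1 (b⁻¹.1 t) = t := fun t => LinearMap.congr_fun b.mul_inv t
  have e' : ∀ A, formAct b⁻¹.1 (formAct b.1 A) = A := fun A => by
    rw [← formAct_mul, Units.inv_mul]
    induction A with
    | zero => simp
    | add s t hs ht => simp only [map_add, hs, ht]
    | tmul ω z => simp [formAct_tmul]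
  rw [e] at h2
  rw [← h2, e']

end Forms

/-! ### Oper forms: invariance, normal forms, rigidity. -/

section OperForms

variable {R S : Type} [CommRing R] [Algebra ℂ R] [CommRing S] [Algebra ℂ S]
variable {𝔤 : Type} [LieRing 𝔤] [LieAlgebra ℂ 𝔤] {H : LieSubalgebra ℂ 𝔤}
  {ι : Type} [Fintype ι] {α : ι → Module.Dual ℂ H} {T : PrincipalTriple H α}

/-- The component of a `𝔤`-valued form along a linear functional. -/
def formCoef (M : Type) [AddCommGroup M] [Module ℂ M] (ξ : Module.Dual ℂ 𝔤) : M ⊗[ℂ] 𝔤 →ₗ[ℂ] M :=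
  (TensorProduct.rid ℂ M).toLinearMap ∘ₗ ξ.lTensor M

@[simp] lemma formCoef_tmul {M : Type} [AddCommGroup M] [Module ℂ M] (ξ : Module.Dual ℂ 𝔤) (m : M)
    (z : 𝔤) : formCoef M ξ (m ⊗ₜ z) = ξ z • m := by simp [formCoef]

lemma formCoef_map {M N : Type} [AddCommGroup M] [Module ℂ M] [AddCommGroup N] [Module ℂ N]
    (ξ : Module.Dual ℂ 𝔤) (φ : M →ₗ[ℂ] N) (A : M ⊗[ℂ] 𝔤) :
    formCoef N ξ (φ.rTensor 𝔤 A) = φ (formCoef M ξ A) := by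
  induction A with
  | zero => simp
  | add s t hs ht => simp only [map_add, hs, ht]
  | tmul ω z => simp

lemma formCoef_lTensor {M : Type} [AddCommGroup M] [Module ℂ M] (ξ : Module.Dual ℂ 𝔤)
    (f : 𝔤 →ₗ[ℂ] 𝔤) (A : M ⊗[ℂ] 𝔤) :
    formCoef M ξ (f.lTensor M A) = formCoef M (ξ ∘ₗ f) A := by
  induction A with
  | zero => simp
  | add s t hs ht => simp only [map_add, hs, ht]
  | tmul ω z => simp

lemma formCoef_mulForm (ξ : Module.Dual ℂ 𝔤) (a : Om R) (X : R ⊗[ℂ] 𝔤) :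
    formCoef (Om R) ξ (mulForm a X) = formCoef R ξ X • a := by
  induction X with
  | zero => simp
  | add s t hs ht => simp only [map_add, add_smul, hs, ht]
  | tmul ω z => simp

lemma formCoef_smul (ξ : Module.Dual ℂ 𝔤) (r : R) (X : R ⊗[ℂ] 𝔤) :
    formCoef R ξ (r • X) = r * formCoef R ξ X := by
  induction X with
  | zero => simp
  | add s t hs ht => simp only [smul_add, map_add, mul_add, hs, ht]
  | tmul ω z => simp [TensorProduct.smul_tmul']

lemma eq_zero_of_formCoef {M : Type} [AddCommGroup M] [Module ℂ M] {A : M ⊗[ℂ] 𝔤}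
    (h : ∀ ξ, formCoef M ξ A = 0) : A = 0 := by
  apply (TensorProduct.comm ℂ M 𝔤).injective
  rw [map_zero]
  refine eq_zero_of_contract fun ξ => ?_
  rw [← h ξ]
  clear h
  induction A with
  | zero => simp
  | add s t hs ht => simp only [map_add, hs, ht]
  | tmul ω z => simp

variable (D : OperData T)

lemma OperData.sum_lTensor_pr (M : Type) [AddCommGroup M] [Module ℂ M] (A : M ⊗[ℂ] 𝔤) :
    ∑ j ∈ Finset.Icc (-(D.G.bound : ℤ)) (D.G.bound : ℤ), (D.G.pr j).lTensor M A = A := by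
  induction A with
  | zero => simp
  | add s t hs ht => simp only [map_add, Finset.sum_add_distrib, hs, ht]
  | tmul ω z => simp only [LinearMap.lTensor_tmul]; rw [← TensorProduct.tmul_sum, D.G.sum_pr]

lemma OperData.mem_formsIn_iff (k : ℤ) (A : Om R ⊗[ℂ] 𝔤) :
    A ∈ formsIn R (filt H α k) ↔ ∀ j < k, (D.G.pr j).lTensor (Om R) A = 0 := by
  constructor
  · rintro ⟨t, rfl⟩ j hj
    induction t with
    | zero => simp
    | add s t hs ht => simp only [map_add, hs, ht, add_zero]
    | tmul ω z =>
      have h := PrincipalGrading.mem_F.1 ((D.mem_filt k _).1 z.2) j hj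
      simp [h]
  · intro h
    rw [← D.sum_lTensor_pr _ A]
    refine Submodule.sum_mem _ fun j _ => ?_
    rcases lt_or_ge j k with hj | hj
    · rw [h j hj]; exact zero_mem _
    · clear h
      induction A with
      | zero => simp
      | add s t hs ht => rw [map_add]; exact add_mem hs ht
      | tmul ω z =>
        refine ⟨ω ⊗ₜ ⟨D.G.pr j z, (D.mem_filt k _).2 (PrincipalGrading.pr_mem_F hj z)⟩, ?_⟩
        simp

lemma OperData.lTensor_pr_mulForm (a : Om R) (j : ℤ) (X : R ⊗[ℂ] 𝔤) :
    (D.G.pr j).lTensor (Om R) (mulForm a X) = mulForm a ((D.G.baseChange R).pr j X) :=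
  (mulForm_baseChange a (D.G.pr j) X).symm

lemma OperData.mulForm_mem_formsIn_iff {a : Om R} (ha : IsGen a) (k : ℤ) (X : R ⊗[ℂ] 𝔤) :
    mulForm a X ∈ formsIn R (filt H α k) ↔ X ∈ (D.G.baseChange R).F k := by
  rw [D.mem_formsIn_iff, PrincipalGrading.mem_F]
  refine forall₂_congr fun j hj => ?_
  rw [D.lTensor_pr_mulForm]
  exact map_eq_zero_iff _ ha.mulForm_bijective.1

lemma OperData.pr_f (i : ι) : D.G.pr (-1) (D.f i) = D.f i := by
  classical
  rw [D.pr_neg_one, Finset.sum_eq_single i (fun j _ hj => by rw [D.ψ_f_ne j i hj, zero_smul])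
    (by simp), D.ψ_f_self, one_smul]

lemma OperData.ψ_eq (i : ι) (z : 𝔤) : D.ψ i z = D.ψ i (D.G.pr (-1) z) := by
  classical
  rw [D.pr_neg_one, map_sum, Finset.sum_eq_single i
    (fun j _ hj => by rw [map_smul, D.ψ_f_ne i j hj.symm, smul_zero]) (by simp), map_smul,
    D.ψ_f_self, smul_eq_mul, mul_one]

lemma OperData.lTensor_pr_neg_one (M : Type) [AddCommGroup M] [Module ℂ M] (A : M ⊗[ℂ] 𝔤) :
    (D.G.pr (-1)).lTensor M A = ∑ i, formCoef M (D.ψ i) A ⊗ₜ D.f i := by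
  induction A with
  | zero => simp
  | add s t hs ht => simp only [map_add, TensorProduct.add_tmul, Finset.sum_add_distrib, hs, ht]
  | tmul ω z =>
    rw [LinearMap.lTensor_tmul, D.pr_neg_one, TensorProduct.tmul_sum]
    refine Finset.sum_congr rfl fun i _ => ?_
    rw [formCoef_tmul, TensorProduct.smul_tmul]

lemma OperData.formCoef_of_pr {M : Type} [AddCommGroup M] [Module ℂ M] {A : M ⊗[ℂ] 𝔤}
    (h : (D.G.pr (-1)).lTensor M A = 0) (i : ι) : formCoef M (D.ψ i) A = 0 := by
  have : D.ψ i = D.ψ i ∘ₗ D.G.pr (-1) := LinearMap.ext (D.ψ_eq i)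
  rw [this, ← formCoef_lTensor, h, map_zero]

/-- The definition allows arbitrary root vectors `e i`. As `𝔤^{-αᵢ}` is a line, they are nonzero
multiples of the fixed `f i`, and the scalars are absorbed in the generators of `Ω`. -/
theorem OperData.isOperForm_iff (A : Om R ⊗[ℂ] 𝔤) : IsOperForm H α A ↔
    (∀ j < -1, (D.G.pr j).lTensor (Om R) A = 0) ∧ ∀ i, IsGen (formCoef (Om R) (D.ψ i) A) := by
  classical
  constructor
  · rintro ⟨a, e, ha, he, hA⟩
    choose c hc0 hc using fun i => D.rootSub_neg i (e i) (he i).1 (he i).2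
    have hA' := (D.mem_formsIn_iff 0 _).1 hA
    refine ⟨fun j hj => ?_, fun i => ?_⟩
    · have h1 := hA' j (by omega)
      rw [map_sub, map_sum, Finset.sum_eq_zero, sub_zero] at h1
      · exact h1
      · intro i _
        rw [LinearMap.lTensor_tmul, hc, map_smul, ← D.pr_f, D.G.pr_pr, if_neg (by omega), smul_zero,
          TensorProduct.tmul_zero]
    · have h1 := D.formCoef_of_pr (hA' (-1) (by norm_num)) i
      rw [map_sub, map_sum, Finset.sum_eq_single i, sub_eq_zero] at h1
      · rw [h1, formCoef_tmul, hc, map_smul, D.ψ_f_self, smul_eq_mul, mul_one,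
          algebra_compatible_smul R]
        have hu : IsUnit (algebraMap ℂ R (c i)) := (IsUnit.mk0 _ (hc0 i)).map _
        obtain ⟨u, hu⟩ := hu
        rw [← hu]
        exact IsGen.smul_unit (ha i) u
      · intro j _ hj
        rw [formCoef_tmul, hc, map_smul, D.ψ_f_ne i j hj.symm, smul_zero, zero_smul]
      · simp
  · rintro ⟨h1, h2⟩
    refine ⟨fun i => formCoef (Om R) (D.ψ i) A, D.f, h2, fun i => ⟨D.f_mem i, D.f_ne_zero i⟩, ?_⟩
    rw [← D.lTensor_pr_neg_one, D.mem_formsIn_iff]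
    intro j hj
    rw [map_sub, ← LinearMap.comp_apply, ← LinearMap.lTensor_comp]
    rcases (show j < -1 ∨ j = -1 by omega) with h | h
    · have : D.G.pr j ∘ₗ D.G.pr (-1) = 0 := LinearMap.ext fun z => by simp [D.G.pr_pr, h.ne]
      rw [h1 j h, this, LinearMap.lTensor_zero, LinearMap.zero_apply, sub_zero]
    · have : D.G.pr j ∘ₗ D.G.pr (-1) = D.G.pr (-1) := LinearMap.ext fun z => by simp [D.G.pr_pr, h]
      rw [this, h, sub_self]

/-- The `𝔤`-valued functions `X` such that `X a` is an oper form for a generator `a`. -/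
def OperData.IsOperVec (X : R ⊗[ℂ] 𝔤) : Prop :=
  X ∈ (D.G.baseChange R).F (-1) ∧ ∀ i, IsUnit (formCoef R (D.ψ i) X)

lemma OperData.isOperForm_mulForm_iff {a : Om R} (ha : IsGen a) (X : R ⊗[ℂ] 𝔤) :
    IsOperForm H α (mulForm a X) ↔ D.IsOperVec X := by
  rw [D.isOperForm_iff, OperData.IsOperVec, PrincipalGrading.mem_F]
  refine and_congr (forall₂_congr fun j hj => ?_) (forall_congr' fun i => ?_)
  · rw [D.lTensor_pr_mulForm]
    exact map_eq_zero_iff _ ha.mulForm_bijective.1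
  · rw [formCoef_mulForm]
    exact ⟨ha.isUnit, fun ⟨u, hu⟩ => hu ▸ ha.smul_unit u⟩

lemma OperData.formCoef_of_mem_F {X : R ⊗[ℂ] 𝔤} (hX : X ∈ (D.G.baseChange R).F 0) (i : ι) :
    formCoef R (D.ψ i) X = 0 :=
  D.formCoef_of_pr (PrincipalGrading.mem_F.1 hX (-1) (by norm_num)) i

variable {D}

lemma OperData.IsOperVec.add {X Z : R ⊗[ℂ] 𝔤} (hX : D.IsOperVec X)
    (hZ : Z ∈ (D.G.baseChange R).F 0) : D.IsOperVec (X + Z) :=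
  ⟨add_mem hX.1 (PrincipalGrading.F_mono (by norm_num) hZ), fun i => by
    rw [map_add, D.formCoef_of_mem_F hZ, add_zero]; exact hX.2 i⟩

variable (D)

lemma OperData.sub_sum_mem {X : R ⊗[ℂ] 𝔤} (hX : X ∈ (D.G.baseChange R).F (-1)) :
    X - ∑ i, formCoef R (D.ψ i) X ⊗ₜ D.f i ∈ (D.G.baseChange R).F 0 := by
  rw [← D.lTensor_pr_neg_one]
  have := PrincipalGrading.sub_pr_mem hX
  rw [neg_add_cancel] at this
  exact this

lemma OperData.tmul_f_mem (i : ι) (r : R) : r ⊗ₜ[ℂ] D.f i ∈ (D.G.baseChange R).F (-1) := by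
  rw [← D.pr_f]
  exact PrincipalGrading.pr_mem_F (G := D.G.baseChange R) le_rfl (r ⊗ₜ[ℂ] D.f i)

/-- The Borel group acts diagonally on `F (-1) / F 0`. Indeed `b` fixes the coweight `w i` modulo `F
1`, so `ad (w i)` kills `b (f j)` modulo `F 0`, just as it kills `f j`; on the `f i`-component,
however, it acts by `-1`. -/
lemma OperData.formCoef_map_f_ne {b : (R ⊗[ℂ] 𝔤) ≃ₗ⁅R⁆ (R ⊗[ℂ] 𝔤)}
    (hb : (D.G.baseChange R).IsUpper b) {i j : ι} (hij : i ≠ j) :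
    formCoef R (D.ψ i) (b (1 ⊗ₜ D.f j)) = 0 := by
  classical
  set z := b (1 ⊗ₜ D.f j) with hz
  have hzF : z ∈ (D.G.baseChange R).F (-1) := hb.mem _ _ (D.tmul_f_mem j 1)
  have hw : (1 : R) ⊗ₜ[ℂ] D.w i ∈ (D.G.baseChange R).F 0 := by
    rw [← D.pr_w]
    exact PrincipalGrading.pr_mem_F (G := D.G.baseChange R) le_rfl (1 ⊗ₜ[ℂ] D.w i)
  have h1 : ⁅(1 : R) ⊗ₜ[ℂ] D.w i, (1 : R) ⊗ₜ[ℂ] D.f j⁆ = 0 := by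
    rw [LieAlgebra.ExtendScalars.bracket_tmul, D.lie_w_ne i j hij, TensorProduct.tmul_zero]
  have h2 : ⁅(1 : R) ⊗ₜ[ℂ] D.w i, z⁆ + ⁅b (1 ⊗ₜ[ℂ] D.w i) - 1 ⊗ₜ[ℂ] D.w i, z⁆ = 0 := by
    rw [← add_lie, add_sub_cancel, hz, ← LieEquiv.map_lie, h1, map_zero]
  have h3 : ⁅b (1 ⊗ₜ[ℂ] D.w i) - 1 ⊗ₜ[ℂ] D.w i, z⁆ ∈ (D.G.baseChange R).F 0 :=
    PrincipalGrading.lie_mem_F' (by norm_num) (hb.sub_mem _ hw) hzF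
  have h4 : ⁅(1 : R) ⊗ₜ[ℂ] D.w i, z - ∑ k, formCoef R (D.ψ k) z ⊗ₜ[ℂ] D.f k⁆ ∈
      (D.G.baseChange R).F 0 :=
    PrincipalGrading.lie_mem_F' (by norm_num) hw (D.sub_sum_mem hzF)
  have h5 : ⁅(1 : R) ⊗ₜ[ℂ] D.w i, ∑ k, formCoef R (D.ψ k) z ⊗ₜ[ℂ] D.f k⁆ =
      -(formCoef R (D.ψ i) z ⊗ₜ[ℂ] D.f i) := by
    rw [lie_sum, Finset.sum_eq_single i]
    · rw [LieAlgebra.ExtendScalars.bracket_tmul, D.lie_w_self, one_mul, TensorProduct.tmul_neg]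
    · intro k _ hk
      rw [LieAlgebra.ExtendScalars.bracket_tmul, D.lie_w_ne i k hk.symm, TensorProduct.tmul_zero]
    · simp
  have h6 := congrArg (formCoef R (D.ψ i)) h2
  rw [map_add, D.formCoef_of_mem_F h3, add_zero, map_zero] at h6
  have h7 := D.formCoef_of_mem_F h4 i
  rw [lie_sub, map_sub, h6, h5, map_neg, formCoef_tmul, D.ψ_f_self, one_smul] at h7
  simpa using h7

lemma OperData.formCoef_map {b : (R ⊗[ℂ] 𝔤) ≃ₗ⁅R⁆ (R ⊗[ℂ] 𝔤)}
    (hb : (D.G.baseChange R).IsUpper b) {X : R ⊗[ℂ] 𝔤} (hX : X ∈ (D.G.baseChange R).F (-1)) (i : ι) :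
    formCoef R (D.ψ i) (b X) = formCoef R (D.ψ i) (b (1 ⊗ₜ D.f i)) * formCoef R (D.ψ i) X := by
  classical
  have h1 := D.formCoef_of_mem_F (hb.mem _ _ (D.sub_sum_mem hX)) i
  rw [map_sub, map_sub, sub_eq_zero] at h1
  have e : ∀ (r : R) z, b (r ⊗ₜ z) = r • b (1 ⊗ₜ z) := fun r z => by
    rw [← map_smul, TensorProduct.smul_tmul', smul_eq_mul, mul_one]
  rw [h1, map_sum, map_sum, Finset.sum_eq_single i]
  · rw [e, formCoef_smul, mul_comm]
  · intro j _ hj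
    rw [e, formCoef_smul, D.formCoef_map_f_ne hb hj.symm, mul_zero]
  · simp

variable {D}

lemma OperData.IsOperVec.map {b : (R ⊗[ℂ] 𝔤) ≃ₗ⁅R⁆ (R ⊗[ℂ] 𝔤)}
    (hb : (D.G.baseChange R).IsBorel b) {X : R ⊗[ℂ] 𝔤} (hX : D.IsOperVec X) :
    D.IsOperVec (b X) := by
  refine ⟨hb.upper.mem _ _ hX.1, fun i => ?_⟩
  rw [D.formCoef_map hb.upper hX.1]
  refine IsUnit.mul (IsUnit.of_mul_eq_one (formCoef R (D.ψ i) (b.symm (1 ⊗ₜ D.f i))) ?_) (hX.2 i)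
  rw [← D.formCoef_map hb.upper (hb.symm_upper.mem _ _ (D.tmul_f_mem i 1)),
    LieEquiv.apply_symm_apply, formCoef_tmul, D.ψ_f_self, one_smul]

variable (D)

/-- The torus of the adjoint group scales the simple root lines independently. The torus of the
`j`-th coweight grading acts on `f j` only, and one multiplies these over all `j`. -/
lemma OperData.exists_torus (u : ι → Rˣ) : ∃ b : (R ⊗[ℂ] 𝔤) ≃ₗ⁅R⁆ (R ⊗[ℂ] 𝔤),
    (D.G.baseChange R).IsBorel b ∧ ∀ i, b (1 ⊗ₜ D.f i) = (u i : R) ⊗ₜ D.f i := by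
  classical
  have key : ∀ s : Finset ι, ∃ b : (R ⊗[ℂ] 𝔤) ≃ₗ⁅R⁆ (R ⊗[ℂ] 𝔤), (D.G.baseChange R).IsBorel b ∧
      ∀ i, b (1 ⊗ₜ D.f i) = if i ∈ s then (u i : R) ⊗ₜ D.f i else 1 ⊗ₜ D.f i := by
    intro s
    induction s using Finset.induction_on with
    | empty => exact ⟨LieEquiv.refl, PrincipalGrading.IsBorel.refl, fun i => by simp⟩
    | insert j s hj ih =>
      obtain ⟨b, hb, hb'⟩ := ih
      let C := (D.cow j).baseChange R
      have hC : ∀ (c : Rˣ) (z : 𝔤) (k : ℤ) (r : R), (D.cow j).pr k z = z →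
          C.torus c (r ⊗ₜ z) = ((c ^ k : Rˣ) : R) • (r ⊗ₜ z) := by
        intro c z k r hz
        have : r ⊗ₜ[ℂ] z = C.pr k (r ⊗ₜ z) := by
          change _ = ((D.cow j).pr k).baseChange R _
          rw [LinearMap.baseChange_tmul, hz]
        rw [this, C.torus_pr]
      have hCpr : ∀ (c : Rˣ) k t, (D.G.baseChange R).pr k (C.torus c t) =
          C.torus c ((D.G.baseChange R).pr k t) := by
        intro c k t
        rw [C.torus_apply, C.torus_apply, map_sum]
        refine Finset.sum_congr rfl fun l _ => ?_
        rw [map_smul]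
        congr 1
        change (D.G.pr k).baseChange R (((D.cow j).pr l).baseChange R t) =
          ((D.cow j).pr l).baseChange R ((D.G.pr k).baseChange R t)
        rw [baseChange_comp_apply, baseChange_comp_apply]
        congr 2
        exact LinearMap.ext fun z => D.pr_cow j l k z
      have hfix : ∀ (c : Rˣ) t, C.torus c ((D.G.baseChange R).pr 0 t) = (D.G.baseChange R).pr 0 t := by
        intro c t
        induction t with
        | zero => simp
        | add s t hs ht => simp only [map_add, hs, ht]
        | tmul r z =>
          change C.torus c (r ⊗ₜ (D.G.pr 0 z)) = r ⊗ₜ (D.G.pr 0 z)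
          rw [hC c (D.G.pr 0 z) 0 r (D.cow_H j _ ((D.mem_H _).2 (PrincipalGrading.pr_self 0 z))),
            zpow_zero, Units.val_one, one_smul]
      have hup : ∀ c : Rˣ, (D.G.baseChange R).IsUpper (C.torus c) := fun c =>
        ⟨fun k z hz => PrincipalGrading.mem_F.2 fun l hl => by
          rw [hCpr, PrincipalGrading.mem_F.1 hz l hl, map_zero],
         fun z hz => by
          have : C.torus c z - z ∈ (D.G.baseChange R).F (0 + 1) := by
            refine PrincipalGrading.mem_F_succ (sub_mem (PrincipalGrading.mem_F.2 fun l hl => ?_) hz) ?_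
            · rw [hCpr, PrincipalGrading.mem_F.1 hz l hl, map_zero]
            · rw [map_sub, hCpr, hfix, sub_self]
          simpa using this⟩
      -- The inverse enters because `f j` has degree `-1`.
      refine ⟨b.trans (C.torus (u j)⁻¹), hb.trans ⟨hup _, ?_⟩, fun i => ?_⟩
      · have : (C.torus (u j)⁻¹).symm = C.torus (u j) := by
          refine LieEquiv.ext fun z => ?_
          have h : ∀ z, C.torus (u j)⁻¹ (C.torus (u j) z) = z := fun z =>
            C.torusMap_torusMap (by simp) z
          conv_lhs => rw [← h z, LieEquiv.symm_apply_apply]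
        rw [this]; exact hup _
      · rw [LieEquiv.trans_apply, hb']
        by_cases hij : i = j
        · subst hij
          rw [if_neg hj, if_pos (Finset.mem_insert_self _ _), hC _ _ (-1) 1 (D.cow_f_self i)]
          simp [TensorProduct.smul_tmul']
        · have h0 : ∀ r : R, C.torus (u j)⁻¹ (r ⊗ₜ D.f i) = r ⊗ₜ D.f i := fun r => by
            rw [hC _ _ 0 r (D.cow_f_ne j i (Ne.symm hij)), zpow_zero, Units.val_one, one_smul]
          by_cases his : i ∈ s
          · rw [if_pos his, if_pos (Finset.mem_insert_of_mem his), h0]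
          · rw [if_neg his, if_neg (by simp [hij, his]), h0]
  obtain ⟨b, hb, h⟩ := key Finset.univ
  exact ⟨b, hb, fun i => by simpa using h i⟩

variable [FiniteDimensional ℂ 𝔤]

lemma OperData.isDer (d : Derivation ℂ R R) : (D.G.baseChange R).IsDer d (derTensor 𝔤 d) :=
  derTensor_isDer D.inner D.G d

variable {D}

lemma OperData.IsOperVec.exists_gauge {d : Derivation ℂ R R} {X : R ⊗[ℂ] 𝔤} (hX : D.IsOperVec X)
    {b : (R ⊗[ℂ] 𝔤) ≃ₗ⁅R⁆ (R ⊗[ℂ] 𝔤)} (hb : (D.G.baseChange R).IsBorel b) :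
    ∃ X' Z, PrincipalGrading.Gauge (derTensor 𝔤 d) b X X' ∧ D.IsOperVec X' ∧
      X' = b.symm X + Z ∧ Z ∈ (D.G.baseChange R).F 0 := by
  obtain ⟨Z, hZ⟩ := (D.isDer d).exists_conn b
  have hZ0 : Z ∈ (D.G.baseChange R).F 0 := PrincipalGrading.conn_mem (D.isDer d) hb hZ
    (fun k z hz => by rw [add_zero]; exact sub_mem (hb.upper.mem k z hz) hz)
  refine ⟨b.symm X + Z, Z, ?_, (hX.map hb.symm).add hZ0, rfl, hZ0⟩
  rw [PrincipalGrading.gauge_iff hZ (D.G.baseChange R), map_add, LieEquiv.apply_symm_apply]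

/-- The torus first moves the leading coefficients to `1`, so that `X` lies in `y + F 0`; its
connection term lies in `F 0` and does no harm. Then `PrincipalGrading.exists_gauge` takes over. -/
lemma OperData.IsOperVec.exists_normal {d : Derivation ℂ R R} {X : R ⊗[ℂ] 𝔤} (hX : D.IsOperVec X) :
    ∃ b X', (D.G.baseChange R).IsBorel b ∧ PrincipalGrading.Gauge (derTensor 𝔤 d) b X X' ∧
      X' - (D.G.baseChange R).y ∈ (D.G.baseChange R).V := by
  choose u hu using hX.2
  obtain ⟨b, hb, hbf⟩ := D.exists_torus u
  obtain ⟨X', Z, hg, -, hX', hZ⟩ := hX.exists_gauge (d := d) hb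
  have h1 : X' - (D.G.baseChange R).y ∈ (D.G.baseChange R).F 0 := by
    have h2 := hb.symm_upper.mem _ _ (D.sub_sum_mem hX.1)
    have h3 : ∑ i, formCoef R (D.ψ i) X ⊗ₜ D.f i = b (D.G.baseChange R).y := by
      change _ = b (1 ⊗ₜ D.G.y)
      rw [D.sum_f, TensorProduct.tmul_sum, map_sum]
      exact Finset.sum_congr rfl fun i _ => by rw [hbf, hu]
    rw [h3, map_sub, LieEquiv.symm_apply_apply] at h2
    rw [hX']
    convert add_mem h2 hZ using 1
    abel
  obtain ⟨c, X'', hc, hg', hV⟩ := PrincipalGrading.exists_gauge (D.isDer d) h1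
  exact ⟨c.trans b, X'', hc.trans hb, hg.trans hg', hV⟩

variable (D)

/-- Without simple roots `y`, and with it `h = [x, y]`, would vanish. Together with `exists_isGen`
below this ensures that an oper form trivializes `Ω`. -/
lemma OperData.nonempty (D : OperData T) : Nonempty ι := by
  by_contra h
  rw [not_nonempty_iff] at h
  have h1 : T.y = 0 := by rw [← D.y_eq, D.sum_f]; simp
  have h2 := T.isSl2Triple.lie_e_f
  rw [h1, lie_zero] at h2
  exact T.isSl2Triple.h_ne_zero h2.symm

lemma OperData.exists_isGen (D : OperData T) {A : Om R ⊗[ℂ] 𝔤} (hA : IsOperForm H α A) : ∃ a : Om R, IsGen a := by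
  obtain ⟨i⟩ := D.nonempty
  exact ⟨_, ((D.isOperForm_iff A).1 hA).2 i⟩

/-- The two results of the gauge transformation define the same operator, so their difference
brackets to zero with all of `𝔤`. -/
lemma FormGauge.right_unique (hf : ∀ z : 𝔤, (∀ w : 𝔤, ⁅z, w⁆ = 0) → z = 0)
    {b : (Module.End R (R ⊗[ℂ] 𝔤))ˣ} {A A' A'' : Om R ⊗[ℂ] 𝔤}
    (h : FormGauge b.1 A A') (h' : FormGauge b.1 A A'') : A' = A'' := by
  have h1 := h.inv.mul h'
  rw [Units.inv_mul] at h1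
  rw [← sub_eq_zero]
  refine eq_zero_of_contract fun ξ => hf _ fun z => ?_
  have h2 := (formGauge_iff _ _ _).1 h1 z
  have h3 : ∀ A : Om R ⊗[ℂ] 𝔤, formAct (1 : Module.End R (R ⊗[ℂ] 𝔤)) A = A := by
    intro A
    induction A with
    | zero => simp
    | add s t hs ht => simp only [map_add, hs, ht]
    | tmul ω z => simp [formAct_tmul]
  rw [h3, Module.End.one_apply, connOp_tmul, connOp_tmul, one_smul, one_smul] at h2
  have h4 := congrArg (contract 𝔤 ξ) (add_left_cancel h2)
  rw [contract_lTensor, contract_lTensor] at h4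
  rw [map_sub, sub_lie, sub_eq_zero]
  simpa using h4.symm

theorem OperData.exists_formGauge {A : Om R ⊗[ℂ] 𝔤} (hA : IsOperForm H α A)
    {b : (R ⊗[ℂ] 𝔤) ≃ₗ⁅R⁆ (R ⊗[ℂ] 𝔤)} (hb : (D.G.baseChange R).IsBorel b) :
    ∃ A', FormGauge (lieUnit b).1 A A' ∧ IsOperForm H α A' := by
  obtain ⟨a, ha⟩ := D.exists_isGen hA
  obtain ⟨X, rfl⟩ := ha.mulForm_bijective.2 A
  rw [D.isOperForm_mulForm_iff ha] at hA
  obtain ⟨X', Z, hg, hX', -⟩ := hA.exists_gauge (d := ha.der) hb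
  exact ⟨mulForm a X', (formGauge_mulForm_iff ha b X X').2 hg, (D.isOperForm_mulForm_iff ha _).2 hX'⟩

theorem OperData.exists_normalForm {a : Om R} (ha : IsGen a) {A : Om R ⊗[ℂ] 𝔤}
    (hA : IsOperForm H α A) : ∃ b v, (D.G.baseChange R).IsBorel b ∧ v ∈ (D.G.baseChange R).V ∧
      FormGauge (lieUnit b).1 A (mulForm a ((D.G.baseChange R).y + v)) := by
  obtain ⟨X, rfl⟩ := ha.mulForm_bijective.2 A
  rw [D.isOperForm_mulForm_iff ha] at hA
  obtain ⟨b, X', hb, hg, hV⟩ := hA.exists_normal (d := ha.der)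
  refine ⟨b, X' - (D.G.baseChange R).y, hb, hV, ?_⟩
  rw [add_sub_cancel, formGauge_mulForm_iff ha]
  exact hg

theorem OperData.normalForm_unique {a : Om R} (ha : IsGen a) {v v' : R ⊗[ℂ] 𝔤}
    (hv : v ∈ (D.G.baseChange R).V) (hv' : v' ∈ (D.G.baseChange R).V)
    {b : (R ⊗[ℂ] 𝔤) ≃ₗ⁅R⁆ (R ⊗[ℂ] 𝔤)} (hb : (D.G.baseChange R).IsBorel b)
    (h : FormGauge (lieUnit b).1 (mulForm a ((D.G.baseChange R).y + v))
      (mulForm a ((D.G.baseChange R).y + v'))) : b = LieEquiv.refl ∧ v = v' := by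
  have h' := (formGauge_mulForm_iff ha b _ _).1 h
  have hb1 := PrincipalGrading.Gauge.eq_refl (D.isDer ha.der) hb h' (by simpa using hv) (by simpa using hv')
  refine ⟨hb1, ?_⟩
  rw [hb1, lieUnit_refl] at h
  have h2 := FormGauge.right_unique (b := 1) D.G.faithful (FormGauge.refl _) h
  exact add_left_cancel (ha.mulForm_bijective.1 h2)

/-- Conjugating to a normal form turns a stabilizer of `A` into a stabilizer of a normal form, which
is trivial. This rigidity lets bundles be replaced by sets of connection forms. -/
theorem OperData.eq_refl_of_formGauge {A : Om R ⊗[ℂ] 𝔤} (hA : IsOperForm H α A)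
    {b : (R ⊗[ℂ] 𝔤) ≃ₗ⁅R⁆ (R ⊗[ℂ] 𝔤)} (hb : (D.G.baseChange R).IsBorel b)
    (h : FormGauge (lieUnit b).1 A A) : b = LieEquiv.refl := by
  obtain ⟨a, ha⟩ := D.exists_isGen hA
  obtain ⟨c, v, hc, hv, hg⟩ := D.exists_normalForm ha hA
  have h1 := (hg.inv.mul h).mul hg
  have h2 := (D.normalForm_unique ha hv hv ((hc.trans hb).trans hc.symm) h1).1
  refine LieEquiv.ext fun z => ?_
  have h3 := congrArg (fun e : (R ⊗[ℂ] 𝔤) ≃ₗ⁅R⁆ (R ⊗[ℂ] 𝔤) => e (c.symm z)) h2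
  simp only [LieEquiv.trans_apply, LieEquiv.apply_symm_apply, LieEquiv.refl_apply] at h3
  simpa using congrArg c h3

end OperForms

/-! ### Tensor powers of the module of differentials. -/

section Powers

variable {R S : Type} [CommRing R] [Algebra ℂ R] [CommRing S] [Algebra ℂ S]

/-- `a^{⊗ k}`. -/
def powGen (a : Om R) (k : ℕ) : ⨂[R]^k (Om R) := PiTensorProduct.tprod R fun _ => a

lemma mulPow_smul (a : Om R) (j : ℕ) (f : R) : mulPow a j (f • a) = f • powGen a (j + 1) := by
  have : mulPow a j (f • a) =
      PiTensorProduct.tprod R (Function.update (fun _ : Fin (j + 1) => a) 0 (f • a)) := rfl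
  rw [this, MultilinearMap.map_update_smul, Function.update_eq_self]
  rfl

lemma powGen_smul (a : Om R) (k : ℕ) (f : R) : powGen (f • a) k = f ^ k • powGen a k := by
  have := (PiTensorProduct.tprod R).map_smul_univ (fun _ : Fin k => f) (fun _ => a)
  rw [Finset.prod_const, Finset.card_univ, Fintype.card_fin] at this
  exact this

lemma IsGen.powGen_bijective {a : Om R} (ha : IsGen a) (k : ℕ) :
    Function.Bijective (fun f : R => f • powGen a k) := by
  let e : R ≃ₗ[R] Om R := LinearEquiv.ofBijective (LinearMap.toSpanSingleton R (Om R) a) ha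
  have he : ∀ ω, e.symm ω • a = ω := fun ω => e.apply_symm_apply ω
  let m : ⨂[R]^k (Om R) →ₗ[R] R := PiTensorProduct.lift
    ((MultilinearMap.mkPiAlgebra R (Fin k) R).compLinearMap fun _ => e.symm.toLinearMap)
  have hm : m (powGen a k) = 1 := by
    have h1 : e.symm a = 1 := by
      rw [LinearEquiv.symm_apply_eq]
      exact (one_smul R a).symm
    simp [m, powGen, h1]
  constructor
  · intro f g h
    have := congrArg m h
    simpa [hm] using this
  · intro ω
    refine PiTensorProduct.induction_on ω (fun r w => ⟨r * ∏ i, e.symm (w i), ?_⟩) ?_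
    · have := (PiTensorProduct.tprod R).map_smul_univ (fun i => e.symm (w i)) (fun _ : Fin k => a)
      simp only
      rw [mul_smul, powGen, ← this]
      simp only [he]
    · rintro x y ⟨f, rfl⟩ ⟨g, rfl⟩
      exact ⟨f + g, by simp only [add_smul]⟩

lemma IsGen.mulPow_bijective {a : Om R} (ha : IsGen a) (j : ℕ) : Function.Bijective (mulPow a j) := by
  have h : (mulPow a j) ∘ (fun f : R => f • a) = fun f : R => f • powGen a (j + 1) :=
    funext fun f => mulPow_smul a j f
  have h1 := ha.powGen_bijective (j + 1)
  rw [← h] at h1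
  exact (Function.Bijective.of_comp_iff _ ha).1 h1

lemma omPowMap_smul (φ : R →ₐ[ℂ] S) (k : ℕ) (r : R) (ω : ⨂[R]^k (Om R)) :
    omPowMap φ k (r • ω) = φ r • omPowMap φ k ω := by
  letI := φ.toRingHom.toAlgebra
  haveI : IsScalarTower ℂ R S := IsScalarTower.of_algebraMap_eq fun c => (φ.commutes c).symm
  have h := (PiTensorProduct.lift
    (((PiTensorProduct.tprod S).restrictScalars R).compLinearMap
      fun _ : Fin k => KaehlerDifferential.map ℂ ℂ R S)).map_smul r ω
  exact h.trans (algebra_compatible_smul S r _)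

lemma omPowMap_tprod (φ : R →ₐ[ℂ] S) (k : ℕ) (w : Fin k → Om R) :
    omPowMap φ k (PiTensorProduct.tprod R w) = PiTensorProduct.tprod S fun i => omMap φ (w i) := by
  letI := φ.toRingHom.toAlgebra
  haveI : IsScalarTower ℂ R S := IsScalarTower.of_algebraMap_eq fun c => (φ.commutes c).symm
  exact PiTensorProduct.lift.tprod w

lemma omPowMap_powGen (φ : R →ₐ[ℂ] S) (k : ℕ) (a : Om R) :
    omPowMap φ k (powGen a k) = powGen (omMap φ a) k := omPowMap_tprod φ k _

end Powers

/-! ### The homomorphism from `sl(2)` and the Borel subgroup of `PGL(2)`. -/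

section Hom

variable {R S : Type} [CommRing R] [Algebra ℂ R] [CommRing S] [Algebra ℂ S]
variable {𝔤 : Type} [LieRing 𝔤] [LieAlgebra ℂ 𝔤] {H : LieSubalgebra ℂ 𝔤}
  {ι : Type} [Fintype ι] {α : ι → Module.Dual ℂ H} {T : PrincipalTriple H α}

lemma PrincipalTriple.hom_h : T.hom sl2Triple.h = T.h := by
  simp [PrincipalTriple.hom, sl2Triple]

lemma PrincipalTriple.hom_x : T.hom sl2Triple.x = T.x := by
  simp [PrincipalTriple.hom, sl2Triple]

lemma PrincipalTriple.hom_y : T.hom sl2Triple.y = T.y := by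
  simp [PrincipalTriple.hom, sl2Triple]

lemma sl2Triple_hom : sl2Triple.hom = LinearMap.id := by
  refine LinearMap.ext fun z => ?_
  conv_rhs => rw [LinearMap.id_apply, sl2_eq z]
  rfl

lemma PrincipalTriple.hom_lie (z w : sl2) : T.hom ⁅z, w⁆ = ⁅T.hom z, T.hom w⁆ := by
  have t := T.isSl2Triple
  have t0 := sl2Triple.isSl2Triple
  have key : ∀ {𝔞 : Type} [LieRing 𝔞] [LieAlgebra ℂ 𝔞] (h x y : 𝔞), IsSl2Triple h x y →
      ⁅h, x⁆ = (2 : ℂ) • x ∧ ⁅h, y⁆ = (-2 : ℂ) • y ∧ ⁅x, y⁆ = h ∧ ⁅x, h⁆ = (-2 : ℂ) • x ∧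
        ⁅y, h⁆ = (2 : ℂ) • y ∧ ⁅y, x⁆ = -h := by
    intro 𝔞 _ _ h x y t
    have h1 : ⁅h, x⁆ = (2 : ℂ) • x := by rw [t.lie_h_e_nsmul, two_smul, two_smul]
    have h2 : ⁅h, y⁆ = (-2 : ℂ) • y := by rw [t.lie_h_f_nsmul, neg_smul, two_smul, two_smul]
    refine ⟨h1, h2, t.lie_e_f, ?_, ?_, ?_⟩
    · rw [← lie_skew, h1, neg_smul]
    · rw [← lie_skew, h2, neg_smul, neg_neg]
    · rw [← lie_skew, t.lie_e_f]
  obtain ⟨a1, a2, a3, a4, a5, a6⟩ := key _ _ _ t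
  obtain ⟨b1, b2, b3, b4, b5, b6⟩ := key _ _ _ t0
  rw [sl2_eq z, sl2_eq w]
  simp only [map_add, map_smul, lie_add, add_lie, lie_smul, smul_lie, lie_self, T.hom_h, T.hom_x,
    T.hom_y, a1, a2, a3, a4, a5, a6, b1, b2, b3, b4, b5, b6, map_neg, map_zero]

variable (D₀ : OperData sl2Triple) (D : OperData T)

lemma OperData.hom_pr (k : ℤ) (z : sl2) : T.hom (D₀.G.pr k z) = D.G.pr k (T.hom z) := by
  have hp : ∀ {𝔞 : Type} [LieRing 𝔞] [LieAlgebra ℂ 𝔞] (G : PrincipalGrading ℂ 𝔞) (j k : ℤ) (z : 𝔞),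
      G.pr j z = z → G.pr k z = if k = j then z else 0 := by
    intro 𝔞 _ _ G j k z hz
    rw [← hz, G.pr_pr]
  have h1 := hp D₀.G 0 k _ D₀.G.pr_h
  have h2 := hp D₀.G 1 k _ D₀.G.pr_x
  have h3 := hp D₀.G (-1) k _ D₀.G.pr_y
  have h4 := hp D.G 0 k _ D.G.pr_h
  have h5 := hp D.G 1 k _ D.G.pr_x
  have h6 := hp D.G (-1) k _ D.G.pr_y
  rw [D₀.h_eq] at h1
  rw [D₀.x_eq] at h2
  rw [D₀.y_eq] at h3
  rw [D.h_eq] at h4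
  rw [D.x_eq] at h5
  rw [D.y_eq] at h6
  rw [sl2_eq z]
  simp only [map_add, map_smul, h1, h2, h3, T.hom_h, T.hom_x, T.hom_y, h4, h5, h6]
  congr 1
  · congr 1
    · split_ifs
      · rw [T.hom_h]
      · simp
    · split_ifs
      · rw [T.hom_x]
      · simp
  · split_ifs
    · rw [T.hom_y]
    · simp

lemma baseChange_lie {𝔞 : Type} [LieRing 𝔞] [LieAlgebra ℂ 𝔞] (f : 𝔞 →ₗ[ℂ] 𝔤)
    (hf : ∀ z w, f ⁅z, w⁆ = ⁅f z, f w⁆) (s t : R ⊗[ℂ] 𝔞) :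
    f.baseChange R ⁅s, t⁆ = ⁅f.baseChange R s, f.baseChange R t⁆ := by
  induction s with
  | zero => simp
  | add a b ha hb => simp only [map_add, add_lie, ha, hb]
  | tmul a z =>
    induction t with
    | zero => simp
    | add a b ha hb => simp only [map_add, lie_add, ha, hb]
    | tmul c w => simp [LieAlgebra.ExtendScalars.bracket_tmul, hf]

lemma hom_baseChange_lie (s t : R ⊗[ℂ] sl2) :
    T.hom.baseChange R ⁅s, t⁆ = ⁅T.hom.baseChange R s, T.hom.baseChange R t⁆ :=
  baseChange_lie T.hom T.hom_lie s t

lemma hom_baseChange_pr (k : ℤ) (t : R ⊗[ℂ] sl2) : T.hom.baseChange R ((D₀.G.baseChange R).pr k t) =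
    (D.G.baseChange R).pr k (T.hom.baseChange R t) := by
  change T.hom.baseChange R ((D₀.G.pr k).baseChange R t) = (D.G.pr k).baseChange R _
  rw [baseChange_comp_apply, baseChange_comp_apply]
  congr 2
  exact LinearMap.ext fun z => OperData.hom_pr D₀ D k z

lemma hom_baseChange_x : T.hom.baseChange R (D₀.G.baseChange R).x = (D.G.baseChange R).x := by
  change T.hom.baseChange R (1 ⊗ₜ D₀.G.x) = 1 ⊗ₜ D.G.x
  rw [LinearMap.baseChange_tmul, D₀.x_eq, D.x_eq, T.hom_x]

lemma hom_baseChange_y : T.hom.baseChange R (D₀.G.baseChange R).y = (D.G.baseChange R).y := by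
  change T.hom.baseChange R (1 ⊗ₜ D₀.G.y) = 1 ⊗ₜ D.G.y
  rw [LinearMap.baseChange_tmul, D₀.y_eq, D.y_eq, T.hom_y]

lemma hom_baseChange_h : T.hom.baseChange R (D₀.G.baseChange R).h = (D.G.baseChange R).h := by
  change T.hom.baseChange R (1 ⊗ₜ D₀.G.h) = 1 ⊗ₜ D.G.h
  rw [LinearMap.baseChange_tmul, D₀.h_eq, D.h_eq, T.hom_h]

lemma hom_baseChange_upTri (u : Rˣ) (r : R) (t : R ⊗[ℂ] sl2) :
    T.hom.baseChange R ((D₀.G.baseChange R).upTri u r t) =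
      (D.G.baseChange R).upTri u r (T.hom.baseChange R t) :=
  PrincipalGrading.map_upTri _ hom_baseChange_lie (hom_baseChange_pr D₀ D) (hom_baseChange_x D₀ D)
    u r t

lemma hom_baseChange_mem_F {k : ℤ} {t : R ⊗[ℂ] sl2} (ht : t ∈ (D₀.G.baseChange R).F k) :
    T.hom.baseChange R t ∈ (D.G.baseChange R).F k :=
  PrincipalGrading.mem_F.2 fun j hj => by
    rw [← hom_baseChange_pr D₀ D, PrincipalGrading.mem_F.1 ht j hj, map_zero]

lemma sl2_tensor_eq (t : R ⊗[ℂ] sl2) : ∃ p q s : R,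
    t = p • (D₀.G.baseChange R).h + q • (D₀.G.baseChange R).x + s • (D₀.G.baseChange R).y := by
  have hh : ∀ p : R, p • (D₀.G.baseChange R).h = p ⊗ₜ sl2Triple.h := fun p => by
    change p • (1 : R) ⊗ₜ[ℂ] D₀.G.h = _
    rw [D₀.h_eq, TensorProduct.smul_tmul', smul_eq_mul, mul_one]
  have hx : ∀ p : R, p • (D₀.G.baseChange R).x = p ⊗ₜ sl2Triple.x := fun p => by
    change p • (1 : R) ⊗ₜ[ℂ] D₀.G.x = _
    rw [D₀.x_eq, TensorProduct.smul_tmul', smul_eq_mul, mul_one]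
  have hy : ∀ p : R, p • (D₀.G.baseChange R).y = p ⊗ₜ sl2Triple.y := fun p => by
    change p • (1 : R) ⊗ₜ[ℂ] D₀.G.y = _
    rw [D₀.y_eq, TensorProduct.smul_tmul', smul_eq_mul, mul_one]
  induction t with
  | zero => exact ⟨0, 0, 0, by simp⟩
  | add s t hs ht =>
    obtain ⟨p, q, s, rfl⟩ := hs
    obtain ⟨p', q', s', rfl⟩ := ht
    exact ⟨p + p', q + q', s + s', by module⟩
  | tmul r z =>
    refine ⟨z.1 0 0 • r, z.1 0 1 • r, z.1 1 0 • r, ?_⟩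
    conv_lhs => rw [sl2_eq z]
    rw [hh, hx, hy, TensorProduct.tmul_add, TensorProduct.tmul_add, TensorProduct.tmul_smul,
      TensorProduct.tmul_smul, TensorProduct.tmul_smul, TensorProduct.smul_tmul',
      TensorProduct.smul_tmul', TensorProduct.smul_tmul']

lemma sl2_pr (p q s : R) :
    (D₀.G.baseChange R).pr 1 (p • (D₀.G.baseChange R).h + q • (D₀.G.baseChange R).x +
      s • (D₀.G.baseChange R).y) = q • (D₀.G.baseChange R).x ∧
    (D₀.G.baseChange R).pr 0 (p • (D₀.G.baseChange R).h + q • (D₀.G.baseChange R).x +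
      s • (D₀.G.baseChange R).y) = p • (D₀.G.baseChange R).h ∧
    (D₀.G.baseChange R).pr (-1) (p • (D₀.G.baseChange R).h + q • (D₀.G.baseChange R).x +
      s • (D₀.G.baseChange R).y) = s • (D₀.G.baseChange R).y := by
  have hp : ∀ (j k : ℤ) (z : R ⊗[ℂ] sl2),
      (D₀.G.baseChange R).pr j z = z → (D₀.G.baseChange R).pr k z = if k = j then z else 0 := by
    intro j k z hz
    rw [← hz, (D₀.G.baseChange R).pr_pr]
  have h1 := fun k => hp 0 k _ (D₀.G.baseChange R).pr_h
  have h2 := fun k => hp 1 k _ (D₀.G.baseChange R).pr_x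
  have h3 := fun k => hp (-1) k _ (D₀.G.baseChange R).pr_y
  simp only [map_add, map_smul, h1, h2, h3]
  refine ⟨?_, ?_, ?_⟩ <;> simp

lemma sl2_smul_h_inj {p q : R} (h : p • (D₀.G.baseChange R).h = q • (D₀.G.baseChange R).h) :
    p = q := by
  let ξ : Module.Dual ℂ sl2 :=
    { toFun := fun A => A.1 0 0
      map_add' := by intros; simp
      map_smul' := by intros; simp }
  have e : ∀ p : R, formCoef R ξ (p • (D₀.G.baseChange R).h) = p := fun p => by
    rw [formCoef_smul]
    change p * formCoef R ξ (1 ⊗ₜ D₀.G.h) = p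
    rw [formCoef_tmul, D₀.h_eq]
    have : ξ sl2Triple.h = 1 := by
      change sl2Triple.h.1 0 0 = 1
      simp [sl2Triple]
    rw [this, one_smul, mul_one]
  rw [← e p, h, e]

lemma sl2_smul_x_inj {p q : R} (h : p • (D₀.G.baseChange R).x = q • (D₀.G.baseChange R).x) :
    p = q := by
  have h1 := congrArg (fun t => ⁅t, (D₀.G.baseChange R).y⁆) h
  simp only [smul_lie, (D₀.G.baseChange R).lie_x_y] at h1
  exact sl2_smul_h_inj D₀ h1

/-- The Borel group of `sl(2)` consists of the automorphisms `upTri u r`. -/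
lemma sl2_exists_upTri {b : (R ⊗[ℂ] sl2) ≃ₗ⁅R⁆ (R ⊗[ℂ] sl2)} (hb : (D₀.G.baseChange R).IsBorel b) :
    ∃ u r, b = (D₀.G.baseChange R).upTri u r := by
  set G := D₀.G.baseChange R with hG
  have hF1 : ∀ t ∈ G.F 1, ∃ q : R, t = q • G.x := by
    intro t ht
    obtain ⟨p, q, s, rfl⟩ := sl2_tensor_eq D₀ t
    have h0 := PrincipalGrading.mem_F.1 ht 0 (by norm_num)
    have h1 := PrincipalGrading.mem_F.1 ht (-1) (by norm_num)
    rw [(sl2_pr D₀ p q s).2.1] at h0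
    rw [(sl2_pr D₀ p q s).2.2] at h1
    exact ⟨q, by rw [← hG] at h0 h1 ⊢; rw [h0, h1, zero_add, add_zero]⟩
  have hxF : G.x ∈ G.F 1 := PrincipalGrading.x_mem
  obtain ⟨t, ht⟩ := hF1 _ (hb.upper.mem 1 _ hxF)
  obtain ⟨t', ht'⟩ := hF1 _ (hb.symm_upper.mem 1 _ hxF)
  have htt : t * t' = 1 := by
    refine sl2_smul_x_inj D₀ ?_
    rw [← hG, mul_comm, mul_smul, ← ht, ← map_smul, ← ht', LieEquiv.apply_symm_apply, one_smul]
  obtain ⟨q, hq⟩ := hF1 _ (hb.symm_upper.sub_mem _ PrincipalGrading.h_mem)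
  let u : Rˣ := ⟨t, t', htt, by rw [mul_comm, htt]⟩
  have h2 : (2 : R) * algebraMap ℂ R (1 / 2) = 1 := by
    rw [← map_ofNat (algebraMap ℂ R) 2, ← map_mul]
    norm_num
  -- The factor on `x` gives `u`, and `b⁻¹ h = h + 2 r x` gives `r`, whence the half.
  refine ⟨u, algebraMap ℂ R (1 / 2) * q, ?_⟩
  set c := G.upTri u (algebraMap ℂ R (1 / 2) * q) with hc
  have hcb : G.IsBorel c := PrincipalGrading.upTri_isBorel _ _
  have e1 : c.symm G.h = b.symm G.h := by
    rw [hc, PrincipalGrading.upTri_symm_h, ← mul_assoc, h2, one_mul, ← hq]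
    abel
  have e2 : c.symm G.x = b.symm G.x := by
    have h3 := PrincipalGrading.pr_upTri_symm_of_mem_V (G := G) u (algebraMap ℂ R (1 / 2) * q)
      PrincipalGrading.x_mem_V 1
    rw [G.pr_x] at h3
    obtain ⟨p, hp⟩ := hF1 _ (hcb.symm_upper.mem 1 _ hxF)
    rw [← hc, hp, map_smul, G.pr_x] at h3
    rw [hp, h3, ht']
    simp [u]
  -- `e` fixes `h` and `x`; preserving degrees, it multiplies `y` by a scalar, and `[x, y] = h`
  -- forces the scalar to be `1`.
  let e := b.symm.trans c
  have heh : e G.h = G.h := by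
    change c (b.symm G.h) = _
    rw [← e1, LieEquiv.apply_symm_apply]
  have hex : e G.x = G.x := by
    change c (b.symm G.x) = _
    rw [← e2, LieEquiv.apply_symm_apply]
  have hey : e G.y = G.y := by
    have h3 := G.pr_map_of_map_h heh (-1) G.y
    rw [G.pr_y] at h3
    obtain ⟨p, q, s, hp⟩ := sl2_tensor_eq D₀ (e G.y)
    rw [hp] at h3
    rw [(sl2_pr D₀ p q s).2.2, ← hp] at h3
    have h4 := congrArg e G.lie_x_y
    rw [LieEquiv.map_lie, hex, heh, h3, lie_smul, ← hG, G.lie_x_y] at h4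
    have : s = 1 := sl2_smul_h_inj D₀ (by rw [← hG, h4, one_smul])
    rw [h3, this, one_smul]
  have he : ∀ z, e z = z := by
    intro z
    obtain ⟨p, q, s, rfl⟩ := sl2_tensor_eq D₀ z
    rw [← hG, map_add, map_add, map_smul, map_smul, map_smul, heh, hex, hey]
  refine LieEquiv.ext fun z => ?_
  have := he (b z)
  change c (b.symm (b z)) = b z at this
  rw [LieEquiv.symm_apply_apply] at this
  exact this.symm

/-- Fixing `y`, the automorphism is trivial on all graded pieces of the filtration by `sub_mem_one`;
fixing `h`, it is homogeneous. Hence it is trivial. -/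
lemma PrincipalGrading.eq_refl_of_fix {E : Type} [LieRing E] [LieAlgebra R E]
    {G : PrincipalGrading R E} {b : E ≃ₗ⁅R⁆ E} (hb : G.IsBorel b) (hh : b G.h = G.h)
    (hy : b G.y = G.y) : b = LieEquiv.refl := by
  refine LieEquiv.ext fun z => ?_
  rw [LieEquiv.refl_apply]
  refine PrincipalGrading.ext_pr (G := G) fun k => ?_
  have h1 := PrincipalGrading.sub_mem_one hb (by rw [hy, sub_self]; exact zero_mem _) k (G.pr k z)
    (PrincipalGrading.pr_mem_F le_rfl z)
  have h2 := PrincipalGrading.mem_F.1 h1 k (by omega)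
  rw [map_sub, G.pr_map_of_map_h hh, PrincipalGrading.pr_self, PrincipalGrading.pr_self,
    sub_eq_zero] at h2
  exact h2

/-- Two elements with the same restriction to the image of `sl(2)` differ by one fixing `h` and `y`.
So the intertwining relation determines the image of an upper triangular element under `ρ`. -/
lemma eq_upTri_of_intertwines {b : (R ⊗[ℂ] 𝔤) ≃ₗ⁅R⁆ (R ⊗[ℂ] 𝔤)} (hb : (D.G.baseChange R).IsBorel b)
    {u : Rˣ} {r : R} (h : ∀ z : R ⊗[ℂ] sl2, b (T.hom.baseChange R z) =
      T.hom.baseChange R ((D₀.G.baseChange R).upTri u r z)) : b = (D.G.baseChange R).upTri u r := by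
  set c := (D.G.baseChange R).upTri u r with hc
  have hcb : (D.G.baseChange R).IsBorel c := PrincipalGrading.upTri_isBorel _ _
  have hfix : ∀ z : R ⊗[ℂ] sl2, (b.trans c.symm) (T.hom.baseChange R z) = T.hom.baseChange R z := by
    intro z
    rw [LieEquiv.trans_apply, h, hom_baseChange_upTri D₀ D, LieEquiv.symm_apply_apply]
  have h1 := PrincipalGrading.eq_refl_of_fix (hb.trans hcb.symm)
    (by rw [← hom_baseChange_h D₀ D]; exact hfix _) (by rw [← hom_baseChange_y D₀ D]; exact hfix _)
  refine LieEquiv.ext fun z => ?_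
  have h2 := congrArg (fun e : (R ⊗[ℂ] 𝔤) ≃ₗ⁅R⁆ (R ⊗[ℂ] 𝔤) => c (e z)) h1
  simpa using h2

end Hom

/-! ### Functions with values in `V` as sections of the bundles `V_j ⊗ Ω^{⊗ (j+1)}`. -/

section Coeffs

variable {R S : Type} [CommRing R] [Algebra ℂ R] [CommRing S] [Algebra ℂ S]
variable {𝔤 : Type} [LieRing 𝔤] [LieAlgebra ℂ 𝔤] {H : LieSubalgebra ℂ 𝔤}
  {ι : Type} [Fintype ι] {α : ι → Module.Dual ℂ H} {T : PrincipalTriple H α}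
variable (D₀ : OperData sl2Triple) (D : OperData T)

variable (R T) in
/-- The sections of `⨁_j V_j ⊗ Ω^{⊗ (j+1)}` over `R`. -/
abbrev CoefFamily : Type := ∀ j : ℕ, T.V j ⊗[ℂ] (⨂[R]^(j + 1) (Om R))

/-- The function `v` with values in `V` is the section `ε` of `⨁_j V_j ⊗ Ω^{⊗ (j+1)}` in the
trivialization given by the generator `a` of `Ω`. -/
structure OperData.HasCoeffs (a : Om R) (v : R ⊗[ℂ] 𝔤) (ε : CoefFamily R T) : Prop where
  mem : v ∈ (D.G.baseChange R).V
  coef : ∀ (j : ℕ) (ξ : Module.Dual ℂ 𝔤), formCoef R ξ ((D.G.baseChange R).pr j v) • powGen a (j + 1) =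
    contract _ (ξ ∘ₗ (T.V j).subtype) (ε j)

lemma OperData.tmul_mem_V (r : R) {z : 𝔤} (hz : z ∈ D.G.V) : r ⊗ₜ[ℂ] z ∈ (D.G.baseChange R).V := by
  rw [PrincipalGrading.mem_V] at hz ⊢
  refine ⟨PrincipalGrading.mem_F.2 fun j hj => ?_, ?_⟩
  · change (D.G.pr j).baseChange R _ = 0
    rw [LinearMap.baseChange_tmul, PrincipalGrading.mem_F.1 hz.1 j hj, TensorProduct.tmul_zero]
  · change D.G.sig.baseChange R _ = 0
    rw [LinearMap.baseChange_tmul, hz.2, TensorProduct.tmul_zero]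

lemma OperData.subsingleton_V {j : ℕ} (hj : D.G.bound < j) : Subsingleton (T.V j) :=
  ⟨fun z w => by
    have h : ∀ z : T.V j, (z : 𝔤) = 0 := fun z => by
      rw [← ((D.mem_V j z).1 z.2).1]
      exact D.G.pr_eq_zero _ _ (Or.inl (by exact_mod_cast hj))
    exact Subtype.ext ((h z).trans (h w).symm)⟩

lemma OperData.exists_vec_of_sumForm {a : Om R} (ha : IsGen a)
    (θ : DirectSum ℕ fun j => T.V j ⊗[ℂ] Om R) : ∃ v ∈ (D.G.baseChange R).V,
      mulForm a v = sumForm R T θ ∧ ∀ (j : ℕ) (ξ : Module.Dual ℂ 𝔤),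
        formCoef R ξ ((D.G.baseChange R).pr j v) • a =
          contract (Om R) (ξ ∘ₗ (T.V j).subtype) (θ j) := by
  classical
  induction θ using DirectSum.induction_on with
  | zero => exact ⟨0, zero_mem _, by simp, fun j ξ => by simp⟩
  | add θ θ' h h' =>
    obtain ⟨v, hv, h1, h2⟩ := h
    obtain ⟨v', hv', h1', h2'⟩ := h'
    refine ⟨v + v', add_mem hv hv', by simp only [map_add, h1, h1'], fun j ξ => ?_⟩
    simp only [map_add, add_smul, h2, h2', DirectSum.add_apply]
  | of j t =>
    induction t with
    | zero => exact ⟨0, zero_mem _, by simp, fun j ξ => by simp⟩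
    | add t t' h h' =>
      obtain ⟨v, hv, h1, h2⟩ := h
      obtain ⟨v', hv', h1', h2'⟩ := h'
      refine ⟨v + v', add_mem hv hv', by simp only [map_add, h1, h1'], fun j ξ => ?_⟩
      simp only [map_add, add_smul, h2, h2', DirectSum.add_apply]
    | tmul z ω =>
      obtain ⟨f, rfl⟩ := ha.2 ω
      have hz := (D.mem_V j z).1 z.2
      refine ⟨f ⊗ₜ z, D.tmul_mem_V f hz.2, ?_, fun k ξ => ?_⟩
      · have : sumForm R T (DirectSum.of _ j (z ⊗ₜ[ℂ] (f • a))) = (f • a) ⊗ₜ (z : 𝔤) := by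
          rw [sumForm]
          erw [DirectSum.toModule_lof]
          simp
        rw [this, mulForm_tmul]
      · have h3 : (D.G.baseChange R).pr k (f ⊗ₜ[ℂ] (z : 𝔤)) = f ⊗ₜ D.G.pr k z := rfl
        rw [h3, ← hz.1, D.G.pr_pr]
        by_cases hk : k = j
        · subst hk
          rw [if_pos rfl, hz.1, DirectSum.of_eq_same]
          simp [smul_assoc]
        · rw [if_neg (by exact_mod_cast hk), DirectSum.of_eq_of_ne _ _ _ hk]
          simp

lemma OperData.HasCoeffs.unique {a : Om R} (ha : IsGen a) {v v' : R ⊗[ℂ] 𝔤} {ε : CoefFamily R T}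
    (h : D.HasCoeffs a v ε) (h' : D.HasCoeffs a v' ε) : v = v' := by
  refine PrincipalGrading.ext_pr (G := D.G.baseChange R) fun k => ?_
  rcases lt_or_ge k 0 with hk | hk
  · rw [PrincipalGrading.mem_F.1 (PrincipalGrading.mem_V.1 h.mem).1 k hk,
      PrincipalGrading.mem_F.1 (PrincipalGrading.mem_V.1 h'.mem).1 k hk]
  · obtain ⟨j, rfl⟩ := Int.eq_ofNat_of_zero_le hk
    rw [← sub_eq_zero]
    refine eq_zero_of_formCoef fun ξ => ?_
    rw [map_sub, sub_eq_zero]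
    exact (ha.powGen_bijective (j + 1)).1 ((h.coef j ξ).trans (h'.coef j ξ).symm)

lemma OperData.exists_hasCoeffs {a : Om R} (ha : IsGen a) (ε : CoefFamily R T) :
    ∃ (v : R ⊗[ℂ] 𝔤) (θ : DirectSum ℕ fun j => T.V j ⊗[ℂ] Om R), D.HasCoeffs a v ε ∧
      mulForm a v = sumForm R T θ ∧ ∀ j, (mulPow a j).lTensor (T.V j) (θ j) = ε j := by
  classical
  have h1 : ∀ j : ℕ, ∃ t : T.V j ⊗[ℂ] Om R, (mulPow a j).lTensor (T.V j) t = ε j := fun j =>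
    LinearMap.lTensor_surjective (T.V j) (ha.mulPow_bijective j).2 (ε j)
  choose t ht using h1
  -- Finitely many degrees suffice, since `V_j = 0` beyond the bound of the grading.
  let θ : DirectSum ℕ fun j => T.V j ⊗[ℂ] Om R :=
    DirectSum.mk _ (Finset.range (D.G.bound + 1)) fun j => t j
  have hθ : ∀ j, θ j = t j := by
    intro j
    by_cases hj : j ∈ Finset.range (D.G.bound + 1)
    · exact DirectSum.mk_apply_of_mem hj
    · have : Subsingleton (T.V j) := D.subsingleton_V (by simpa using hj)
      have : Subsingleton (T.V j ⊗[ℂ] Om R) :=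
        ⟨fun x y => by
          have h0 : ∀ x : T.V j ⊗[ℂ] Om R, x = 0 := fun x => by
            induction x with
            | zero => rfl
            | add x y hx hy => rw [hx, hy, add_zero]
            | tmul z ω => rw [Subsingleton.elim z 0, TensorProduct.zero_tmul]
          rw [h0 x, h0 y]⟩
      exact Subsingleton.elim _ _
  obtain ⟨v, hv, h2, h3⟩ := D.exists_vec_of_sumForm ha θ
  refine ⟨v, θ, ⟨hv, fun j ξ => ?_⟩, h2, fun j => by rw [hθ, ht]⟩
  rw [← mulPow_smul, h3, ← contract_lTensor, hθ, ht]

lemma OperData.hasCoeffs_of_sumForm {a : Om R} (ha : IsGen a) {ε : CoefFamily R T}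
    {θ : DirectSum ℕ fun j => T.V j ⊗[ℂ] Om R}
    (h : ∀ j, (mulPow a j).lTensor (T.V j) (θ j) = ε j) :
    ∃ v, D.HasCoeffs a v ε ∧ mulForm a v = sumForm R T θ := by
  obtain ⟨v, hv, h2, h3⟩ := D.exists_vec_of_sumForm ha θ
  exact ⟨v, ⟨hv, fun j ξ => by rw [← mulPow_smul, h3, ← contract_lTensor, h]⟩, h2⟩

variable {D}

lemma OperData.HasCoeffs.add {a : Om R} {v v' : R ⊗[ℂ] 𝔤} {ε ε' : CoefFamily R T}
    (h : D.HasCoeffs a v ε) (h' : D.HasCoeffs a v' ε') : D.HasCoeffs a (v + v') (ε + ε') :=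
  ⟨add_mem h.mem h'.mem, fun j ξ => by
    rw [map_add, map_add, add_smul, h.coef, h'.coef, Pi.add_apply, map_add]⟩

lemma OperData.HasCoeffs.change {a : Om R} {v v' : R ⊗[ℂ] 𝔤} {ε : CoefFamily R T}
    (h : D.HasCoeffs a v ε) (u : Rˣ) (hv' : v' ∈ (D.G.baseChange R).V)
    (hu : ∀ j : ℕ, (u : R) ^ (j + 1) • (D.G.baseChange R).pr j v' = (D.G.baseChange R).pr j v) :
    D.HasCoeffs ((u : R) • a) v' ε :=
  ⟨hv', fun j ξ => by
    rw [← h.coef, ← hu, formCoef_smul, powGen_smul, smul_smul, mul_comm]⟩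

/-- The image of a section of `⨁_j V_j ⊗ Ω^{⊗ (j+1)}` under a homomorphism of rings. -/
def CoefFamily.map (φ : R →ₐ[ℂ] S) (ε : CoefFamily R T) : CoefFamily S T :=
  fun j => (omPowMap φ (j + 1)).lTensor (T.V j) (ε j)

lemma rTensor_mem_V (φ : R →ₐ[ℂ] S) {v : R ⊗[ℂ] 𝔤} (hv : v ∈ (D.G.baseChange R).V) :
    φ.toLinearMap.rTensor 𝔤 v ∈ (D.G.baseChange S).V := by
  rw [PrincipalGrading.mem_V] at hv ⊢
  refine ⟨PrincipalGrading.mem_F.2 fun j hj => ?_, ?_⟩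
  · have := congrArg (φ.toLinearMap.rTensor 𝔤) (PrincipalGrading.mem_F.1 hv.1 j hj)
    rw [map_zero] at this
    exact (rTensor_baseChange φ (D.G.pr j) v).symm.trans this
  · have := congrArg (φ.toLinearMap.rTensor 𝔤) hv.2
    rw [map_zero] at this
    exact (rTensor_baseChange φ D.G.sig v).symm.trans this

lemma rTensor_pr (φ : R →ₐ[ℂ] S) (k : ℤ) (v : R ⊗[ℂ] 𝔤) :
    φ.toLinearMap.rTensor 𝔤 ((D.G.baseChange R).pr k v) =
      (D.G.baseChange S).pr k (φ.toLinearMap.rTensor 𝔤 v) :=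
  rTensor_baseChange φ (D.G.pr k) v

lemma rTensor_one_tmul (φ : R →ₐ[ℂ] S) (z : 𝔤) :
    φ.toLinearMap.rTensor 𝔤 (1 ⊗ₜ z) = 1 ⊗ₜ z := by simp

lemma OperData.HasCoeffs.map (φ : R →ₐ[ℂ] S) {a : Om R} {v : R ⊗[ℂ] 𝔤} {ε : CoefFamily R T}
    (h : D.HasCoeffs a v ε) : D.HasCoeffs (omMap φ a) (φ.toLinearMap.rTensor 𝔤 v) (ε.map φ) :=
  ⟨rTensor_mem_V φ h.mem, fun j ξ => by
    have h1 := congrArg (omPowMap φ (j + 1)) (h.coef j ξ)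
    rw [omPowMap_smul, omPowMap_powGen, ← contract_lTensor] at h1
    rw [← rTensor_pr, Opers.formCoef_map]
    exact h1⟩

variable (D)

/-- The section `ω · x`. -/
def CoefFamily.single (T : PrincipalTriple H α) (w : ⨂[R]^2 (Om R)) : CoefFamily R T :=
  Pi.single 1 ((⟨T.x, T.x_mem_V⟩ : T.V ((1 : ℕ) : ℤ)) ⊗ₜ[ℂ] w)

lemma CoefFamily.single_one (w : ⨂[R]^2 (Om R)) :
    CoefFamily.single T w 1 = (⟨T.x, T.x_mem_V⟩ : T.V ((1 : ℕ) : ℤ)) ⊗ₜ[ℂ] w :=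
  Pi.single_eq_same _ _

lemma CoefFamily.single_ne (w : ⨂[R]^2 (Om R)) {j : ℕ} (hj : j ≠ 1) :
    CoefFamily.single T w j = 0 :=
  Pi.single_eq_of_ne hj _

lemma OperData.hasCoeffs_single (a : Om R) (w : R) :
    D.HasCoeffs a (w • (D.G.baseChange R).x) (CoefFamily.single T (w • powGen a 2)) := by
  refine ⟨Submodule.smul_mem _ _ PrincipalGrading.x_mem_V, fun j ξ => ?_⟩
  rw [map_smul, ← (D.G.baseChange R).pr_x, (D.G.baseChange R).pr_pr]
  by_cases hj : j = 1
  · subst hj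
    have e : formCoef R ξ (w • (D.G.baseChange R).x) = w * (ξ T.x • (1 : R)) := by
      rw [formCoef_smul]
      change w * formCoef R ξ (1 ⊗ₜ D.G.x) = _
      rw [formCoef_tmul, D.x_eq]
    rw [if_pos (by norm_num), (D.G.baseChange R).pr_x, CoefFamily.single_one, e, contract_tmul]
    simp
  · rw [if_neg (by exact_mod_cast hj), CoefFamily.single_ne _ hj]
    simp

end Coeffs

/-! ### Induced connection forms and their equivariance. -/

section Induced

variable {R S : Type} [CommRing R] [Algebra ℂ R] [CommRing S] [Algebra ℂ S]
variable {𝔤 : Type} [LieRing 𝔤] [LieAlgebra ℂ 𝔤] {H : LieSubalgebra ℂ 𝔤}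
  {ι : Type} [Fintype ι] {α : ι → Module.Dual ℂ H} {T : PrincipalTriple H α}
variable (D₀ : OperData sl2Triple) (D : OperData T)

/-- `A` is the connection form induced from the connection form `A₀` of an `sl(2)`-oper and the
section `ε` of `⨁_j V_j ⊗ Ω^{⊗ (j+1)}`. -/
def IndForm (ε : CoefFamily R T) (A₀ : Om R ⊗[ℂ] sl2) (A : Om R ⊗[ℂ] 𝔤) : Prop :=
  ∃ (a : Om R) (θ : DirectSum ℕ fun j => T.V j ⊗[ℂ] Om R),
    A₀ - a ⊗ₜ[ℂ] sl2Triple.y ∈ formsIn R (filt sl2Cartan sl2Root 0) ∧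
    A = T.hom.lTensor (Om R) A₀ + sumForm R T θ ∧
    ∀ j, (mulPow a j).lTensor (T.V j) (θ j) = ε j

lemma OperData.sl2_f : D₀.f () = sl2Triple.y := by
  rw [← D₀.y_eq, D₀.sum_f]; simp

lemma OperData.sl2_coef_eq (D₀ : OperData sl2Triple) {A₀ : Om R ⊗[ℂ] sl2} {a : Om R}
    (h : A₀ - a ⊗ₜ[ℂ] sl2Triple.y ∈ formsIn R (filt sl2Cartan sl2Root 0)) :
    a = formCoef (Om R) (D₀.ψ ()) A₀ := by
  have h1 := D₀.formCoef_of_pr ((D₀.mem_formsIn_iff 0 _).1 h (-1) (by norm_num)) ()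
  rw [map_sub, sub_eq_zero, formCoef_tmul, ← D₀.sl2_f, D₀.ψ_f_self, one_smul] at h1
  exact h1.symm

lemma OperData.sl2_isGen (D₀ : OperData sl2Triple) {A₀ : Om R ⊗[ℂ] sl2} (hA : IsOperForm sl2Cartan sl2Root A₀) {a : Om R}
    (h : A₀ - a ⊗ₜ[ℂ] sl2Triple.y ∈ formsIn R (filt sl2Cartan sl2Root 0)) : IsGen a := by
  rw [D₀.sl2_coef_eq h]
  exact ((D₀.isOperForm_iff A₀).1 hA).2 ()

lemma OperData.sl2_exists_coef (D₀ : OperData sl2Triple) {A₀ : Om R ⊗[ℂ] sl2} (hA : IsOperForm sl2Cartan sl2Root A₀) :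
    ∃ a : Om R, A₀ - a ⊗ₜ[ℂ] sl2Triple.y ∈ formsIn R (filt sl2Cartan sl2Root 0) := by
  obtain ⟨a, e, -, he, h⟩ := hA
  obtain ⟨c, -, hc⟩ := D₀.rootSub_neg () (e ()) (he ()).1 (he ()).2
  refine ⟨c • a (), ?_⟩
  rw [D₀.sl2_f] at hc
  simpa [hc, TensorProduct.smul_tmul] using h

lemma OperData.sl2_mem_iff {a : Om R} (ha : IsGen a) (X₀ : R ⊗[ℂ] sl2) (r : R) :
    mulForm a X₀ - (r • a) ⊗ₜ[ℂ] sl2Triple.y ∈ formsIn R (filt sl2Cartan sl2Root 0) ↔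
      X₀ - r • (D₀.G.baseChange R).y ∈ (D₀.G.baseChange R).F 0 := by
  have : (r • a) ⊗ₜ[ℂ] sl2Triple.y = mulForm a (r • (D₀.G.baseChange R).y) := by
    rw [mulForm_smul]
    change _ = r • mulForm a (1 ⊗ₜ D₀.G.y)
    rw [mulForm_tmul, one_smul, D₀.y_eq, TensorProduct.smul_tmul']
  rw [this, ← map_sub, D₀.mulForm_mem_formsIn_iff ha]

/-- The coefficient `a` of `y` in `A₀` is unique and generates `Ω`, so the data `(a, θ)` amount to
one `V`-valued function `v`. -/
lemma indForm_iff (D₀ : OperData sl2Triple) (D : OperData T) {A₀ : Om R ⊗[ℂ] sl2} (hA : IsOperForm sl2Cartan sl2Root A₀) {a : Om R}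
    (h : A₀ - a ⊗ₜ[ℂ] sl2Triple.y ∈ formsIn R (filt sl2Cartan sl2Root 0)) (ε : CoefFamily R T)
    (A : Om R ⊗[ℂ] 𝔤) : IndForm ε A₀ A ↔
      ∃ v, D.HasCoeffs a v ε ∧ A = T.hom.lTensor (Om R) A₀ + mulForm a v := by
  have ha := D₀.sl2_isGen hA h
  constructor
  · rintro ⟨a', θ, h', rfl, hθ⟩
    obtain rfl : a' = a := (D₀.sl2_coef_eq h').trans (D₀.sl2_coef_eq h).symm
    obtain ⟨v, hv, hv'⟩ := D.hasCoeffs_of_sumForm ha hθ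
    exact ⟨v, hv, by rw [hv']⟩
  · rintro ⟨v, hv, rfl⟩
    obtain ⟨v', θ, hv', h1, h2⟩ := D.exists_hasCoeffs ha ε
    rw [OperData.HasCoeffs.unique D ha hv hv']
    exact ⟨a, θ, h, by rw [h1], h2⟩

lemma IndForm.unique (D₀ : OperData sl2Triple) (D : OperData T) {A₀ : Om R ⊗[ℂ] sl2} (hA : IsOperForm sl2Cartan sl2Root A₀)
    {ε : CoefFamily R T} {A A' : Om R ⊗[ℂ] 𝔤} (h : IndForm ε A₀ A) (h' : IndForm ε A₀ A') :
    A = A' := by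
  obtain ⟨a, ha⟩ := D₀.sl2_exists_coef hA
  obtain ⟨v, hv, rfl⟩ := (indForm_iff D₀ D hA ha ε A).1 h
  obtain ⟨v', hv', rfl⟩ := (indForm_iff D₀ D hA ha ε A').1 h'
  rw [OperData.HasCoeffs.unique D (D₀.sl2_isGen hA ha) hv hv']

lemma sl2_exists_vec {A₀ : Om R ⊗[ℂ] sl2} (hA : IsOperForm sl2Cartan sl2Root A₀) {a : Om R}
    (h : A₀ - a ⊗ₜ[ℂ] sl2Triple.y ∈ formsIn R (filt sl2Cartan sl2Root 0)) :
    ∃ X₀, A₀ = mulForm a X₀ ∧ X₀ - (D₀.G.baseChange R).y ∈ (D₀.G.baseChange R).F 0 := by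
  have ha := D₀.sl2_isGen hA h
  obtain ⟨X₀, rfl⟩ := ha.mulForm_bijective.2 A₀
  rw [← one_smul R a, smul_mulForm, one_smul, D₀.sl2_mem_iff ha, one_smul] at h
  exact ⟨X₀, rfl, h⟩

lemma IndForm.exists (D₀ : OperData sl2Triple) (D : OperData T) {A₀ : Om R ⊗[ℂ] sl2}
    (hA : IsOperForm sl2Cartan sl2Root A₀) (ε : CoefFamily R T) :
    ∃ A : Om R ⊗[ℂ] 𝔤, IndForm ε A₀ A := by
  obtain ⟨a, ha⟩ := D₀.sl2_exists_coef hA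
  obtain ⟨v, θ, hv, h1, h2⟩ := D.exists_hasCoeffs (D₀.sl2_isGen hA ha) ε
  exact ⟨_, (indForm_iff D₀ D hA ha ε _).2 ⟨v, hv, rfl⟩⟩

lemma OperData.isOperVec_of_sub_mem {X : R ⊗[ℂ] 𝔤}
    (h : X - (D.G.baseChange R).y ∈ (D.G.baseChange R).F 0) : D.IsOperVec X := by
  classical
  have hy : D.IsOperVec (D.G.baseChange R).y := by
    refine ⟨PrincipalGrading.y_mem, fun i => ?_⟩
    change IsUnit (formCoef R (D.ψ i) (1 ⊗ₜ D.G.y))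
    rw [formCoef_tmul, D.sum_f, map_sum,
      Finset.sum_eq_single i (fun j _ hj => D.ψ_f_ne i j hj.symm) (by simp), D.ψ_f_self, one_smul]
    exact isUnit_one
  simpa using hy.add h

lemma IndForm.isOperForm (D₀ : OperData sl2Triple) (D : OperData T) {A₀ : Om R ⊗[ℂ] sl2}
    (hA : IsOperForm sl2Cartan sl2Root A₀) {ε : CoefFamily R T} {A : Om R ⊗[ℂ] 𝔤}
    (h : IndForm ε A₀ A) : IsOperForm H α A := by
  obtain ⟨a, ha⟩ := D₀.sl2_exists_coef hA
  obtain ⟨v, hv, rfl⟩ := (indForm_iff D₀ D hA ha ε A).1 h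
  have hg := D₀.sl2_isGen hA ha
  obtain ⟨X₀, rfl, hX₀⟩ := sl2_exists_vec D₀ hA ha
  rw [← mulForm_baseChange, ← map_add, D.isOperForm_mulForm_iff hg]
  refine D.isOperVec_of_sub_mem ?_
  have h1 := hom_baseChange_mem_F D₀ D hX₀
  rw [map_sub, hom_baseChange_y D₀ D] at h1
  convert add_mem h1 (PrincipalGrading.mem_V.1 hv.mem).1 using 1
  abel

lemma IndForm.map (D₀ : OperData sl2Triple) (D : OperData T) (φ : R →ₐ[ℂ] S) {A₀ : Om R ⊗[ℂ] sl2}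
    (hA : IsOperForm sl2Cartan sl2Root A₀)
    (hA' : IsOperForm sl2Cartan sl2Root ((omMap φ).rTensor sl2 A₀))
    {ε : CoefFamily R T} {A : Om R ⊗[ℂ] 𝔤} (h : IndForm ε A₀ A) :
    IndForm (ε.map φ) ((omMap φ).rTensor sl2 A₀) ((omMap φ).rTensor 𝔤 A) := by
  obtain ⟨a, ha⟩ := D₀.sl2_exists_coef hA
  obtain ⟨v, hv, rfl⟩ := (indForm_iff D₀ D hA ha ε A).1 h
  have ha' : (omMap φ).rTensor sl2 A₀ - omMap φ a ⊗ₜ[ℂ] sl2Triple.y ∈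
      formsIn S (filt sl2Cartan sl2Root 0) := by
    have e : (omMap φ).rTensor sl2 A₀ - omMap φ a ⊗ₜ[ℂ] sl2Triple.y =
        (omMap φ).rTensor sl2 (A₀ - a ⊗ₜ[ℂ] sl2Triple.y) := by
      rw [map_sub, LinearMap.rTensor_tmul]
    rw [D₀.mem_formsIn_iff] at ha ⊢
    intro j hj
    rw [e, ← rTensor_omMap_lTensor, ha j hj, map_zero]
  rw [indForm_iff D₀ D hA' ha']
  exact ⟨_, hv.map φ, by rw [map_add, rTensor_omMap_lTensor, rTensor_omMap_mulForm]⟩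

lemma units_pow_succ_mul_eq_one (u : Rˣ) (j : ℕ) :
    ((u : R) ^ (j + 1)) * ((u⁻¹ : Rˣ) : R) * ((u ^ (-(j : ℤ)) : Rˣ) : R) = 1 := by
  rw [zpow_neg, zpow_natCast, pow_succ, mul_assoc _ (u : R), Units.mul_inv, mul_one,
    ← Units.val_pow_eq_pow_val, Units.mul_inv]

/-- Induction of connection forms is equivariant. -/
theorem IndForm.formGauge [FiniteDimensional ℂ 𝔤] (D₀ : OperData sl2Triple) (D : OperData T)
    {A₀ A₀' : Om R ⊗[ℂ] sl2}
    (hA : IsOperForm sl2Cartan sl2Root A₀) (hA' : IsOperForm sl2Cartan sl2Root A₀')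
    {ε : CoefFamily R T} {A A' : Om R ⊗[ℂ] 𝔤} (h : IndForm ε A₀ A) (h' : IndForm ε A₀' A')
    {b₀ : (R ⊗[ℂ] sl2) ≃ₗ⁅R⁆ (R ⊗[ℂ] sl2)} (hb₀ : (D₀.G.baseChange R).IsBorel b₀)
    {b : (R ⊗[ℂ] 𝔤) ≃ₗ⁅R⁆ (R ⊗[ℂ] 𝔤)} (hb : (D.G.baseChange R).IsBorel b)
    (hbb : ∀ z : R ⊗[ℂ] sl2, b (T.hom.baseChange R z) = T.hom.baseChange R (b₀ z))
    (hg : FormGauge (lieUnit b₀).1 A₀ A₀') : FormGauge (lieUnit b).1 A A' := by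
  -- Both gauge transformations become `upTri` with the same parameters. Their connection terms are
  -- then combinations of `h` and `x` with the same coefficients and correspond under the
  -- homomorphism.
  obtain ⟨u, r, rfl⟩ := sl2_exists_upTri D₀ hb₀
  obtain rfl := eq_upTri_of_intertwines D₀ D hb hbb
  set c₀ := (D₀.G.baseChange R).upTri u r with hc₀
  set c := (D.G.baseChange R).upTri u r with hc
  obtain ⟨a, ha⟩ := D₀.sl2_exists_coef hA
  have hag := D₀.sl2_isGen hA ha
  obtain ⟨v, hv, rfl⟩ := (indForm_iff D₀ D hA ha ε A).1 h
  obtain ⟨X₀, rfl, hX₀⟩ := sl2_exists_vec D₀ hA ha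
  obtain ⟨X₀', rfl⟩ := hag.mulForm_bijective.2 A₀'
  have h2 : (2 : R) * (algebraMap ℂ R (1 / 2) * ((u⁻¹ : Rˣ) * hag.der u)) =
      (u⁻¹ : Rˣ) * hag.der u := by
    rw [← mul_assoc, ← map_ofNat (algebraMap ℂ R) 2, ← map_mul]
    norm_num
  have hconn₀ := PrincipalGrading.upTri_conn (D₀.isDer hag.der) u r h2
  have hconn := PrincipalGrading.upTri_conn (D.isDer hag.der) u r h2
  rw [formGauge_mulForm_iff hag, PrincipalGrading.gauge_iff hconn₀ (D₀.G.baseChange R), ← hc₀] at hg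
  set Z₀ := (algebraMap ℂ R (1 / 2) * ((u⁻¹ : Rˣ) * hag.der u)) • (D₀.G.baseChange R).h +
    (2 * r * (algebraMap ℂ R (1 / 2) * ((u⁻¹ : Rˣ) * hag.der u)) + hag.der r) •
      (D₀.G.baseChange R).x with hZ₀
  have hZF : Z₀ ∈ (D₀.G.baseChange R).F 0 :=
    add_mem (Submodule.smul_mem _ _ PrincipalGrading.h_mem)
      (Submodule.smul_mem _ _ (PrincipalGrading.F_mono (by norm_num) PrincipalGrading.x_mem))
  have hX₀' : X₀' = c₀.symm X₀ + Z₀ := by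
    rw [← LieEquiv.symm_apply_apply c₀ X₀', hg, map_add, LieEquiv.symm_apply_apply]
  -- The gauge transformation multiplies the coefficient of `y` by `u`, so `V`-valued functions for
  -- the new section are read with respect to `u a`.
  have ha' : mulForm a X₀' - ((u : R) • a) ⊗ₜ[ℂ] sl2Triple.y ∈
      formsIn R (filt sl2Cartan sl2Root 0) := by
    rw [D₀.sl2_mem_iff hag, hX₀']
    have e1 := hb₀.symm_upper.mem 0 _ hX₀
    rw [map_sub, hc₀, PrincipalGrading.upTri_symm_y, ← hc₀] at e1
    have e2 : (u : R) • (r • (D₀.G.baseChange R).h + (r * r) • (D₀.G.baseChange R).x) ∈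
        (D₀.G.baseChange R).F 0 :=
      Submodule.smul_mem _ _ (add_mem (Submodule.smul_mem _ _ PrincipalGrading.h_mem)
        (Submodule.smul_mem _ _ (PrincipalGrading.F_mono (by norm_num) PrincipalGrading.x_mem)))
    convert sub_mem (add_mem e1 hZF) e2 using 1
    module
  obtain ⟨v', hv', rfl⟩ := (indForm_iff D₀ D hA' ha' ε A').1 h'
  -- Passing from `a` to `u a` divides the coefficient in degree `j` by `u ^ (j + 1)`: the torus in
  -- `c⁻¹` accounts for `u ^ j`, the scalar for the remaining factor.
  have hv'' : v' = ((u⁻¹ : Rˣ) : R) • c.symm v := by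
    refine OperData.HasCoeffs.unique D (hag.smul_unit u) hv' (hv.change u ?_ fun j => ?_)
    · exact Submodule.smul_mem _ _ (PrincipalGrading.upTri_symm_mem_V u r hv.mem)
    · rw [map_smul, hc, PrincipalGrading.pr_upTri_symm_of_mem_V u r hv.mem, smul_smul, smul_smul,
        units_pow_succ_mul_eq_one, one_smul]
  rw [smul_mulForm, hv'', smul_smul, Units.mul_inv, one_smul, ← mulForm_baseChange,
    ← mulForm_baseChange, ← map_add, ← map_add, formGauge_mulForm_iff hag,
    PrincipalGrading.gauge_iff hconn (D.G.baseChange R), ← hc, map_add, LieEquiv.apply_symm_apply]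
  have e3 : T.hom.baseChange R Z₀ = (algebraMap ℂ R (1 / 2) * ((u⁻¹ : Rˣ) * hag.der u)) •
      (D.G.baseChange R).h + (2 * r * (algebraMap ℂ R (1 / 2) * ((u⁻¹ : Rˣ) * hag.der u)) +
        hag.der r) • (D.G.baseChange R).x := by
    rw [hZ₀, map_add, map_smul, map_smul, hom_baseChange_h D₀ D, hom_baseChange_x D₀ D]
  rw [← e3, hbb, hbb, hg, map_add]
  abel

/-- Shifting `A₀` along `x` does not change its coefficient at `y`, hence not the trivialization of
`Ω`; and `sl(2) → 𝔤` takes `x` to `x`. The shift therefore just adds to the `V`-part. -/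
lemma IndForm.comp (D₀ : OperData sl2Triple) (D : OperData T) {A₀ A₀' : Om R ⊗[ℂ] sl2}
    (hA : IsOperForm sl2Cartan sl2Root A₀) {w : ⨂[R]^2 (Om R)} {ε : CoefFamily R T}
    {A : Om R ⊗[ℂ] 𝔤} (h : IndForm (CoefFamily.single sl2Triple w) A₀ A₀') (h' : IndForm ε A₀' A) :
    IndForm (CoefFamily.single T w + ε) A₀ A := by
  have hA' := h.isOperForm D₀ D₀ hA
  obtain ⟨a, ha⟩ := D₀.sl2_exists_coef hA
  have hag := D₀.sl2_isGen hA ha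
  obtain ⟨f, rfl⟩ := (hag.powGen_bijective 2).2 w
  obtain ⟨v₀, hv₀, rfl⟩ := (indForm_iff D₀ D₀ hA ha _ _).1 h
  obtain rfl := OperData.HasCoeffs.unique D₀ hag hv₀ (D₀.hasCoeffs_single a f)
  rw [sl2Triple_hom, LinearMap.lTensor_id, LinearMap.id_apply] at h' hA'
  have ha' : A₀ + mulForm a (f • (D₀.G.baseChange R).x) - a ⊗ₜ[ℂ] sl2Triple.y ∈
      formsIn R (filt sl2Cartan sl2Root 0) := by
    rw [add_sub_right_comm]
    refine add_mem ha ?_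
    rw [D₀.mulForm_mem_formsIn_iff hag]
    exact Submodule.smul_mem _ _ (PrincipalGrading.F_mono (by norm_num) PrincipalGrading.x_mem)
  obtain ⟨v, hv, rfl⟩ := (indForm_iff D₀ D hA' ha' _ _).1 h'
  rw [indForm_iff D₀ D hA ha]
  refine ⟨_, (D.hasCoeffs_single a f).add hv, ?_⟩
  rw [map_add, ← mulForm_baseChange, map_smul, hom_baseChange_x D₀ D, map_add]
  abel

end Induced

/-! ### Étale restriction maps and complex points of smooth algebras. -/

section Etale

variable {R S : Type} [CommRing R] [Algebra ℂ R] [CommRing S] [Algebra ℂ S] {φ : R →ₐ[ℂ] S}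

/-- For an étale map, `Ω_S` is the base change of `Ω_R` and so is spanned over `S` by its image. -/
lemma omMap_induction (hφ : φ.toRingHom.Etale) {P : Om S → Prop} (hz : P 0)
    (hadd : ∀ a b, P a → P b → P (a + b)) (hmap : ∀ (s : S) ω, P (s • omMap φ ω)) (ω : Om S) : P ω := by
  algebraize [φ.toRingHom]
  haveI : IsScalarTower ℂ R S := IsScalarTower.of_algebraMap_eq fun c => (φ.commutes c).symm
  have hb := KaehlerDifferential.isBaseChange_of_formallyEtale ℂ R S
  obtain ⟨t, rfl⟩ := hb.equiv.surjective ω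
  induction t with
  | zero => simpa using hz
  | add a b ha hb => rw [map_add]; exact hadd _ _ ha hb
  | tmul s ω => rw [hb.equiv_tmul]; exact hmap s ω

lemma exists_extend_dual (hφ : φ.toRingHom.Etale) (ξ : Om R →ₗ[R] R) :
    ∃ ξ' : Om S →ₗ[S] S, ∀ ω, ξ' (omMap φ ω) = φ (ξ ω) := by
  algebraize [φ.toRingHom]
  haveI : IsScalarTower ℂ R S := IsScalarTower.of_algebraMap_eq fun c => (φ.commutes c).symm
  have hb := KaehlerDifferential.isBaseChange_of_formallyEtale ℂ R S
  exact ⟨hb.lift (Algebra.linearMap R S ∘ₗ ξ), fun ω => hb.lift_eq _ ω⟩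

lemma IsGen.map (hφ : φ.toRingHom.Etale) {a : Om R} (ha : IsGen a) : IsGen (omMap φ a) := by
  let e : R ≃ₗ[R] Om R := LinearEquiv.ofBijective (LinearMap.toSpanSingleton R (Om R) a) ha
  have he : ∀ f : R, e.symm (f • a) = f := fun f => e.symm_apply_apply f
  obtain ⟨ξ, hξ⟩ := exists_extend_dual hφ e.symm.toLinearMap
  have h1 : ξ (omMap φ a) = 1 := by
    rw [hξ]
    have := he 1
    rw [one_smul] at this
    rw [LinearEquiv.coe_coe, this, map_one]
  constructor
  · intro s s' h
    have := congrArg ξ h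
    simpa [h1] using this
  · intro ω
    induction ω using omMap_induction hφ with
    | hz => exact ⟨0, by simp⟩
    | hadd x y hx hy =>
      obtain ⟨s, rfl⟩ := hx
      obtain ⟨s', rfl⟩ := hy
      exact ⟨s + s', add_smul _ _ _⟩
    | hmap s ω =>
      obtain ⟨f, rfl⟩ := ha.2 ω
      exact ⟨s * φ f, by simp only [omMap_smul, mul_smul]⟩

end Etale

section Points

variable {S : Type} [CommRing S] [Algebra ℂ S]

lemma coeff_one_of_isIntegral {p : Polynomial ℂ} (hp : IsIntegral ℂ p) : p.coeff 1 = 0 := by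
  obtain ⟨c, hc⟩ := (IsAlgClosed.algebraMap_bijective_of_isIntegral (k := ℂ)
    (K := integralClosure ℂ (Polynomial ℂ))).2 ⟨p, hp⟩
  have : p = Polynomial.C c := (congrArg Subtype.val hc).symm
  simp [this, Polynomial.coeff_C]

/-- For nilpotent `r`, the element `r ⊗ X` of `S ⊗ ℂ[X]` is nilpotent, hence integral over `S`.
Integral closure commutes with smooth base change and the integral closure of `ℂ` in `ℂ[X]` consists
of constants, so the coefficient `r` of `X` vanishes. -/
lemma isReduced_of_smooth [Algebra.Smooth ℂ S] : IsReduced S := by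
  refine ⟨fun r hr => ?_⟩
  have hn : IsNilpotent (r ⊗ₜ[ℂ] (Polynomial.X : Polynomial ℂ)) := by
    obtain ⟨n, hn⟩ := hr
    exact ⟨n, by rw [Algebra.TensorProduct.tmul_pow, hn, TensorProduct.zero_tmul]⟩
  have hint : IsIntegral S (r ⊗ₜ[ℂ] (Polynomial.X : Polynomial ℂ)) := by
    obtain ⟨n, hn⟩ := hn
    refine ⟨Polynomial.X ^ n, Polynomial.monic_X_pow n, by simp [hn]⟩
  obtain ⟨t, ht⟩ := (TensorProduct.toIntegralClosure_bijective_of_smooth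
    (R := ℂ) (S := S) (B := Polynomial ℂ)).2 ⟨_, hint⟩
  have ht' : (r ⊗ₜ[ℂ] (Polynomial.X : Polynomial ℂ)) =
      ((integralClosure ℂ (Polynomial ℂ)).val.toLinearMap).lTensor S t := by
    have := congrArg Subtype.val ht
    refine this.symm.trans ?_
    clear this ht
    induction t with
    | zero => simp
    | add a b ha hb => simpa [map_add] using congrArg₂ (· + ·) ha hb
    | tmul s p => rfl
  have h1 := congrArg ((Polynomial.lcoeff ℂ 1).lTensor S) ht'
  rw [← LinearMap.comp_apply, ← LinearMap.lTensor_comp] at h1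
  have h0 : Polynomial.lcoeff ℂ 1 ∘ₗ (integralClosure ℂ (Polynomial ℂ)).val.toLinearMap = 0 := by
    ext p
    exact coeff_one_of_isIntegral p.2
  rw [h0, LinearMap.lTensor_zero, LinearMap.zero_apply, LinearMap.lTensor_tmul] at h1
  have h2 := congrArg (TensorProduct.rid ℂ S) h1
  simpa using h2

/-- The Nullstellensatz: residue fields at maximal ideals are `ℂ`, so a function vanishing at all
points is in the Jacobson radical, which is zero for a reduced Jacobson ring. -/
lemma separatedByPoints_of_smooth [Algebra.Smooth ℂ S] : SeparatedByPoints S := by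
  intro r hr
  haveI := isReduced_of_smooth (S := S)
  haveI : IsJacobsonRing S := isJacobsonRing_of_finiteType (A := ℂ)
  have : r ∈ (⊥ : Ideal S).jacobson := by
    refine Ideal.mem_sInf.2 fun {M} hM => ?_
    haveI : M.IsMaximal := hM.2
    letI : Field (S ⧸ M) := Ideal.Quotient.field M
    haveI : Algebra.FiniteType ℂ (S ⧸ M) := inferInstance
    haveI : Module.Finite ℂ (S ⧸ M) := finite_of_finite_type_of_isJacobsonRing ℂ (S ⧸ M)
    let e : ℂ ≃ₐ[ℂ] (S ⧸ M) := AlgEquiv.ofBijective (Algebra.ofId ℂ (S ⧸ M))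
      (IsAlgClosed.algebraMap_bijective_of_isIntegral (k := ℂ) (K := S ⧸ M))
    have h := hr (e.symm.toAlgHom.comp (Ideal.Quotient.mkₐ ℂ M))
    exact Ideal.Quotient.eq_zero_iff_mem.1 (e.symm.injective (h.trans (map_zero _).symm))
  rw [(isJacobsonRing_iff.1 ‹_›) ⊥ (by
    intro x hx
    obtain ⟨n, hn⟩ := hx
    exact Ideal.mem_bot.2 (IsReduced.eq_zero x ⟨n, hn⟩))] at this
  exact this

end Points

/-! ### Gluing over affine opens: functions, differentials, their tensor powers. -/

section Restriction

variable {Y : Scheme.{0}} {π : Y ⟶ Spec (.of ℂ)}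

@[simp] lemma res_refl (U : Y.Opens) : res π (le_refl U) = AlgHom.id ℂ (Reg π U) := by
  ext f
  exact congrArg (fun k => k.hom f) (Y.presheaf.map_id (op U))

lemma res_res {U V W : Y.Opens} (i : V ≤ U) (j : W ≤ V) (f : Reg π U) :
    res π j (res π i f) = res π (j.trans i) f :=
  congrArg (fun k => k.hom f) (Y.presheaf.map_comp (homOfLE i).op (homOfLE j).op).symm

lemma res_comp {U V W : Y.Opens} (i : V ≤ U) (j : W ≤ V) :
    (res π j).comp (res π i) = res π (j.trans i) := AlgHom.ext fun f => res_res i j f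

/-- Restriction between affine opens is the ring map attached to the identity of `Y`, which is
étale. -/
lemma etale_res {U V : Y.affineOpens} (i : V.1 ≤ U.1) : (res π i).toRingHom.Etale := by
  have h := HasRingHomProperty.appLE @AlgebraicGeometry.Etale (𝟙 Y) inferInstance U V i
  have e : (𝟙 Y : Y ⟶ Y).appLE U.1 V.1 i = Y.presheaf.map (homOfLE i).op := by
    simp only [Scheme.Hom.appLE, Scheme.Hom.id_app]
    exact Category.id_comp _
  rw [e] at h
  exact h

lemma smooth_reg [SmoothOfRelativeDimension 1 π] (U : Y.affineOpens) : Algebra.Smooth ℂ (Reg π U) := by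
  haveI := SmoothOfRelativeDimension.smooth 1 π
  have h := HasRingHomProperty.appLE @AlgebraicGeometry.Smooth π inferInstance ⟨⊤, isAffineOpen_top _⟩ U le_top
  have h' := RingHom.Smooth.respectsIso.2 _ (Scheme.ΓSpecIso (.of ℂ)).symm.commRingCatIsoToRingEquiv h
  exact h'

lemma exists_affine_le {U : Y.Opens} {p : Y} (hp : p ∈ U) : ∃ W : Y.affineOpens, p ∈ W.1 ∧ W.1 ≤ U := by
  obtain ⟨_, ⟨W, hW, rfl⟩, h1, h2⟩ := Y.isBasis_affineOpens.exists_subset_of_mem_open hp U.2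
  exact ⟨⟨W, hW⟩, h1, h2⟩

lemma omMap_id {R : Type} [CommRing R] [Algebra ℂ R] (ω : Om R) : omMap (AlgHom.id ℂ R) ω = ω := by
  have h : Submodule.span R (Set.range (KaehlerDifferential.D ℂ R)) = ⊤ :=
    KaehlerDifferential.span_range_derivation ℂ R
  have hω : ω ∈ Submodule.span R (Set.range (KaehlerDifferential.D ℂ R)) := h ▸ Submodule.mem_top
  induction hω using Submodule.span_induction with
  | mem x hx =>
    obtain ⟨r, rfl⟩ := hx
    rw [omMap_D]
    rfl
  | zero => simp
  | add x y _ _ hx hy => rw [map_add, hx, hy]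
  | smul r x _ hx => rw [omMap_smul, hx]; rfl

lemma omMap_comp {R S S' : Type} [CommRing R] [Algebra ℂ R] [CommRing S] [Algebra ℂ S] [CommRing S']
    [Algebra ℂ S'] (φ : R →ₐ[ℂ] S) (ψ : S →ₐ[ℂ] S') (ω : Om R) :
    omMap ψ (omMap φ ω) = omMap (ψ.comp φ) ω := by
  have hω : ω ∈ Submodule.span R (Set.range (KaehlerDifferential.D ℂ R)) :=
    KaehlerDifferential.span_range_derivation ℂ R ▸ Submodule.mem_top
  induction hω using Submodule.span_induction with
  | mem x hx =>
    obtain ⟨r, rfl⟩ := hx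
    simp only [omMap_D]
    rfl
  | zero => simp
  | add x y _ _ hx hy => simp only [map_add, hx, hy]
  | smul r x _ hx => simp only [omMap_smul, hx]; rfl

lemma omPowMap_comp {R S S' : Type} [CommRing R] [Algebra ℂ R] [CommRing S] [Algebra ℂ S] [CommRing S']
    [Algebra ℂ S'] (φ : R →ₐ[ℂ] S) (ψ : S →ₐ[ℂ] S') (k : ℕ) (ω : ⨂[R]^k (Om R)) :
    omPowMap ψ k (omPowMap φ k ω) = omPowMap (ψ.comp φ) k ω := by
  induction ω using PiTensorProduct.induction_on with
  | smul_tprod r w =>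
    simp only [omPowMap_smul, omPowMap_tprod, omMap_comp]
    rfl
  | add x y hx hy => simp only [map_add, hx, hy]

/-- A family of affine opens of `U` that covers `U` and contains with each of its members all smaller
affine opens. -/
structure IsAffineSieve (U : Y.Opens) (S : Set Y.affineOpens) : Prop where
  le : ∀ W ∈ S, W.1 ≤ U
  down : ∀ W ∈ S, ∀ W' : Y.affineOpens, W'.1 ≤ W.1 → W' ∈ S
  cover : ∀ p ∈ U, ∃ W ∈ S, p ∈ W.1

lemma IsAffineSieve.of_locally {U : Y.Opens} {C : Y.affineOpens → Prop}
    (hdown : ∀ W W' : Y.affineOpens, W'.1 ≤ W.1 → W.1 ≤ U → C W → C W')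
    (h : ∀ p ∈ U, ∃ W : Y.affineOpens, p ∈ W.1 ∧ W.1 ≤ U ∧ C W) :
    IsAffineSieve U {W | W.1 ≤ U ∧ C W} where
  le _ hW := hW.1
  down W hW W' i := ⟨i.trans hW.1, hdown W W' i hW.1 hW.2⟩
  cover p hp := by
    obtain ⟨W, h1, h2, h3⟩ := h p hp
    exact ⟨W, ⟨h2, h3⟩, h1⟩

lemma isAffineSieve_all (U : Y.Opens) : IsAffineSieve U {W | W.1 ≤ U} where
  le _ hW := hW
  down _ hW _ i := i.trans hW
  cover p hp := by
    obtain ⟨W, h1, h2⟩ := exists_affine_le hp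
    exact ⟨W, h2, h1⟩

lemma IsAffineSieve.inter {U : Y.Opens} {S S' : Set Y.affineOpens} (h : IsAffineSieve U S)
    (h' : IsAffineSieve U S') : IsAffineSieve U (S ∩ S') where
  le _ hW := h.le _ hW.1
  down W hW W' i := ⟨h.down W hW.1 W' i, h'.down W hW.2 W' i⟩
  cover p hp := by
    obtain ⟨W, hW, h1⟩ := h.cover p hp
    obtain ⟨W', hW', h2⟩ := h'.cover p hp
    obtain ⟨W'', h3, h4⟩ := exists_affine_le (U := W.1 ⊓ W'.1) ⟨h1, h2⟩
    exact ⟨W'', ⟨h.down W hW W'' (h4.trans inf_le_left), h'.down W' hW' W'' (h4.trans inf_le_right)⟩, h3⟩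

lemma IsAffineSieve.restrict {U V : Y.Opens} {S : Set Y.affineOpens} (h : IsAffineSieve U S)
    (i : V ≤ U) : IsAffineSieve V {W | W.1 ≤ V ∧ W ∈ S} where
  le _ hW := hW.1
  down W hW W' j := ⟨j.trans hW.1, h.down W hW.2 W' j⟩
  cover p hp := by
    obtain ⟨W, hW, h1⟩ := h.cover p (i hp)
    obtain ⟨W', h2, h3⟩ := exists_affine_le (U := W.1 ⊓ V) ⟨h1, hp⟩
    exact ⟨W', ⟨h3.trans inf_le_right, h.down W hW W' (h3.trans inf_le_left)⟩, h2⟩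

section Sheaf

variable (F : TopCat.Sheaf Type Y.toTopCat) {U : Y.Opens} {S : Set Y.affineOpens}

lemma IsAffineSieve.sheaf_ext (hS : IsAffineSieve U S) {s t : F.presheaf.obj (op U)}
    (h : ∀ W (hW : W ∈ S), F.presheaf.map (homOfLE (hS.le W hW)).op s =
      F.presheaf.map (homOfLE (hS.le W hW)).op t) : s = t := by
  refine TopCat.Sheaf.eq_of_locally_eq' F (fun W : S => W.1.1) U (fun W => homOfLE (hS.le W.1 W.2)) ?_ s t
    fun W => h W.1 W.2
  intro p hp
  obtain ⟨W, hW, h1⟩ := hS.cover p hp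
  exact Opens.mem_iSup.2 ⟨⟨W, hW⟩, h1⟩

lemma IsAffineSieve.sheaf_glue (hS : IsAffineSieve U S)
    (t : ∀ W ∈ S, F.presheaf.obj (op W.1))
    (ht : ∀ W (hW : W ∈ S) (W' : Y.affineOpens) (i : W'.1 ≤ W.1),
      F.presheaf.map (homOfLE i).op (t W hW) = t W' (hS.down W hW W' i)) :
    ∃ s : F.presheaf.obj (op U), ∀ W (hW : W ∈ S),
      F.presheaf.map (homOfLE (hS.le W hW)).op s = t W hW := by
  obtain ⟨s, hs, -⟩ := TopCat.Sheaf.existsUnique_gluing' F (fun W : S => W.1.1) U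
    (fun W => homOfLE (hS.le W.1 W.2)) (by
      intro p hp
      obtain ⟨W, hW, h1⟩ := hS.cover p hp
      exact Opens.mem_iSup.2 ⟨⟨W, hW⟩, h1⟩) (fun W => t W.1 W.2) (by
      intro W W'
      -- An intersection of two affine opens need not be affine, so agreement is tested on the
      -- affine opens inside it.
      refine (isAffineSieve_all (W.1.1 ⊓ W'.1.1)).sheaf_ext F fun V hV => ?_
      have h1 := ht W.1 W.2 V (le_trans hV inf_le_left)
      have h2 := ht W'.1 W'.2 V (le_trans hV inf_le_right)
      rw [← Functor.map_comp_apply, ← Functor.map_comp_apply]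
      exact h1.trans h2.symm)
  exact ⟨s, fun W hW => hs ⟨W, hW⟩⟩

end Sheaf

section Functions

variable {U : Y.Opens} {S : Set Y.affineOpens}

lemma IsAffineSieve.reg_ext (hS : IsAffineSieve U S) {f g : Reg π U}
    (h : ∀ W (hW : W ∈ S), res π (hS.le W hW) f = res π (hS.le W hW) g) : f = g :=
  hS.sheaf_ext ((sheafCompose _ (forget CommRingCat)).obj Y.sheaf) h

lemma IsAffineSieve.reg_glue (hS : IsAffineSieve U S) (t : ∀ W ∈ S, Reg π W.1)
    (ht : ∀ W (hW : W ∈ S) (W' : Y.affineOpens) (i : W'.1 ≤ W.1),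
      res π i (t W hW) = t W' (hS.down W hW W' i)) :
    ∃ f : Reg π U, ∀ W (hW : W ∈ S), res π (hS.le W hW) f = t W hW :=
  hS.sheaf_glue ((sheafCompose _ (forget CommRingCat)).obj Y.sheaf) t ht

/-- For an arbitrary open `U`, points of an affine open inside `U` give points of the ring of
functions on `U` by composition with restriction; these suffice. -/
lemma separatedByPoints_reg [SmoothOfRelativeDimension 1 π] (U : Y.Opens) :
    SeparatedByPoints (Reg π U) := by
  intro f hf
  refine (isAffineSieve_all U).reg_ext fun W hW => ?_
  haveI := smooth_reg (π := π) W
  rw [map_zero]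
  exact separatedByPoints_of_smooth _ fun p => hf (p.comp (res π hW))

end Functions

end Restriction

section TensorGlue

lemma sum_formCoef_tmul {𝔤 : Type} [LieRing 𝔤] [LieAlgebra ℂ 𝔤] {J : Type} [Fintype J]
    (e : Module.Basis J ℂ 𝔤) (M : Type) [AddCommGroup M] [Module ℂ M] (A : M ⊗[ℂ] 𝔤) :
    ∑ i, formCoef M (e.coord i) A ⊗ₜ[ℂ] e i = A := by
  induction A with
  | zero => simp
  | add a b ha hb => simp only [map_add, TensorProduct.add_tmul, Finset.sum_add_distrib, ha, hb]
  | tmul m z =>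
    conv_rhs => rw [← e.sum_repr z, TensorProduct.tmul_sum]
    refine Finset.sum_congr rfl fun i _ => ?_
    rw [formCoef_tmul, TensorProduct.smul_tmul]
    rfl

lemma tensor_ext {𝔤 : Type} [LieRing 𝔤] [LieAlgebra ℂ 𝔤] [FiniteDimensional ℂ 𝔤]
    {I N₀ : Type} {N : I → Type} [AddCommGroup N₀] [Module ℂ N₀]
    [∀ i, AddCommGroup (N i)] [∀ i, Module ℂ (N i)] (ρ : ∀ i, N₀ →ₗ[ℂ] N i)
    (hext : ∀ s : N₀, (∀ i, ρ i s = 0) → s = 0) {A : N₀ ⊗[ℂ] 𝔤}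
    (h : ∀ i, (ρ i).rTensor 𝔤 A = 0) : A = 0 := by
  refine eq_zero_of_formCoef fun ξ => hext _ fun i => ?_
  rw [← formCoef_map, h, map_zero]

/-- `𝔤` is finite-dimensional, so one glues coordinates with respect to a basis. -/
lemma tensor_glue {𝔤 : Type} [LieRing 𝔤] [LieAlgebra ℂ 𝔤] [FiniteDimensional ℂ 𝔤]
    {I N₀ : Type} {N : I → Type} [AddCommGroup N₀] [Module ℂ N₀]
    [∀ i, AddCommGroup (N i)] [∀ i, Module ℂ (N i)] (ρ : ∀ i, N₀ →ₗ[ℂ] N i)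
    {r : I → I → Prop} (τ : ∀ i j, r i j → (N i →ₗ[ℂ] N j))
    (hglue : ∀ t : ∀ i, N i, (∀ i j h, τ i j h (t i) = t j) → ∃ s, ∀ i, ρ i s = t i)
    (t : ∀ i, N i ⊗[ℂ] 𝔤) (ht : ∀ i j h, (τ i j h).rTensor 𝔤 (t i) = t j) :
    ∃ A : N₀ ⊗[ℂ] 𝔤, ∀ i, (ρ i).rTensor 𝔤 A = t i := by
  let e := Module.finBasis ℂ 𝔤
  have h : ∀ l, ∃ s, ∀ i, ρ i s = formCoef (N i) (e.coord l) (t i) := fun l =>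
    hglue _ fun i j h => by rw [← ht i j h, formCoef_map]
  choose s hs using h
  refine ⟨∑ l, s l ⊗ₜ[ℂ] e l, fun i => ?_⟩
  rw [map_sum]
  simp only [LinearMap.rTensor_tmul, hs]
  exact sum_formCoef_tmul e (N i) (t i)

end TensorGlue

section Gluing

variable {Y : Scheme.{0}} {π : Y ⟶ Spec (.of ℂ)}

section Module

variable {M : Y.affineOpens → Type} [∀ W, AddCommGroup (M W)] [∀ W, Module ℂ (M W)]
  [∀ W : Y.affineOpens, Module (Reg π W) (M W)]
  {r : ∀ V W : Y.affineOpens, W.1 ≤ V.1 → (M V →ₗ[ℂ] M W)}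
  {U : Y.affineOpens} {S : Set Y.affineOpens} {J : Type} [Fintype J] {m : J → M U}
  {ξ : ∀ W : Y.affineOpens, W.1 ≤ U.1 → J → M W → Reg π W}

/-- A finite dual basis compatible with restriction expresses sections through functions, reducing
this and the gluing below to the structure sheaf. -/
lemma IsAffineSieve.module_ext (hS : IsAffineSieve U.1 S)
    (hr : ∀ (V W : Y.affineOpens) i (f : Reg π V) (x : M V), r V W i (f • x) = res π i f • r V W i x)
    (hξ : ∀ (W : Y.affineOpens) i (V : Y.affineOpens) (j : V.1 ≤ W.1) l x, ξ V (le_trans j i) l (r W V j x) = res π j (ξ W i l x))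
    (hm : ∀ (W : Y.affineOpens) i x, ∑ l, ξ W i l x • r U W i (m l) = x)
    {x y : M U} (h : ∀ W (hW : W ∈ S), r U W (hS.le W hW) x = r U W (hS.le W hW) y) : x = y := by
  rw [← hm U le_rfl x, ← hm U le_rfl y]
  refine Finset.sum_congr rfl fun l _ => ?_
  congr 1
  refine hS.reg_ext fun W hW => ?_
  rw [← hξ U le_rfl W (hS.le W hW), h W hW, hξ]

lemma IsAffineSieve.module_glue (hS : IsAffineSieve U.1 S)
    (hr : ∀ (V W : Y.affineOpens) i (f : Reg π V) (x : M V), r V W i (f • x) = res π i f • r V W i x)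
    (hξ : ∀ (W : Y.affineOpens) i (V : Y.affineOpens) (j : V.1 ≤ W.1) l x, ξ V (le_trans j i) l (r W V j x) = res π j (ξ W i l x))
    (hm : ∀ (W : Y.affineOpens) i x, ∑ l, ξ W i l x • r U W i (m l) = x)
    (t : ∀ W ∈ S, M W)
    (ht : ∀ W (hW : W ∈ S) (W' : Y.affineOpens) (i : W'.1 ≤ W.1),
      r W W' i (t W hW) = t W' (hS.down W hW W' i)) :
    ∃ x : M U, ∀ W (hW : W ∈ S), r U W (hS.le W hW) x = t W hW := by
  have h : ∀ l, ∃ f : Reg π U, ∀ W (hW : W ∈ S),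
      res π (hS.le W hW) f = ξ W (hS.le W hW) l (t W hW) := fun l =>
    hS.reg_glue _ fun W hW W' i => by rw [← ht W hW W' i, hξ]
  choose f hf using h
  refine ⟨∑ l, f l • m l, fun W hW => ?_⟩
  rw [map_sum]
  refine Eq.trans (Finset.sum_congr rfl fun l _ => ?_) (hm W (hS.le W hW) (t W hW))
  rw [hr, hf l W hW]

end Module

variable [SmoothOfRelativeDimension 1 π]

/-- Over a smooth algebra `Ω` is finite projective and has a dual basis; since restrictions are
étale, its functionals extend to all smaller affine opens. -/
lemma exists_dualBasis (π : Y ⟶ Spec (.of ℂ)) [SmoothOfRelativeDimension 1 π] (U : Y.affineOpens) :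
    ∃ (n : ℕ) (m : Fin n → Om (Reg π U))
    (ξ : ∀ W : Y.affineOpens, W.1 ≤ U.1 → Fin n → (Om (Reg π W) →ₗ[Reg π W] Reg π W)),
    (∀ (W : Y.affineOpens) i (V : Y.affineOpens) (j : V.1 ≤ W.1) l x,
      ξ V (le_trans j i) l (omMap (res π j) x) = res π j (ξ W i l x)) ∧
    ∀ (W : Y.affineOpens) i x, ∑ l, ξ W i l x • omMap (res π i) (m l) = x := by
  haveI := smooth_reg (π := π) U
  obtain ⟨n, f, g, -, -, hfg⟩ := Module.Finite.exists_comp_eq_id_of_projective (Reg π U) (Om (Reg π U))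
  have h : ∀ (W : Y.affineOpens) (i : W.1 ≤ U.1) (l : Fin n), ∃ ξ : Om (Reg π W) →ₗ[Reg π W] Reg π W,
      ∀ x, ξ (omMap (res π i) x) = res π i (g x l) := fun W i l =>
    exists_extend_dual (etale_res i) (LinearMap.proj l ∘ₗ g)
  choose ξ hξ using h
  refine ⟨n, fun l => f (Pi.single l 1), ξ, fun W i V j l x => ?_, fun W i x => ?_⟩
  · induction x using omMap_induction (etale_res i) with
    | hz => simp
    | hadd a b ha hb => simp only [map_add, ha, hb]
    | hmap s x => rw [omMap_smul, map_smul, map_smul, omMap_comp, res_comp, hξ, hξ, smul_eq_mul,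
        smul_eq_mul, map_mul, res_res]
  · induction x using omMap_induction (etale_res i) with
    | hz => simp
    | hadd a b ha hb => simp only [map_add, add_smul, Finset.sum_add_distrib, ha, hb]
    | hmap s x =>
      simp only [map_smul, hξ, smul_assoc, ← Finset.smul_sum, ← omMap_smul, ← map_sum]
      congr 2
      conv_rhs => rw [← LinearMap.id_apply (R := Reg π U) x, ← hfg, LinearMap.comp_apply,
        pi_eq_sum_univ' (g x)]
      rw [map_sum]
      refine Finset.sum_congr rfl fun l _ => ?_
      rw [← map_smul]

section Affine

variable {U : Y.affineOpens} {S : Set Y.affineOpens}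

lemma IsAffineSieve.om_ext (hS : IsAffineSieve U.1 S) {x y : Om (Reg π U)}
    (h : ∀ W (hW : W ∈ S), omMap (res π (hS.le W hW)) x = omMap (res π (hS.le W hW)) y) : x = y := by
  obtain ⟨n, m, ξ, h1, h2⟩ := exists_dualBasis π U
  exact hS.module_ext (M := fun W => Om (Reg π W)) (r := fun V W i => omMap (res π i))
    (ξ := fun W i l x => ξ W i l x) (fun V W i f x => omMap_smul _ _ _) h1 h2 h

lemma IsAffineSieve.om_glue (hS : IsAffineSieve U.1 S) (t : ∀ W ∈ S, Om (Reg π W))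
    (ht : ∀ W (hW : W ∈ S) (W' : Y.affineOpens) (i : W'.1 ≤ W.1),
      omMap (res π i) (t W hW) = t W' (hS.down W hW W' i)) :
    ∃ x : Om (Reg π U), ∀ W (hW : W ∈ S), omMap (res π (hS.le W hW)) x = t W hW := by
  obtain ⟨n, m, ξ, h1, h2⟩ := exists_dualBasis π U
  exact hS.module_glue (M := fun W => Om (Reg π W)) (r := fun V W i => omMap (res π i))
    (ξ := fun W i l x => ξ W i l x) (fun V W i f x => omMap_smul _ _ _) h1 h2 t ht

/-- The product of functionals on the tensor power. -/
def dualPow {R : Type} [CommRing R] [Algebra ℂ R] {k : ℕ} (ξ : Fin k → Om R →ₗ[R] R) :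
    (⨂[R]^k (Om R)) →ₗ[R] R :=
  PiTensorProduct.lift ((MultilinearMap.mkPiAlgebra R (Fin k) R).compLinearMap ξ)

lemma dualPow_tprod {R : Type} [CommRing R] [Algebra ℂ R] {k : ℕ} (ξ : Fin k → Om R →ₗ[R] R)
    (w : Fin k → Om R) : dualPow ξ (PiTensorProduct.tprod R w) = ∏ i, ξ i (w i) := by
  simp [dualPow]

lemma exists_dualBasis_pow (π : Y ⟶ Spec (.of ℂ)) [SmoothOfRelativeDimension 1 π] (U : Y.affineOpens)
    (k : ℕ) : ∃ (J : Type) (_ : Fintype J) (m : J → ⨂[Reg π U]^k (Om (Reg π U)))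
    (ξ : ∀ W : Y.affineOpens, W.1 ≤ U.1 → J → (⨂[Reg π W]^k (Om (Reg π W)) →ₗ[Reg π W] Reg π W)),
    (∀ (W : Y.affineOpens) i (V : Y.affineOpens) (j : V.1 ≤ W.1) l x,
      ξ V (le_trans j i) l (omPowMap (res π j) k x) = res π j (ξ W i l x)) ∧
    ∀ (W : Y.affineOpens) i x, ∑ l, ξ W i l x • omPowMap (res π i) k (m l) = x := by
  obtain ⟨n, m, ξ, h1, h2⟩ := exists_dualBasis π U
  refine ⟨Fin k → Fin n, inferInstance, fun c => PiTensorProduct.tprod _ fun i => m (c i),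
    fun W i c => dualPow fun l => ξ W i (c l), fun W i V j c x => ?_, fun W i x => ?_⟩
  · induction x using PiTensorProduct.induction_on with
    | smul_tprod f w => simp only [omPowMap_smul, map_smul, omPowMap_tprod, dualPow_tprod, h1 W i,
        smul_eq_mul, map_mul, map_prod]
    | add a b ha hb => simp only [map_add, ha, hb]
  · induction x using PiTensorProduct.induction_on with
    | smul_tprod f w =>
      simp only [map_smul, smul_assoc, ← Finset.smul_sum, dualPow_tprod, omPowMap_tprod]
      congr 1
      conv_rhs => rw [show w = fun q => ∑ l, ξ W i l (w q) • omMap (res π i) (m l) from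
        funext fun q => (h2 W i (w q)).symm]
      rw [MultilinearMap.map_sum]
      refine Finset.sum_congr rfl fun c _ => ?_
      rw [MultilinearMap.map_smul_univ]
    | add a b ha hb => simp only [map_add, add_smul, Finset.sum_add_distrib, ha, hb]

lemma IsAffineSieve.omPow_ext (hS : IsAffineSieve U.1 S) {k : ℕ} {x y : ⨂[Reg π U]^k (Om (Reg π U))}
    (h : ∀ W (hW : W ∈ S), omPowMap (res π (hS.le W hW)) k x = omPowMap (res π (hS.le W hW)) k y) :
    x = y := by
  obtain ⟨J, _, m, ξ, h1, h2⟩ := exists_dualBasis_pow π U k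
  exact hS.module_ext (M := fun W => ⨂[Reg π W]^k (Om (Reg π W))) (r := fun V W i => omPowMap (res π i) k)
    (ξ := fun W i l x => ξ W i l x) (fun V W i f x => omPowMap_smul _ _ _ _) h1 h2 h

lemma IsAffineSieve.omPow_glue (hS : IsAffineSieve U.1 S) {k : ℕ}
    (t : ∀ W ∈ S, ⨂[Reg π W]^k (Om (Reg π W)))
    (ht : ∀ W (hW : W ∈ S) (W' : Y.affineOpens) (i : W'.1 ≤ W.1),
      omPowMap (res π i) k (t W hW) = t W' (hS.down W hW W' i)) :
    ∃ x : ⨂[Reg π U]^k (Om (Reg π U)), ∀ W (hW : W ∈ S), omPowMap (res π (hS.le W hW)) k x = t W hW := by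
  obtain ⟨J, _, m, ξ, h1, h2⟩ := exists_dualBasis_pow π U k
  exact hS.module_glue (M := fun W => ⨂[Reg π W]^k (Om (Reg π W))) (r := fun V W i => omPowMap (res π i) k)
    (ξ := fun W i l x => ξ W i l x) (fun V W i f x => omPowMap_smul _ _ _ _) h1 h2 t ht

lemma IsAffineSieve.isGen (hS : IsAffineSieve U.1 S) {a : Om (Reg π U)}
    (h : ∀ W (hW : W ∈ S), IsGen (omMap (res π (hS.le W hW)) a)) : IsGen a := by
  constructor
  · intro f g hfg
    refine hS.reg_ext fun W hW => (h W hW).1 ?_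
    simpa only [omMap_smul] using congrArg (omMap (res π (hS.le W hW))) hfg
  · intro ω
    choose f hf using fun W (hW : W ∈ S) => (h W hW).2 (omMap (res π (hS.le W hW)) ω)
    obtain ⟨g, hg⟩ := hS.reg_glue f fun W hW W' i => (h W' (hS.down W hW W' i)).1 (by
      have := congrArg (omMap (res π i)) (hf W hW)
      simp only [omMap_smul, omMap_comp, res_comp] at this
      simp only [hf, this])
    refine ⟨g, hS.om_ext fun W hW => ?_⟩
    simp only [omMap_smul]
    rw [hg W hW]
    exact hf W hW

end Affine

section Forms

variable {𝔤 : Type} [LieRing 𝔤] [LieAlgebra ℂ 𝔤] [FiniteDimensional ℂ 𝔤] {S : Set Y.affineOpens}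

lemma IsAffineSieve.vec_ext (π : Y ⟶ Spec (.of ℂ)) {U : Y.Opens} (hS : IsAffineSieve U S) {t t' : Reg π U ⊗[ℂ] 𝔤}
    (h : ∀ W (hW : W ∈ S), (res π (hS.le W hW)).toLinearMap.rTensor 𝔤 t =
      (res π (hS.le W hW)).toLinearMap.rTensor 𝔤 t') : t = t' := by
  rw [← sub_eq_zero]
  refine tensor_ext (fun W : S => (res π (hS.le W.1 W.2)).toLinearMap) (fun s hs => ?_) fun W => ?_
  · refine hS.reg_ext fun W hW => ?_
    rw [map_zero]
    exact hs ⟨W, hW⟩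
  · rw [map_sub, h W.1 W.2, sub_self]

lemma IsAffineSieve.vec_glue (π : Y ⟶ Spec (.of ℂ)) {U : Y.Opens} (hS : IsAffineSieve U S)
    (t : ∀ W ∈ S, Reg π W ⊗[ℂ] 𝔤)
    (ht : ∀ W (hW : W ∈ S) (W' : Y.affineOpens) (i : W'.1 ≤ W.1),
      (res π i).toLinearMap.rTensor 𝔤 (t W hW) = t W' (hS.down W hW W' i)) :
    ∃ x : Reg π U ⊗[ℂ] 𝔤, ∀ W (hW : W ∈ S), (res π (hS.le W hW)).toLinearMap.rTensor 𝔤 x = t W hW := by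
  obtain ⟨x, hx⟩ := tensor_glue (N := fun W : S => Reg π W.1)
    (fun W : S => (res π (hS.le W.1 W.2)).toLinearMap)
    (r := fun W W' => W'.1.1 ≤ W.1.1) (fun W W' i => (res π i).toLinearMap)
    (fun t ht => by
      obtain ⟨s, hs⟩ := hS.reg_glue (fun W hW => t ⟨W, hW⟩) fun W hW W' i =>
        ht ⟨W, hW⟩ ⟨W', hS.down W hW W' i⟩ i
      exact ⟨s, fun W => hs W.1 W.2⟩) (fun W => t W.1 W.2) (fun W W' i => ht W.1 W.2 W'.1 i)
  exact ⟨x, fun W hW => hx ⟨W, hW⟩⟩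

variable {U : Y.affineOpens}

lemma IsAffineSieve.form_ext (hS : IsAffineSieve U.1 S) {t t' : Om (Reg π U) ⊗[ℂ] 𝔤}
    (h : ∀ W (hW : W ∈ S), (omMap (res π (hS.le W hW))).rTensor 𝔤 t =
      (omMap (res π (hS.le W hW))).rTensor 𝔤 t') : t = t' := by
  rw [← sub_eq_zero]
  refine tensor_ext (fun W : S => omMap (res π (hS.le W.1 W.2))) (fun s hs => ?_) fun W => ?_
  · refine hS.om_ext fun W hW => ?_
    rw [map_zero]
    exact hs ⟨W, hW⟩
  · rw [map_sub, h W.1 W.2, sub_self]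

lemma IsAffineSieve.form_glue (hS : IsAffineSieve U.1 S) (t : ∀ W ∈ S, Om (Reg π W) ⊗[ℂ] 𝔤)
    (ht : ∀ W (hW : W ∈ S) (W' : Y.affineOpens) (i : W'.1 ≤ W.1),
      (omMap (res π i)).rTensor 𝔤 (t W hW) = t W' (hS.down W hW W' i)) :
    ∃ x : Om (Reg π U) ⊗[ℂ] 𝔤, ∀ W (hW : W ∈ S),
      (omMap (res π (hS.le W hW))).rTensor 𝔤 x = t W hW := by
  obtain ⟨x, hx⟩ := tensor_glue (N := fun W : S => Om (Reg π W.1))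
    (fun W : S => omMap (res π (hS.le W.1 W.2)))
    (r := fun W W' => W'.1.1 ≤ W.1.1) (fun W W' i => omMap (res π i))
    (fun t ht => by
      obtain ⟨s, hs⟩ := hS.om_glue (fun W hW => t ⟨W, hW⟩) fun W hW W' i =>
        ht ⟨W, hW⟩ ⟨W', hS.down W hW W' i⟩ i
      exact ⟨s, fun W => hs W.1 W.2⟩) (fun W => t W.1 W.2) (fun W W' i => ht W.1 W.2 W'.1 i)
  exact ⟨x, fun W hW => hx ⟨W, hW⟩⟩

end Forms

end Gluing

/-! ### The sheaf of functions with values in the Borel group. -/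

section EndMap

variable {R S S' : Type} [CommRing R] [Algebra ℂ R] [CommRing S] [Algebra ℂ S] [CommRing S'] [Algebra ℂ S']
variable {𝔤 : Type} [LieRing 𝔤] [LieAlgebra ℂ 𝔤] {H : LieSubalgebra ℂ 𝔤}
  {ι : Type} [Fintype ι] {α : ι → Module.Dual ℂ H} {T : PrincipalTriple H α}

lemma endMap_rTensor (φ : R →ₐ[ℂ] S) (b : Module.End R (R ⊗[ℂ] 𝔤)) (t : R ⊗[ℂ] 𝔤) :
    endMap 𝔤 φ b (φ.toLinearMap.rTensor 𝔤 t) = φ.toLinearMap.rTensor 𝔤 (b t) :=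
  endMapFun_rTensor 𝔤 φ b t

lemma rTensor_omMap_comp (φ : R →ₐ[ℂ] S) (ψ : S →ₐ[ℂ] S') (A : Om R ⊗[ℂ] 𝔤) :
    (omMap ψ).rTensor 𝔤 ((omMap φ).rTensor 𝔤 A) = (omMap (ψ.comp φ)).rTensor 𝔤 A := by
  induction A with
  | zero => simp
  | add s t hs ht => simp only [map_add, hs, ht]
  | tmul ω z => simp [omMap_comp]

lemma rTensor_omMap_id (A : Om R ⊗[ℂ] 𝔤) : (omMap (AlgHom.id ℂ R)).rTensor 𝔤 A = A := by
  induction A with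
  | zero => simp
  | add s t hs ht => simp only [map_add, hs, ht]
  | tmul ω z => simp [omMap_id]

lemma end_ext {b c : Module.End S (S ⊗[ℂ] 𝔤)} (φ : R →ₐ[ℂ] S)
    (h : ∀ t : R ⊗[ℂ] 𝔤, b (φ.toLinearMap.rTensor 𝔤 t) = c (φ.toLinearMap.rTensor 𝔤 t)) : b = c := by
  ext z
  simpa using h (1 ⊗ₜ z)

lemma borelMap_apply (φ : R →ₐ[ℂ] S) (b : borelPts R H α) :
    ((borelMap H α φ b).1 : Module.End S (S ⊗[ℂ] 𝔤)) = endMap 𝔤 φ b.1.1 := rfl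

lemma borelPts_ext {b c : borelPts R H α}
    (h : ∀ t, (b.1 : Module.End R (R ⊗[ℂ] 𝔤)) t = (c.1 : Module.End R (R ⊗[ℂ] 𝔤)) t) : b = c :=
  Subtype.ext (Units.ext (LinearMap.ext h))

lemma borelMap_comp (φ : R →ₐ[ℂ] S) (ψ : S →ₐ[ℂ] S') (b : borelPts R H α) :
    borelMap H α ψ (borelMap H α φ b) = borelMap H α (ψ.comp φ) b := by
  refine Subtype.ext (Units.ext ?_)
  simp only [borelMap_apply]
  refine end_ext (ψ.comp φ) fun t => ?_
  rw [endMap_rTensor, show (ψ.comp φ).toLinearMap = ψ.toLinearMap ∘ₗ φ.toLinearMap from rfl,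
    LinearMap.rTensor_comp, LinearMap.comp_apply, endMap_rTensor, endMap_rTensor]
  rfl

lemma OperData.exists_lieEquiv (D : OperData T) (hR : SeparatedByPoints R) (b : borelPts R H α) :
    ∃ c, (D.G.baseChange R).IsBorel c ∧ lieUnit c = b.1 := (D.mem_borelPts_iff hR b.1).1 b.2

/-- A Borel automorphism as a point of the Borel group. -/
def OperData.toBorel (D : OperData T) (hR : SeparatedByPoints R) {c : (R ⊗[ℂ] 𝔤) ≃ₗ⁅R⁆ (R ⊗[ℂ] 𝔤)}
    (hc : (D.G.baseChange R).IsBorel c) : borelPts R H α :=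
  ⟨lieUnit c, (D.mem_borelPts_iff hR _).2 ⟨c, hc, rfl⟩⟩

end EndMap

section BorelSheaf

variable {Y : Scheme.{0}} {π : Y ⟶ Spec (.of ℂ)} [SmoothOfRelativeDimension 1 π]
variable {𝔤 : Type} [LieRing 𝔤] [LieAlgebra ℂ 𝔤] [FiniteDimensional ℂ 𝔤] {H : LieSubalgebra ℂ 𝔤}
  {ι : Type} [Fintype ι] {α : ι → Module.Dual ℂ H} {T : PrincipalTriple H α}

variable (π) in
/-- Restriction of `𝔤`-valued functions. -/
abbrev resVec (𝔤 : Type) [LieRing 𝔤] [LieAlgebra ℂ 𝔤] {U V : Y.Opens} (i : V ≤ U) :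
    Reg π U ⊗[ℂ] 𝔤 →ₗ[ℂ] Reg π V ⊗[ℂ] 𝔤 := (res π i).toLinearMap.rTensor 𝔤

variable (π) in
/-- Restriction of `𝔤`-valued forms. -/
abbrev resForm (𝔤 : Type) [LieRing 𝔤] [LieAlgebra ℂ 𝔤] {U V : Y.Opens} (i : V ≤ U) :
    Om (Reg π U) ⊗[ℂ] 𝔤 →ₗ[ℂ] Om (Reg π V) ⊗[ℂ] 𝔤 := (omMap (res π i)).rTensor 𝔤

lemma resVec_resVec {U V W : Y.Opens} (i : V ≤ U) (j : W ≤ V) (t : Reg π U ⊗[ℂ] 𝔤) :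
    resVec π 𝔤 j (resVec π 𝔤 i t) = resVec π 𝔤 (j.trans i) t := by
  rw [resVec, resVec, ← LinearMap.comp_apply, ← LinearMap.rTensor_comp, resVec, ← res_comp i j]
  rfl

lemma resForm_resForm {U V W : Y.Opens} (i : V ≤ U) (j : W ≤ V) (t : Om (Reg π U) ⊗[ℂ] 𝔤) :
    resForm π 𝔤 j (resForm π 𝔤 i t) = resForm π 𝔤 (j.trans i) t := by
  rw [resForm, resForm, rTensor_omMap_comp, res_comp]

lemma resForm_refl {U : Y.Opens} (t : Om (Reg π U) ⊗[ℂ] 𝔤) : resForm π 𝔤 (le_refl U) t = t := by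
  rw [resForm, res_refl, rTensor_omMap_id]

lemma borelMap_res_res {U V W : Y.Opens} (i : V ≤ U) (j : W ≤ V) (b : borelPts (Reg π U) H α) :
    borelMap H α (res π j) (borelMap H α (res π i) b) = borelMap H α (res π (j.trans i)) b := by
  rw [borelMap_comp, res_comp]

lemma borelMap_resVec {U V : Y.Opens} (i : V ≤ U) (b : borelPts (Reg π U) H α) (t : Reg π U ⊗[ℂ] 𝔤) :
    (borelMap H α (res π i) b).1.1 (resVec π 𝔤 i t) = resVec π 𝔤 i (b.1.1 t) :=
  endMap_rTensor _ _ _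

lemma IsAffineSieve.borel_ext {U : Y.Opens} {S : Set Y.affineOpens} (hS : IsAffineSieve U S)
    {b c : borelPts (Reg π U) H α}
    (h : ∀ W (hW : W ∈ S), borelMap H α (res π (hS.le W hW)) b = borelMap H α (res π (hS.le W hW)) c) :
    b = c := by
  refine borelPts_ext fun t => hS.vec_ext π fun W hW => ?_
  have h1 := borelMap_resVec (hS.le W hW) b t
  have h2 := borelMap_resVec (hS.le W hW) c t
  rw [← h W hW] at h2
  exact h1.symm.trans h2

lemma IsAffineSieve.end_glue {U : Y.Opens} {S : Set Y.affineOpens} (hS : IsAffineSieve U S)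
    (b : ∀ W ∈ S, borelPts (Reg π W) H α)
    (hb : ∀ W (hW : W ∈ S) (W' : Y.affineOpens) (i : W'.1 ≤ W.1),
      borelMap H α (res π i) (b W hW) = b W' (hS.down W hW W' i)) :
    ∃ c : Module.End (Reg π U) (Reg π U ⊗[ℂ] 𝔤), ∀ W (hW : W ∈ S) t,
      resVec π 𝔤 (hS.le W hW) (c t) = (b W hW).1.1 (resVec π 𝔤 (hS.le W hW) t) := by
  have h : ∀ t : Reg π U ⊗[ℂ] 𝔤, ∃ x : Reg π U ⊗[ℂ] 𝔤, ∀ W (hW : W ∈ S),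
      resVec π 𝔤 (hS.le W hW) x = (b W hW).1.1 (resVec π 𝔤 (hS.le W hW) t) := fun t =>
    hS.vec_glue π _ fun W hW W' i => by
      rw [← hb W hW W' i, ← resVec_resVec (hS.le W hW) i, borelMap_resVec]
  choose c hc using h
  refine ⟨⟨⟨c, fun s t => ?_⟩, fun f t => ?_⟩, fun W hW t => hc t W hW⟩
  · refine hS.vec_ext π fun W hW => ?_
    have h1 := hc s W hW
    have h2 := hc t W hW
    have h3 := hc (s + t) W hW
    simp only [resVec] at h1 h2 h3
    rw [h3, map_add, map_add, map_add, h1, h2]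
  · refine hS.vec_ext π fun W hW => ?_
    have h2 := hc t W hW
    have h3 := hc (f • t) W hW
    simp only [resVec, RingHom.id_apply] at h2 h3 ⊢
    rw [h3, rTensor_smul, rTensor_smul, h2, map_smul]

/-- The operators and their inverses are glued separately as endomorphisms. That the result lies in
the Borel group can be checked locally in the form of `mem_borelPts_iff`. -/
lemma IsAffineSieve.borel_glue (D : OperData T) {U : Y.Opens} {S : Set Y.affineOpens}
    (hS : IsAffineSieve U S) (b : ∀ W ∈ S, borelPts (Reg π W) H α)
    (hb : ∀ W (hW : W ∈ S) (W' : Y.affineOpens) (i : W'.1 ≤ W.1),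
      borelMap H α (res π i) (b W hW) = b W' (hS.down W hW W' i)) :
    ∃ c : borelPts (Reg π U) H α, ∀ W (hW : W ∈ S), borelMap H α (res π (hS.le W hW)) c = b W hW := by
  obtain ⟨c, hc⟩ := hS.end_glue b hb
  obtain ⟨c', hc'⟩ := hS.end_glue (fun W hW => (b W hW)⁻¹) fun W hW W' i => by
    rw [map_inv, hb]
  have hcc : ∀ t, c (c' t) = t := fun t => hS.vec_ext π fun W hW => by
    have h1 := hc W hW (c' t)
    rw [hc' W hW t] at h1
    exact h1.trans (LinearMap.congr_fun (b W hW).1.val_inv _)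
  have hcc' : ∀ t, c' (c t) = t := fun t => hS.vec_ext π fun W hW => by
    have h1 := hc' W hW (c t)
    rw [hc W hW t] at h1
    exact h1.trans (LinearMap.congr_fun (b W hW).1.inv_val _)
  let u : (Module.End (Reg π U) (Reg π U ⊗[ℂ] 𝔤))ˣ :=
    ⟨c, c', LinearMap.ext hcc, LinearMap.ext hcc'⟩
  choose e he hbe using fun W (hW : W ∈ S) => D.exists_lieEquiv (separatedByPoints_reg W.1) (b W hW)
  have hce : ∀ W (hW : W ∈ S) t, resVec π 𝔤 (hS.le W hW) (c t) = e W hW (resVec π 𝔤 (hS.le W hW) t) :=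
    fun W hW t => by rw [hc W hW t, ← hbe W hW]; rfl
  have hce' : ∀ W (hW : W ∈ S) t,
      resVec π 𝔤 (hS.le W hW) (c' t) = (e W hW).symm (resVec π 𝔤 (hS.le W hW) t) := fun W hW t => by
    rw [hc' W hW t, Subgroup.coe_inv, ← hbe W hW]; rfl
  have hF : ∀ k (t : Reg π U ⊗[ℂ] 𝔤), (∀ W (hW : W ∈ S), resVec π 𝔤 (hS.le W hW) t ∈
      (D.G.baseChange (Reg π W)).F k) → t ∈ (D.G.baseChange (Reg π U)).F k := fun k t ht =>
    PrincipalGrading.mem_F.2 fun j hj => hS.vec_ext π fun W hW => by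
      rw [rTensor_pr, map_zero]
      exact PrincipalGrading.mem_F.1 (ht W hW) j hj
  have hF' : ∀ k (t : Reg π U ⊗[ℂ] 𝔤), t ∈ (D.G.baseChange (Reg π U)).F k → ∀ W (hW : W ∈ S),
      resVec π 𝔤 (hS.le W hW) t ∈ (D.G.baseChange (Reg π W)).F k := fun k t ht W hW =>
    PrincipalGrading.mem_F.2 fun j hj => by
      rw [resVec, ← rTensor_pr, PrincipalGrading.mem_F.1 ht j hj, map_zero]
  have hu : ∀ s t, u.1 ⁅s, t⁆ = ⁅u.1 s, u.1 t⁆ := fun s t => hS.vec_ext π fun W hW => by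
    have h1 := hce W hW ⁅s, t⁆
    have h2 := hce W hW s
    have h3 := hce W hW t
    simp only [resVec] at h1 h2 h3
    change (res π (hS.le W hW)).toLinearMap.rTensor 𝔤 (c ⁅s, t⁆) =
      (res π (hS.le W hW)).toLinearMap.rTensor 𝔤 ⁅c s, c t⁆
    rw [h1, rTensor_lie, rTensor_lie, h2, h3, LieEquiv.map_lie]
  have hB : (D.G.baseChange (Reg π U)).IsBorel (lieEquivOfUnit u hu) := by
    refine ⟨⟨fun k z hz => hF _ _ fun W hW => ?_, fun z hz => hF _ _ fun W hW => ?_⟩,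
      ⟨fun k z hz => hF _ _ fun W hW => ?_, fun z hz => hF _ _ fun W hW => ?_⟩⟩
    · exact (hce W hW z).symm ▸ (he W hW).upper.mem k _ (hF' k z hz W hW)
    · have := (he W hW).upper.sub_mem _ (hF' 0 z hz W hW)
      rw [← hce W hW z, ← map_sub] at this
      exact this
    · exact (hce' W hW z).symm ▸ (he W hW).symm_upper.mem k _ (hF' k z hz W hW)
    · have := (he W hW).symm_upper.sub_mem _ (hF' 0 z hz W hW)
      rw [← hce' W hW z, ← map_sub] at this
      exact this
  refine ⟨⟨u, (D.mem_borelPts_iff (separatedByPoints_reg U) u).2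
    ⟨_, hB, lieUnit_lieEquivOfUnit u hu⟩⟩, fun W hW => ?_⟩
  refine Subtype.ext (Units.ext (end_ext (res π (hS.le W hW)) fun t => ?_))
  rw [borelMap_apply, endMap_rTensor]
  exact hc W hW t

lemma isOperForm_res (D : OperData T) {U V : Y.affineOpens} (i : V.1 ≤ U.1) {A : Om (Reg π U) ⊗[ℂ] 𝔤}
    (hA : IsOperForm H α A) : IsOperForm H α (resForm π 𝔤 i A) := by
  rw [D.isOperForm_iff] at hA ⊢
  refine ⟨fun j hj => ?_, fun l => ?_⟩
  · rw [resForm, ← rTensor_omMap_lTensor, hA.1 j hj, map_zero]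
  · rw [resForm, formCoef_map]
    exact (hA.2 l).map (etale_res i)

lemma IsAffineSieve.isOperForm (D : OperData T) {U : Y.affineOpens} {S : Set Y.affineOpens}
    (hS : IsAffineSieve U.1 S) {A : Om (Reg π U) ⊗[ℂ] 𝔤}
    (hA : ∀ W (hW : W ∈ S), IsOperForm H α (resForm π 𝔤 (hS.le W hW) A)) : IsOperForm H α A := by
  simp only [D.isOperForm_iff] at hA ⊢
  refine ⟨fun j hj => hS.form_ext fun W hW => ?_, fun l => hS.isGen fun W hW => ?_⟩
  · rw [rTensor_omMap_lTensor, map_zero]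
    exact (hA W hW).1 j hj
  · rw [← formCoef_map]
    exact (hA W hW).2 l

end BorelSheaf

/-! ### Sections of oper bundles determined by their connection forms. -/

section Sections

variable {Y : Scheme.{0}} {π : Y ⟶ Spec (.of ℂ)}
variable {𝔤 : Type} [LieRing 𝔤] [LieAlgebra ℂ 𝔤] {H : LieSubalgebra ℂ 𝔤}
  {ι : Type} [Fintype ι] {α : ι → Module.Dual ℂ H} {T : PrincipalTriple H α}

/-- Sections of the bundle of an oper. -/
abbrev Oper.sec (P : Oper π H α) (U : Y.Opens) : Type := P.sheaf.presheaf.obj (op U)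

/-- Restriction of sections of the bundle of an oper. -/
abbrev Oper.rs (P : Oper π H α) {U V : Y.Opens} (i : V ≤ U) (s : P.sec U) : P.sec V :=
  P.sheaf.presheaf.map (homOfLE i).op s

lemma Oper.rs_rs (P : Oper π H α) {U V W : Y.Opens} (i : V ≤ U) (j : W ≤ V) (s : P.sec U) :
    P.rs j (P.rs i s) = P.rs (j.trans i) s := by
  rw [Oper.rs, Oper.rs, ← Functor.map_comp_apply]
  rfl

lemma Oper.rs_refl (P : Oper π H α) {U : Y.Opens} (s : P.sec U) : P.rs (le_refl U) s = s := by
  have := Functor.map_id_apply P.sheaf.presheaf (op U) s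
  exact this

lemma Oper.form_rs (P : Oper π H α) {U V : Y.affineOpens} (i : V.1 ≤ U.1) (s : P.sec U.1) :
    P.form V (P.rs i s) = resForm π 𝔤 i (P.form U s) := P.form_map U V i s

lemma Oper.formGauge (P : Oper π H α) (U : Y.affineOpens) (s : P.sec U.1) (b : borelPts (Reg π U) H α) :
    FormGauge b.1.1 (P.form U s) (P.form U (P.act U.1 s b)) := P.form_act U s b

lemma Oper.exists_sec_nhds (P : Oper π H α) {U : Y.Opens} {p : Y} (hp : p ∈ U) :
    ∃ W : Y.affineOpens, p ∈ W.1 ∧ W.1 ≤ U ∧ Nonempty (P.sec W.1) := by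
  obtain ⟨V, hV, ⟨s⟩⟩ := P.locally_nonempty p
  obtain ⟨W, h1, h2⟩ := exists_affine_le (U := V ⊓ U) ⟨hV, hp⟩
  exact ⟨W, h1, h2.trans inf_le_right, ⟨P.rs (h2.trans inf_le_left) s⟩⟩

variable [SmoothOfRelativeDimension 1 π] [FiniteDimensional ℂ 𝔤]

lemma OperData.eq_one_of_formGauge (D : OperData T) {R : Type} [CommRing R] [Algebra ℂ R]
    (hR : SeparatedByPoints R) {b : borelPts R H α} {A : Om R ⊗[ℂ] 𝔤} (hA : IsOperForm H α A)
    (h : FormGauge b.1.1 A A) : b = 1 := by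
  obtain ⟨c, hc, hcb⟩ := D.exists_lieEquiv hR b
  rw [← hcb] at h
  obtain rfl := D.eq_refl_of_formGauge hA hc h
  exact Subtype.ext hcb.symm

lemma OperData.borel_unique (D : OperData T) {R : Type} [CommRing R] [Algebra ℂ R]
    (hR : SeparatedByPoints R) {b c : borelPts R H α} {A A' : Om R ⊗[ℂ] 𝔤} (hA : IsOperForm H α A)
    (hb : FormGauge b.1.1 A A') (hc : FormGauge c.1.1 A A') : b = c := by
  have := D.eq_one_of_formGauge (b := b * c⁻¹) hR hA (hb.mul hc.inv)
  rwa [mul_inv_eq_one] at this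

/-- Two sections differ by an element of the Borel group, which fixes the common form and is
therefore trivial. -/
lemma Oper.form_inj (D : OperData T) (P : Oper π H α) {U : Y.affineOpens} {s t : P.sec U.1}
    (h : P.form U s = P.form U t) : s = t := by
  obtain ⟨b, rfl, -⟩ := P.simply_transitive U.1 s t
  have h1 := P.formGauge U s b
  rw [← h] at h1
  rw [D.eq_one_of_formGauge (separatedByPoints_reg U.1) (P.isOperForm U s) h1, P.act_one]

lemma Oper.ext_forms (D : OperData T) (P : Oper π H α) {U : Y.Opens} {S : Set Y.affineOpens}
    (hS : IsAffineSieve U S) {s t : P.sec U}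
    (h : ∀ W (hW : W ∈ S), P.form W (P.rs (hS.le W hW) s) = P.form W (P.rs (hS.le W hW) t)) : s = t :=
  hS.sheaf_ext P.sheaf fun W hW => P.form_inj D (h W hW)

lemma Oper.glue_forms (D : OperData T) (P : Oper π H α) {U : Y.Opens}
    (Φ : ∀ W : Y.affineOpens, W.1 ≤ U → Om (Reg π W) ⊗[ℂ] 𝔤)
    (hΦ : ∀ (V : Y.affineOpens) (i : V.1 ≤ U) (W : Y.affineOpens) (j : W.1 ≤ V.1),
      resForm π 𝔤 j (Φ V i) = Φ W (j.trans i))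
    (hloc : ∀ p ∈ U, ∃ W : Y.affineOpens, p ∈ W.1 ∧ ∃ (h : W.1 ≤ U) (t : P.sec W.1), P.form W t = Φ W h) :
    ∃ t : P.sec U, ∀ (W : Y.affineOpens) (h : W.1 ≤ U), P.form W (P.rs h t) = Φ W h := by
  have hS : IsAffineSieve U {W | ∃ (h : W.1 ≤ U) (t : P.sec W.1), P.form W t = Φ W h} := by
    refine ⟨fun W hW => hW.1, ?_, fun p hp => ?_⟩
    · rintro W ⟨h, t, ht⟩ W' i
      exact ⟨i.trans h, P.rs i t, by rw [P.form_rs, ht, hΦ]⟩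
    · obtain ⟨W, h1, h2⟩ := hloc p hp
      exact ⟨W, h2, h1⟩
  choose t ht using fun W (hW : W ∈ {W : Y.affineOpens | ∃ (h : W.1 ≤ U) (t : P.sec W.1), P.form W t = Φ W h}) =>
    hW.2
  obtain ⟨s, hs⟩ := hS.sheaf_glue P.sheaf t fun W hW W' i => P.form_inj D (by
    rw [P.form_map, ht, ht]
    exact hΦ W _ W' i)
  refine ⟨s, fun W h => ?_⟩
  refine (hS.restrict h).form_ext fun W' hW' => ?_
  rw [← P.form_map, hΦ W h W' hW'.1]
  have h1 := hs W' hW'.2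
  rw [← ht W' hW'.2, ← h1]
  congr 1
  exact P.rs_rs h hW'.1 s

section Morphism

variable {𝔞 : Type} [LieRing 𝔞] [LieAlgebra ℂ 𝔞] [FiniteDimensional ℂ 𝔞] {H₀ : LieSubalgebra ℂ 𝔞}
  {ι₀ : Type} [Fintype ι₀] {α₀ : ι₀ → Module.Dual ℂ H₀}

/-- A section `s` is sent to the unique section whose forms are related by `Ind` to those of `s`.
Isomorphisms of opers are obtained with `Ind` equality, induced bundles with `Ind` the relation
`IndForm`. One related pair near every point is enough, since the torsor structures carry it to all
other sections. -/
theorem Oper.exists_morphism (D : OperData T) (L : Oper π H₀ α₀) (Q : Oper π H α)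
    (Ind : ∀ W : Y.affineOpens, Om (Reg π W) ⊗[ℂ] 𝔞 → Om (Reg π W) ⊗[ℂ] 𝔤 → Prop)
    (Rel : ∀ U : Y.Opens, borelPts (Reg π U) H₀ α₀ → borelPts (Reg π U) H α → Prop)
    (hex : ∀ W A₀, IsOperForm H₀ α₀ A₀ → ∃ A, Ind W A₀ A)
    (huniq : ∀ W A₀ A A', IsOperForm H₀ α₀ A₀ → Ind W A₀ A → Ind W A₀ A' → A = A')
    (hmap : ∀ (V W : Y.affineOpens) (i : W.1 ≤ V.1) A₀ A, IsOperForm H₀ α₀ A₀ → Ind V A₀ A →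
      Ind W (resForm π 𝔞 i A₀) (resForm π 𝔤 i A))
    (hRel : ∀ (U V : Y.Opens) (i : V ≤ U) b₀ b, Rel U b₀ b →
      Rel V (borelMap H₀ α₀ (res π i) b₀) (borelMap H α (res π i) b))
    (hRelex : ∀ (W : Y.affineOpens) b₀, ∃ b, Rel W.1 b₀ b)
    (hg : ∀ (W : Y.affineOpens) b₀ b A₀ A₀' A A', IsOperForm H₀ α₀ A₀ → IsOperForm H₀ α₀ A₀' →
      Rel W.1 b₀ b → Ind W A₀ A →
      FormGauge b₀.1.1 A₀ A₀' → FormGauge b.1.1 A A' → Ind W A₀' A')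
    (hloc : ∀ p : Y, ∃ W : Y.affineOpens, p ∈ W.1 ∧ ∃ s t, Ind W (L.form W s) (Q.form W t)) :
    ∃ φ : L.sheaf.presheaf ⟶ Q.sheaf.presheaf,
      (∀ (U : Y.Opens) s b₀ b, Rel U b₀ b →
        φ.app (op U) (L.act U s b₀) = Q.act U (φ.app (op U) s) b) ∧
      ∀ (W : Y.affineOpens) s, Ind W (L.form W s) (Q.form W (φ.app (op W.1) s)) := by
  have key : ∀ (U : Y.Opens) (s : L.sec U), ∃ t : Q.sec U, ∀ (W : Y.affineOpens) (h : W.1 ≤ U),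
      Ind W (L.form W (L.rs h s)) (Q.form W (Q.rs h t)) := by
    intro U s
    choose Φ hΦ using fun (W : Y.affineOpens) (h : W.1 ≤ U) =>
      hex W (L.form W (L.rs h s)) (L.isOperForm W _)
    obtain ⟨t, ht⟩ := Q.glue_forms D Φ (fun V i W j => by
      refine huniq W (L.form W (L.rs (j.trans i) s)) _ _ (L.isOperForm W _) ?_ (hΦ W _)
      rw [← L.rs_rs i j, L.form_rs]
      exact hmap V W j _ _ (L.isOperForm V _) (hΦ V i)) (fun p hp => by
      -- Near `p`, the given section is `s₁` moved by some `b₀`; moving `t₁` by a related `b`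
      -- produces a section with the required form.
      obtain ⟨W₁, hp₁, s₁, t₁, h₁⟩ := hloc p
      obtain ⟨W, hpW, hW⟩ := exists_affine_le (U := W₁.1 ⊓ U) ⟨hp₁, hp⟩
      have i : W.1 ≤ W₁.1 := hW.trans inf_le_left
      have j : W.1 ≤ U := hW.trans inf_le_right
      obtain ⟨b₀, hb₀, -⟩ := L.simply_transitive W.1 (L.rs i s₁) (L.rs j s)
      obtain ⟨b, hb⟩ := hRelex W b₀
      have h2 := hmap W₁ W i _ _ (L.isOperForm _ _) h₁
      rw [← L.form_rs, ← Q.form_rs] at h2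
      have h3 := hg W b₀ b _ _ _ _ (L.isOperForm _ _) (L.isOperForm _ _) hb h2
        (L.formGauge W _ b₀) (Q.formGauge W _ b)
      rw [hb₀] at h3
      exact ⟨W, hpW, j, _, huniq W _ _ _ (L.isOperForm _ _) h3 (hΦ W j)⟩)
    exact ⟨t, fun W h => (ht W h).symm ▸ hΦ W h⟩
  choose F hF using key
  have huq : ∀ (U : Y.Opens) (s : L.sec U) (t : Q.sec U), (∀ (W : Y.affineOpens) (h : W.1 ≤ U),
      Ind W (L.form W (L.rs h s)) (Q.form W (Q.rs h t))) → F U s = t := fun U s t ht =>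
    Q.ext_forms D (isAffineSieve_all U) fun W hW =>
      huniq W _ _ _ (L.isOperForm W _) (hF U s W hW) (ht W hW)
  refine ⟨⟨fun U => TypeCat.ofHom (F U.unop), fun U V i => ?_⟩, fun U s b₀ b hb => ?_, fun W s => ?_⟩
  · ext s
    have i' : V.unop ≤ U.unop := i.unop.le
    refine huq V.unop (L.rs i' s) (Q.rs i' (F U.unop s)) fun W h => ?_
    rw [L.rs_rs, Q.rs_rs]
    exact hF _ _ _ _
  · refine huq U (L.act U s b₀) (Q.act U (F U s) b) fun W h => ?_
    have h1 := L.map_act U W.1 h s b₀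
    have h2 := Q.map_act U W.1 h (F U s) b
    change Ind W (L.form W (L.sheaf.presheaf.map (homOfLE h).op _))
      (Q.form W (Q.sheaf.presheaf.map (homOfLE h).op _))
    rw [h1, h2]
    exact hg W _ _ _ _ _ _ (L.isOperForm _ _) (L.isOperForm _ _) (hRel _ _ h _ _ hb) (hF U s W h)
      (L.formGauge W _ _) (Q.formGauge W _ _)
  · have := hF W.1 s W le_rfl
    rw [L.rs_refl, Q.rs_refl] at this
    exact this

end Morphism

end Sections

/-! ### Construction of opers from local connection forms. -/

variable {Y : Scheme.{0}} {π : Y ⟶ Spec (.of ℂ)}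
variable {𝔤 : Type} [LieRing 𝔤] [LieAlgebra ℂ 𝔤] {H : LieSubalgebra ℂ 𝔤}
  {ι : Type} [Fintype ι] {α : ι → Module.Dual ℂ H} {T : PrincipalTriple H α}

variable (π H α) in
/-- Local connection forms that glue to an oper. -/
structure OperAtlas where
  carrier : ∀ W : Y.affineOpens, Set (Om (Reg π W) ⊗[ℂ] 𝔤)
  isOperForm : ∀ W, ∀ A ∈ carrier W, IsOperForm H α A
  res_mem : ∀ (V W : Y.affineOpens) (i : W.1 ≤ V.1), ∀ A ∈ carrier V, resForm π 𝔤 i A ∈ carrier W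
  gauge : ∀ W, ∀ A ∈ carrier W, ∀ A' ∈ carrier W, ∃ b : borelPts (Reg π W) H α, FormGauge b.1.1 A A'
  locally_nonempty : ∀ p : Y, ∃ W : Y.affineOpens, p ∈ W.1 ∧ (carrier W).Nonempty

namespace OperAtlas

variable (E : OperAtlas π H α)

/-- The forms that are gauge equivalent to those of the atlas. -/
def Orb (W : Y.affineOpens) (A : Om (Reg π W) ⊗[ℂ] 𝔤) : Prop :=
  ∃ A₀ ∈ E.carrier W, ∃ b : borelPts (Reg π W) H α, FormGauge b.1.1 A₀ A

variable {E}

lemma orb_of_mem {W : Y.affineOpens} {A : Om (Reg π W) ⊗[ℂ] 𝔤} (hA : A ∈ E.carrier W) : E.Orb W A :=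
  ⟨A, hA, 1, FormGauge.refl A⟩

lemma Orb.gauge {W : Y.affineOpens} {A A' : Om (Reg π W) ⊗[ℂ] 𝔤} (hA : E.Orb W A)
    {b : borelPts (Reg π W) H α} (h : FormGauge b.1.1 A A') : E.Orb W A' := by
  obtain ⟨A₀, hA₀, c, hc⟩ := hA
  exact ⟨A₀, hA₀, c * b, hc.mul h⟩

lemma Orb.exists_gauge {W : Y.affineOpens} {A A' : Om (Reg π W) ⊗[ℂ] 𝔤} (hA : E.Orb W A)
    (hA' : E.Orb W A') : ∃ b : borelPts (Reg π W) H α, FormGauge b.1.1 A A' := by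
  obtain ⟨A₀, hA₀, c, hc⟩ := hA
  obtain ⟨A₁, hA₁, d, hd⟩ := hA'
  obtain ⟨e, he⟩ := E.gauge W A₀ hA₀ A₁ hA₁
  exact ⟨c⁻¹ * e * d, (hc.inv.mul he).mul hd⟩

lemma Orb.restrict {V W : Y.affineOpens} (i : W.1 ≤ V.1) {A : Om (Reg π V) ⊗[ℂ] 𝔤} (hA : E.Orb V A) :
    E.Orb W (resForm π 𝔤 i A) := by
  obtain ⟨A₀, hA₀, c, hc⟩ := hA
  exact ⟨_, E.res_mem V W i A₀ hA₀, borelMap H α (res π i) c, hc.map (res π i)⟩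

variable [SmoothOfRelativeDimension 1 π] [FiniteDimensional ℂ 𝔤]

lemma _root_.Opers.OperData.exists_formGauge_borel (D : OperData T) {R : Type} [CommRing R] [Algebra ℂ R]
    (hR : SeparatedByPoints R) {A : Om R ⊗[ℂ] 𝔤} (hA : IsOperForm H α A) (b : borelPts R H α) :
    ∃ A', FormGauge b.1.1 A A' ∧ IsOperForm H α A' := by
  obtain ⟨c, hc, hcb⟩ := D.exists_lieEquiv hR b
  rw [← hcb]
  exact D.exists_formGauge hA hc

lemma Orb.isOperForm (D : OperData T) {W : Y.affineOpens} {A : Om (Reg π W) ⊗[ℂ] 𝔤} (hA : E.Orb W A) :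
    IsOperForm H α A := by
  obtain ⟨A₀, hA₀, c, hc⟩ := hA
  obtain ⟨A', h, h'⟩ := D.exists_formGauge_borel (separatedByPoints_reg W.1) (E.isOperForm W A₀ hA₀) c
  rwa [FormGauge.right_unique D.G.faithful hc h]

variable (E) in
/-- Sections of the bundle given by an atlas: compatible families of forms that are locally gauge
equivalent to those of the atlas. -/
structure Sec (U : Y.Opens) where
  form : ∀ W : Y.affineOpens, W.1 ≤ U → Om (Reg π W) ⊗[ℂ] 𝔤
  res_form : ∀ (V : Y.affineOpens) (i : V.1 ≤ U) (W : Y.affineOpens) (j : W.1 ≤ V.1),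
    resForm π 𝔤 j (form V i) = form W (j.trans i)
  orb : ∀ p ∈ U, ∃ W : Y.affineOpens, p ∈ W.1 ∧ ∃ h, E.Orb W (form W h)

@[ext] lemma Sec.ext' {U : Y.Opens} {s t : E.Sec U} (h : ∀ W i, s.form W i = t.form W i) : s = t := by
  cases s
  cases t
  congr
  exact funext fun W => funext fun i => h W i

lemma Sec.sieve {U : Y.Opens} (s : E.Sec U) : IsAffineSieve U {W | ∃ h, E.Orb W (s.form W h)} where
  le _ hW := hW.1
  down := by
    rintro W ⟨h, hW⟩ W' i
    exact ⟨i.trans h, s.res_form W h W' i ▸ hW.restrict i⟩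
  cover p hp := by
    obtain ⟨W, h1, h2⟩ := s.orb p hp
    exact ⟨W, h2, h1⟩

lemma Sec.isOperForm (D : OperData T) {U : Y.Opens} (s : E.Sec U) (W : Y.affineOpens) (h : W.1 ≤ U) :
    IsOperForm H α (s.form W h) := by
  refine (s.sieve.restrict h).isOperForm D fun W' hW' => ?_
  rw [s.res_form W h W' hW'.1]
  obtain ⟨_, h'⟩ := hW'.2
  exact h'.isOperForm D

/-- Restriction of sections. -/
def Sec.res {U V : Y.Opens} (i : V ≤ U) (s : E.Sec U) : E.Sec V where
  form W h := s.form W (h.trans i)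
  res_form V' i' W j := s.res_form V' (i'.trans i) W j
  orb p hp := by
    obtain ⟨W, hW, h⟩ := (s.sieve.restrict i).cover p hp
    exact ⟨W, h, hW.1, hW.2.2⟩

lemma Sec.exists_act (D : OperData T) {U : Y.Opens} (s : E.Sec U) (b : borelPts (Reg π U) H α) :
    ∃ t : E.Sec U, ∀ W h, FormGauge (borelMap H α (Opers.res π h) b).1.1 (s.form W h) (t.form W h) := by
  choose A hA using fun (W : Y.affineOpens) (h : W.1 ≤ U) =>
    D.exists_formGauge_borel (separatedByPoints_reg W.1) (s.isOperForm D W h) (borelMap H α (Opers.res π h) b)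
  refine ⟨⟨A, fun V i W j => ?_, fun p hp => ?_⟩, fun W h => (hA W h).1⟩
  · have h1 := (hA V i).1.map (Opers.res π j)
    have h2 := (hA W (j.trans i)).1
    rw [← borelMap_apply, borelMap_res_res] at h1
    refine FormGauge.right_unique D.G.faithful (h1 :) ?_
    have h3 := s.res_form V i W j
    rw [resForm] at h3
    rw [h3]
    exact h2
  · obtain ⟨W, h1, h, h2⟩ := s.orb p hp
    exact ⟨W, h1, h, h2.gauge (hA W h).1⟩

/-- Local gauge transformations exist by the atlas axiom, are unique by rigidity, and hence glue. -/
lemma Sec.exists_gauge (D : OperData T) {U : Y.Opens} (s t : E.Sec U) :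
    ∃ b : borelPts (Reg π U) H α,
      ∀ W h, FormGauge (borelMap H α (Opers.res π h) b).1.1 (s.form W h) (t.form W h) := by
  have hS := s.sieve.inter t.sieve
  choose b hb using fun W (hW : W ∈ {W | ∃ h, E.Orb W (s.form W h)} ∩ {W | ∃ h, E.Orb W (t.form W h)}) =>
    hW.1.2.exists_gauge hW.2.2
  obtain ⟨c, hc⟩ := hS.borel_glue D b fun W hW W' i => by
    refine D.borel_unique (separatedByPoints_reg W'.1)
      (s.isOperForm D W' (hS.le W' (hS.down W hW W' i))) ?_ (hb W' _)
    have := (hb W hW).map (Opers.res π i)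
    have h3 := s.res_form W (hS.le W hW) W' i
    have h4 := t.res_form W (hS.le W hW) W' i
    rw [resForm] at h3 h4
    rw [h3, h4] at this
    exact this
  refine ⟨c, fun W h => ?_⟩
  obtain ⟨A', hA', -⟩ := D.exists_formGauge_borel (separatedByPoints_reg W.1) (s.isOperForm D W h)
    (borelMap H α (Opers.res π h) c)
  have hS' := hS.restrict h
  suffices A' = t.form W h from this ▸ hA'
  refine hS'.form_ext fun W' hW' => ?_
  have h1 := hA'.map (Opers.res π hW'.1)
  have h3 := s.res_form W h W' hW'.1
  have h4 := t.res_form W h W' hW'.1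
  rw [resForm] at h3 h4
  rw [h4]
  rw [← borelMap_apply, borelMap_res_res, h3] at h1
  refine FormGauge.right_unique D.G.faithful (h1 :) ?_
  rw [hc W' hW'.2]
  exact hb W' hW'.2

variable (E) in
/-- The presheaf of sections. -/
def presheaf : TopCat.Presheaf Type Y.toTopCat where
  obj U := E.Sec U.unop
  map i := TypeCat.ofHom (Sec.res i.unop.le)

variable (E) in
lemma isSheaf : E.presheaf.IsSheaf := by
  rw [TopCat.Presheaf.isSheaf_iff_isSheafUniqueGluing_types]
  intro J U sf hsf
  have hcomp : ∀ (j k : J) (W : Y.affineOpens) (hj : W.1 ≤ U j) (hk : W.1 ≤ U k),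
      Sec.form (E := E) (sf j) W hj = Sec.form (E := E) (sf k) W hk := fun j k W hj hk =>
    congrArg (fun s : E.Sec (U j ⊓ U k) => s.form W (le_inf hj hk)) (hsf j k)
  -- An affine open of the union need not lie in any `U j`; its form is glued from the smaller
  -- affine opens that do.
  have hS : ∀ W : Y.affineOpens, W.1 ≤ iSup U →
      IsAffineSieve W.1 {W' | W'.1 ≤ W.1 ∧ ∃ j, W'.1 ≤ U j} := fun W hW => by
    refine IsAffineSieve.of_locally (fun V V' i _ hV => ?_) fun p hp => ?_
    · obtain ⟨j, hj⟩ := hV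
      exact ⟨j, i.trans hj⟩
    · obtain ⟨j, hj⟩ := Opens.mem_iSup.1 (hW hp)
      obtain ⟨V, h1, h2⟩ := exists_affine_le (U := W.1 ⊓ U j) ⟨hp, hj⟩
      exact ⟨V, h1, h2.trans inf_le_left, j, h2.trans inf_le_right⟩
  have hA : ∀ (W : Y.affineOpens) (hW : W.1 ≤ iSup U), ∃ A : Om (Reg π W) ⊗[ℂ] 𝔤,
      ∀ (W' : Y.affineOpens) (i : W'.1 ≤ W.1) (j : J) (hj : W'.1 ≤ U j),
        resForm π 𝔤 i A = Sec.form (E := E) (sf j) W' hj := fun W hW => by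
    obtain ⟨A, hA⟩ := (hS W hW).form_glue
      (fun W' hW' => Sec.form (E := E) (sf hW'.2.choose) W' hW'.2.choose_spec) fun W' hW' W'' i => by
        have := Sec.res_form (E := E) (sf hW'.2.choose) W' hW'.2.choose_spec W'' i
        rw [resForm] at this
        rw [this]
        exact hcomp _ _ _ _ _
    exact ⟨A, fun W' i j hj => (hA W' ⟨i, j, hj⟩).trans (hcomp _ _ _ _ _)⟩
  choose A hA using hA
  refine ⟨(⟨A, fun V i W k => ?_, fun p hp => ?_⟩ : E.Sec (iSup U)), fun j => ?_, fun t ht => ?_⟩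
  · refine (hS W (k.trans i)).form_ext fun W' hW' => ?_
    obtain ⟨h1, j, hj⟩ := hW'
    have h2 := resForm_resForm k h1 (A V i)
    simp only [resForm] at h2 hA ⊢
    rw [h2, hA V i W' (h1.trans k) j hj, hA W (k.trans i) W' h1 j hj]
  · obtain ⟨j, hj⟩ := Opens.mem_iSup.1 hp
    obtain ⟨W, h1, h, h2⟩ := Sec.orb (E := E) (sf j) p hj
    refine ⟨W, h1, h.trans (le_iSup U j), ?_⟩
    rw [← hA W (h.trans (le_iSup U j)) W le_rfl j h, resForm_refl] at h2
    exact h2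
  · refine Sec.ext' (E := E) fun W i => ?_
    have := hA W (i.trans (le_iSup U j)) W le_rfl j i
    rw [resForm_refl] at this
    exact this
  · refine Sec.ext' (E := E) fun W i => ?_
    refine (hS W i).form_ext fun W' hW' => ?_
    obtain ⟨h1, j, hj⟩ := hW'
    have h2 := Sec.res_form (E := E) t W i W' h1
    have h3 := congrArg (fun s : E.Sec (U j) => s.form W' hj) (ht j)
    have h4 := hA W i W' h1 j hj
    simp only [resForm] at h2 h4 ⊢
    rw [h2]
    exact h3.trans h4.symm

/-- The action of the Borel group on sections. -/
def act (D : OperData T) (U : Y.Opens) (s : E.Sec U) (b : borelPts (Reg π U) H α) : E.Sec U :=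
  (s.exists_act D b).choose

lemma formGauge_act (D : OperData T) (U : Y.Opens) (s : E.Sec U) (b : borelPts (Reg π U) H α) (W h) :
    FormGauge (borelMap H α (Opers.res π h) b).1.1 (s.form W h) ((act D U s b).form W h) :=
  (s.exists_act D b).choose_spec W h

lemma eq_act (D : OperData T) {U : Y.Opens} {s t : E.Sec U} {b : borelPts (Reg π U) H α}
    (h : ∀ W h, FormGauge (borelMap H α (Opers.res π h) b).1.1 (s.form W h) (t.form W h)) :
    act D U s b = t :=
  Sec.ext' fun W i => FormGauge.right_unique D.G.faithful (formGauge_act D U s b W i) (h W i)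

lemma borelMap_res_refl {U : Y.Opens} (b : borelPts (Reg π U) H α) :
    borelMap H α (Opers.res π (le_refl U)) b = b := by
  refine Subtype.ext (Units.ext (end_ext (Opers.res π (le_refl U)) fun t => ?_))
  rw [borelMap_apply, endMap_rTensor, res_refl]
  simp [LinearMap.rTensor_id, show (AlgHom.id ℂ (Reg π U)).toLinearMap = LinearMap.id from rfl]

variable (E) in
/-- The oper defined by an atlas. -/
def toOper (D : OperData T) : Oper π H α where
  sheaf := ⟨E.presheaf, E.isSheaf⟩
  act := act D
  act_one U s := eq_act D fun W h => by
    rw [map_one]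
    exact FormGauge.refl _
  act_mul U s b c := eq_act D fun W h => by
    rw [map_mul]
    exact (formGauge_act D U s b W h).mul (formGauge_act D U _ c W h)
  map_act U V i s b := (eq_act D fun W h => by
    rw [borelMap_res_res]
    exact formGauge_act D U s b W (h.trans i)).symm
  simply_transitive U s t := by
    obtain ⟨b, hb⟩ := Sec.exists_gauge D s t
    refine ⟨b, eq_act D hb, fun c hc => ?_⟩
    refine (isAffineSieve_all U).borel_ext fun W hW => ?_
    refine D.borel_unique (separatedByPoints_reg W.1) (Sec.isOperForm D s W hW) ?_ (hb W hW)
    have := formGauge_act D U s c W hW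
    rwa [show act D U s c = t from hc] at this
  locally_nonempty p := by
    obtain ⟨W, h, A, hA⟩ := E.locally_nonempty p
    refine ⟨W.1, h, ⟨(⟨fun W' i => resForm π 𝔤 i A, fun V i W' j => resForm_resForm i j A,
      fun q hq => ⟨W, hq, le_rfl, ?_⟩⟩ : E.Sec W.1)⟩⟩
    rw [resForm_refl]
    exact orb_of_mem hA
  form U s := Sec.form (E := E) s U le_rfl
  form_map U V i s := (Sec.res_form (E := E) s U le_rfl V i).symm
  form_act U s b := by
    have := formGauge_act D U.1 s b U le_rfl
    rw [borelMap_res_refl] at this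
    exact this
  isOperForm U s := Sec.isOperForm D s U le_rfl

lemma exists_form_eq (D : OperData T) (W : Y.affineOpens) {A : Om (Reg π W) ⊗[ℂ] 𝔤}
    (hA : A ∈ E.carrier W) : ∃ s : (E.toOper D).sec W.1, (E.toOper D).form W s = A := by
  refine ⟨(⟨fun W' i => resForm π 𝔤 i A, fun V i W' j => resForm_resForm i j A,
      fun q hq => ⟨W, hq, le_rfl, ?_⟩⟩ : E.Sec W.1), resForm_refl A⟩
  rw [resForm_refl]
  exact orb_of_mem hA

end OperAtlas

/-! ### Existence of induced opers and the map to `𝔤`-opers. -/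

section Intertwines

variable {R S : Type} [CommRing R] [Algebra ℂ R] [CommRing S] [Algebra ℂ S]
variable {𝔤 : Type} [LieRing 𝔤] [LieAlgebra ℂ 𝔤] {H : LieSubalgebra ℂ 𝔤}
  {ι : Type} [Fintype ι] {α : ι → Module.Dual ℂ H} {T : PrincipalTriple H α}

/-- The elements `b₀` and `b` of the Borel groups are intertwined by `sl(2) → 𝔤`. -/
def Intertwines (T : PrincipalTriple H α) (b₀ : borelPts R sl2Cartan sl2Root) (b : borelPts R H α) : Prop :=
  ∀ z, (b.1 : Module.End R (R ⊗[ℂ] 𝔤)) (T.hom.lTensor R z) =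
    T.hom.lTensor R ((b₀.1 : Module.End R (R ⊗[ℂ] sl2)) z)

lemma lTensor_hom_smul (r : R) (z : R ⊗[ℂ] sl2) : T.hom.lTensor R (r • z) = r • T.hom.lTensor R z :=
  map_smul (T.hom.baseChange R) r z

lemma rTensor_lTensor_hom (φ : R →ₐ[ℂ] S) (z : R ⊗[ℂ] sl2) :
    φ.toLinearMap.rTensor 𝔤 (T.hom.lTensor R z) = T.hom.lTensor S (φ.toLinearMap.rTensor sl2 z) := by
  induction z with
  | zero => simp
  | add s t hs ht => simp only [map_add, hs, ht]
  | tmul r z => simp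

lemma Intertwines.map (φ : R →ₐ[ℂ] S) {b₀ : borelPts R sl2Cartan sl2Root} {b : borelPts R H α}
    (h : Intertwines T b₀ b) : Intertwines T (borelMap _ _ φ b₀) (borelMap _ _ φ b) := by
  intro z
  induction z with
  | zero => simp
  | add s t hs ht => simp only [map_add, hs, ht]
  | tmul s w =>
    have e : s ⊗ₜ[ℂ] w = s • φ.toLinearMap.rTensor sl2 (1 ⊗ₜ[ℂ] w) := by
      simp [TensorProduct.smul_tmul']
    rw [e, lTensor_hom_smul, map_smul, map_smul, lTensor_hom_smul, ← rTensor_lTensor_hom, borelMap_apply,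
      borelMap_apply, endMap_rTensor, endMap_rTensor, h, rTensor_lTensor_hom]

lemma exists_intertwines (D₀ : OperData sl2Triple) (D : OperData T) (hR : SeparatedByPoints R)
    (b₀ : borelPts R sl2Cartan sl2Root) : ∃ b : borelPts R H α, Intertwines T b₀ b := by
  obtain ⟨c₀, hc₀, hcb⟩ := D₀.exists_lieEquiv hR b₀
  obtain ⟨u, r, rfl⟩ := sl2_exists_upTri D₀ hc₀
  refine ⟨D.toBorel hR (c := (D.G.baseChange R).upTri u r) (PrincipalGrading.upTri_isBorel _ _), fun z => ?_⟩
  rw [← hcb]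
  exact (hom_baseChange_upTri D₀ D u r z).symm

lemma IndForm.formGauge_borel [FiniteDimensional ℂ 𝔤] (D₀ : OperData sl2Triple) (D : OperData T)
    (hR : SeparatedByPoints R) {A₀ A₀' : Om R ⊗[ℂ] sl2}
    (hA : IsOperForm sl2Cartan sl2Root A₀) (hA' : IsOperForm sl2Cartan sl2Root A₀')
    {ε : CoefFamily R T} {A A' : Om R ⊗[ℂ] 𝔤} (h : IndForm ε A₀ A) (h' : IndForm ε A₀' A')
    {b₀ : borelPts R sl2Cartan sl2Root} {b : borelPts R H α} (hb : Intertwines T b₀ b)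
    (hg : FormGauge b₀.1.1 A₀ A₀') : FormGauge b.1.1 A A' := by
  obtain ⟨c₀, hc₀, hcb₀⟩ := D₀.exists_lieEquiv hR b₀
  obtain ⟨c, hc, hcb⟩ := D.exists_lieEquiv hR b
  rw [← hcb₀] at hg
  rw [← hcb]
  refine IndForm.formGauge D₀ D hA hA' h h' hc₀ hc (fun z => ?_) hg
  have := hb z
  rw [← hcb, ← hcb₀] at this
  exact this

end Intertwines

variable {Y : Scheme.{0}} {π : Y ⟶ Spec (.of ℂ)}
variable {𝔤 : Type} [LieRing 𝔤] [LieAlgebra ℂ 𝔤] {H : LieSubalgebra ℂ 𝔤}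
  {ι : Type} [Fintype ι] {α : ι → Module.Dual ℂ H} {T : PrincipalTriple H α}

/-- The value on an affine open of an element of `V^𝔤(Y)`. -/
def restrVY (η : VY π T) (U : Y.affineOpens) : CoefFamily (Reg π U) T :=
  fun j => (H0.restr π (j + 1) U).lTensor (T.V j) (η j)

lemma restrVY_map (η : VY π T) {U V : Y.affineOpens} (i : V.1 ≤ U.1) :
    (restrVY η U).map (res π i) = restrVY η V := by
  funext j
  rw [CoefFamily.map, restrVY, restrVY, ← LinearMap.comp_apply, ← LinearMap.lTensor_comp]
  congr 2
  ext ω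
  exact ω.2 U V i

lemma restrVY_add (η η' : VY π T) (U : Y.affineOpens) : restrVY (η + η') U = restrVY η U + restrVY η' U :=
  funext fun j => by simp [restrVY]

lemma restrVY_neg (η : VY π T) (U : Y.affineOpens) : restrVY (-η) U = -restrVY η U :=
  funext fun j => by
    rw [Pi.neg_apply, restrVY, restrVY, ← map_neg]
    rfl

lemma restrVY_sub (η η' : VY π T) (U : Y.affineOpens) :
    restrVY (η - η') U = -restrVY η' U + restrVY η U :=
  funext fun j => by
    rw [Pi.add_apply, Pi.neg_apply, restrVY, restrVY, restrVY, neg_add_eq_sub, ← map_sub]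
    rfl

lemma restrVY_mulX (ω : H0 π 2) (U : Y.affineOpens) :
    restrVY (mulX T ω) U = CoefFamily.single T (H0.restr π 2 U ω) := by
  funext j
  by_cases hj : j = 1
  · subst hj
    rw [CoefFamily.single_one, restrVY, mulX, DirectSum.lof_eq_of, DirectSum.of_eq_same, LinearMap.lTensor_tmul]
  · rw [CoefFamily.single_ne _ hj, restrVY, mulX, DirectSum.lof_eq_of, DirectSum.of_eq_of_ne _ _ _ hj, map_zero]

lemma single_neg {R : Type} [CommRing R] [Algebra ℂ R] (w : ⨂[R]^2 (Om R)) :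
    CoefFamily.single T (-w) = -CoefFamily.single T w := by
  rw [CoefFamily.single, CoefFamily.single, TensorProduct.tmul_neg, Pi.single_neg]

lemma IsInduced.exists_indForm {L : Sl2Oper π} {η : VY π T} {P : Oper π H α} (h : IsInduced T L η P)
    (W : Y.affineOpens) (s : L.sec W.1) :
    ∃ t : P.sec W.1, IndForm (restrVY η W) (L.form W s) (P.form W t) := by
  obtain ⟨φ, -, h⟩ := h
  exact ⟨φ.app (op W.1) s, h W s⟩

variable [SmoothOfRelativeDimension 1 π] [FiniteDimensional ℂ 𝔤]

/-- Because forms determine sections, morphisms preserving forms in the two directions are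
automatically inverse to each other. -/
theorem Oper.isIso_of_forms (D : OperData T) {P Q : Oper π H α}
    (h : ∀ p : Y, ∃ W : Y.affineOpens, p ∈ W.1 ∧ ∃ s t, P.form W s = Q.form W t) : P.IsIso Q := by
  have key : ∀ P Q : Oper π H α,
      (∀ p : Y, ∃ W : Y.affineOpens, p ∈ W.1 ∧ ∃ s t, P.form W s = Q.form W t) →
      ∃ φ : P.sheaf.presheaf ⟶ Q.sheaf.presheaf,
        (∀ (U : Y.Opens) s b, φ.app (op U) (P.act U s b) = Q.act U (φ.app (op U) s) b) ∧
        ∀ (U : Y.affineOpens) s, P.form U s = Q.form U (φ.app (op U.1) s) := by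
    intro P Q h
    obtain ⟨φ, h1, h2⟩ := Oper.exists_morphism D P Q (fun W A A' => A = A') (fun U b b' => b = b')
      (fun W A _ => ⟨A, rfl⟩) (fun W A A' A'' _ h1 h2 => h1.symm.trans h2)
      (fun V W i A A' _ h => by rw [h]) (fun U V i b b' h => by rw [h]) (fun W b => ⟨b, rfl⟩)
      (fun W b b' A A₁ A' A₁' _ _ hb hA h1 h2 => by
        subst hb hA
        exact FormGauge.right_unique D.G.faithful h1 h2) h
    exact ⟨φ, fun U s b => h1 U s b b rfl, h2⟩
  obtain ⟨φ, h1, h2⟩ := key P Q h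
  obtain ⟨ψ, -, h4⟩ := key Q P fun p => by
    obtain ⟨W, hW, s, t, hst⟩ := h p
    exact ⟨W, hW, t, s, hst.symm⟩
  have hcomp : ∀ (P Q : Oper π H α) (φ : P.sheaf.presheaf ⟶ Q.sheaf.presheaf)
      (ψ : Q.sheaf.presheaf ⟶ P.sheaf.presheaf)
      (_ : ∀ (U : Y.affineOpens) s, P.form U s = Q.form U (φ.app (op U.1) s))
      (_ : ∀ (U : Y.affineOpens) s, Q.form U s = P.form U (ψ.app (op U.1) s)), φ ≫ ψ = 𝟙 _ := by
    intro P Q φ ψ h2 h4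
    ext U s
    refine P.ext_forms D (isAffineSieve_all U) fun W hW => ?_
    change P.form W (P.sheaf.presheaf.map (homOfLE hW).op (ψ.app (op U) (φ.app (op U) s))) = _
    have e1 := NatTrans.naturality_apply ψ (homOfLE hW).op (φ.app (op U) s)
    have e2 := NatTrans.naturality_apply φ (homOfLE hW).op s
    rw [← e1, ← e2, ← h4, ← h2]
    rfl
  exact ⟨⟨φ, ψ, hcomp P Q φ ψ h2 h4, hcomp Q P ψ φ h4 h2⟩, h1, fun U s => (h2 U s).symm⟩

theorem isInduced_of_forms (D₀ : OperData sl2Triple) (D : OperData T) {L : Sl2Oper π} {η : VY π T}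
    {P : Oper π H α} (h : ∀ p : Y, ∃ W : Y.affineOpens, p ∈ W.1 ∧ ∃ s t,
      IndForm (restrVY η W) (L.form W s) (P.form W t)) : IsInduced T L η P := by
  obtain ⟨φ, h1, h2⟩ := Oper.exists_morphism D L P (fun W => IndForm (restrVY η W))
    (fun U => Intertwines T) (fun W A₀ hA => IndForm.exists D₀ D hA _)
    (fun W A₀ A A' hA h h' => IndForm.unique D₀ D hA h h')
    (fun V W i A₀ A hA h => restrVY_map η i ▸ h.map D₀ D (res π i) hA (isOperForm_res D₀ i hA))
    (fun U V i b₀ b hb => hb.map (res π i))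
    (fun W b₀ => exists_intertwines D₀ D (separatedByPoints_reg W.1) b₀)
    (fun W b₀ b A₀ A₀' A A' hA hA' hb hi h h' => by
      obtain ⟨A'', hA''⟩ := IndForm.exists D₀ D hA' (restrVY η W)
      have := IndForm.formGauge_borel D₀ D (separatedByPoints_reg W.1) hA hA' hi hA'' hb h
      rwa [FormGauge.right_unique D.G.faithful h' this]) h
  exact ⟨φ, h1, h2⟩

variable (T) in
/-- The connection forms induced from an `sl(2)`-oper. -/
def inducedAtlas (D₀ : OperData sl2Triple) (D : OperData T) (L : Sl2Oper π) (η : VY π T) :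
    OperAtlas π H α where
  carrier W := {A | ∃ s : L.sec W.1, IndForm (restrVY η W) (L.form W s) A}
  isOperForm := by
    rintro W A ⟨s, h⟩
    exact h.isOperForm D₀ D (L.isOperForm W s)
  res_mem := by
    rintro V W i A ⟨s, h⟩
    refine ⟨L.rs i s, ?_⟩
    rw [L.form_rs, ← restrVY_map η i]
    exact h.map D₀ D (res π i) (L.isOperForm V s) (isOperForm_res D₀ i (L.isOperForm V s))
  gauge := by
    rintro W A ⟨s, h⟩ A' ⟨s', h'⟩
    obtain ⟨b₀, rfl, -⟩ := L.simply_transitive W.1 s s'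
    obtain ⟨b, hb⟩ := exists_intertwines D₀ D (separatedByPoints_reg W.1) b₀
    exact ⟨b, IndForm.formGauge_borel D₀ D (separatedByPoints_reg W.1) (L.isOperForm W _)
      (L.isOperForm W _) h h' hb (L.formGauge W s b₀)⟩
  locally_nonempty p := by
    obtain ⟨W, h1, -, ⟨s⟩⟩ := L.exists_sec_nhds (U := ⊤) (p := p) trivial
    obtain ⟨A, hA⟩ := IndForm.exists D₀ D (L.isOperForm W s) (restrVY η W)
    exact ⟨W, h1, A, s, hA⟩

theorem exists_isInduced (D₀ : OperData sl2Triple) (D : OperData T) (L : Sl2Oper π) (η : VY π T) :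
    ∃ P : Oper π H α, IsInduced T L η P := by
  refine ⟨(inducedAtlas T D₀ D L η).toOper D, isInduced_of_forms D₀ D fun p => ?_⟩
  obtain ⟨W, h1, -, ⟨s⟩⟩ := L.exists_sec_nhds (U := ⊤) (p := p) trivial
  obtain ⟨A, hA⟩ := IndForm.exists D₀ D (L.isOperForm W s) (restrVY η W)
  obtain ⟨t, rfl⟩ := OperAtlas.exists_form_eq (E := inducedAtlas T D₀ D L η) D W ⟨s, hA⟩
  exact ⟨W, h1, s, t, hA⟩

theorem IsInduced.isIso (D₀ : OperData sl2Triple) (D : OperData T) {L L' : Sl2Oper π} {η : VY π T}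
    {P P' : Oper π H α} (hL : L.IsIso L') (h : IsInduced T L η P) (h' : IsInduced T L' η P') :
    P.IsIso P' := by
  obtain ⟨ψ, -, hψ⟩ := hL
  refine Oper.isIso_of_forms D fun p => ?_
  obtain ⟨W, h1, -, ⟨s⟩⟩ := L.exists_sec_nhds (U := ⊤) (p := p) trivial
  obtain ⟨t, ht⟩ := h.exists_indForm W s
  obtain ⟨t', ht'⟩ := h'.exists_indForm W (ψ.hom.app (op W.1) s)
  rw [hψ] at ht'
  exact ⟨W, h1, t, t', ht.unique D₀ D (L.isOperForm W s) ht'⟩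

theorem IsInduced.of_isIso (D₀ : OperData sl2Triple) (D : OperData T) {L : Sl2Oper π} {η : VY π T}
    {P P' : Oper π H α} (h : IsInduced T L η P) (hP : P.IsIso P') : IsInduced T L η P' := by
  obtain ⟨ψ, -, hψ⟩ := hP
  refine isInduced_of_forms D₀ D fun p => ?_
  obtain ⟨W, h1, -, ⟨s⟩⟩ := L.exists_sec_nhds (U := ⊤) (p := p) trivial
  obtain ⟨t, ht⟩ := h.exists_indForm W s
  exact ⟨W, h1, s, ψ.hom.app (op W.1) t, (hψ W t).symm ▸ ht⟩

/-- Well-definedness: near every point both opers have a section with form `y + q x - ω x + η` up to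
gauge, the term `-ω x` being counted with the `sl(2)`-oper on one side and with the `V`-part on the
other. `IndForm.comp` identifies the two. -/
theorem IsShift.isIso (D₀ : OperData sl2Triple) (D : OperData T) {L L' : Sl2Oper π} {ω : H0 π 2}
    (hL : IsShift L ω L') {η : VY π T} {P P' : Oper π H α} (h : IsInduced T L' η P)
    (h' : IsInduced T L (η - mulX T ω) P') : P.IsIso P' := by
  refine Oper.isIso_of_forms D fun p => ?_
  obtain ⟨W, h1, -, ⟨s⟩⟩ := L.exists_sec_nhds (U := ⊤) (p := p) trivial
  obtain ⟨s', hs'⟩ := IsInduced.exists_indForm hL W s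
  rw [restrVY_neg, restrVY_mulX, ← single_neg] at hs'
  obtain ⟨t, ht⟩ := h.exists_indForm W s'
  obtain ⟨t', ht'⟩ := h'.exists_indForm W s
  have h2 := hs'.comp D₀ D (L.isOperForm W s) ht
  rw [restrVY_sub, restrVY_mulX, ← single_neg] at ht'
  exact ⟨W, h1, t, t', h2.unique D₀ D (L.isOperForm W s) ht'⟩

theorem exists_map (D₀ : OperData sl2Triple) (D : OperData T) :
    ∃ F : UnderlineOp π T → Op π H α,
      ∀ L η P, F (UnderlineOp.mk T L η) = Quotient.mk _ P ↔ IsInduced T L η P := by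
  choose I hI using fun (L : Sl2Oper π) (η : VY π T) => exists_isInduced D₀ D L η
  let F₀ : Op π sl2Cartan sl2Root × VY π T → Op π H α := fun q =>
    Quotient.liftOn q.1 (fun L => Quotient.mk _ (I L q.2)) fun L L' h =>
      Quotient.sound (IsInduced.isIso D₀ D h (hI L q.2) (hI L' q.2))
  refine ⟨Quot.lift F₀ ?_, fun L η P => ⟨fun h => ?_, fun h => ?_⟩⟩
  · rintro _ _ ⟨L, L', ω, η, hs, rfl, rfl⟩
    exact Quotient.sound (IsShift.isIso D₀ D hs (hI L' η) (hI L _))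
  · exact (hI L η).of_isIso D₀ D (Quotient.exact h)
  · exact Quotient.sound (IsInduced.isIso D₀ D (Oper.IsIso.refl L) (hI L η) h)

/-! ### Transformation of normal forms under a change of generator. -/

section NormalForms

variable {R S : Type} [CommRing R] [Algebra ℂ R] [CommRing S] [Algebra ℂ S]
variable {𝔤 : Type} [LieRing 𝔤] [LieAlgebra ℂ 𝔤] {H : LieSubalgebra ℂ 𝔤}
  {ι : Type} [Fintype ι] {α : ι → Module.Dual ℂ H} {T : PrincipalTriple H α}

lemma OperData.HasCoeffs.right_unique (D : OperData T) {a : Om R} {v : R ⊗[ℂ] 𝔤} {ε ε' : CoefFamily R T}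
    (h : D.HasCoeffs a v ε) (h' : D.HasCoeffs a v ε') : ε = ε' := by
  funext j
  rw [← sub_eq_zero]
  refine eq_zero_of_contract fun ξ => ?_
  obtain ⟨ξ', rfl⟩ := LinearMap.exists_extend ξ
  rw [map_sub, ← h.coef, ← h'.coef, sub_self]

/-- The component of degree `j ≥ 0` of the elements killed by `sig`. -/
def OperData.prV (D : OperData T) (j : ℕ) : LinearMap.ker D.G.sig →ₗ[ℂ] T.V j :=
  (D.G.pr j ∘ₗ (LinearMap.ker D.G.sig).subtype).codRestrict (T.V j) fun z => by
    rw [D.mem_V]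
    refine ⟨by simp [D.G.pr_pr], PrincipalGrading.mem_V.2 ⟨PrincipalGrading.pr_mem_F (by omega) _, ?_⟩⟩
    have hz : D.G.sig z = 0 := z.2
    rw [LinearMap.comp_apply, ← D.G.pr_sig, Submodule.subtype_apply, hz, map_zero]

lemma OperData.exists_coeffs (D : OperData T) (a : Om R) {v : R ⊗[ℂ] 𝔤} (hv : v ∈ (D.G.baseChange R).V) :
    ∃ ε, D.HasCoeffs a v ε := by
  have h1 : D.G.sig.lTensor R v = 0 := (PrincipalGrading.mem_V.1 hv).2
  -- By flatness over `ℂ`, the kernel of `sig` after extension of scalars comes from the kernel of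
  -- `sig` on `𝔤`.
  obtain ⟨t, rfl⟩ := (Module.Flat.lTensor_exact R (LinearMap.exact_subtype_ker_map D.G.sig) v).1 h1
  refine ⟨fun j => TensorProduct.map (D.prV j)
    ((LinearMap.toSpanSingleton R _ (powGen a (j + 1))).restrictScalars ℂ) (TensorProduct.comm ℂ _ _ t),
    hv, fun j ξ => ?_⟩
  clear h1 hv
  induction t with
  | zero => simp
  | add s t hs ht => simp only [map_add, add_smul, hs, ht]
  | tmul r z =>
    simp only [LinearMap.lTensor_tmul, TensorProduct.comm_tmul, TensorProduct.map_tmul, contract_tmul]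
    change formCoef R ξ (r ⊗ₜ D.G.pr j z) • _ = ξ (D.G.pr j z) • (r • powGen a (j + 1))
    rw [formCoef_tmul, smul_assoc]

/-- Splits off the line of `x` from `V`; `V_1` may be larger when `𝔤` is not simple. No canonical
choice is needed. -/
lemma OperData.exists_x_dual (D : OperData T) : ∃ ℓ : Module.Dual ℂ 𝔤, ℓ T.x = 1 ∧ ∀ z, ℓ (D.G.pr 1 z) = ℓ z := by
  have hx : T.x ≠ 0 := T.isSl2Triple.e_ne_zero
  obtain ⟨ℓ, hℓ⟩ := Module.Projective.exists_dual_ne_zero ℂ hx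
  refine ⟨(ℓ T.x)⁻¹ • (ℓ ∘ₗ D.G.pr 1), ?_, fun z => ?_⟩
  · rw [LinearMap.smul_apply, LinearMap.comp_apply, ← D.x_eq, D.G.pr_x, D.x_eq, smul_eq_mul, inv_mul_cancel₀ hℓ]
  · simp [D.G.pr_pr]

lemma formCoef_x (D : OperData T) (ℓ : Module.Dual ℂ 𝔤) (hℓ : ℓ T.x = 1) :
    formCoef R ℓ (D.G.baseChange R).x = 1 := by
  change formCoef R ℓ (1 ⊗ₜ D.G.x) = 1
  rw [formCoef_tmul, D.x_eq, hℓ, one_smul]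

lemma formCoef_pr_one (D : OperData T) {ℓ : Module.Dual ℂ 𝔤} (hℓ : ∀ z, ℓ (D.G.pr 1 z) = ℓ z)
    (v : R ⊗[ℂ] 𝔤) : formCoef R ℓ ((D.G.baseChange R).pr 1 v) = formCoef R ℓ v := by
  change formCoef R ℓ ((D.G.pr 1).lTensor R v) = _
  rw [formCoef_lTensor, show ℓ ∘ₗ D.G.pr 1 = ℓ from LinearMap.ext hℓ]

lemma PrincipalGrading.lie_x_add {E : Type} [LieRing E] [LieAlgebra R E] (G : PrincipalGrading R E) (p q : R) :
    ⁅G.x, p • G.h + q • G.x⁆ = -((p * 2) • G.x) := by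
  have := G.lie_h 1 G.x
  rw [G.pr_x] at this
  rw [lie_add, lie_smul, lie_smul, lie_self, smul_zero, add_zero, ← lie_skew, this, smul_neg, smul_smul]
  norm_num

lemma sl2_eq_smul_x (D₀ : OperData sl2Triple) {v : R ⊗[ℂ] sl2} (hv : v ∈ (D₀.G.baseChange R).V) :
    ∃ q : R, v = q • (D₀.G.baseChange R).x := by
  obtain ⟨p, q, s, rfl⟩ := sl2_tensor_eq D₀ v
  have hs : s • (D₀.G.baseChange R).y = 0 :=
    (sl2_pr D₀ p q s).2.2.symm.trans (PrincipalGrading.mem_F.1 (PrincipalGrading.mem_V.1 hv).1 (-1) (by norm_num))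
  have hl := PrincipalGrading.lie_x_of_mem_V hv
  rw [hs, add_zero, PrincipalGrading.lie_x_add, neg_eq_zero] at hl
  have hp : p * 2 = 0 := sl2_smul_x_inj D₀ (hl.trans (zero_smul _ _).symm)
  have hp' : p = 0 := by
    have h2 : (2⁻¹ : ℂ) • (p * 2) = p := by
      rw [mul_two, ← two_smul ℂ, smul_smul]
      norm_num
    rw [← h2, hp, smul_zero]
  exact ⟨q, by rw [hs, hp', zero_smul, zero_add, add_zero]⟩

/-- The oper form `a (y + v)`. -/
abbrev OperData.nf (D : OperData T) (a : Om R) (v : R ⊗[ℂ] 𝔤) : Om R ⊗[ℂ] 𝔤 :=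
  mulForm a ((D.G.baseChange R).y + v)

lemma OperData.isOperForm_nf (D : OperData T) {a : Om R} (ha : IsGen a) {v : R ⊗[ℂ] 𝔤}
    (hv : v ∈ (D.G.baseChange R).V) : IsOperForm H α (D.nf a v) := by
  rw [D.isOperForm_mulForm_iff ha]
  refine D.isOperVec_of_sub_mem ?_
  rw [add_sub_cancel_left]
  exact (PrincipalGrading.mem_V.1 hv).1

lemma OperData.nf_map (D : OperData T) (φ : R →ₐ[ℂ] S) (a : Om R) (v : R ⊗[ℂ] 𝔤) :
    (omMap φ).rTensor 𝔤 (D.nf a v) = D.nf (omMap φ a) (φ.toLinearMap.rTensor 𝔤 v) := by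
  rw [OperData.nf, rTensor_omMap_mulForm, map_add]
  congr 2
  exact rTensor_one_tmul φ D.G.y

lemma smul_x_map (D : OperData T) (φ : R →ₐ[ℂ] S) (q : R) :
    φ.toLinearMap.rTensor 𝔤 (q • (D.G.baseChange R).x) = φ q • (D.G.baseChange S).x := by
  rw [rTensor_smul]
  congr 1
  exact rTensor_one_tmul φ D.G.x

lemma indForm_nf_iff (D₀ : OperData sl2Triple) (D : OperData T) {a : Om R} (ha : IsGen a) (q : R)
    (ε : CoefFamily R T) (A : Om R ⊗[ℂ] 𝔤) :
    IndForm ε (D₀.nf a (q • (D₀.G.baseChange R).x)) A ↔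
      ∃ v, D.HasCoeffs a v ε ∧ A = D.nf a (q • (D.G.baseChange R).x + v) := by
  have hx : q • (D₀.G.baseChange R).x ∈ (D₀.G.baseChange R).V :=
    Submodule.smul_mem _ _ PrincipalGrading.x_mem_V
  rw [indForm_iff D₀ D (D₀.isOperForm_nf ha hx) (a := a) (by
    have := (D₀.sl2_mem_iff ha ((D₀.G.baseChange R).y + q • (D₀.G.baseChange R).x) 1).2 (by
      rw [one_smul, add_sub_cancel_left]
      exact (PrincipalGrading.mem_V.1 hx).1)
    rwa [one_smul] at this)]
  have e : T.hom.lTensor (Om R) (D₀.nf a (q • (D₀.G.baseChange R).x)) =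
      D.nf a (q • (D.G.baseChange R).x) := by
    rw [OperData.nf, ← mulForm_baseChange, map_add, map_smul, hom_baseChange_x D₀ D, hom_baseChange_y D₀ D]
  simp only [e, OperData.nf, ← map_add, add_assoc]

/-- The function `c` with `2 c = u⁻¹ du / a`. -/
def IsGen.half {a : Om R} (ha : IsGen a) (u : Rˣ) : R := (2⁻¹ : ℂ) • ((u⁻¹ : Rˣ) * ha.der u : R)

lemma IsGen.two_mul_half {a : Om R} (ha : IsGen a) (u : Rˣ) : 2 * ha.half u = (u⁻¹ : Rˣ) * ha.der u := by
  rw [IsGen.half, mul_smul_comm, two_mul, ← two_smul ℂ, smul_smul]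
  norm_num

/-- The coefficient at `x` in the change of generator. -/
def IsGen.kappa {a : Om R} (ha : IsGen a) (u : Rˣ) : R :=
  ha.half u * ha.half u * (u⁻¹ : Rˣ) + ha.der (ha.half u * (u⁻¹ : Rˣ))

/-- The normal form for the generator `u a` that corresponds to the normal form `v` for `a`. -/
def OperData.chg (D : OperData T) {a : Om R} (ha : IsGen a) (u : Rˣ) (v : R ⊗[ℂ] 𝔤) : R ⊗[ℂ] 𝔤 :=
  ((u⁻¹ : Rˣ) : R) • (((D.G.baseChange R).upTri u (ha.half u * (u⁻¹ : Rˣ))).symm v +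
    ha.kappa u • (D.G.baseChange R).x)

lemma OperData.formGauge_chg [FiniteDimensional ℂ 𝔤] (D : OperData T) {a : Om R} (ha : IsGen a) (u : Rˣ) (v : R ⊗[ℂ] 𝔤) :
    FormGauge (lieUnit ((D.G.baseChange R).upTri u (ha.half u * (u⁻¹ : Rˣ)))).1 (D.nf a v)
      (D.nf ((u : R) • a) (D.chg ha u v)) := by
  have h := PrincipalGrading.upTri_gauge (D.isDer ha.der) u (ha.two_mul_half u) (v := v)
  rw [← formGauge_mulForm_iff ha] at h
  convert h using 1
  rw [OperData.nf, smul_mulForm, OperData.chg, smul_add, smul_smul, Units.mul_inv, one_smul, add_assoc]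
  rfl

/-- The component in degree `k` scales like the coefficient of a section of `Ω^{⊗ (k+1)}`; the
inhomogeneous term lies along `x`, and its coefficient depends only on `a` and `u`, not on `𝔤`. -/
lemma OperData.pr_chg (D : OperData T) {a : Om R} (ha : IsGen a) (u : Rˣ) {v : R ⊗[ℂ] 𝔤}
    (hv : v ∈ (D.G.baseChange R).V) (k : ℤ) : (D.G.baseChange R).pr k (D.chg ha u v) =
      ((u ^ (-(k + 1)) : Rˣ) : R) • (D.G.baseChange R).pr k v +
        (((u⁻¹ : Rˣ) : R) * ha.kappa u) • (D.G.baseChange R).pr k (D.G.baseChange R).x := by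
  rw [OperData.chg, map_smul, map_add, PrincipalGrading.pr_upTri_symm_of_mem_V _ _ hv, map_smul, smul_add,
    smul_smul, smul_smul, ← Units.val_mul, ← zpow_neg_one, ← zpow_add]
  congr 4
  ring

lemma OperData.chg_mem_V (D : OperData T) {a : Om R} (ha : IsGen a) (u : Rˣ) {v : R ⊗[ℂ] 𝔤}
    (hv : v ∈ (D.G.baseChange R).V) : D.chg ha u v ∈ (D.G.baseChange R).V :=
  Submodule.smul_mem _ _ (Submodule.add_mem _ (PrincipalGrading.upTri_symm_mem_V _ _ hv)
    (Submodule.smul_mem _ _ PrincipalGrading.x_mem_V))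

lemma OperData.formCoef_chg (D : OperData T) {a : Om R} (ha : IsGen a) (u : Rˣ) {v : R ⊗[ℂ] 𝔤}
    (hv : v ∈ (D.G.baseChange R).V) {ℓ : Module.Dual ℂ 𝔤} (hx : ℓ T.x = 1) (hℓ : ∀ z, ℓ (D.G.pr 1 z) = ℓ z) :
    formCoef R ℓ (D.chg ha u v) = ((u ^ (-(1 + 1) : ℤ) : Rˣ) : R) * formCoef R ℓ v +
      ((u⁻¹ : Rˣ) : R) * ha.kappa u := by
  rw [← formCoef_pr_one D hℓ, D.pr_chg ha u hv, map_add, formCoef_smul, formCoef_smul, formCoef_pr_one D hℓ,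
    formCoef_pr_one D hℓ, formCoef_x D ℓ hx, mul_one]

/-- The part of `v` that is complementary to `x`. -/
def OperData.compl (D : OperData T) (ℓ : Module.Dual ℂ 𝔤) (v : R ⊗[ℂ] 𝔤) : R ⊗[ℂ] 𝔤 :=
  v - formCoef R ℓ v • (D.G.baseChange R).x

lemma OperData.compl_mem_V (D : OperData T) (ℓ : Module.Dual ℂ 𝔤) {v : R ⊗[ℂ] 𝔤}
    (hv : v ∈ (D.G.baseChange R).V) : D.compl ℓ v ∈ (D.G.baseChange R).V :=
  Submodule.sub_mem _ hv (Submodule.smul_mem _ _ PrincipalGrading.x_mem_V)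

/-- Subtracting the `x`-part removes the inhomogeneous term of `pr_chg`. The rest transforms as a
section and does not depend on the generator. -/
lemma OperData.hasCoeffs_chg (D : OperData T) {a : Om R} (ha : IsGen a) (u : Rˣ) {v : R ⊗[ℂ] 𝔤}
    (hv : v ∈ (D.G.baseChange R).V) {ℓ : Module.Dual ℂ 𝔤} (hx : ℓ T.x = 1) (hℓ : ∀ z, ℓ (D.G.pr 1 z) = ℓ z)
    {ε : CoefFamily R T} (h : D.HasCoeffs a (D.compl ℓ v) ε) :
    D.HasCoeffs ((u : R) • a) (D.compl ℓ (D.chg ha u v)) ε := by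
  refine OperData.HasCoeffs.change h u (D.compl_mem_V ℓ (D.chg_mem_V ha u hv)) fun j => ?_
  have hu : ((u : R) ^ (j + 1)) * ((u ^ (-((j : ℤ) + 1)) : Rˣ) : R) = 1 := by
    rw [← Units.val_pow_eq_pow_val, ← Units.val_mul, ← zpow_natCast, ← zpow_add]
    simp
  rw [OperData.compl, OperData.compl, map_sub, map_sub, D.pr_chg ha u hv, D.formCoef_chg ha u hv hx hℓ, map_smul,
    map_smul, add_smul, add_sub_add_comm, sub_self,
    add_zero]
  have hxp : (D.G.baseChange R).pr j (D.G.baseChange R).x =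
      if (j : ℤ) = 1 then (D.G.baseChange R).x else 0 := by
    rw [← (D.G.baseChange R).pr_x, (D.G.baseChange R).pr_pr]
  by_cases hj : (j : ℤ) = 1
  · rw [hxp, if_pos hj, smul_sub, smul_smul, hu, one_smul, smul_smul, ← mul_assoc]
    obtain rfl : j = 1 := by exact_mod_cast hj
    have hu' : (u : R) ^ (1 + 1) * ((u ^ (-(1 + 1) : ℤ) : Rˣ) : R) = 1 := by exact_mod_cast hu
    rw [hu', one_mul]
  · rw [hxp, if_neg hj]
    simp only [smul_zero, sub_zero]
    rw [smul_smul, hu, one_smul]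

end NormalForms

/-! ### Injectivity and surjectivity. -/

variable {Y : Scheme.{0}} {π : Y ⟶ Spec (.of ℂ)} [SmoothOfRelativeDimension 1 π]
variable {𝔤 : Type} [LieRing 𝔤] [LieAlgebra ℂ 𝔤] [FiniteDimensional ℂ 𝔤] {H : LieSubalgebra ℂ 𝔤}
  {ι : Type} [Fintype ι] {α : ι → Module.Dual ℂ H} {T : PrincipalTriple H α}

/-- `v` is the normal form of the oper `P` over `W` for the generator `a`. -/
structure OperData.IsNF (D : OperData T) (P : Oper π H α) (W : Y.affineOpens) (a : Om (Reg π W))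
    (v : Reg π W ⊗[ℂ] 𝔤) : Prop where
  gen : IsGen a
  mem : v ∈ (D.G.baseChange (Reg π W)).V
  exists_sec : ∃ s : P.sec W.1, P.form W s = D.nf a v

lemma OperData.exists_isNF (D : OperData T) (P : Oper π H α) {W : Y.affineOpens} (s : P.sec W.1)
    {a : Om (Reg π W)} (ha : IsGen a) : ∃ v, D.IsNF P W a v := by
  obtain ⟨b, v, hb, hv, hg⟩ := D.exists_normalForm ha (P.isOperForm W s)
  refine ⟨v, ha, hv, P.act W.1 s (D.toBorel (separatedByPoints_reg W.1) hb), ?_⟩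
  exact FormGauge.right_unique D.G.faithful (P.formGauge W s _) hg

lemma OperData.exists_isNF_nhds (D : OperData T) (P : Oper π H α) (p : Y) :
    ∃ (W : Y.affineOpens) (a : Om (Reg π W)) (v : Reg π W ⊗[ℂ] 𝔤), p ∈ W.1 ∧ D.IsNF P W a v := by
  obtain ⟨W, h1, -, ⟨s⟩⟩ := P.exists_sec_nhds (U := ⊤) (p := p) trivial
  obtain ⟨a, ha⟩ := D.exists_isGen (P.isOperForm W s)
  obtain ⟨v, hv⟩ := D.exists_isNF P s ha
  exact ⟨W, a, v, h1, hv⟩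

lemma OperData.IsNF.res {D : OperData T} {P : Oper π H α} {V W : Y.affineOpens} (i : W.1 ≤ V.1)
    {a : Om (Reg π V)} {v : Reg π V ⊗[ℂ] 𝔤} (h : D.IsNF P V a v) :
    D.IsNF P W (omMap (Opers.res π i) a) (resVec π 𝔤 i v) := by
  obtain ⟨s, hs⟩ := h.exists_sec
  refine ⟨h.gen.map (etale_res i), rTensor_mem_V (Opers.res π i) h.mem, P.rs i s, ?_⟩
  rw [P.form_rs, hs]
  exact D.nf_map _ _ _

lemma OperData.IsNF.unique {D : OperData T} {P : Oper π H α} {W : Y.affineOpens} {a : Om (Reg π W)}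
    {v v' : Reg π W ⊗[ℂ] 𝔤} (h : D.IsNF P W a v) (h' : D.IsNF P W a v') : v = v' := by
  obtain ⟨s, hs⟩ := h.exists_sec
  obtain ⟨s', hs'⟩ := h'.exists_sec
  obtain ⟨b, rfl, -⟩ := P.simply_transitive W.1 s s'
  have h1 := P.formGauge W s b
  obtain ⟨c, hc, hcb⟩ := D.exists_lieEquiv (separatedByPoints_reg W.1) b
  rw [hs, hs', ← hcb] at h1
  exact (D.normalForm_unique h.gen h.mem h'.mem hc h1).2

lemma OperData.IsNF.chg {D : OperData T} {P : Oper π H α} {W : Y.affineOpens} {a : Om (Reg π W)}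
    {v : Reg π W ⊗[ℂ] 𝔤} (h : D.IsNF P W a v) (u : (Reg π W)ˣ) :
    D.IsNF P W ((u : Reg π W) • a) (D.chg h.gen u v) := by
  obtain ⟨s, hs⟩ := h.exists_sec
  refine ⟨h.gen.smul_unit u, D.chg_mem_V h.gen u h.mem, P.act W.1 s
    (D.toBorel (separatedByPoints_reg W.1) (PrincipalGrading.upTri_isBorel u
      (h.gen.half u * (u⁻¹ : (Reg π W)ˣ)))), ?_⟩
  refine FormGauge.right_unique D.G.faithful (P.formGauge W s _) ?_
  rw [hs]
  exact D.formGauge_chg h.gen u v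

lemma OperData.IsNF.exists_chg {D : OperData T} {P : Oper π H α} {W : Y.affineOpens} {a a' : Om (Reg π W)}
    {v v' : Reg π W ⊗[ℂ] 𝔤} (h : D.IsNF P W a v) (h' : D.IsNF P W a' v') :
    ∃ u : (Reg π W)ˣ, a' = (u : Reg π W) • a ∧ v' = D.chg h.gen u v := by
  obtain ⟨u, rfl⟩ := h.gen.exists_unit h'.gen
  exact ⟨u, rfl, h'.unique (h.chg u)⟩

lemma VY_eq_zero {δ : VY π T} (h : ∀ p : Y, ∃ W : Y.affineOpens, p ∈ W.1 ∧ restrVY δ W = 0) : δ = 0 := by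
  refine DFinsupp.ext fun j => eq_zero_of_contract fun ξ => ?_
  refine Subtype.ext (funext fun U => ?_)
  have hS : IsAffineSieve U.1 {W | W.1 ≤ U.1 ∧ restrVY δ W = 0} := by
    refine IsAffineSieve.of_locally (fun V W i _ hV => ?_) fun p hp => ?_
    · rw [← restrVY_map δ i, hV]
      exact funext fun j => map_zero _
    · obtain ⟨V, h1, h2⟩ := h p
      obtain ⟨W, h3, h4⟩ := exists_affine_le (U := V.1 ⊓ U.1) ⟨h1, hp⟩
      refine ⟨W, h3, h4.trans inf_le_right, ?_⟩
      rw [← restrVY_map δ (h4.trans inf_le_left), h2]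
      exact funext fun j => map_zero _
  refine hS.omPow_ext fun W hW => ?_
  rw [(contract _ ξ (δ j)).2 U W hW.1]
  have h1 := contract_lTensor ξ (H0.restr π (j + 1) W) (δ j)
  have h2 : (H0.restr π (j + 1) W).lTensor (T.V j) (δ j) = 0 := congrFun hW.2 j
  rw [h2, map_zero] at h1
  exact h1.symm.trans (map_zero _).symm

/-- Injectivity. Locally `Lᵢ` has normal form `y + qᵢ x`, so `P` has the normal forms `y + qᵢ x +
wᵢ` for the same generator; by uniqueness `w₁ - w₂ = (q₂ - q₁) x`. So `η₁ - η₂` lies along `x`, and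
its coefficient is globally defined. -/
theorem exists_isShift (D₀ : OperData sl2Triple) (D : OperData T) {L₁ L₂ : Sl2Oper π} {η₁ η₂ : VY π T}
    {P : Oper π H α} (h₁ : IsInduced T L₁ η₁ P) (h₂ : IsInduced T L₂ η₂ P) :
    ∃ ω : H0 π 2, IsShift L₁ ω L₂ ∧ η₁ = η₂ - mulX T ω := by
  obtain ⟨ℓ, hx, -⟩ := D.exists_x_dual
  have key : ∀ p : Y, ∃ (W : Y.affineOpens) (a : Om (Reg π W)) (q₁ q₂ : Reg π W) (s₁ : L₁.sec W.1)
      (s₂ : L₂.sec W.1), p ∈ W.1 ∧ IsGen a ∧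
      L₁.form W s₁ = D₀.nf a (q₁ • (D₀.G.baseChange _).x) ∧
      L₂.form W s₂ = D₀.nf a (q₂ • (D₀.G.baseChange _).x) ∧
      restrVY η₁ W = CoefFamily.single T ((q₂ - q₁) • powGen a 2) + restrVY η₂ W := by
    intro p
    obtain ⟨W₁, h1, -, ⟨s₁⟩⟩ := L₁.exists_sec_nhds (U := ⊤) (p := p) trivial
    obtain ⟨W, hp, hW, ⟨s₂⟩⟩ := L₂.exists_sec_nhds h1
    obtain ⟨a, ha⟩ := D₀.exists_isGen (L₂.isOperForm W s₂)
    obtain ⟨v₁, -, hv₁, s₁', hs₁⟩ := D₀.exists_isNF L₁ (L₁.rs hW s₁) ha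
    obtain ⟨v₂, -, hv₂, s₂', hs₂⟩ := D₀.exists_isNF L₂ s₂ ha
    obtain ⟨q₁, rfl⟩ := sl2_eq_smul_x D₀ hv₁
    obtain ⟨q₂, rfl⟩ := sl2_eq_smul_x D₀ hv₂
    refine ⟨W, a, q₁, q₂, s₁', s₂', hp, ha, hs₁, hs₂, ?_⟩
    obtain ⟨t₁, ht₁⟩ := h₁.exists_indForm W s₁'
    obtain ⟨t₂, ht₂⟩ := h₂.exists_indForm W s₂'
    rw [hs₁, indForm_nf_iff D₀ D ha] at ht₁
    rw [hs₂, indForm_nf_iff D₀ D ha] at ht₂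
    obtain ⟨w₁, hw₁, hf₁⟩ := ht₁
    obtain ⟨w₂, hw₂, hf₂⟩ := ht₂
    have hxV : ∀ q : Reg π W, q • (D.G.baseChange (Reg π W)).x ∈ (D.G.baseChange (Reg π W)).V := fun q =>
      Submodule.smul_mem _ _ PrincipalGrading.x_mem_V
    have hn₁ : D.IsNF P W a _ := ⟨ha, Submodule.add_mem _ (hxV q₁) hw₁.mem, t₁, hf₁⟩
    have hn₂ : D.IsNF P W a _ := ⟨ha, Submodule.add_mem _ (hxV q₂) hw₂.mem, t₂, hf₂⟩
    have he : w₁ = (q₂ - q₁) • (D.G.baseChange (Reg π W)).x + w₂ := by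
      have := hn₁.unique hn₂
      rw [sub_smul, sub_add_eq_add_sub, ← this, add_sub_cancel_left]
    rw [he] at hw₁
    exact OperData.HasCoeffs.right_unique D hw₁ ((D.hasCoeffs_single a (q₂ - q₁)).add hw₂)
  -- The local value of `ω` is `-(q₂ - q₁) a^{⊗ 2}`; the sign reflects that `L + ω` has connection
  -- `∇ - ω`.
  let ω : H0 π 2 := -contract (H0 π 2) (ℓ ∘ₗ (T.V ((1 : ℕ) : ℤ)).subtype) ((η₁ - η₂) 1)
  have hω : ∀ (W : Y.affineOpens) (w : ⨂[Reg π W]^2 (Om (Reg π W))),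
      restrVY η₁ W = CoefFamily.single T w + restrVY η₂ W → H0.restr π 2 W ω = -w := by
    intro W w h
    have h1 : restrVY (η₁ - η₂) W = CoefFamily.single T w := by
      rw [restrVY_sub, h]
      abel
    have h2 := contract_lTensor (ℓ ∘ₗ (T.V ((1 : ℕ) : ℤ)).subtype) (H0.restr π 2 W) ((η₁ - η₂) 1)
    have h3 : (H0.restr π 2 W).lTensor (T.V ((1 : ℕ) : ℤ)) ((η₁ - η₂) 1) = _ := congrFun h1 1
    rw [h3, CoefFamily.single_one, contract_tmul] at h2
    rw [map_neg, ← h2]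
    simp [hx]
  refine ⟨ω, isInduced_of_forms D₀ D₀ fun p => ?_, ?_⟩
  · obtain ⟨W, a, q₁, q₂, s₁, s₂, hp, ha, hs₁, hs₂, h⟩ := key p
    refine ⟨W, hp, s₁, s₂, ?_⟩
    rw [hs₁, hs₂, indForm_nf_iff D₀ D₀ ha, restrVY_neg, restrVY_mulX, hω W _ h, single_neg, neg_neg]
    refine ⟨_, D₀.hasCoeffs_single a (q₂ - q₁), ?_⟩
    rw [← add_smul, add_sub_cancel]
  · rw [eq_sub_iff_add_eq, ← sub_eq_zero]
    refine VY_eq_zero fun p => ?_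
    obtain ⟨W, a, q₁, q₂, s₁, s₂, hp, ha, hs₁, hs₂, h⟩ := key p
    refine ⟨W, hp, ?_⟩
    rw [restrVY_sub, restrVY_add, restrVY_mulX, hω W _ h, single_neg, h]
    abel

/-- Contracting with a functional on `V_j` gives local sections of `Ω^{⊗ (j+1)}`, which glue. A
basis of each of the finitely many nonzero `V_j` reassembles them. -/
theorem exists_glue_VY (D : OperData T) (E : ∀ W : Y.affineOpens, CoefFamily (Reg π W) T → Prop)
    (huniq : ∀ W ε ε', E W ε → E W ε' → ε = ε')
    (hmap : ∀ (V W : Y.affineOpens) (i : W.1 ≤ V.1) ε, E V ε → E W (ε.map (res π i)))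
    (hloc : ∀ p : Y, ∃ W : Y.affineOpens, p ∈ W.1 ∧ ∃ ε, E W ε) :
    ∃ η : VY π T, ∀ W ε, E W ε → restrVY η W = ε := by
  have hS : ∀ U : Y.affineOpens, IsAffineSieve U.1 {W | W.1 ≤ U.1 ∧ ∃ ε, E W ε} := fun U => by
    refine IsAffineSieve.of_locally (fun V W i _ hV => ?_) fun p hp => ?_
    · obtain ⟨ε, hε⟩ := hV
      exact ⟨_, hmap V W i ε hε⟩
    · obtain ⟨V, h1, ε, h2⟩ := hloc p
      obtain ⟨W, h3, h4⟩ := exists_affine_le (U := V.1 ⊓ U.1) ⟨h1, hp⟩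
      exact ⟨W, h3, h4.trans inf_le_right, _, hmap V W (h4.trans inf_le_left) ε h2⟩
  have hω : ∀ (j : ℕ) (ξ : Module.Dual ℂ (T.V j)), ∃ ω : H0 π (j + 1), ∀ W ε, E W ε →
      H0.restr π (j + 1) W ω = contract _ ξ (ε j) := by
    intro j ξ
    have hU : ∀ U : Y.affineOpens, ∃ x : ⨂[Reg π U]^(j + 1) (Om (Reg π U)), ∀ (W : Y.affineOpens)
        (i : W.1 ≤ U.1) ε, E W ε → omPowMap (res π i) (j + 1) x = contract _ ξ (ε j) := fun U => by
      obtain ⟨x, hx⟩ := (hS U).omPow_glue (k := j + 1)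
        (fun W hW => contract _ ξ (hW.2.choose j)) fun W hW W' i => by
          rw [← contract_lTensor]
          exact congrArg (contract _ ξ) (congrFun (huniq W' _ _ (hmap W W' i _ hW.2.choose_spec)
            ((hS U).down W hW W' i).2.choose_spec) j)
      refine ⟨x, fun W i ε hε => (hx W ⟨i, ε, hε⟩).trans ?_⟩
      exact congrArg (contract _ ξ) (congrFun (huniq W _ _ (Exists.choose_spec ⟨ε, hε⟩) hε) j)
    choose x hx using hU
    refine ⟨⟨x, fun U V i => (hS V).omPow_ext fun W hW => ?_⟩, fun W ε hε => ?_⟩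
    · obtain ⟨h1, ε, h2⟩ := hW
      rw [omPowMap_comp, res_comp, hx U W (h1.trans i) ε h2, hx V W h1 ε h2]
    · exact (hS W).omPow_ext fun W' hW' =>
        (hx W W' hW'.1 _ (hmap W W' hW'.1 ε hε)).trans (contract_lTensor ξ _ (ε j))
  choose ω hω using hω
  let e := fun j : ℕ => Module.finBasis ℂ (T.V j)
  let η : VY π T := DirectSum.mk (fun j : ℕ => T.V j ⊗[ℂ] H0 π (j + 1)) (Finset.range (D.G.bound + 1))
    fun j => ∑ i, e j i ⊗ₜ[ℂ] ω j ((e j).coord i)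
  refine ⟨η, fun W ε hε => funext fun j => ?_⟩
  by_cases hj : j ∈ Finset.range (D.G.bound + 1)
  · have h1 : η j = ∑ i, e j i ⊗ₜ[ℂ] ω j ((e j).coord i) := DirectSum.mk_apply_of_mem hj
    rw [restrVY, h1, ← sub_eq_zero]
    refine eq_zero_of_contract fun ξ => ?_
    rw [map_sum, map_sub, map_sum, sub_eq_zero]
    simp only [LinearMap.lTensor_tmul, contract_tmul, hω j _ W ε hε]
    generalize ε j = t
    induction t with
    | zero => simp
    | add s t hs ht => simp only [map_add, smul_add, Finset.sum_add_distrib, hs, ht]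
    | tmul w m =>
      simp only [contract_tmul]
      conv_rhs => rw [← (e j).sum_repr w, map_sum, Finset.sum_smul]
      refine Finset.sum_congr rfl fun i _ => ?_
      rw [map_smul, smul_assoc, smul_comm]
      rfl
  · haveI := D.subsingleton_V (j := j) (by simpa using hj)
    have hz : ∀ t : T.V j ⊗[ℂ] ⨂[Reg π W]^(j + 1) (Om (Reg π W)), t = 0 := fun t => by
      induction t with
      | zero => rfl
      | add s t hs ht => rw [hs, ht, add_zero]
      | tmul w m => rw [Subsingleton.elim w 0, TensorProduct.zero_tmul]
    rw [hz (restrVY η W j), hz (ε j)]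

/-- The connection forms of the `sl(2)`-oper underlying an oper. -/
def sl2Atlas (D₀ : OperData sl2Triple) (D : OperData T) (P : Oper π H α) {ℓ : Module.Dual ℂ 𝔤}
    (hx : ℓ T.x = 1) (hℓ : ∀ z, ℓ (D.G.pr 1 z) = ℓ z) : OperAtlas π sl2Cartan sl2Root where
  carrier W := {A | ∃ a v, D.IsNF P W a v ∧
    A = D₀.nf a (formCoef (Reg π W) ℓ v • (D₀.G.baseChange (Reg π W)).x)}
  isOperForm := by
    rintro W _ ⟨a, v, h, rfl⟩
    exact D₀.isOperForm_nf h.gen (Submodule.smul_mem _ _ PrincipalGrading.x_mem_V)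
  res_mem := by
    rintro V W i _ ⟨a, v, h, rfl⟩
    refine ⟨_, _, h.res i, ?_⟩
    rw [resForm, D₀.nf_map, smul_x_map, resVec, formCoef_map]
    rfl
  gauge := by
    rintro W _ ⟨a, v, h, rfl⟩ _ ⟨a', v', h', rfl⟩
    obtain ⟨u, rfl, rfl⟩ := h.exists_chg h'
    have hb := PrincipalGrading.upTri_isBorel (G := D₀.G.baseChange (Reg π W)) u
      (h.gen.half u * (u⁻¹ : (Reg π W)ˣ))
    refine ⟨D₀.toBorel (separatedByPoints_reg W.1) hb, ?_⟩
    have hg := D₀.formGauge_chg h.gen u (formCoef (Reg π W) ℓ v • (D₀.G.baseChange (Reg π W)).x)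
    have hxV : formCoef (Reg π W) ℓ v • (D₀.G.baseChange (Reg π W)).x ∈ (D₀.G.baseChange (Reg π W)).V :=
      Submodule.smul_mem _ _ PrincipalGrading.x_mem_V
    -- The `x`-coefficient `q` obeys the same law `u⁻² q + u⁻¹ κ` in `𝔤` and in `sl(2)`, where `κ`
    -- is `kappa`.
    have he : D₀.chg h.gen u (formCoef (Reg π W) ℓ v • (D₀.G.baseChange (Reg π W)).x) =
        formCoef (Reg π W) ℓ (D.chg h.gen u v) • (D₀.G.baseChange (Reg π W)).x := by
      obtain ⟨q, hq⟩ := sl2_eq_smul_x D₀ (D₀.chg_mem_V h.gen u hxV)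
      have h1 := D₀.pr_chg h.gen u hxV 1
      rw [hq, map_smul, map_smul, (D₀.G.baseChange (Reg π W)).pr_x, smul_smul, ← add_smul] at h1
      rw [hq, h1, D.formCoef_chg h.gen u h.mem hx hℓ]
    rw [he] at hg
    exact hg
  locally_nonempty p := by
    obtain ⟨W, a, v, hp, h⟩ := D.exists_isNF_nhds P p
    exact ⟨W, hp, _, a, v, h, rfl⟩

/-- Surjectivity. The `x`-coefficients of the local normal forms of `P` form an atlas of an
`sl(2)`-oper, and the complementary parts are independent of the generator and glue to `η`. -/
theorem exists_isInduced_eq (D₀ : OperData sl2Triple) (D : OperData T) (P : Oper π H α) :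
    ∃ (L : Sl2Oper π) (η : VY π T), IsInduced T L η P := by
  obtain ⟨ℓ, hx, hℓ⟩ := D.exists_x_dual
  obtain ⟨η, hη⟩ := exists_glue_VY D
    (fun W ε => ∃ a v, D.IsNF P W a v ∧ D.HasCoeffs a (D.compl ℓ v) ε)
    (fun W ε ε' hε hε' => by
      obtain ⟨a, v, h, hc⟩ := hε
      obtain ⟨a', v', h', hc'⟩ := hε'
      obtain ⟨u, rfl, rfl⟩ := h.exists_chg h'
      exact OperData.HasCoeffs.right_unique D (D.hasCoeffs_chg h.gen u h.mem hx hℓ hc) hc')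
    (fun V W i ε hε => by
      obtain ⟨a, v, h, hc⟩ := hε
      refine ⟨_, _, h.res i, ?_⟩
      have := hc.map (res π i)
      rw [OperData.compl, map_sub, smul_x_map, ← AlgHom.toLinearMap_apply, ← formCoef_map] at this
      exact this)
    (fun p => by
      obtain ⟨W, a, v, hp, h⟩ := D.exists_isNF_nhds P p
      obtain ⟨ε, hε⟩ := D.exists_coeffs a (D.compl_mem_V ℓ h.mem)
      exact ⟨W, hp, ε, a, v, h, hε⟩)
  refine ⟨(sl2Atlas D₀ D P hx hℓ).toOper D₀, η, isInduced_of_forms D₀ D fun p => ?_⟩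
  obtain ⟨W, a, v, hp, h⟩ := D.exists_isNF_nhds P p
  obtain ⟨ε, hε⟩ := D.exists_coeffs a (D.compl_mem_V ℓ h.mem)
  obtain ⟨s, hs⟩ := OperAtlas.exists_form_eq (E := sl2Atlas D₀ D P hx hℓ) D₀ W ⟨a, v, h, rfl⟩
  obtain ⟨t, ht⟩ := h.exists_sec
  refine ⟨W, hp, s, t, ?_⟩
  rw [hs, ht, indForm_nf_iff D₀ D h.gen, hη W ε ⟨a, v, h, hε⟩]
  exact ⟨_, hε, by rw [OperData.compl, add_sub_cancel]⟩

theorem exists_bijective_map (D₀ : OperData sl2Triple) (D : OperData T) :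
    ∃ F : UnderlineOp π T → Op π H α,
      (∀ L η P, F (UnderlineOp.mk T L η) = Quotient.mk _ P ↔ IsInduced T L η P) ∧ Function.Bijective F := by
  obtain ⟨F, hF⟩ := exists_map (π := π) D₀ D
  refine ⟨F, hF, ?_, ?_⟩
  · rintro ⟨⟨L₁⟩, η₁⟩ ⟨⟨L₂⟩, η₂⟩ h
    obtain ⟨P, hP⟩ := Quotient.exists_rep (F (UnderlineOp.mk T L₁ η₁))
    obtain ⟨ω, hs, rfl⟩ := exists_isShift D₀ D ((hF L₁ η₁ P).1 hP.symm)
      ((hF L₂ η₂ P).1 (hP.trans h).symm)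
    exact (Quot.sound ⟨L₁, L₂, ω, η₂, hs, rfl, rfl⟩).symm
  · intro Q
    obtain ⟨P, rfl⟩ := Quotient.exists_rep Q
    obtain ⟨L, η, h⟩ := exists_isInduced_eq D₀ D P
    exact ⟨UnderlineOp.mk T L η, (hF L η P).2 h⟩

end Opers

end

theorem theorem3p4 {Y : AlgebraicGeometry.Scheme.{0}}
    (π : Y ⟶ AlgebraicGeometry.Spec (.of ℂ)) [AlgebraicGeometry.SmoothOfRelativeDimension 1 π]
    {𝔤 : Type} [LieRing 𝔤] [LieAlgebra ℂ 𝔤] [FiniteDimensional ℂ 𝔤] [LieAlgebra.IsSemisimple ℂ 𝔤]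
    (H : LieSubalgebra ℂ 𝔤) [H.IsCartanSubalgebra]
    (Γ : (LieAlgebra.IsKilling.rootSystem H).Base)
    (T : Opers.PrincipalTriple H
      (fun i : Γ.support => (LieAlgebra.IsKilling.rootSystem H).root i)) :
    ∃ F : Opers.UnderlineOp π T → Opers.Op π H
        (fun i : Γ.support => (LieAlgebra.IsKilling.rootSystem H).root i),
      (∀ L η P, F (Opers.UnderlineOp.mk T L η) = Quotient.mk _ P ↔ Opers.IsInduced T L η P) ∧
      Function.Bijective F := by
  obtain ⟨D₀⟩ := Opers.isSimpleRoots_sl2.exists_operData Opers.sl2Triple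
  obtain ⟨D⟩ := (Opers.isSimpleRoots_base H Γ).exists_operData T
  exact Opers.exists_bijective_map D₀ D
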